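/- **Theorem 5.1 ($\Gamma$-expansions).** Let $d\ge 2$, let $\omega\subset\mathbb R^{d-1}$ be a bounded connected (non-empty) open set with Lipschitz boundary, and write $\Omega_\varepsilon=\omega\times(0,\varepsilon)$, $\Omega=\omega\times(0,1)$, and $x=(x',x_d)$ for $x\in\mathbb R^d$. For $s\in(0,1)$ and $v\in L^2(\Omega)$ let $u(x',x_d)=v(x',x_d/\varepsilon)$ for $(x',x_d)\in\Omega_\varepsilon$ and $$\lfloor u\rfloor_s^2(\Omega_\varepsilon)=\int_{\Omega_\varepsilon}\int_{\Omega_\varepsilon}\frac{|u(x)-u(y)|^2}{|x-y|^{d+2s}}\,dx\,dy\in[0,+\infty].$$ Put $\sigma_k=\mathcal H^{k-1}(S^{k-1})$, $$C_{s,d}=\int_{\mathbb R^{d-1}}\frac{d\xi}{(1+|\xi|^2)^{\frac d2+s}},\qquad K_{s,d}=\frac1{(3-2s)(d-1)}\int_{\mathbb R^{d-1}}\frac{|\xi|^2}{(1+|\xi|^2)^{\frac d2+s}}\,d\xi\quad (s>\tfrac12).$$ *$\Gamma$-limits* of functionals on $L^2(\Omega)$ as $\varepsilon\to0^+$ are sequential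 $\Gamma$-limits with respect to the weak convergence of $v$ in $L^2(\Omega)$, required along every sequence of positive numbers $\varepsilon_k\to0$. For functionals $F_\varepsilon\ge0$ on $L^2(\Omega)$ we write $$F_\varepsilon\ \overset{\Gamma}{=}\ \lambda_{1,\varepsilon}F^1+\lambda_{2,\varepsilon}F^2+o(\lambda_{2,\varepsilon})$$ if: $\lambda_{1,\varepsilon},\lambda_{2,\varepsilon}>0$ for small $\varepsilon$ and $\lambda_{2,\varepsilon}/\lambda_{1,\varepsilon}\to0$; $F_\varepsilon/\lambda_{1,\varepsilon}$ $\Gamma$-converges to $F^1$; $\min F^1=0$; $F_\varepsilon/\lambda_{2,\varepsilon}$ $\Gamma$-converges to $F^2$; whenever $\eta_\varepsilon>0$ satisfies $\lambda_{2,\varepsilon}/\eta_\varepsilon\to0$ and $\eta_\varepsilon/\lambda_{1,\varepsilon}\to0$, $F_\varepsilon/\eta_\varepsilon$ $\Gamma$-converges to the functional equal to $0$ on the minimizers of $F^1$ and $+\infty$ elsewhere; and $F^1$, $F^2$ are non-trivial, that is, each takes some value in $(0,+\infty)$. Below, a second term written with $v(x')$ or $\nabla'v$ denotes the functional on $L^2(\Omega)$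 given by that expression when $v$ does not depend on $x_d$ and equal to $+\infty$ otherwise; Dirichlet integrals are $+\infty$ when the weak derivatives involved do not exist in $L^2$. Let $s_\varepsilon\in(0,1)$ for $\varepsilon>0$, with $s_\varepsilon\to s_0$ as $\varepsilon\to0^+$. (i) If $s_0\in[0,1/2)$, then $$\lfloor u\rfloor^2_{s_\varepsilon}(\Omega_\varepsilon)\overset{\Gamma}{=}\varepsilon^{1-2s_\varepsilon}C_{s_0,d}\int_\omega\int_0^1\int_0^1\frac{|v(x',x_d)-v(x',y_d)|^2}{|x_d-y_d|^{1+2s_0}}\,dx_d\,dy_d\,dx'+\varepsilon^2\int_\omega\int_\omega\frac{|v(x')-v(y')|^2}{|x'-y'|^{d+2s_0}}\,dx'\,dy'+o(\varepsilon^2).$$ (ii) If $s_\varepsilon=1/2$ for all $\varepsilon$, then $$\lfloor u\rfloor^2_{1/2}(\Omega_\varepsilon)\overset{\Gamma}{=}\frac{\sigma_{d-1}}{d-1}\int_\omega\int_0^1\int_0^1\frac{|v(x',x_d)-v(x',y_d)|^2}{|x_d-y_d|^{2}}\,dx_d\,dy_d\,dx'+\varepsilon^2|\log\varepsilon|\,\frac{\sigma_{d-1}}{d-1}\int_\omega|\nabla'v|^2\,dx'+o(\varepsilon^2|\log\varepsilon|).$$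 (iii) If $s_0\in(1/2,1)$, then $$\lfloor u\rfloor^2_{s_\varepsilon}(\Omega_\varepsilon)\overset{\Gamma}{=}\varepsilon^{1-2s_\varepsilon}C_{s_0,d}\int_\omega\int_0^1\int_0^1\frac{|v(x',x_d)-v(x',y_d)|^2}{|x_d-y_d|^{1+2s_0}}\,dx_d\,dy_d\,dx'+\varepsilon^{3-2s_\varepsilon}\frac{K_{s_0,d}}{1-s_0}\int_\omega|\nabla'v|^2\,dx'+o(\varepsilon^{3-2s_\varepsilon}).$$ (iv) If $s_0=1$, then $$\lfloor u\rfloor^2_{s_\varepsilon}(\Omega_\varepsilon)\overset{\Gamma}{=}\frac{\varepsilon^{1-2s_\varepsilon}}{1-s_\varepsilon}\,\frac{\sigma_d}{2d}\int_\omega\int_0^1\Big|\frac{\partial v}{\partial x_d}\Big|^2dx_d\,dx'+\frac{\varepsilon^{3-2s_\varepsilon}}{1-s_\varepsilon}\,\frac{\sigma_d}{2d}\int_\omega|\nabla'v|^2\,dx'+o\Big(\frac{\varepsilon^{3-2s_\varepsilon}}{1-s_\varepsilon}\Big).$$ -/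

import Mathlib

open MeasureTheory Set Filter Topology Asymptotics
open scoped ENNReal NNReal

namespace ThinFilm

/-! ### Convergence and expansions -/

/-- Weak convergence of a sequence in a real normed space. -/
def WeakTendsto {X : Type*} [NormedAddCommGroup X] [NormedSpace ℝ X]
    (w : ℕ → X) (v : X) : Prop :=
  ∀ l : X →L[ℝ] ℝ, Tendsto (fun k => l (w k)) atTop (𝓝 (l v))

/-- `F ε` Gamma-converges to `F₀` as `ε → 0⁺`, with respect to weak convergence: along every
positive infinitesimal sequence `ε k`, the liminf inequality holds for all weakly converging
sequences, and every `v` has a weakly converging recovery sequence. -/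
def GammaTendsto {X : Type*} [NormedAddCommGroup X] [NormedSpace ℝ X]
    (F : ℝ → X → ℝ≥0∞) (F₀ : X → ℝ≥0∞) : Prop :=
  ∀ ε : ℕ → ℝ, (∀ k, 0 < ε k) → Tendsto ε atTop (𝓝 0) → ∀ v : X,
    (∀ w : ℕ → X, WeakTendsto w v →
      F₀ v ≤ liminf (fun k => F (ε k) (w k)) atTop) ∧
    (∃ w : ℕ → X, WeakTendsto w v ∧
      limsup (fun k => F (ε k) (w k)) atTop ≤ F₀ v)

/-- The two-term expansion `F ε = a ε * F₁ + b ε * F₂ + o (b ε)` in the sense of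
Gamma-convergence, for nonnegative functionals whose first Gamma-limit has minimum value `0`
(so that subtracting the minimum of `F₁` changes nothing). -/
structure IsGammaExpansion {X : Type*} [NormedAddCommGroup X] [NormedSpace ℝ X]
    (F : ℝ → X → ℝ≥0∞) (a : ℝ → ℝ) (F₁ : X → ℝ≥0∞) (b : ℝ → ℝ) (F₂ : X → ℝ≥0∞) : Prop where
  /-- the scales are positive, and `a` is much larger than `b` -/
  a_pos : ∀ᶠ ε in 𝓝[>] (0 : ℝ), 0 < a ε
  b_pos : ∀ᶠ ε in 𝓝[>] (0 : ℝ), 0 < b ε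
  scales : b =o[𝓝[>] (0 : ℝ)] a
  first : GammaTendsto (fun ε v => F ε v / ENNReal.ofReal (a ε)) F₁
  min_zero : IsLeast (range F₁) 0
  second : GammaTendsto (fun ε v => F ε v / ENNReal.ofReal (b ε)) F₂
  /-- at every intermediate scale the Gamma-limit is `0` on the minimizers of `F₁`
  and `+∞` elsewhere -/
  intermediate : ∀ η : ℝ → ℝ, (∀ᶠ ε in 𝓝[>] (0 : ℝ), 0 < η ε) →
    b =o[𝓝[>] (0 : ℝ)] η → η =o[𝓝[>] (0 : ℝ)] a →
    GammaTendsto (fun ε v => F ε v / ENNReal.ofReal (η ε))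
      (indicator {v | F₁ v ≠ 0} (fun _ => ∞))
  /-- the two Gamma-limits are not trivial -/
  nontrivial_first : ∃ v, F₁ v ≠ 0 ∧ F₁ v ≠ ∞
  nontrivial_second : ∃ v, F₂ v ≠ 0 ∧ F₂ v ≠ ∞

/-! ### Domains -/

/-- The planar space `ℝⁿ`; the ambient dimension is `d = n + 1`, and a point of `ℝᵈ` is
written as a pair `(x', x_d)` in `Plane n × ℝ`. -/
abbrev Plane (n : ℕ) : Type := EuclideanSpace ℝ (Fin n)

/-- The Euclidean distance in `ℝᵈ = Plane n × ℝ` (Mathlib's distance on a product is the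
maximum distance). -/
noncomputable def eucDist {n : ℕ} (x y : Plane n × ℝ) : ℝ :=
  Real.sqrt (‖x.1 - y.1‖ ^ 2 + (x.2 - y.2) ^ 2)

/-- Lipschitz boundary: near every boundary point the set is the strict epigraph, in some unit
direction `ν`, of a Lipschitz function of the component orthogonal to `ν`. -/
def HasLipschitzBoundary {n : ℕ} (ω : Set (Plane n)) : Prop :=
  ∀ x ∈ frontier ω, ∃ ν : Plane n, ‖ν‖ = 1 ∧
    ∃ (K : ℝ≥0) (γ : Plane n → ℝ), LipschitzWith K γ ∧
      ∃ r : ℝ, 0 < r ∧ ∀ y ∈ Metric.ball x r,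
        (y ∈ ω ↔ γ (y - (inner ℝ ν y) • ν) < inner ℝ ν y)

/-- The film `ω × (0, ε)` of thickness `ε`. -/
def film {n : ℕ} (ω : Set (Plane n)) (ε : ℝ) : Set (Plane n × ℝ) := ω ×ˢ Ioo 0 ε

/-- `L²(ω × (0,1))`, where the scaled functions `v` live. -/
abbrev FilmL2 {n : ℕ} (ω : Set (Plane n)) : Type :=
  Lp ℝ 2 ((volume : Measure (Plane n × ℝ)).restrict (film ω 1))

/-- `L²(ω)`. -/
abbrev PlaneL2 {n : ℕ} (ω : Set (Plane n)) : Type :=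
  Lp ℝ 2 ((volume : Measure (Plane n)).restrict ω)

/-! ### Constants -/

/-- `σ_k`, the surface measure of the unit sphere of `ℝᵏ`. -/
noncomputable def sphereArea (k : ℕ) : ℝ :=
  (volume : Measure (EuclideanSpace ℝ (Fin k))).toSphere.real univ

/-- `C_{s,d}` with `d = n + 1`. -/
noncomputable def constC (n : ℕ) (s : ℝ) : ℝ :=
  ∫ ξ : Plane n, 1 / (1 + ‖ξ‖ ^ 2) ^ (((n : ℝ) + 1) / 2 + s)

/-- `K_{s,d}` with `d = n + 1`. -/
noncomputable def constK (n : ℕ) (s : ℝ) : ℝ :=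
  1 / ((3 - 2 * s) * (n : ℝ)) *
    ∫ ξ : Plane n, ‖ξ‖ ^ 2 / (1 + ‖ξ‖ ^ 2) ^ (((n : ℝ) + 1) / 2 + s)

/-! ### Energies -/

/-- The squared Gagliardo seminorm of order `s` on `A ⊆ ℝᵈ`, `d = n + 1`; it is `+∞` when `u`
has no finite seminorm. -/
noncomputable def gagliardo {n : ℕ} (s : ℝ) (A : Set (Plane n × ℝ)) (u : Plane n × ℝ → ℝ) :
    ℝ≥0∞ :=
  ∫⁻ x in A, ∫⁻ y in A,
    ENNReal.ofReal (|u x - u y| ^ 2 / eucDist x y ^ (((n : ℝ) + 1) + 2 * s))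

/-- The squared `s`-seminorm on `ω × (0, ε)` of the function `u` whose scaled version is `v`,
that is, `u (x', x_d) = v (x', x_d / ε)`. -/
noncomputable def filmEnergy {n : ℕ} (ω : Set (Plane n)) (s ε : ℝ) (v : FilmL2 ω) : ℝ≥0∞ :=
  gagliardo s (film ω ε) (fun x => v (x.1, x.2 / ε))

/-- The integral over `ω` of the squared one-dimensional `s`-seminorms of the vertical
sections. -/
noncomputable def verticalEnergy {n : ℕ} (ω : Set (Plane n)) (s : ℝ) (v : FilmL2 ω) : ℝ≥0∞ :=
  ∫⁻ x in ω, ∫⁻ t in Ioo (0 : ℝ) 1, ∫⁻ r in Ioo (0 : ℝ) 1,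
    ENNReal.ofReal (|v (x, t) - v (x, r)| ^ 2 / |t - r| ^ (1 + 2 * s))

/-- The squared seminorm of order `s + 1/2` on `ω ⊆ ℝⁿ`; the exponent of the kernel is
`n + 2 (s + 1/2) = d + 2 s`. -/
noncomputable def planarEnergy {n : ℕ} (ω : Set (Plane n)) (s : ℝ) (w : PlaneL2 ω) : ℝ≥0∞ :=
  ∫⁻ x in ω, ∫⁻ y in ω,
    ENNReal.ofReal (|w x - w y| ^ 2 / ‖x - y‖ ^ (((n : ℝ) + 1) + 2 * s))

/-- `g` is the weak derivative of `f` in the direction `e` on the open set `U`. -/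
def HasWeakDirDeriv {E : Type*} [NormedAddCommGroup E] [NormedSpace ℝ E] [MeasureSpace E]
    (U : Set E) (e : E) (f g : E → ℝ) : Prop :=
  ∀ φ : E → ℝ, ContDiff ℝ ((⊤ : ℕ∞) : WithTop ℕ∞) φ → HasCompactSupport φ → tsupport φ ⊆ U →
    ∫ x in U, f x * fderiv ℝ φ x e = - ∫ x in U, g x * φ x

/-- `∫ |∂v/∂x_d|²` over `ω × (0,1)`, equal to `+∞` unless `v` has a weak derivative in the
vertical direction belonging to `L²` (the infimum is over at most one `g`). -/
noncomputable def verticalDirichlet {n : ℕ} (ω : Set (Plane n)) (v : FilmL2 ω) : ℝ≥0∞ :=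
  ⨅ (g : FilmL2 ω) (_ : HasWeakDirDeriv (film ω 1) ((0 : Plane n), (1 : ℝ)) v g),
    ∫⁻ x in film ω 1, ENNReal.ofReal (|g x| ^ 2)

/-- `∫ |∇'w|²` over `ω`, equal to `+∞` unless `w` belongs to `H¹(ω)` (the infimum is over at
most one weak gradient `G` in `L²`). -/
noncomputable def planarDirichlet {n : ℕ} (ω : Set (Plane n)) (w : PlaneL2 ω) : ℝ≥0∞ :=
  ⨅ (G : Lp (Plane n) 2 ((volume : Measure (Plane n)).restrict ω))
    (_ : ∀ i : Fin n,
      HasWeakDirDeriv ω (EuclideanSpace.single i (1 : ℝ)) w (fun x => G x i)),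
    ∫⁻ x in ω, ENNReal.ofReal (‖G x‖ ^ 2)

/-- The functional on `L²(ω × (0,1))` that equals `J w` if `v (x', x_d) = w x'` does not depend
on `x_d`, and `+∞` otherwise (the infimum is over at most one `w`). -/
noncomputable def onPlanar {n : ℕ} {ω : Set (Plane n)} (J : PlaneL2 ω → ℝ≥0∞) (v : FilmL2 ω) :
    ℝ≥0∞ :=
  ⨅ (w : PlaneL2 ω)
    (_ : ∀ᵐ x ∂((volume : Measure (Plane n × ℝ)).restrict (film ω 1)), v x = w x.1), J w

end ThinFilm

open ThinFilm

namespace ThinFilm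

/-! ### Abstract Gamma-convergence -/

/-! Stretching the film to unit thickness turns the seminorm into ε² times an integral over shifts z
= (z', t). The integrand is the squared L² increment Q(z) of v (`shiftEnergy`) against the kernel
(|z'|² + ε²t²)^(-(d+2s)/2), see `gagliardo_scaled`. By evenness only 0 < t < 1 matters, and the
dilation z' = εtξ gives 2ε^(1-2s) ∫ t^(-1-2s) ∫ (1+|ξ|²)^(-(d/2+s)) Q(εtξ, t) dξ dt
(`gagliardo_eq_ker`). To leading order the shift (εtξ, t) becomes vertical, the ξ-integral produces
the constant C, and vertical seminorms remain. If v does not depend on x_d, then Q is 1 - t times a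
planar increment, and the second term depends on which horizontal lengths carry the energy: lengths
of order one for s₀ < 1/2, of order ε for s₀ > 1/2, and all scales between ε and 1 equally, in
logarithmic measure, for s = 1/2.

Lower bounds rest on the weak lower semicontinuity of increments, also along varying shifts
(`shiftEnergy_le_liminf`). It is proved by duality: the shift is moved onto a test function and
Cauchy-Schwarz is applied. Fatou's lemma in t and ξ then gives the nonlocal terms. The same duality
with vanishing shifts gives derivatives (`sq_integral_vertical_le_liminf`,
`sq_integral_horizontal_le_liminf`). In the horizontal case the slanted shifts (hξ, t) and (-hξ, t)
are paired, so that vertical oscillations of the sequence cancel. The substitution τ = t^(2-2s)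
absorbs the factor 1/(1-s) uniformly up to s = 1, and z' = ε^τ ξ does the same for the logarithm.
The resulting bounds on directional derivatives are averaged over a radial kernel and become the
full Dirichlet integral (`planarDirichlet_le_of_directional`).

Upper bounds are computed for smooth compactly supported functions by splitting or expanding their
increments. Smooth functions are dense in energy because a bounded Lipschitz domain can be
compressed smoothly into itself with a uniform gap (`exists_inward_field`, `exists_compression`).
Mollifying after the compression multiplies the energies by at most 1 + ρ (`exists_smooth_film`,
`exists_smooth_plane`).

A diagonal argument produces recovery sequences, and the statement at intermediate scales follows
from the two extreme ones (`isGammaExpansion_of_approx`). -/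

theorem exists_diagonal {p : ℕ → ℕ → Prop} (h : ∀ j, ∀ᶠ k in atTop, p j k) :
    ∃ J : ℕ → ℕ, Tendsto J atTop atTop ∧ ∀ᶠ k in atTop, p (J k) k := by
  classical
  have h' : ∀ j, ∃ N, ∀ k ≥ N, p j k := fun j => eventually_atTop.1 (h j)
  choose N hN using h'
  -- `J k` is the largest j ≤ k whose threshold `N j` has been passed. From k ≥ `N 0` on, the search
  -- has the witness j = 0.
  refine ⟨fun k => Nat.findGreatest (fun j => N j ≤ k) k, ?_, ?_⟩
  · refine tendsto_atTop.2 fun b => ?_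
    filter_upwards [eventually_ge_atTop (max b (N b))] with k hk
    exact Nat.le_findGreatest (le_trans (le_max_left _ _) hk) (le_trans (le_max_right _ _) hk)
  · filter_upwards [eventually_ge_atTop (N 0)] with k hk
    refine hN _ _ ?_
    exact Nat.findGreatest_spec (P := fun j => N j ≤ k) (Nat.zero_le k) hk

section Abstract

variable {X : Type*} [NormedAddCommGroup X] [NormedSpace ℝ X]

theorem weakTendsto_of_tendsto {w : ℕ → X} {v : X} (h : Tendsto w atTop (𝓝 v)) :
    WeakTendsto w v := fun l => (l.continuous.tendsto v).comp h

theorem tendsto_nhdsGT_zero {ε : ℕ → ℝ} (hpos : ∀ k, 0 < ε k) (hε : Tendsto ε atTop (𝓝 0)) :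
    Tendsto ε atTop (𝓝[>] 0) :=
  tendsto_nhdsWithin_iff.2 ⟨hε, Eventually.of_forall hpos⟩

/-- Constant sequences suffice for the upper bound, up to an error ρ in norm and in energy: a
diagonal choice among nearly optimal approximants is a recovery sequence, which even converges
strongly. -/
theorem gammaTendsto_of_approx {F : ℝ → X → ℝ≥0∞} {F₀ : X → ℝ≥0∞}
    (hinf : ∀ ε : ℕ → ℝ, (∀ k, 0 < ε k) → Tendsto ε atTop (𝓝 0) → ∀ (v : X) (w : ℕ → X),
      WeakTendsto w v → F₀ v ≤ liminf (fun k => F (ε k) (w k)) atTop)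
    (hsup : ∀ v, F₀ v ≠ ∞ → ∀ ρ : ℝ, 0 < ρ → ∃ u : X, ‖u - v‖ < ρ ∧
      limsup (fun ε => F ε u) (𝓝[>] 0) ≤ F₀ v + ENNReal.ofReal ρ) :
    GammaTendsto F F₀ := by
  intro ε hpos hε v
  refine ⟨fun w hw => hinf ε hpos hε v w hw, ?_⟩
  by_cases hv : F₀ v = ∞
  · exact ⟨fun _ => v, weakTendsto_of_tendsto tendsto_const_nhds, by simp [hv]⟩
  have hρ : ∀ j : ℕ, (0 : ℝ) < 1 / ((j : ℝ) + 1) := fun j => by positivity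
  choose u hu hsupu using fun j : ℕ => hsup v hv (1 / ((j : ℝ) + 1)) (hρ j)
  have hlim := tendsto_nhdsGT_zero hpos hε
  -- The error 1/(j+1) appears twice: once from the approximation, once as room to turn a limsup
  -- bound into an eventual inequality.
  have hev : ∀ j : ℕ, ∀ᶠ k in atTop,
      F (ε k) (u j) ≤ F₀ v + ENNReal.ofReal (1 / ((j : ℝ) + 1)) +
        ENNReal.ofReal (1 / ((j : ℝ) + 1)) := by
    intro j
    refine hlim.eventually ((eventually_lt_of_limsup_lt (f := 𝓝[>] (0 : ℝ)) (u := fun ε => F ε (u j))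
      (lt_of_le_of_lt (hsupu j) ?_)).mono fun _ h => le_of_lt h)
    refine ENNReal.lt_add_right ?_ ?_
    · exact ENNReal.add_ne_top.2 ⟨hv, ENNReal.ofReal_ne_top⟩
    · simpa using hρ j
  obtain ⟨J, hJ, hJp⟩ := exists_diagonal hev
  refine ⟨fun k => u (J k), ?_, ?_⟩
  · apply weakTendsto_of_tendsto
    rw [tendsto_iff_norm_sub_tendsto_zero]
    refine squeeze_zero (fun _ => norm_nonneg _) (fun k => (hu (J k)).le) ?_
    exact tendsto_one_div_add_atTop_nhds_zero_nat.comp hJ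
  · have hb : Tendsto (fun k => F₀ v + ENNReal.ofReal (1 / ((J k : ℝ) + 1)) +
        ENNReal.ofReal (1 / ((J k : ℝ) + 1))) atTop (𝓝 (F₀ v + 0 + 0)) := by
      have h0 : Tendsto (fun k => ENNReal.ofReal (1 / ((J k : ℝ) + 1))) atTop (𝓝 0) := by
        have := (tendsto_one_div_add_atTop_nhds_zero_nat (𝕜 := ℝ)).comp hJ
        simpa [Function.comp_def] using (ENNReal.continuous_ofReal.tendsto 0).comp this
      exact (tendsto_const_nhds.add h0).add h0
    have := limsup_le_limsup hJp
    refine this.trans ?_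
    rw [hb.limsup_eq]
    simp

theorem div_ofReal_eq_mul {x : ℝ≥0∞} {a b : ℝ} (ha : 0 < a) (hb : 0 < b) :
    x / ENNReal.ofReal a = x / ENNReal.ofReal b * ENNReal.ofReal (b / a) := by
  rw [ENNReal.ofReal_div_of_pos ha, div_eq_mul_inv, div_eq_mul_inv, div_eq_mul_inv, mul_assoc,
    ← mul_assoc (ENNReal.ofReal b)⁻¹, ENNReal.inv_mul_cancel (by simpa using hb)
    ENNReal.ofReal_ne_top, one_mul]

theorem tendsto_ofReal_div {a b : ℝ → ℝ} (hab : b =o[𝓝[>] (0 : ℝ)] a) :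
    Tendsto (fun ε => ENNReal.ofReal (b ε / a ε)) (𝓝[>] 0) (𝓝 0) := by
  simpa [Function.comp_def] using (ENNReal.continuous_ofReal.tendsto 0).comp hab.tendsto_div_nhds_zero

/-- A sequence bounded at the scale `b` vanishes at any larger scale `a`. -/
theorem liminf_div_eq_zero {f : ℕ → ℝ≥0∞} {a b : ℝ → ℝ} {ε : ℕ → ℝ}
    (hε : Tendsto ε atTop (𝓝[>] 0))
    (ha : ∀ᶠ ε in 𝓝[>] (0 : ℝ), 0 < a ε) (hb : ∀ᶠ ε in 𝓝[>] (0 : ℝ), 0 < b ε)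
    (hab : b =o[𝓝[>] (0 : ℝ)] a)
    (h : liminf (fun k => f k / ENNReal.ofReal (b (ε k))) atTop ≠ ∞) :
    liminf (fun k => f k / ENNReal.ofReal (a (ε k))) atTop = 0 := by
  set M := liminf (fun k => f k / ENNReal.ofReal (b (ε k))) atTop with hM
  have hfreq : ∃ᶠ k in atTop, f k / ENNReal.ofReal (b (ε k)) < M + 1 :=
    frequently_lt_of_liminf_lt (u := fun k => f k / ENNReal.ofReal (b (ε k))) (h := by
      rw [← hM]; exact ENNReal.lt_add_right h one_ne_zero)
  have h0 := (tendsto_ofReal_div hab).comp hε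
  have h1 : Tendsto (fun k => (M + 1) * ENNReal.ofReal (b (ε k) / a (ε k))) atTop (𝓝 0) := by
    have := ENNReal.Tendsto.const_mul (a := M + 1) h0
      (Or.inr (ENNReal.add_ne_top.2 ⟨h, ENNReal.one_ne_top⟩))
    simpa using this
  refine le_antisymm (le_of_forall_gt fun c hc => ?_) bot_le
  obtain ⟨d, hd0, hdc⟩ := exists_between hc
  have hev : ∀ᶠ k in atTop, (M + 1) * ENNReal.ofReal (b (ε k) / a (ε k)) < d :=
    h1.eventually (gt_mem_nhds hd0)
  refine lt_of_le_of_lt (liminf_le_of_frequently_le ?_) hdc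
  refine (hfreq.and_eventually (hev.and ((hε.eventually ha).and (hε.eventually hb)))).mono ?_
  rintro k ⟨h1, h2, h3, h4⟩
  rw [div_ofReal_eq_mul h3 h4]
  exact (mul_le_mul_left h1.le _).trans h2.le

theorem limsup_div_eq_zero {f : ℝ → ℝ≥0∞} {a b : ℝ → ℝ}
    (ha : ∀ᶠ ε in 𝓝[>] (0 : ℝ), 0 < a ε) (hb : ∀ᶠ ε in 𝓝[>] (0 : ℝ), 0 < b ε)
    (hab : b =o[𝓝[>] (0 : ℝ)] a)
    (h : limsup (fun ε => f ε / ENNReal.ofReal (b ε)) (𝓝[>] 0) ≠ ∞) :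
    limsup (fun ε => f ε / ENNReal.ofReal (a ε)) (𝓝[>] 0) = 0 := by
  set M := limsup (fun ε => f ε / ENNReal.ofReal (b ε)) (𝓝[>] 0) with hM
  have hev : ∀ᶠ ε in 𝓝[>] 0, f ε / ENNReal.ofReal (b ε) < M + 1 :=
    eventually_lt_of_limsup_lt (u := fun ε => f ε / ENNReal.ofReal (b ε)) (h := by
      rw [← hM]; exact ENNReal.lt_add_right h one_ne_zero)
  have h1 : Tendsto (fun ε => (M + 1) * ENNReal.ofReal (b ε / a ε)) (𝓝[>] 0) (𝓝 0) := by
    have := ENNReal.Tendsto.const_mul (a := M + 1) (tendsto_ofReal_div hab)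
      (Or.inr (ENNReal.add_ne_top.2 ⟨h, ENNReal.one_ne_top⟩))
    simpa using this
  rw [← h1.limsup_eq] 
  refine le_antisymm (limsup_le_limsup ?_) (by rw [h1.limsup_eq]; exact bot_le)
  filter_upwards [hev, ha, hb] with k h1 h3 h4
  rw [div_ofReal_eq_mul h3 h4]
  exact mul_le_mul_left h1.le _

/-- If the energies have a finite lower limit at a scale much smaller than `a`, their lower limit at
scale `a` is zero, and the first lower bound forces `F₁ v = 0`. Hence lower bounds at scale `b` are
needed only on the zero set of `F₁`, and those at intermediate scales are automatic. For the
intermediate upper bound it is enough that minimizers of `F₁` be limits of functions with bounded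
energy at scale `b`. -/
theorem isGammaExpansion_of_approx {F : ℝ → X → ℝ≥0∞} {a b : ℝ → ℝ} {F₁ F₂ : X → ℝ≥0∞}
    (ha : ∀ᶠ ε in 𝓝[>] (0 : ℝ), 0 < a ε) (hb : ∀ᶠ ε in 𝓝[>] (0 : ℝ), 0 < b ε)
    (hab : b =o[𝓝[>] (0 : ℝ)] a)
    (hinf₁ : ∀ ε : ℕ → ℝ, (∀ k, 0 < ε k) → Tendsto ε atTop (𝓝 0) → ∀ (v : X) (w : ℕ → X),
      WeakTendsto w v → F₁ v ≤ liminf (fun k => F (ε k) (w k) / ENNReal.ofReal (a (ε k))) atTop)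
    (hsup₁ : ∀ v, F₁ v ≠ ∞ → ∀ ρ : ℝ, 0 < ρ → ∃ u : X, ‖u - v‖ < ρ ∧
      limsup (fun ε => F ε u / ENNReal.ofReal (a ε)) (𝓝[>] 0) ≤ F₁ v + ENNReal.ofReal ρ)
    (hzero : F₁ 0 = 0)
    (hinf₂ : ∀ ε : ℕ → ℝ, (∀ k, 0 < ε k) → Tendsto ε atTop (𝓝 0) → ∀ (v : X) (w : ℕ → X),
      WeakTendsto w v → F₁ v = 0 →
      F₂ v ≤ liminf (fun k => F (ε k) (w k) / ENNReal.ofReal (b (ε k))) atTop)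
    (hsup₂ : ∀ v, F₂ v ≠ ∞ → ∀ ρ : ℝ, 0 < ρ → ∃ u : X, ‖u - v‖ < ρ ∧
      limsup (fun ε => F ε u / ENNReal.ofReal (b ε)) (𝓝[>] 0) ≤ F₂ v + ENNReal.ofReal ρ)
    (hker : ∀ v, F₁ v = 0 → ∀ ρ : ℝ, 0 < ρ → ∃ u : X, ‖u - v‖ < ρ ∧
      limsup (fun ε => F ε u / ENNReal.ofReal (b ε)) (𝓝[>] 0) ≠ ∞)
    (hnt₁ : ∃ v, F₁ v ≠ 0 ∧ F₁ v ≠ ∞) (hnt₂ : ∃ v, F₂ v ≠ 0 ∧ F₂ v ≠ ∞) :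
    IsGammaExpansion F a F₁ b F₂ where
  a_pos := ha
  b_pos := hb
  scales := hab
  first := gammaTendsto_of_approx hinf₁ hsup₁
  min_zero := ⟨⟨0, hzero⟩, fun _ _ => bot_le⟩
  second := by
    refine gammaTendsto_of_approx (fun ε hpos hε v w hw => ?_) hsup₂
    by_cases hv : F₁ v = 0
    · exact hinf₂ ε hpos hε v w hw hv
    by_cases htop : liminf (fun k => F (ε k) (w k) / ENNReal.ofReal (b (ε k))) atTop = ∞
    · rw [htop]; exact le_top
    · have := hinf₁ ε hpos hε v w hw
      rw [liminf_div_eq_zero (tendsto_nhdsGT_zero hpos hε) ha hb hab htop] at this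
      exact absurd (le_antisymm this bot_le) hv
  intermediate := by
    intro η hη hbη hηa
    refine gammaTendsto_of_approx (fun ε hpos hε v w hw => ?_) (fun v hv ρ hρ => ?_)
    · by_cases hv : F₁ v = 0
      · simp [indicator, hv]
      by_cases htop : liminf (fun k => F (ε k) (w k) / ENNReal.ofReal (η (ε k))) atTop = ∞
      · rw [htop]; exact le_top
      · have := hinf₁ ε hpos hε v w hw
        rw [liminf_div_eq_zero (tendsto_nhdsGT_zero hpos hε) ha hη hηa htop] at this
        exact absurd (le_antisymm this bot_le) hv
    · have hv0 : F₁ v = 0 := by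
        by_contra h
        exact hv (by simp [indicator, h])
      obtain ⟨u, hu, hfin⟩ := hker v hv0 ρ hρ
      refine ⟨u, hu, ?_⟩
      rw [limsup_div_eq_zero hη hb hbη hfin]
      exact bot_le
  nontrivial_first := hnt₁
  nontrivial_second := hnt₂

end Abstract

set_option linter.unusedSectionVars false

instance instIsAddHaarMeasureFilm (n : ℕ) : (volume : Measure (Plane n × ℝ)).IsAddHaarMeasure :=
  inferInstanceAs ((volume : Measure (Plane n)).prod (volume : Measure ℝ)).IsAddHaarMeasure

/-! ### Shift energies and representation of the seminorms -/

/-- The squared `L²` norm of the increment of `v` by `z`, over the points `x` such that both `x`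
and `x + z` belong to `U`. -/
noncomputable def shiftEnergy {G : Type*} [AddCommGroup G] [MeasureSpace G] (U : Set G)
    (v : G → ℝ) (z : G) : ℝ≥0∞ :=
  ∫⁻ x in U ∩ (fun x => x + z) ⁻¹' U, ENNReal.ofReal ((v (x + z) - v x) ^ 2)

section Shift

variable {G : Type*} [AddCommGroup G] [MeasureSpace G] [MeasurableAdd₂ G] [MeasurableNeg G]
  [(volume : Measure G).IsAddLeftInvariant] [SFinite (volume : Measure G)]

theorem shiftEnergy_eq_lintegral {U : Set G} (hU : MeasurableSet U) (v : G → ℝ) (z : G) :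
    shiftEnergy U v z = ∫⁻ x, U.indicator 1 x * U.indicator 1 (x + z) *
      ENNReal.ofReal ((v (x + z) - v x) ^ 2) := by
  have hU' : MeasurableSet ((fun x => x + z) ⁻¹' U) := (measurable_add_const z) hU
  rw [shiftEnergy, ← lintegral_indicator (hU.inter hU')]
  refine lintegral_congr fun x => ?_
  by_cases h1 : x ∈ U <;> by_cases h2 : x + z ∈ U <;> simp [indicator, h1, h2]

/-- Substitute y = x + z and exchange the integrals by Tonelli. The three nonlocal energies are all
of this form, so they depend on the function only through its increments. -/
theorem lintegral_lintegral_eq_shiftEnergy {U : Set G} (hU : MeasurableSet U) {v : G → ℝ}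
    (hv : Measurable v) {κ : G → ℝ≥0∞} (hκ : Measurable κ) :
    ∫⁻ x in U, ∫⁻ y in U, κ (y - x) * ENNReal.ofReal ((v y - v x) ^ 2) =
      ∫⁻ z, κ z * shiftEnergy U v z := by
  have hi : Measurable (U.indicator (1 : G → ℝ≥0∞)) := measurable_one.indicator hU
  calc ∫⁻ x in U, ∫⁻ y in U, κ (y - x) * ENNReal.ofReal ((v y - v x) ^ 2)
      = ∫⁻ x, ∫⁻ z, κ z * (U.indicator 1 x * U.indicator 1 (x + z) *
        ENNReal.ofReal ((v (x + z) - v x) ^ 2)) := by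
        rw [← lintegral_indicator hU]
        refine lintegral_congr fun x => ?_
        by_cases hx : x ∈ U
        · rw [indicator_of_mem hx, ← lintegral_indicator hU, ← lintegral_add_left_eq_self _ x]
          refine lintegral_congr fun z => ?_
          by_cases hz : x + z ∈ U <;> simp [indicator, hx, hz]
        · simp [hx]
    _ = ∫⁻ z, κ z * shiftEnergy U v z := by
        rw [lintegral_lintegral_swap]
        · refine lintegral_congr fun z => ?_
          rw [shiftEnergy_eq_lintegral hU, lintegral_const_mul]
          fun_prop
        · fun_prop

theorem measurable_shiftEnergy {U : Set G} (hU : MeasurableSet U) {v : G → ℝ}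
    (hv : Measurable v) : Measurable (shiftEnergy U v) := by
  have hi : Measurable (U.indicator (1 : G → ℝ≥0∞)) := measurable_one.indicator hU
  have : shiftEnergy U v = fun z => ∫⁻ x, U.indicator 1 x * U.indicator 1 (x + z) *
      ENNReal.ofReal ((v (x + z) - v x) ^ 2) := funext fun z => shiftEnergy_eq_lintegral hU v z
  rw [this]
  apply Measurable.lintegral_prod_right (f := fun z x => U.indicator 1 x * U.indicator 1 (x + z) *
      ENNReal.ofReal ((v (x + z) - v x) ^ 2))
  fun_prop

/-- Translating the variable of integration by z exchanges the two end points of the increment. -/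
theorem shiftEnergy_neg {U : Set G} (hU : MeasurableSet U) (v : G → ℝ) (z : G) :
    shiftEnergy U v (-z) = shiftEnergy U v z := by
  rw [shiftEnergy_eq_lintegral hU, shiftEnergy_eq_lintegral hU, ← lintegral_add_right_eq_self _ z]
  refine lintegral_congr fun x => ?_
  rw [add_neg_cancel_right, mul_comm (U.indicator 1 (x + z))]
  congr 2
  ring

theorem shiftEnergy_congr {U : Set G} (hU : MeasurableSet U) {v w : G → ℝ}
    (h : v =ᵐ[volume.restrict U] w) (z : G) : shiftEnergy U v z = shiftEnergy U w z := by
  have h' : ∀ᵐ x : G, x ∈ U → v x = w x := (ae_restrict_iff' hU).1 h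
  have h'' : ∀ᵐ x : G, x + z ∈ U → v (x + z) = w (x + z) :=
    (measurePreserving_add_right volume z).quasiMeasurePreserving.ae h'
  rw [shiftEnergy_eq_lintegral hU, shiftEnergy_eq_lintegral hU]
  refine lintegral_congr_ae ?_
  filter_upwards [h', h''] with x hx hx'
  by_cases h1 : x ∈ U <;> by_cases h2 : x + z ∈ U <;> simp [indicator, h1, h2]
  rw [hx h1, hx' h2]

end Shift

/-! ### Changes of variables and the rescaled film energy. -/

theorem lintegral_Ioo_scale {ε : ℝ} (hε : 0 < ε) (g : ℝ → ℝ≥0∞) (b : ℝ) :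
    ∫⁻ t in Ioo 0 (ε * b), g t = ENNReal.ofReal ε * ∫⁻ t in Ioo 0 b, g (ε * t) := by
  have himg : (fun t => ε * t) '' Ioo 0 b = Ioo 0 (ε * b) := by
    rw [Set.image_mul_left_Ioo hε]; simp
  rw [← himg, lintegral_image_eq_lintegral_abs_deriv_mul measurableSet_Ioo (f' := fun _ => ε)]
  · rw [lintegral_const_mul' _ _ ENNReal.ofReal_ne_top, abs_of_pos hε]
  · intro x _
    simpa using ((hasDerivAt_id x).const_mul ε).hasDerivWithinAt
  · intro x _ y _ h
    exact mul_left_cancel₀ hε.ne' h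

theorem lintegral_even {g : ℝ → ℝ≥0∞} (heven : ∀ t, g (-t) = g t)
    (hsupp : ∀ t, 1 ≤ |t| → g t = 0) :
    ∫⁻ t, g t = 2 * ∫⁻ t in Ioo (0 : ℝ) 1, g t := by
  have h1 : ∫⁻ t in Ioi (0 : ℝ), g t = ∫⁻ t in Ioo (0 : ℝ) 1, g t := by
    rw [← lintegral_indicator measurableSet_Ioi, ← lintegral_indicator measurableSet_Ioo]
    refine lintegral_congr fun t => ?_
    by_cases h0 : 0 < t <;> by_cases h1 : t < 1 <;> simp [indicator, h0, h1]
    apply hsupp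
    rw [abs_of_pos h0]
    exact not_lt.1 h1
  have h2 : ∫⁻ t in Iic (0 : ℝ), g t = ∫⁻ t in Ioi (0 : ℝ), g t := by
    rw [← setLIntegral_congr (Iio_ae_eq_Iic (a := (0 : ℝ)) (μ := volume)),
      ← lintegral_indicator measurableSet_Iio, ← lintegral_indicator measurableSet_Ioi,
      ← lintegral_neg_eq_self]
    refine lintegral_congr fun t => ?_
    by_cases h : 0 < t <;> simp [indicator, h, heven]
  rw [← lintegral_add_compl g (measurableSet_Ioi (a := (0 : ℝ))), compl_Ioi, h2, h1, two_mul]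

theorem lintegral_dilation {n : ℕ} {h : ℝ} (hh : 0 < h) (g : Plane n → ℝ≥0∞) :
    ∫⁻ z, g z = ENNReal.ofReal (h ^ n) * ∫⁻ ξ, g (h • ξ) := by
  have hmap := Measure.map_addHaar_smul (volume : Measure (Plane n)) hh.ne'
  have hemb : MeasurableEmbedding (fun x : Plane n => h • x) :=
    (Homeomorph.smulOfNeZero h hh.ne').measurableEmbedding
  have h1 : ∫⁻ ξ, g (h • ξ) = ENNReal.ofReal |(h ^ n)⁻¹| * ∫⁻ z, g z := by
    rw [← hemb.lintegral_map g, hmap, lintegral_smul_measure]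
    simp
  rw [h1, ← mul_assoc, ← ENNReal.ofReal_mul (by positivity), abs_of_pos (by positivity),
    mul_inv_cancel₀ (by positivity)]
  simp

variable {n : ℕ} {ω : Set (Plane n)}

theorem measurableSet_film (hω : MeasurableSet ω) (ε : ℝ) : MeasurableSet (film ω ε) :=
  hω.prod measurableSet_Ioo

theorem lintegral_film {ε : ℝ} {f : Plane n × ℝ → ℝ≥0∞} (hf : Measurable f) :
    ∫⁻ x in film ω ε, f x = ∫⁻ x in ω, ∫⁻ t in Ioo 0 ε, f (x, t) := by
  rw [film, Measure.volume_eq_prod, ← Measure.prod_restrict, lintegral_prod _ hf.aemeasurable]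

theorem lintegral_film_scale {ε : ℝ} (hε : 0 < ε) {f : Plane n × ℝ → ℝ≥0∞} (hf : Measurable f) :
    ∫⁻ x in film ω ε, f x = ENNReal.ofReal ε * ∫⁻ x in film ω 1, f (x.1, ε * x.2) := by
  rw [lintegral_film hf, lintegral_film (f := fun x => f (x.1, ε * x.2)) (by fun_prop),
    ← lintegral_const_mul _ (by fun_prop)]
  refine lintegral_congr fun x => ?_
  have := lintegral_Ioo_scale hε (fun t => f (x, t)) 1
  rwa [mul_one] at this

/-- The kernel of the rescaled seminorm. -/
noncomputable def filmKernel (n : ℕ) (s ε : ℝ) (z : Plane n) (t : ℝ) : ℝ :=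
  1 / Real.sqrt (‖z‖ ^ 2 + (ε * t) ^ 2) ^ (((n : ℝ) + 1) + 2 * s)

/-- The kernel in the variables `ξ = (x' - y') / |x_d - y_d|`. -/
noncomputable def ker (n : ℕ) (s : ℝ) (ξ : Plane n) : ℝ :=
  (1 + ‖ξ‖ ^ 2) ^ (-(((n : ℝ) + 1) / 2 + s))

theorem ker_pos (s : ℝ) (ξ : Plane n) : 0 < ker n s ξ := by unfold ker; positivity

@[fun_prop]
theorem measurable_ker (s : ℝ) : Measurable (ker n s) := by unfold ker; fun_prop

@[fun_prop]
theorem measurable_filmKernel (s ε : ℝ) :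
    Measurable (fun z : Plane n × ℝ => filmKernel n s ε z.1 z.2) := by
  unfold filmKernel; fun_prop

theorem shiftEnergy_film_eq_zero (v : Plane n × ℝ → ℝ) {z : Plane n × ℝ} (hz : 1 ≤ |z.2|) :
    shiftEnergy (film ω 1) v z = 0 := by
  have : film ω 1 ∩ (fun x => x + z) ⁻¹' film ω 1 = ∅ := by
    ext x
    simp only [film, mem_inter_iff, mem_prod, mem_Ioo, mem_preimage, mem_empty_iff_false, iff_false,
      Prod.snd_add]
    rintro ⟨⟨_, h1, h2⟩, _, h3, h4⟩
    rcases le_abs'.1 hz with h | h <;> linarith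
  rw [shiftEnergy, this]
  simp

/-- Each of the two vertical variables contributes a factor ε when the film is stretched to unit
thickness. -/
theorem gagliardo_scaled (hω : MeasurableSet ω) {ε : ℝ} (hε : 0 < ε) (s : ℝ)
    {v : Plane n × ℝ → ℝ} (hv : Measurable v) :
    gagliardo s (film ω ε) (fun x => v (x.1, x.2 / ε)) =
      ENNReal.ofReal (ε ^ 2) * ∫⁻ z : Plane n × ℝ,
        ENNReal.ofReal (filmKernel n s ε z.1 z.2) * shiftEnergy (film ω 1) v z := by
  rw [← lintegral_lintegral_eq_shiftEnergy (measurableSet_film hω 1) hv (by fun_prop)]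
  unfold gagliardo
  have hm : Measurable (fun p : (Plane n × ℝ) × (Plane n × ℝ) =>
      ENNReal.ofReal (|v (p.1.1, p.1.2 / ε) - v (p.2.1, p.2.2 / ε)| ^ 2 /
        eucDist p.1 p.2 ^ (((n : ℝ) + 1) + 2 * s))) := by
    unfold eucDist; fun_prop
  rw [lintegral_film_scale hε (by exact hm.lintegral_prod_right')]
  have : ∀ x : Plane n × ℝ, ∫⁻ y in film ω ε,
      ENNReal.ofReal (|v ((x.1, ε * x.2).1, (x.1, ε * x.2).2 / ε) - v (y.1, y.2 / ε)| ^ 2 /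
        eucDist (x.1, ε * x.2) y ^ (((n : ℝ) + 1) + 2 * s)) = ENNReal.ofReal ε *
      ∫⁻ y in film ω 1, ENNReal.ofReal (filmKernel n s ε (y - x).1 (y - x).2) *
        ENNReal.ofReal ((v y - v x) ^ 2) := by
    intro x
    have hmx : Measurable (fun y : Plane n × ℝ =>
        ENNReal.ofReal (|v (x.1, ε * x.2 / ε) - v (y.1, y.2 / ε)| ^ 2 /
          eucDist (x.1, ε * x.2) y ^ (((n : ℝ) + 1) + 2 * s))) := by
      unfold eucDist; fun_prop
    refine (lintegral_film_scale hε hmx).trans ?_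
    congr 1
    refine lintegral_congr fun y => ?_
    rw [← ENNReal.ofReal_mul (by unfold filmKernel; positivity)]
    congr 1
    simp only [mul_div_cancel_left₀ _ hε.ne', Prod.mk.eta, filmKernel, eucDist, Prod.fst_sub,
      Prod.snd_sub, sq_abs]
    rw [norm_sub_rev, one_div_mul_eq_div]
    congr 1
    · ring
    · congr 3
      ring
  simp_rw [this]
  rw [lintegral_const_mul' _ _ ENNReal.ofReal_ne_top, ← mul_assoc, ← ENNReal.ofReal_mul hε.le, sq]

/-- The reflection z ↦ -z preserves the kernel and the increments, and no shift with |t| ≥ 1 fits in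
the film. -/
theorem gagliardo_eq_half (hω : MeasurableSet ω) {ε : ℝ} (hε : 0 < ε) (s : ℝ)
    {v : Plane n × ℝ → ℝ} (hv : Measurable v) :
    gagliardo s (film ω ε) (fun x => v (x.1, x.2 / ε)) =
      ENNReal.ofReal (2 * ε ^ 2) * ∫⁻ t in Ioo (0 : ℝ) 1, ∫⁻ z : Plane n,
        ENNReal.ofReal (filmKernel n s ε z t) * shiftEnergy (film ω 1) v (z, t) := by
  have hQ := measurable_shiftEnergy (measurableSet_film hω 1) hv
  rw [gagliardo_scaled hω hε s hv, Measure.volume_eq_prod, lintegral_prod_symm _ (by fun_prop),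
    lintegral_even, ← mul_assoc, mul_comm (2 : ℝ), ENNReal.ofReal_mul (by positivity)]
  · norm_num
  · intro t
    rw [← lintegral_neg_eq_self]
    refine lintegral_congr fun z => ?_
    congr 1
    · simp [filmKernel]
    · rw [← shiftEnergy_neg (measurableSet_film hω 1) v (z, t)]
      rfl
  · intro t ht
    simp [shiftEnergy_film_eq_zero v (z := (_, t)) ht]

/-- Homogeneity: at z' = εtξ the kernel scales like (εt)^(-(n+1+2s)) and the Jacobian is (εt)^n, so
that ε²(εt)^(-1-2s) remains. -/
theorem filmKernel_dilation {s ε t : ℝ} (hε : 0 < ε) (ht : 0 < t) (ξ : Plane n) :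
    ε ^ 2 * ((ε * t) ^ n * filmKernel n s ε ((ε * t) • ξ) t) =
      ε ^ (1 - 2 * s) * (t ^ (-(1 + 2 * s)) * ker n s ξ) := by
  have hh : 0 < ε * t := mul_pos hε ht
  have h1 : Real.sqrt (‖(ε * t) • ξ‖ ^ 2 + (ε * t) ^ 2) = (ε * t) * Real.sqrt (1 + ‖ξ‖ ^ 2) := by
    rw [norm_smul, Real.norm_of_nonneg hh.le, mul_pow, show (ε * t) ^ 2 * ‖ξ‖ ^ 2 + (ε * t) ^ 2 =
      (ε * t) ^ 2 * (1 + ‖ξ‖ ^ 2) by ring, Real.sqrt_mul (by positivity), Real.sqrt_sq hh.le]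
  have h2 : Real.sqrt (1 + ‖ξ‖ ^ 2) ^ (((n : ℝ) + 1) + 2 * s) =
      (1 + ‖ξ‖ ^ 2) ^ (((n : ℝ) + 1) / 2 + s) := by
    rw [Real.sqrt_eq_rpow, ← Real.rpow_mul (by positivity)]
    congr 1
    ring
  rw [filmKernel, h1, Real.mul_rpow hh.le (Real.sqrt_nonneg _), h2, ker,
    Real.rpow_neg (by positivity) (((n : ℝ) + 1) / 2 + s)]
  have h3 : (ε * t) ^ (((n : ℝ) + 1) + 2 * s) = (ε * t) ^ n * (ε ^ (1 + 2 * s) * t ^ (1 + 2 * s)) := by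
    rw [← Real.mul_rpow hε.le ht.le, ← Real.rpow_natCast (ε * t) n, ← Real.rpow_add hh]
    congr 1
    ring
  have h4 : ε ^ (1 - 2 * s) = ε ^ 2 / ε ^ (1 + 2 * s) := by
    rw [← Real.rpow_natCast ε 2, ← Real.rpow_sub hε]
    congr 1
    push_cast
    ring
  rw [h3, h4, Real.rpow_neg ht.le]
  have : 0 < ε ^ (1 + 2 * s) := by positivity
  have : 0 < t ^ (1 + 2 * s) := by positivity
  have : 0 < (1 + ‖ξ‖ ^ 2) ^ (((n : ℝ) + 1) / 2 + s) := by positivity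
  field_simp

/-- Powers of ε and t are now separated from a fixed integrable kernel in ξ. This representation
serves for every first term, and for the second term when the exponent is above one half. -/
theorem gagliardo_eq_ker (hω : MeasurableSet ω) {ε : ℝ} (hε : 0 < ε) (s : ℝ)
    {v : Plane n × ℝ → ℝ} (hv : Measurable v) :
    gagliardo s (film ω ε) (fun x => v (x.1, x.2 / ε)) =
      ENNReal.ofReal (2 * ε ^ (1 - 2 * s)) * ∫⁻ t in Ioo (0 : ℝ) 1,
        ENNReal.ofReal (t ^ (-(1 + 2 * s))) *
        ∫⁻ ξ : Plane n, ENNReal.ofReal (ker n s ξ) *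
          shiftEnergy (film ω 1) v ((ε * t) • ξ, t) := by
  rw [gagliardo_eq_half hω hε s hv, ← lintegral_const_mul' _ _ ENNReal.ofReal_ne_top,
    ← lintegral_const_mul' _ _ ENNReal.ofReal_ne_top]
  refine setLIntegral_congr_fun measurableSet_Ioo fun t ht => ?_
  have hh : 0 < ε * t := mul_pos hε ht.1
  rw [lintegral_dilation hh, ← mul_assoc, ← mul_assoc, ← ENNReal.ofReal_mul (by positivity),
    ← ENNReal.ofReal_mul (by positivity), ← lintegral_const_mul' _ _ ENNReal.ofReal_ne_top,
    ← lintegral_const_mul' _ _ ENNReal.ofReal_ne_top]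
  refine lintegral_congr fun ξ => ?_
  have h0 : 0 < t := ht.1
  rw [← mul_assoc, ← mul_assoc, ← ENNReal.ofReal_mul (by positivity),
    ← ENNReal.ofReal_mul (by positivity)]
  congr 2
  have := filmKernel_dilation (s := s) hε ht.1 ξ
  linear_combination 2 * this

/-- The vertical energy of an everywhere defined function, in terms of its vertical increments. -/
noncomputable def vertForm (ω : Set (Plane n)) (s : ℝ) (v : Plane n × ℝ → ℝ) : ℝ≥0∞ :=
  2 * ∫⁻ t in Ioo (0 : ℝ) 1, ENNReal.ofReal (t ^ (-(1 + 2 * s))) *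
    shiftEnergy (film ω 1) v (0, t)

theorem lintegral_shiftEnergy_section (hω : MeasurableSet ω) {v : Plane n × ℝ → ℝ}
    (hv : Measurable v) (t : ℝ) :
    ∫⁻ x in ω, shiftEnergy (Ioo (0 : ℝ) 1) (fun r => v (x, r)) t =
      shiftEnergy (film ω 1) v (0, t) := by
  have hi : Measurable ((film ω 1).indicator (1 : Plane n × ℝ → ℝ≥0∞)) :=
    measurable_one.indicator (measurableSet_film hω 1)
  rw [shiftEnergy_eq_lintegral (measurableSet_film hω 1), Measure.volume_eq_prod,
    lintegral_prod _ (by fun_prop), ← lintegral_indicator hω]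
  refine lintegral_congr fun x => ?_
  by_cases hx : x ∈ ω
  · rw [indicator_of_mem hx, shiftEnergy_eq_lintegral measurableSet_Ioo]
    refine lintegral_congr fun r => ?_
    simp [indicator, film, hx]
  · simp [indicator, film, hx]

/-- The increment formula is applied on each vertical section. Upward and downward shifts contribute
equally, hence the factor 2 in `vertForm`. -/
theorem verticalEnergy_eq (hω : MeasurableSet ω) (s : ℝ) (v : FilmL2 ω) :
    verticalEnergy ω s v = vertForm ω s v := by
  have hv : Measurable v := (Lp.stronglyMeasurable v).measurable
  have hstep : ∀ x : Plane n, ∫⁻ t in Ioo (0 : ℝ) 1, ∫⁻ r in Ioo (0 : ℝ) 1,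
      ENNReal.ofReal (|v (x, t) - v (x, r)| ^ 2 / |t - r| ^ (1 + 2 * s)) =
      2 * ∫⁻ t in Ioo (0 : ℝ) 1, ENNReal.ofReal (t ^ (-(1 + 2 * s))) *
        shiftEnergy (Ioo (0 : ℝ) 1) (fun r => v (x, r)) t := by
    intro x
    have h1 := lintegral_lintegral_eq_shiftEnergy (U := Ioo (0 : ℝ) 1) measurableSet_Ioo
      (v := fun r => v (x, r)) (by fun_prop)
      (κ := fun t => ENNReal.ofReal (|t| ^ (-(1 + 2 * s)))) (by fun_prop)
    rw [lintegral_even] at h1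
    · refine Eq.trans ?_ (h1.trans ?_)
      · refine lintegral_congr fun t => lintegral_congr fun r => ?_
        rw [← ENNReal.ofReal_mul (by positivity), sq_abs, Real.rpow_neg (abs_nonneg _),
          abs_sub_comm t r, div_eq_inv_mul]
        congr 2
        ring
      · congr 1
        refine setLIntegral_congr_fun measurableSet_Ioo fun t ht => ?_
        rw [abs_of_pos ht.1]
    · intro t
      rw [abs_neg, shiftEnergy_neg measurableSet_Ioo]
    · intro t ht
      have : Ioo (0 : ℝ) 1 ∩ (fun x => x + t) ⁻¹' Ioo (0 : ℝ) 1 = ∅ := by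
        ext x
        simp only [mem_inter_iff, mem_Ioo, mem_preimage, mem_empty_iff_false, iff_false]
        rintro ⟨⟨h1, h2⟩, h3, h4⟩
        rcases le_abs'.1 ht with h | h <;> linarith
      rw [shiftEnergy, this]
      simp
  have hi : Measurable ((Ioo (0 : ℝ) 1).indicator (1 : ℝ → ℝ≥0∞)) :=
    measurable_one.indicator measurableSet_Ioo
  have hm : Measurable (fun p : Plane n × ℝ =>
      shiftEnergy (Ioo (0 : ℝ) 1) (fun r => v (p.1, r)) p.2) := by
    simp_rw [shiftEnergy_eq_lintegral measurableSet_Ioo]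
    apply Measurable.lintegral_prod_right (f := fun (p : Plane n × ℝ) x =>
      (Ioo (0 : ℝ) 1).indicator 1 x * (Ioo (0 : ℝ) 1).indicator 1 (x + p.2) *
      ENNReal.ofReal ((v (p.1, x + p.2) - v (p.1, x)) ^ 2))
    fun_prop
  rw [verticalEnergy, vertForm]
  simp_rw [hstep]
  rw [lintegral_const_mul' _ _ (by norm_num), lintegral_lintegral_swap (by
    refine Measurable.aemeasurable ?_
    exact (Measurable.ennreal_ofReal (by fun_prop)).mul hm)]
  congr 1
  refine lintegral_congr fun t => ?_
  rw [lintegral_const_mul' _ _ ENNReal.ofReal_ne_top, lintegral_shiftEnergy_section hω hv]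

theorem planarEnergy_eq (hω : MeasurableSet ω) (s : ℝ) (w : PlaneL2 ω) :
    planarEnergy ω s w = ∫⁻ z : Plane n, ENNReal.ofReal (1 / ‖z‖ ^ (((n : ℝ) + 1) + 2 * s)) *
      shiftEnergy ω w z := by
  have hw : Measurable w := (Lp.stronglyMeasurable w).measurable
  rw [← lintegral_lintegral_eq_shiftEnergy hω hw (by fun_prop), planarEnergy]
  refine lintegral_congr fun x => lintegral_congr fun y => ?_
  rw [← ENNReal.ofReal_mul (by positivity), sq_abs, norm_sub_rev, one_div_mul_eq_div]
  congr 2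
  ring

/-- The increments of a function that does not depend on the last variable. -/
theorem shiftEnergy_comp_fst (hω : MeasurableSet ω) {w : Plane n → ℝ} (hw : Measurable w)
    (z : Plane n) {t : ℝ} (ht : 0 ≤ t) :
    shiftEnergy (film ω 1) (fun x => w x.1) (z, t) =
      ENNReal.ofReal (1 - t) * shiftEnergy ω w z := by
  have hi : Measurable ((film ω 1).indicator (1 : Plane n × ℝ → ℝ≥0∞)) :=
    measurable_one.indicator (measurableSet_film hω 1)
  rw [shiftEnergy_eq_lintegral (measurableSet_film hω 1), Measure.volume_eq_prod,
    lintegral_prod _ (by fun_prop), shiftEnergy_eq_lintegral hω,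
    ← lintegral_const_mul' _ _ ENNReal.ofReal_ne_top]
  refine lintegral_congr fun x => ?_
  have : ∫⁻ r, (Ioo (0 : ℝ) (1 - t)).indicator 1 r = ENNReal.ofReal (1 - t) := by
    rw [lintegral_indicator_one measurableSet_Ioo, Real.volume_Ioo, sub_zero]
  rw [← this, ← lintegral_mul_const _ (measurable_one.indicator measurableSet_Ioo)]
  refine lintegral_congr fun r => ?_
  have hiff : (0 < r ∧ r < 1) ∧ 0 < r + t ∧ r + t < 1 ↔ 0 < r ∧ r < 1 - t :=
    ⟨fun h => ⟨h.1.1, by linarith [h.2.2]⟩, fun h => ⟨⟨h.1, by linarith [h.2]⟩,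
      by linarith [h.1], by linarith [h.2]⟩⟩
  by_cases hr : 0 < r ∧ r < 1 - t
  · have h' := hiff.2 hr
    by_cases hx : x ∈ ω <;> by_cases hxz : x + z ∈ ω <;>
      simp [indicator, film, mem_prod, h'.1, h'.2, hr, hx, hxz]
  · by_cases h1 : 0 < r ∧ r < 1
    · have h2 : ¬ (0 < r + t ∧ r + t < 1) := fun h => hr (hiff.1 ⟨h1, h⟩)
      simp [indicator, film, mem_prod, h2, hr]
    · simp [indicator, film, mem_prod, h1, hr]

/-! ### Weak convergence and duality with test functions -/

section Hilbert

variable {H : Type*} [NormedAddCommGroup H] [InnerProductSpace ℝ H] [CompleteSpace H]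

/-- Weak convergence bounds the dual elements pointwise, so the uniform boundedness principle
applies. -/
theorem WeakTendsto.exists_norm_le {w : ℕ → H} {v : H} (hw : WeakTendsto w v) :
    ∃ C, ∀ k, ‖w k‖ ≤ C := by
  have hb : ∀ x : H, ∃ C, ∀ k, ‖(innerSL ℝ (w k)) x‖ ≤ C := by
    intro x
    have h := (hw (innerSL ℝ x)).norm.bddAbove_range
    obtain ⟨C, hC⟩ := h
    refine ⟨C, fun k => ?_⟩
    have := hC (mem_range_self k)
    simp only [innerSL_apply_apply] at this ⊢
    rwa [real_inner_comm]
  obtain ⟨C, hC⟩ := banach_steinhaus hb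
  exact ⟨C, fun k => by simpa using hC k⟩

theorem WeakTendsto.tendsto_inner {w : ℕ → H} {v : H} (hw : WeakTendsto w v) {φ : ℕ → H} {φ₀ : H}
    (hφ : Tendsto φ atTop (𝓝 φ₀)) :
    Tendsto (fun k => inner ℝ (w k) (φ k)) atTop (𝓝 (inner ℝ v φ₀)) := by
  obtain ⟨C, hC⟩ := hw.exists_norm_le
  have h1 : Tendsto (fun k => inner ℝ φ₀ (w k)) atTop (𝓝 (inner ℝ φ₀ v)) := hw (innerSL ℝ φ₀)
  have h2 : Tendsto (fun k => inner ℝ (w k) (φ k - φ₀)) atTop (𝓝 0) := by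
    rw [tendsto_iff_norm_sub_tendsto_zero] at hφ
    have h3 : Tendsto (fun k => C * ‖φ k - φ₀‖) atTop (𝓝 0) := by
      simpa using hφ.const_mul C
    refine squeeze_zero_norm (fun k => ?_) h3
    exact (norm_inner_le_norm _ _).trans (mul_le_mul_of_nonneg_right (hC k) (norm_nonneg _))
  have h4 := h1.add h2
  rw [add_zero, real_inner_comm] at h4
  refine h4.congr fun k => ?_
  rw [real_inner_comm, ← inner_add_right]
  simp

end Hilbert

section L2

variable {α : Type*} [MeasurableSpace α] {μ : Measure α}

theorem memLp_two_of_bounded [IsFiniteMeasure μ] {Φ : α → ℝ} (hm : Measurable Φ) {M : ℝ}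
    (hb : ∀ x, |Φ x| ≤ M) : MemLp Φ 2 μ :=
  MemLp.of_bound hm.aestronglyMeasurable M (Eventually.of_forall hb)

theorem inner_toLp_eq_integral (f : Lp ℝ 2 μ) {Φ : α → ℝ} (hΦ : MemLp Φ 2 μ) :
    inner ℝ f hΦ.toLp = ∫ x, f x * Φ x ∂μ := by
  rw [L2.inner_def]
  refine integral_congr_ae ?_
  filter_upwards [hΦ.coeFn_toLp] with x hx
  rw [hx]
  simp [mul_comm]

theorem norm_toLp_sq {Φ : α → ℝ} (hΦ : MemLp Φ 2 μ) : ‖hΦ.toLp‖ ^ 2 = ∫ x, Φ x ^ 2 ∂μ := by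
  rw [← real_inner_self_eq_norm_sq, inner_toLp_eq_integral]
  refine integral_congr_ae ?_
  filter_upwards [hΦ.coeFn_toLp] with x hx
  rw [hx, sq]

theorem ofReal_norm_sq_eq_lintegral (f : Lp ℝ 2 μ) :
    ENNReal.ofReal (‖f‖ ^ 2) = ∫⁻ x, ENNReal.ofReal (|f x| ^ 2) ∂μ := by
  rw [← real_inner_self_eq_norm_sq, L2.inner_def, ofReal_integral_eq_lintegral_ofReal]
  · simp [sq]
  · exact L2.integrable_inner (𝕜 := ℝ) f f
  · exact Eventually.of_forall fun x => real_inner_self_nonneg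

/-- On a finite measure space, uniformly bounded functions that converge almost everywhere converge
strongly in L², and a weakly convergent sequence may be paired with them. This is what lets shifts
and difference quotients of a test function vary with k. -/
theorem WeakTendsto.tendsto_integral_mul [IsFiniteMeasure μ] {w : ℕ → Lp ℝ 2 μ} {v : Lp ℝ 2 μ}
    (hw : WeakTendsto w v) {Φ : ℕ → α → ℝ} {Φ₀ : α → ℝ} (hm : ∀ k, Measurable (Φ k))
    (hm₀ : Measurable Φ₀) {M : ℝ} (hb : ∀ k x, |Φ k x| ≤ M) (hb₀ : ∀ x, |Φ₀ x| ≤ M)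
    (hlim : ∀ᵐ x ∂μ, Tendsto (fun k => Φ k x) atTop (𝓝 (Φ₀ x))) :
    Tendsto (fun k => ∫ x, w k x * Φ k x ∂μ) atTop (𝓝 (∫ x, v x * Φ₀ x ∂μ)) := by
  have h₀ : MemLp Φ₀ 2 μ := memLp_two_of_bounded hm₀ hb₀
  have hk : ∀ k, MemLp (Φ k) 2 μ := fun k => memLp_two_of_bounded (hm k) (hb k)
  have hconv : Tendsto (fun k => (hk k).toLp) atTop (𝓝 h₀.toLp) := by
    rw [tendsto_iff_norm_sub_tendsto_zero]
    have h1 : Tendsto (fun k => ∫ x, (Φ k x - Φ₀ x) ^ 2 ∂μ) atTop (𝓝 (∫ x, (0 : ℝ) ∂μ)) := by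
      refine tendsto_integral_of_dominated_convergence (fun _ => (2 * M) ^ 2)
        (fun k => (((hm k).sub hm₀).pow_const 2).aestronglyMeasurable) (integrable_const _)
        (fun k => Eventually.of_forall fun x => ?_) ?_
      · rw [Real.norm_of_nonneg (sq_nonneg _), ← sq_abs]
        have := abs_sub (Φ k x) (Φ₀ x)
        exact pow_le_pow_left₀ (abs_nonneg _) (by linarith [hb k x, hb₀ x]) 2
      · filter_upwards [hlim] with x hx
        have := (hx.sub_const (Φ₀ x)).pow 2
        simpa using this
    rw [integral_zero] at h1
    have h2 := h1.sqrt
    rw [Real.sqrt_zero] at h2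
    refine h2.congr fun k => ?_
    rw [← MemLp.toLp_sub, ← Real.sqrt_sq (norm_nonneg _), norm_toLp_sq]
    rfl
  have := hw.tendsto_inner hconv
  simp_rw [inner_toLp_eq_integral] at this
  exact this

/-- The Cauchy-Schwarz inequality, without integrability assumptions. -/
theorem ofReal_sq_integral_mul_le {f g : α → ℝ} (hf : AEMeasurable f μ) (hg : AEMeasurable g μ) :
    ENNReal.ofReal ((∫ x, f x * g x ∂μ) ^ 2) ≤
      (∫⁻ x, ENNReal.ofReal (f x ^ 2) ∂μ) * ∫⁻ x, ENNReal.ofReal (g x ^ 2) ∂μ := by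
  have h1 : ‖∫ x, f x * g x ∂μ‖ₑ ≤ ∫⁻ x, ‖f x‖ₑ * ‖g x‖ₑ ∂μ := by
    refine (enorm_integral_le_lintegral_enorm _).trans_eq ?_
    simp [enorm_mul]
  have h2 := ENNReal.lintegral_mul_le_Lp_mul_Lq μ (p := 2) (q := 2)
    Real.HolderConjugate.two_two hf.enorm hg.enorm
  have h3 : ∀ a : ℝ, ENNReal.ofReal (a ^ 2) = ‖a‖ₑ ^ (2 : ℝ) := by
    intro a
    rw [Real.enorm_eq_ofReal_abs, ENNReal.rpow_two, ← ENNReal.ofReal_pow (abs_nonneg _), sq_abs]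
  simp_rw [h3]
  calc ‖∫ x, f x * g x ∂μ‖ₑ ^ (2 : ℝ)
      ≤ ((∫⁻ x, ‖f x‖ₑ ^ (2 : ℝ) ∂μ) ^ (1 / 2 : ℝ) *
        (∫⁻ x, ‖g x‖ₑ ^ (2 : ℝ) ∂μ) ^ (1 / 2 : ℝ)) ^ (2 : ℝ) :=
        ENNReal.rpow_le_rpow (h1.trans h2) (by norm_num)
    _ = _ := by
        rw [ENNReal.mul_rpow_of_nonneg _ _ (by norm_num), ← ENNReal.rpow_mul, ← ENNReal.rpow_mul]
        norm_num

end L2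

section Duality

variable {E : Type*} [NormedAddCommGroup E] [NormedSpace ℝ E]

/-- Smooth functions with compact support in `U`. -/
def testSubmodule (U : Set E) : Submodule ℝ (E → ℝ) where
  carrier := {φ | ContDiff ℝ ((⊤ : ℕ∞) : WithTop ℕ∞) φ ∧ HasCompactSupport φ ∧ tsupport φ ⊆ U}
  add_mem' := by
    rintro f g ⟨h1, h2, h3⟩ ⟨h4, h5, h6⟩
    exact ⟨h1.add h4, h2.add h5, (tsupport_add f g).trans (union_subset h3 h6)⟩
  zero_mem' := ⟨contDiff_const, HasCompactSupport.zero, by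
    have : tsupport (0 : E → ℝ) = ∅ := by rw [tsupport_eq_empty_iff]
    rw [this]; exact empty_subset _⟩
  smul_mem' := by
    rintro c f ⟨h1, h2, h3⟩
    exact ⟨contDiff_const.smul h1, h2.smul_left (f := fun _ => c),
      (tsupport_smul_subset_right (fun _ => c) f).trans h3⟩

theorem exists_bound_of_mem_testSubmodule {U : Set E} {φ : E → ℝ} (hφ : φ ∈ testSubmodule U) :
    ∃ M, ∀ x, |φ x| ≤ M := by
  obtain ⟨C, hC⟩ := hφ.1.continuous.bounded_above_of_compact_support hφ.2.1
  exact ⟨C, hC⟩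

theorem exists_lipschitz_of_mem_testSubmodule {U : Set E} {φ : E → ℝ} (hφ : φ ∈ testSubmodule U) :
    ∃ L : ℝ, 0 ≤ L ∧ ∀ x y, |φ x - φ y| ≤ L * ‖x - y‖ := by
  obtain ⟨C, hC⟩ := ContDiff.lipschitzWith_of_hasCompactSupport hφ.2.1 hφ.1 (by simp)
  exact ⟨C, C.2, fun x y => by simpa [dist_eq_norm] using hC.dist_le_mul x y⟩

variable [MeasureSpace E] [BorelSpace E] [IsFiniteMeasureOnCompacts (volume : Measure E)]

theorem memLp_of_mem_testSubmodule {U : Set E} {φ : E → ℝ} (hφ : φ ∈ testSubmodule U) :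
    MemLp φ 2 (volume.restrict U) :=
  (hφ.1.continuous.memLp_of_hasCompactSupport hφ.2.1).restrict U

/-- A linear functional on test functions that is bounded in `L²` is represented by an `L²`
function. -/
theorem exists_L2_repr {U : Set E} (ℓ : testSubmodule U →ₗ[ℝ] ℝ) {M : ℝ≥0∞} (hM : M ≠ ∞)
    (hℓ : ∀ φ : testSubmodule U, ENNReal.ofReal ((ℓ φ) ^ 2) ≤
      M * ∫⁻ x in U, ENNReal.ofReal ((φ : E → ℝ) x ^ 2)) :
    ∃ g : Lp ℝ 2 ((volume : Measure E).restrict U),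
      (∀ φ : testSubmodule U, ℓ φ = ∫ x in U, g x * (φ : E → ℝ) x) ∧
      ∫⁻ x in U, ENNReal.ofReal (|g x| ^ 2) ≤ M := by
  let ι : testSubmodule U →ₗ[ℝ] Lp ℝ 2 ((volume : Measure E).restrict U) :=
    { toFun := fun φ => (memLp_of_mem_testSubmodule φ.2).toLp
      map_add' := fun _ _ => rfl
      map_smul' := fun _ _ => rfl }
  have hι : ∀ φ : testSubmodule U, ι φ = (memLp_of_mem_testSubmodule φ.2).toLp := fun _ => rfl
  have hnorm : ∀ φ : testSubmodule U, |ℓ φ| ≤ Real.sqrt M.toReal * ‖ι φ‖ := by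
    intro φ
    have h1 := hℓ φ
    have h2 : ∫⁻ x in U, ENNReal.ofReal ((φ : E → ℝ) x ^ 2) = ENNReal.ofReal (‖ι φ‖ ^ 2) := by
      rw [hι, ofReal_norm_sq_eq_lintegral]
      refine lintegral_congr_ae ?_
      filter_upwards [(memLp_of_mem_testSubmodule φ.2).coeFn_toLp] with x hx
      rw [hx, sq_abs]
    rw [h2, ← ENNReal.ofReal_toReal hM, ← ENNReal.ofReal_mul ENNReal.toReal_nonneg,
      ENNReal.ofReal_le_ofReal_iff (by positivity)] at h1
    refine abs_le_of_sq_le_sq ?_ (by positivity)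
    rwa [mul_pow, Real.sq_sqrt ENNReal.toReal_nonneg]
  -- The functional must factor through the image of the test functions in L². The bound forces it
  -- to vanish on the kernel of ι, so injectivity of ι is never needed.
  have hker : LinearMap.ker ι ≤ LinearMap.ker ℓ := by
    intro φ hφ
    rw [LinearMap.mem_ker] at hφ ⊢
    have := hnorm φ
    rw [hφ, norm_zero, mul_zero] at this
    exact abs_nonpos_iff.1 this
  let f₀ : LinearMap.range ι →ₗ[ℝ] ℝ :=
    ((LinearMap.ker ι).liftQ ℓ hker) ∘ₗ (ι.quotKerEquivRange.symm : _ →ₗ[ℝ] _)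
  have hf₀ : ∀ φ : testSubmodule U, f₀ ⟨ι φ, LinearMap.mem_range_self ι φ⟩ = ℓ φ := by
    intro φ
    have : ι.quotKerEquivRange.symm ⟨ι φ, LinearMap.mem_range_self ι φ⟩ =
        (LinearMap.ker ι).mkQ φ := LinearMap.quotKerEquivRange_symm_apply_image ι φ _
    simp only [f₀, LinearMap.comp_apply, LinearEquiv.coe_coe, this]
    simp
  let f : StrongDual ℝ (LinearMap.range ι) := f₀.mkContinuous (Real.sqrt M.toReal) (by
    rintro ⟨_, φ, rfl⟩
    rw [hf₀]
    exact hnorm φ)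
  obtain ⟨F, hF, hFn⟩ := exists_extension_norm_eq (LinearMap.range ι) f
  have hFn' : ‖F‖ ≤ Real.sqrt M.toReal := by
    rw [hFn]; exact LinearMap.mkContinuous_norm_le _ (Real.sqrt_nonneg _) _
  refine ⟨(InnerProductSpace.toDual ℝ _).symm F, fun φ => ?_, ?_⟩
  · rw [← inner_toLp_eq_integral _ (memLp_of_mem_testSubmodule φ.2),
      InnerProductSpace.toDual_symm_apply, ← hf₀ φ]
    exact (hF ⟨ι φ, LinearMap.mem_range_self ι φ⟩).symm
  · rw [← ofReal_norm_sq_eq_lintegral, LinearIsometryEquiv.norm_map]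
    refine ENNReal.ofReal_le_of_le_toReal ?_
    calc ‖F‖ ^ 2 ≤ Real.sqrt M.toReal ^ 2 := pow_le_pow_left₀ (norm_nonneg _) hFn' 2
      _ = M.toReal := Real.sq_sqrt ENNReal.toReal_nonneg

end Duality

section ShiftDuality

variable {G : Type*} [AddCommGroup G] [MeasureSpace G] [MeasurableAdd₂ G] [MeasurableNeg G]
  [(volume : Measure G).IsAddLeftInvariant] [SFinite (volume : Measure G)]

/-- Summation by parts for increments: translation moves the shift from Φ to w. The support
condition removes the indicator of U from both terms. -/
theorem integral_mul_shift_sub {U : Set G} (hU : MeasurableSet U) {w : G → ℝ}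
    (hw : IntegrableOn w U) {Φ : G → ℝ} (hΦ : Measurable Φ) {M : ℝ} (hb : ∀ x, |Φ x| ≤ M) (z : G)
    (hsupp : ∀ x, Φ x ≠ 0 → x ∈ U ∧ x + z ∈ U) :
    ∫ x in U, w x * (Φ (x - z) - Φ x) =
      ∫ x in U ∩ (fun x => x + z) ⁻¹' U, (w (x + z) - w x) * Φ x := by
  have hU' : MeasurableSet (U ∩ (fun x => x + z) ⁻¹' U) := hU.inter ((measurable_add_const z) hU)
  have hwi : Integrable (U.indicator w) := hw.integrable_indicator hU
  have hΦz : Measurable fun x => Φ (x - z) := hΦ.comp (by fun_prop)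
  have hi1 : Integrable (fun x => U.indicator w x * Φ (x - z)) :=
    hwi.mul_bdd (c := M) hΦz.aestronglyMeasurable (Eventually.of_forall fun x => hb _)
  have hi2 : Integrable (fun x => U.indicator w x * Φ x) :=
    hwi.mul_bdd (c := M) hΦ.aestronglyMeasurable (Eventually.of_forall fun x => hb _)
  have h1 : ∫ x in U, w x * (Φ (x - z) - Φ x) =
      (∫ x, U.indicator w x * Φ (x - z)) - ∫ x, U.indicator w x * Φ x := by
    rw [← integral_sub hi1 hi2, ← integral_indicator hU]
    refine integral_congr_ae (Eventually.of_forall fun x => ?_)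
    by_cases hx : x ∈ U <;> simp [indicator, hx]
    ring
  have h2 : ∫ x, U.indicator w x * Φ (x - z) = ∫ x, U.indicator w (x + z) * Φ x := by
    rw [← integral_add_right_eq_self _ z]
    simp
  have hi3 : Integrable (fun x => U.indicator w (x + z) * Φ x) := by
    have := hi1.comp_add_right z
    simpa using this
  rw [h1, h2, ← integral_sub hi3 hi2, ← integral_indicator hU']
  refine integral_congr_ae (Eventually.of_forall fun x => ?_)
  by_cases h0 : Φ x = 0
  · simp [indicator, h0]
  · obtain ⟨h3, h4⟩ := hsupp x h0
    simp [indicator, h3, h4]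
    ring

/-- Cauchy-Schwarz after the shift has been moved. The left side passes to the limit under weak
convergence of w, although the increment itself does not. -/
theorem ofReal_sq_integral_le_shiftEnergy {U : Set G} (hU : MeasurableSet U) {w : G → ℝ}
    (hwm : Measurable w) (hw : IntegrableOn w U) {Φ : G → ℝ} (hΦ : Measurable Φ) {M : ℝ}
    (hb : ∀ x, |Φ x| ≤ M) (z : G) (hsupp : ∀ x, Φ x ≠ 0 → x ∈ U ∧ x + z ∈ U) :
    ENNReal.ofReal ((∫ x in U, w x * (Φ (x - z) - Φ x)) ^ 2) ≤
      shiftEnergy U w z * ∫⁻ x, ENNReal.ofReal (Φ x ^ 2) := by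
  rw [integral_mul_shift_sub hU hw hΦ hb z hsupp]
  refine (ofReal_sq_integral_mul_le (by fun_prop) (by fun_prop)).trans ?_
  gcongr
  · exact le_rfl
  · exact Measure.restrict_le_self

end ShiftDuality

/-! ### Weak lower semicontinuity of increments -/

/-- The left sides converge, and multiplication by a finite constant is monotone and continuous, so
it commutes with the lower limit. -/
theorem ofReal_sq_le_liminf_mul {c : ℕ → ℝ} {c₀ : ℝ} (hc : Tendsto c atTop (𝓝 c₀)) {q : ℕ → ℝ≥0∞}
    {B : ℝ≥0∞} (hB : B ≠ ∞) (h : ∀ᶠ k in atTop, ENNReal.ofReal (c k ^ 2) ≤ q k * B) :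
    ENNReal.ofReal (c₀ ^ 2) ≤ liminf q atTop * B := by
  have h1 : Tendsto (fun k => ENNReal.ofReal (c k ^ 2)) atTop (𝓝 (ENNReal.ofReal (c₀ ^ 2))) :=
    (ENNReal.continuous_ofReal.tendsto _).comp (hc.pow 2)
  have hmono : Monotone fun x : ℝ≥0∞ => x * B := fun _ _ h => mul_le_mul_left h B
  have hcont : Continuous fun x : ℝ≥0∞ => x * B := ENNReal.continuous_mul_const hB
  have h2 := hmono.map_liminf_of_continuousAt q (F := atTop) hcont.continuousAt
  rw [← h1.liminf_eq]
  refine (liminf_le_liminf h).trans_eq ?_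
  exact h2.symm

theorem lintegral_sq_ne_top_of_mem_testSubmodule {E : Type*} [NormedAddCommGroup E]
    [NormedSpace ℝ E] [MeasureSpace E] [BorelSpace E]
    [IsFiniteMeasureOnCompacts (volume : Measure E)] {U : Set E} {φ : E → ℝ}
    (hφ : φ ∈ testSubmodule U) : ∫⁻ x, ENNReal.ofReal (φ x ^ 2) ≠ ∞ := by
  have h : MemLp φ 2 volume := hφ.1.continuous.memLp_of_hasCompactSupport hφ.2.1
  have := h.integrable_sq.lintegral_lt_top
  exact this.ne

theorem setLIntegral_sq_of_mem_testSubmodule {E : Type*} [NormedAddCommGroup E]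
    [NormedSpace ℝ E] [MeasureSpace E] [BorelSpace E] {U : Set E} (hU : MeasurableSet U)
    {φ : E → ℝ} (hφ : φ ∈ testSubmodule U) :
    ∫⁻ x in U, ENNReal.ofReal (φ x ^ 2) = ∫⁻ x, ENNReal.ofReal (φ x ^ 2) := by
  rw [← lintegral_indicator hU]
  refine lintegral_congr fun x => ?_
  by_cases hx : x ∈ U
  · simp [hx]
  · have : φ x = 0 := by
      by_contra h
      exact hx (hφ.2.2 (subset_tsupport _ h))
    simp [hx, this]

theorem eventually_forall_add_mem {E : Type*} [NormedAddCommGroup E] {K O : Set E}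
    (hK : IsCompact K) (hO : IsOpen O) {z₀ : E} (h : ∀ x ∈ K, x + z₀ ∈ O) {z : ℕ → E}
    (hz : Tendsto z atTop (𝓝 z₀)) : ∀ᶠ k in atTop, ∀ x ∈ K, x + z k ∈ O := by
  have : ∀ᶠ z in 𝓝 z₀, ∀ x ∈ K, x + z ∈ O := by
    refine hK.eventually_forall_of_forall_eventually fun x hx => ?_
    have hc : Continuous fun p : E × E => p.2 + p.1 := by fun_prop
    exact hc.continuousAt.eventually_mem (hO.mem_nhds (h x hx))
  exact hz.eventually this

theorem ae_eq_zero_of_integral_test {E : Type*} [NormedAddCommGroup E] [NormedSpace ℝ E]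
    [FiniteDimensional ℝ E] [MeasureSpace E] [BorelSpace E] {U : Set E} (hU : IsOpen U)
    {f : E → ℝ} (hf : IntegrableOn f U)
    (h : ∀ φ ∈ testSubmodule U, ∫ x in U, f x * φ x = 0) :
    ∀ᵐ x ∂(volume.restrict U), f x = 0 := by
  have := hU.ae_eq_zero_of_integral_contDiff_smul_eq_zero (μ := volume.restrict U) (f := f) ?_ ?_
  · filter_upwards [this, ae_restrict_mem hU.measurableSet] with x h1 h2
    exact h1 h2
  · have h1 : Integrable f (volume.restrict U) := hf
    exact h1.locallyIntegrable.locallyIntegrableOn U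
  · intro g h1 h2 h3
    simpa [mul_comm] using h g ⟨h1, h2, h3⟩

theorem isOpen_film (hω : IsOpen ω) (ε : ℝ) : IsOpen (film ω ε) := hω.prod isOpen_Ioo

theorem isFiniteMeasure_restrict_film (hfin : volume ω ≠ ∞) :
    IsFiniteMeasure ((volume : Measure (Plane n × ℝ)).restrict (film ω 1)) := by
  refine ⟨?_⟩
  rw [Measure.restrict_apply_univ, film, Measure.volume_eq_prod, Measure.prod_prod]
  exact ENNReal.mul_lt_top hfin.lt_top (by simp)

theorem isFiniteMeasure_restrict_plane (hfin : volume ω ≠ ∞) :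
    IsFiniteMeasure ((volume : Measure (Plane n)).restrict ω) :=
  ⟨by rw [Measure.restrict_apply_univ]; exact hfin.lt_top⟩

theorem integrableOn_filmL2 (hfin : volume ω ≠ ∞) (v : FilmL2 ω) : IntegrableOn v (film ω 1) := by
  have := isFiniteMeasure_restrict_film hfin
  exact (Lp.memLp v).integrable (by norm_num)

theorem integrableOn_planeL2 (hfin : volume ω ≠ ∞) (v : PlaneL2 ω) : IntegrableOn v ω := by
  have := isFiniteMeasure_restrict_plane hfin
  exact (Lp.memLp v).integrable (by norm_num)

theorem measurable_coe_Lp {α : Type*} [MeasurableSpace α] {μ : Measure α} (v : Lp ℝ 2 μ) :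
    Measurable v := (Lp.stronglyMeasurable v).measurable

/-- By duality. Against a test function supported where both x and x + z₀ lie in the film, the
pairing with the increment of v is the limit of pairings for `w k` and `z k`, each controlled by the
increment of `w k`. A functional with such a bound is given by an L² function, which can only be the
increment of v. Letting the shift vary is what makes the slanted shifts (εtξ, t) reach the vertical
one. -/
theorem shiftEnergy_le_liminf (hω : IsOpen ω) (hfin : volume ω ≠ ∞) {w : ℕ → FilmL2 ω}
    {v : FilmL2 ω} (hw : WeakTendsto w v) {z : ℕ → Plane n × ℝ} {z₀ : Plane n × ℝ}
    (hz : Tendsto z atTop (𝓝 z₀)) :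
    shiftEnergy (film ω 1) v z₀ ≤ liminf (fun k => shiftEnergy (film ω 1) (w k) (z k)) atTop := by
  have := isFiniteMeasure_restrict_film hfin
  set M := liminf (fun k => shiftEnergy (film ω 1) (w k) (z k)) atTop with hM
  by_cases htop : M = ∞
  · rw [htop]; exact le_top
  have hΩ : IsOpen (film ω 1) := isOpen_film hω 1
  set U := film ω 1 ∩ (fun x => x + z₀) ⁻¹' film ω 1 with hU
  have hUo : IsOpen U := hΩ.inter (hΩ.preimage (by fun_prop))
  have hv : Measurable v := measurable_coe_Lp v
  have hvi := integrableOn_filmL2 hfin v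
  have hfU : IntegrableOn (fun x => v (x + z₀) - v x) U := by
    refine IntegrableOn.sub ?_ (hvi.mono_set inter_subset_left)
    have : IntegrableOn (fun x => v (x + z₀)) ((fun x => x + z₀) ⁻¹' film ω 1) :=
      ((measurePreserving_add_right volume z₀).integrableOn_comp_preimage
        (measurableEmbedding_addRight z₀)).2 hvi
    exact this.mono_set inter_subset_right
  have hsuppU : ∀ φ ∈ testSubmodule U, ∀ x, φ x ≠ 0 → x ∈ film ω 1 ∧ x + z₀ ∈ film ω 1 :=
    fun φ hφ x hx => hφ.2.2 (subset_tsupport _ hx)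
  have hkey : ∀ φ ∈ testSubmodule U,
      ENNReal.ofReal ((∫ x in U, (v (x + z₀) - v x) * φ x) ^ 2) ≤
        M * ∫⁻ x in U, ENNReal.ofReal (φ x ^ 2) := by
    intro φ hφ
    obtain ⟨C, hC⟩ := exists_bound_of_mem_testSubmodule hφ
    have hφm : Measurable φ := hφ.1.continuous.measurable
    rw [setLIntegral_sq_of_mem_testSubmodule hUo.measurableSet hφ,
      ← integral_mul_shift_sub hΩ.measurableSet hvi hφm hC z₀ (hsuppU φ hφ)]
    refine ofReal_sq_le_liminf_mul (c := fun k => ∫ x in film ω 1, w k x * (φ (x - z k) - φ x)) ?_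
      (lintegral_sq_ne_top_of_mem_testSubmodule hφ) ?_
    · refine hw.tendsto_integral_mul (fun k => by fun_prop) (by fun_prop) (M := 2 * C)
        (fun k x => ?_) (fun x => ?_) ?_
      · exact (abs_sub _ _).trans (by linarith [hC (x - z k), hC x])
      · exact (abs_sub _ _).trans (by linarith [hC (x - z₀), hC x])
      · refine Eventually.of_forall fun x => ?_
        have : Tendsto (fun k => x - z k) atTop (𝓝 (x - z₀)) := tendsto_const_nhds.sub hz
        exact ((hφ.1.continuous.tendsto _).comp this).sub_const _
    · have hsub : ∀ᶠ k in atTop, ∀ x ∈ tsupport φ, x + z k ∈ film ω 1 :=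
        eventually_forall_add_mem hφ.2.1 hΩ (fun x hx => (hφ.2.2 hx).2) hz
      filter_upwards [hsub] with k hk
      exact ofReal_sq_integral_le_shiftEnergy hΩ.measurableSet (measurable_coe_Lp _)
        (integrableOn_filmL2 hfin _) hφm hC (z k)
        (fun x hx => ⟨(hsuppU φ hφ x hx).1, hk x (subset_tsupport _ hx)⟩)
  have hint : ∀ φ ∈ testSubmodule U, Integrable (fun x => (v (x + z₀) - v x) * φ x)
      (volume.restrict U) := by
    intro φ hφ
    obtain ⟨C, hC⟩ := exists_bound_of_mem_testSubmodule hφ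
    exact Integrable.mul_bdd (c := C) hfU hφ.1.continuous.aestronglyMeasurable
      (Eventually.of_forall fun x => hC x)
  let ℓ : testSubmodule U →ₗ[ℝ] ℝ :=
    { toFun := fun φ => ∫ x in U, (v (x + z₀) - v x) * (φ : _ → ℝ) x
      map_add' := fun φ ψ => by
        rw [← integral_add (hint φ φ.2) (hint ψ ψ.2)]
        simp [mul_add]
      map_smul' := fun c φ => by
        rw [RingHom.id_apply, smul_eq_mul, ← integral_const_mul]
        refine integral_congr_ae (Eventually.of_forall fun x => ?_)
        simp only [Submodule.coe_smul, Pi.smul_apply, smul_eq_mul]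
        ring }
  obtain ⟨g, hg, hgM⟩ := exists_L2_repr ℓ htop (fun φ => hkey φ φ.2)
  have : IsFiniteMeasure ((volume : Measure (Plane n × ℝ)).restrict U) :=
    isFiniteMeasure_of_le _ (Measure.restrict_mono inter_subset_left le_rfl)
  have hgi : IntegrableOn g U := (Lp.memLp g).integrable (by norm_num)
  -- Only integrability of the increment is used here; its L² norm is read off from g once test
  -- functions have identified the two.
  have hae : ∀ᵐ x ∂(volume.restrict U), (v (x + z₀) - v x) - g x = 0 := by
    refine ae_eq_zero_of_integral_test hUo (hfU.sub hgi) fun φ hφ => ?_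
    obtain ⟨C, hC⟩ := exists_bound_of_mem_testSubmodule hφ
    have h2 : Integrable (fun x => g x * φ x) (volume.restrict U) :=
      Integrable.mul_bdd (c := C) hgi hφ.1.continuous.aestronglyMeasurable
        (Eventually.of_forall fun x => hC x)
    have h3 : ∫ x in U, (v (x + z₀) - v x) * φ x = ∫ x in U, g x * φ x := hg ⟨φ, hφ⟩
    simp_rw [sub_mul]
    simp_rw [sub_mul] at h3
    have h4 := hint φ hφ
    simp_rw [sub_mul] at h4
    rw [integral_sub h4 h2, h3, sub_self]
  refine le_trans (le_of_eq ?_) hgM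
  rw [shiftEnergy]
  refine lintegral_congr_ae ?_
  filter_upwards [hae] with x hx
  rw [sub_eq_zero.1 hx, sq_abs]

/-- Difference quotients at a vanishing vertical scale control the vertical weak derivative. -/
theorem sq_integral_vertical_le_liminf (hω : IsOpen ω) (hfin : volume ω ≠ ∞) {w : ℕ → FilmL2 ω}
    {v : FilmL2 ω} (hw : WeakTendsto w v) {y : ℕ → Plane n} {t : ℕ → ℝ} (htpos : ∀ k, 0 < t k)
    (ht : Tendsto t atTop (𝓝 0)) (hy : Tendsto (fun k => (t k)⁻¹ • y k) atTop (𝓝 0))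
    {φ : Plane n × ℝ → ℝ} (hφ : φ ∈ testSubmodule (film ω 1)) :
    ENNReal.ofReal ((∫ x in film ω 1, v x * fderiv ℝ φ x (0, 1)) ^ 2) ≤
      liminf (fun k => shiftEnergy (film ω 1) (w k) (y k, t k) / ENNReal.ofReal (t k ^ 2)) atTop *
        ∫⁻ x in film ω 1, ENNReal.ofReal (φ x ^ 2) := by
  have := isFiniteMeasure_restrict_film hfin
  have hΩ : IsOpen (film ω 1) := isOpen_film hω 1
  obtain ⟨C, hC⟩ := exists_bound_of_mem_testSubmodule hφ
  obtain ⟨L, hL0, hL⟩ := exists_lipschitz_of_mem_testSubmodule hφ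
  have hφm : Measurable φ := hφ.1.continuous.measurable
  have hdiff : Differentiable ℝ φ := hφ.1.differentiable (by simp)
  -- The horizontal part of the shift is negligible with respect to its height, so the rescaled
  -- shifts tend to a vertical unit vector and differentiability of φ applies.
  have hz : Tendsto (fun k => (t k)⁻¹ • (-(y k, t k) : Plane n × ℝ)) atTop
      (𝓝 (-(0, 1) : Plane n × ℝ)) := by
    have h1 : Tendsto (fun k => ((t k)⁻¹ • y k, (t k)⁻¹ * t k)) atTop (𝓝 ((0, 1) : Plane n × ℝ)) :=
      hy.prodMk_nhds (tendsto_const_nhds.congr fun k => (inv_mul_cancel₀ (htpos k).ne').symm)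
    have h2 := h1.neg
    refine h2.congr fun k => ?_
    simp
  obtain ⟨R, hR⟩ := hz.norm.bddAbove_range
  have hR0 : 0 ≤ R := (norm_nonneg _).trans (hR (mem_range_self 0))
  have hzk : Tendsto (fun k => (y k, t k)) atTop (𝓝 (0 : Plane n × ℝ)) := by
    have h1 : Tendsto (fun k => t k • (t k)⁻¹ • y k) atTop (𝓝 ((0 : ℝ) • (0 : Plane n))) :=
      ht.smul hy
    rw [smul_zero] at h1
    refine Tendsto.prodMk_nhds (h1.congr fun k => ?_) ht
    rw [smul_smul, mul_inv_cancel₀ (htpos k).ne', one_smul]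
  rw [setLIntegral_sq_of_mem_testSubmodule hΩ.measurableSet hφ]
  -- Moving the shift onto φ evaluates it at x - z, so the limit is the derivative in the opposite
  -- direction; the square hides the sign.
  have hneg : (∫ x in film ω 1, v x * fderiv ℝ φ x (0, 1)) ^ 2 =
      (∫ x in film ω 1, v x * fderiv ℝ φ x (-(0, 1))) ^ 2 := by
    simp_rw [map_neg, mul_neg]
    rw [integral_neg, neg_sq]
  rw [hneg]
  refine ofReal_sq_le_liminf_mul (c := fun k => ∫ x in film ω 1,
    w k x * ((t k)⁻¹ • (φ (x - (y k, t k)) - φ x))) ?_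
    (lintegral_sq_ne_top_of_mem_testSubmodule hφ) ?_
  · have hb : ∀ k x, |(t k)⁻¹ • (φ (x - (y k, t k)) - φ x)| ≤ L * R := by
      intro k x
      have h1 := hL (x - (y k, t k)) x
      have h2 := hR (mem_range_self k)
      simp only [norm_smul, norm_neg, norm_inv, Real.norm_eq_abs, abs_of_pos (htpos k)] at h2
      rw [smul_eq_mul, abs_mul, abs_inv, abs_of_pos (htpos k)]
      have h3 : ‖x - (y k, t k) - x‖ = ‖(y k, t k)‖ := by rw [sub_sub_cancel_left, norm_neg]
      rw [h3] at h1
      calc (t k)⁻¹ * |φ (x - (y k, t k)) - φ x| ≤ (t k)⁻¹ * (L * ‖(y k, t k)‖) :=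
            mul_le_mul_of_nonneg_left h1 (inv_pos.2 (htpos k)).le
        _ = L * ((t k)⁻¹ * ‖(y k, t k)‖) := by ring
        _ ≤ L * R := mul_le_mul_of_nonneg_left h2 hL0
    have hlim : ∀ x, Tendsto (fun k => (t k)⁻¹ • (φ (x - (y k, t k)) - φ x)) atTop
        (𝓝 (fderiv ℝ φ x (-(0, 1)))) := by
      intro x
      have := (hdiff x).hasFDerivAt.hasFDerivWithinAt (s := univ).lim (by simpa using hzk.neg)
        (Eventually.of_forall fun _ => mem_univ _) hz
      simpa [sub_eq_add_neg] using this
    refine hw.tendsto_integral_mul (fun k => by fun_prop) ?_ hb (M := L * R) (fun x => ?_)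
      (Eventually.of_forall hlim)
    · exact measurable_of_tendsto_metrizable (f := fun k x => (t k)⁻¹ • (φ (x - (y k, t k)) - φ x))
        (fun k => by fun_prop) (tendsto_pi_nhds.2 hlim)
    · exact le_of_tendsto (hlim x).abs (Eventually.of_forall fun k => hb k x)
  · have hsub : ∀ᶠ k in atTop, ∀ x ∈ tsupport φ, x + (y k, t k) ∈ film ω 1 :=
      eventually_forall_add_mem hφ.2.1 hΩ (fun x hx => by simpa using hφ.2.2 hx) hzk
    filter_upwards [hsub] with k hk
    have h1 := ofReal_sq_integral_le_shiftEnergy hΩ.measurableSet (measurable_coe_Lp (w k))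
        (integrableOn_filmL2 hfin _) hφm hC (y k, t k)
        (fun x hx => ⟨hφ.2.2 (subset_tsupport _ hx), hk x (subset_tsupport _ hx)⟩)
    have h2 : ∫ x in film ω 1, w k x * ((t k)⁻¹ • (φ (x - (y k, t k)) - φ x)) =
        (t k)⁻¹ * ∫ x in film ω 1, w k x * (φ (x - (y k, t k)) - φ x) := by
      rw [← integral_const_mul]
      refine integral_congr_ae (Eventually.of_forall fun x => ?_)
      simp only [smul_eq_mul]
      ring
    rw [h2, mul_pow, ENNReal.ofReal_mul (by positivity), inv_pow, ENNReal.ofReal_inv_of_pos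
      (by have := htpos k; positivity), ENNReal.div_eq_inv_mul, mul_assoc]
    exact mul_le_mul_right h1 _

/-- Paired horizontal difference quotients control the horizontal weak derivatives of a limit
that does not depend on the last variable. -/
theorem sq_integral_horizontal_le_liminf (hω : IsOpen ω) (hfin : volume ω ≠ ∞)
    {w : ℕ → FilmL2 ω} {v : FilmL2 ω} (hw : WeakTendsto w v) {u : PlaneL2 ω}
    (hu : ∀ᵐ x ∂((volume : Measure (Plane n × ℝ)).restrict (film ω 1)), v x = u x.1)
    {h t : ℕ → ℝ} {t₀ : ℝ} (hpos : ∀ k, 0 < h k) (hh : Tendsto h atTop (𝓝 0))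
    (ht0 : ∀ k, 0 ≤ t k) (ht : Tendsto t atTop (𝓝 t₀)) (ht₀ : t₀ < 1)
    (ξ : Plane n) {φ : Plane n → ℝ} (hφ : φ ∈ testSubmodule ω) :
    ENNReal.ofReal (1 - t₀) * ENNReal.ofReal ((∫ x in ω, u x * fderiv ℝ φ x ξ) ^ 2) ≤
      liminf (fun k => (shiftEnergy (film ω 1) (w k) (h k • ξ, t k) +
        shiftEnergy (film ω 1) (w k) (-(h k • ξ), t k)) / ENNReal.ofReal (2 * h k ^ 2)) atTop *
        ∫⁻ x in ω, ENNReal.ofReal (φ x ^ 2) := by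
  have := isFiniteMeasure_restrict_film hfin
  have hΩ : IsOpen (film ω 1) := isOpen_film hω 1
  obtain ⟨C, hC⟩ := exists_bound_of_mem_testSubmodule hφ
  obtain ⟨L, hL0, hL⟩ := exists_lipschitz_of_mem_testSubmodule hφ
  have hφm : Measurable φ := hφ.1.continuous.measurable
  have hdiff : Differentiable ℝ φ := hφ.1.differentiable (by simp)
  have ht00 : 0 ≤ t₀ := ge_of_tendsto' ht ht0
  set B := ∫⁻ x in ω, ENNReal.ofReal (φ x ^ 2) with hB
  have hBfull := setLIntegral_sq_of_mem_testSubmodule hω.measurableSet hφ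
  have hBtop : B ≠ ∞ := by
    rw [hB, hBfull]; exact lintegral_sq_ne_top_of_mem_testSubmodule hφ
  set D := ∫ x in ω, u x * fderiv ℝ φ x ξ with hD
  -- the quotients of the test function
  set Ψ : ℕ → Plane n → ℝ := fun k x => (h k)⁻¹ • (φ (x - h k • ξ) - φ (x + h k • ξ)) with hΨ
  have hΨlim : ∀ x, Tendsto (fun k => Ψ k x) atTop (𝓝 (-2 * fderiv ℝ φ x ξ)) := by
    intro x
    have h1 : Tendsto (fun k => ‖(h k)⁻¹‖) atTop atTop := by
      have : Tendsto h atTop (𝓝[>] 0) := tendsto_nhdsGT_zero hpos hh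
      exact (tendsto_norm_atTop_atTop.comp (tendsto_inv_nhdsGT_zero.comp this))
    have h2 := (hdiff x).hasFDerivAt.lim (-ξ) h1
    have h3 := (hdiff x).hasFDerivAt.lim ξ h1
    simp only [inv_inv, smul_neg] at h2 h3
    have h4 := h2.sub h3
    have h5 : fderiv ℝ φ x (-ξ) - fderiv ℝ φ x ξ = -2 * fderiv ℝ φ x ξ := by
      rw [map_neg]; ring
    rw [h5] at h4
    refine h4.congr fun k => ?_
    simp only [hΨ, smul_eq_mul, sub_eq_add_neg]
    ring
  have hΨb : ∀ k x, |Ψ k x| ≤ L * (2 * ‖ξ‖) := by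
    intro k x
    have h1 := hL (x - h k • ξ) (x + h k • ξ)
    have h2 : x - h k • ξ - (x + h k • ξ) = -((2 * h k) • ξ) := by
      rw [two_mul, add_smul]; abel
    rw [h2, norm_neg, norm_smul, Real.norm_of_nonneg (by linarith [hpos k])] at h1
    simp only [hΨ, smul_eq_mul]
    rw [abs_mul, abs_inv, abs_of_pos (hpos k), inv_mul_le_iff₀ (hpos k)]
    linarith
  have hΨm : ∀ k, Measurable (Ψ k) := fun k => by simp only [hΨ]; fun_prop
  have hdm : Measurable fun x => -2 * fderiv ℝ φ x ξ :=
    measurable_of_tendsto_metrizable hΨm (tendsto_pi_nhds.2 hΨlim)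
  -- the limit of the tested quotients
  have hlim : Tendsto (fun k => ∫ x in film ω 1, w k x * (Ψ k x.1 * (Ioi (t k)).indicator 1 x.2))
      atTop (𝓝 (-2 * (1 - t₀) * D)) := by
    have h1 := hw.tendsto_integral_mul
      (Φ := fun k x => Ψ k x.1 * (Ioi (t k)).indicator 1 x.2)
      (Φ₀ := fun x => (-2 * fderiv ℝ φ x.1 ξ) * (Ioi t₀).indicator 1 x.2)
      (fun k => ((hΨm k).comp measurable_fst).mul
        ((measurable_one.indicator measurableSet_Ioi).comp measurable_snd))
      ((hdm.comp measurable_fst).mul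
        ((measurable_one.indicator measurableSet_Ioi).comp measurable_snd))
      (M := L * (2 * ‖ξ‖)) (fun k x => ?_) (fun x => ?_) ?_
    · convert h1 using 2
      have h2 : ∫ x in film ω 1, v x * ((-2 * fderiv ℝ φ x.1 ξ) * (Ioi t₀).indicator 1 x.2) =
          ∫ x in film ω 1, (u x.1 * (-2 * fderiv ℝ φ x.1 ξ)) * (Ioi t₀).indicator 1 x.2 := by
        refine integral_congr_ae ?_
        filter_upwards [hu] with x hx
        rw [hx]; ring
      rw [h2, film, Measure.volume_eq_prod, ← Measure.prod_restrict,
        integral_prod_mul (fun x : Plane n => u x * (-2 * fderiv ℝ φ x ξ))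
          (fun r : ℝ => (Ioi t₀).indicator (1 : ℝ → ℝ) r)]
      have h3 : ∫ r in Ioo (0 : ℝ) 1, (Ioi t₀).indicator (1 : ℝ → ℝ) r = 1 - t₀ := by
        rw [integral_indicator_one measurableSet_Ioi, Measure.real, Measure.restrict_apply
          measurableSet_Ioi]
        have : Ioi t₀ ∩ Ioo 0 1 = Ioo t₀ 1 := by
          ext r
          simp only [mem_inter_iff, mem_Ioi, mem_Ioo]
          exact ⟨fun h => ⟨h.1, h.2.2⟩, fun h => ⟨h.1, ht00.trans_lt h.1, h.2⟩⟩
        rw [this, Real.volume_Ioo, ENNReal.toReal_ofReal (by linarith)]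
      rw [h3, hD]
      have h4 : ∫ x in ω, u x * (-2 * fderiv ℝ φ x ξ) = -2 * ∫ x in ω, u x * fderiv ℝ φ x ξ := by
        rw [← integral_const_mul]
        refine integral_congr_ae (Eventually.of_forall fun x => ?_)
        simp only
        ring
      rw [h4]; ring
    · rw [abs_mul]
      refine (mul_le_of_le_one_right (abs_nonneg _) ?_).trans (hΨb k x.1)
      by_cases hx : x.2 ∈ Ioi (t k) <;> simp [hx]
    · have h3 := le_of_tendsto (hΨlim x.1).abs (Eventually.of_forall fun k => hΨb k x.1)
      rw [abs_mul]
      refine (mul_le_of_le_one_right (abs_nonneg _) ?_).trans h3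
      by_cases hx : x.2 ∈ Ioi t₀ <;> simp [hx]
    -- The indicators may fail to converge at height t₀, which is a null set.
    · have hne : ∀ᵐ x : Plane n × ℝ, x.2 ≠ t₀ := by
        have h5 : ∀ᵐ r : ℝ, r ≠ t₀ := by
          rw [ae_iff]
          simp
        exact (Measure.quasiMeasurePreserving_snd (μ := (volume : Measure (Plane n)))
          (ν := (volume : Measure ℝ))).ae h5
      filter_upwards [ae_restrict_of_ae hne] with x hx
      refine (hΨlim x.1).mul ?_
      refine tendsto_const_nhds.congr' ?_
      rcases lt_or_gt_of_ne hx with hlt | hgt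
      · filter_upwards [ht.eventually (lt_mem_nhds hlt)] with k hk
        simp [indicator, not_lt.2 hk.le, not_lt.2 hlt.le]
      · filter_upwards [ht.eventually (gt_mem_nhds hgt)] with k hk
        have h6 : t₀ < x.2 := hgt
        simp [indicator, hk, h6]
  -- the inequality before the limit
  have hineq : ∀ᶠ k in atTop, ENNReal.ofReal
      ((∫ x in film ω 1, w k x * (Ψ k x.1 * (Ioi (t k)).indicator 1 x.2)) ^ 2) ≤
      ((shiftEnergy (film ω 1) (w k) (h k • ξ, t k) +
        shiftEnergy (film ω 1) (w k) (-(h k • ξ), t k)) / ENNReal.ofReal (2 * h k ^ 2) *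
        ENNReal.ofReal (1 - t k)) * (4 * B) := by
    have hz1 : Tendsto (fun k => h k • ξ) atTop (𝓝 (0 : Plane n)) := by
      have := hh.smul_const ξ
      rwa [zero_smul] at this
    have hz2 : Tendsto (fun k => -(h k • ξ)) atTop (𝓝 (0 : Plane n)) := by
      simpa using hz1.neg
    have hs1 := eventually_forall_add_mem hφ.2.1 hω (fun x hx => by simpa using hφ.2.2 hx) hz1
    have hs2 := eventually_forall_add_mem hφ.2.1 hω (fun x hx => by simpa using hφ.2.2 hx) hz2
    filter_upwards [hs1, hs2] with k hk1 hk2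
    -- Cutting at height 1 - `t k` keeps both slanted shifts of the support inside the film.
    set Φ : Plane n × ℝ → ℝ := fun x => φ x.1 * (Ioo 0 (1 - t k)).indicator 1 x.2 with hΦ
    have hΦm : Measurable Φ := (hφm.comp measurable_fst).mul
        ((measurable_one.indicator measurableSet_Ioo).comp measurable_snd)
    have hΦb : ∀ x, |Φ x| ≤ C := by
      intro x
      simp only [hΦ, abs_mul]
      refine (mul_le_of_le_one_right (abs_nonneg _) ?_).trans (hC x.1)
      by_cases hx : x.2 ∈ Ioo 0 (1 - t k) <;> simp [hx]
    have hΦsupp : ∀ x, Φ x ≠ 0 → x.1 ∈ tsupport φ ∧ 0 < x.2 ∧ x.2 < 1 - t k := by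
      intro x hx
      by_cases hx2 : x.2 ∈ Ioo 0 (1 - t k)
      · refine ⟨subset_tsupport _ fun h0 => hx ?_, hx2⟩
        simp [hΦ, h0]
      · exact absurd (by simp [hΦ, hx2]) hx
    have hsup : ∀ y : Plane n, (∀ x ∈ tsupport φ, x + y ∈ ω) → ∀ x, Φ x ≠ 0 →
        x ∈ film ω 1 ∧ x + (y, t k) ∈ film ω 1 := by
      intro y hy x hx
      obtain ⟨h1, h2, h3⟩ := hΦsupp x hx
      have h4 := ht0 k
      exact ⟨⟨hφ.2.2 h1, h2, by linarith⟩, hy _ h1, by simp only [Prod.snd_add]; linarith,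
        by simp only [Prod.snd_add]; linarith⟩
    have hΦ2 : ∫⁻ x, ENNReal.ofReal (Φ x ^ 2) = ENNReal.ofReal (1 - t k) * B := by
      have : ∀ x, ENNReal.ofReal (Φ x ^ 2) =
          ENNReal.ofReal (φ x.1 ^ 2) * (Ioo 0 (1 - t k)).indicator 1 x.2 := by
        intro x
        by_cases hx2 : x.2 ∈ Ioo 0 (1 - t k) <;> simp [hΦ, hx2]
      simp_rw [this]
      rw [Measure.volume_eq_prod, lintegral_prod_mul (f := fun x => ENNReal.ofReal (φ x ^ 2))
        (g := fun r : ℝ => (Ioo 0 (1 - t k)).indicator 1 r) (by fun_prop)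
        (measurable_one.indicator measurableSet_Ioo).aemeasurable,
        lintegral_indicator_one measurableSet_Ioo, Real.volume_Ioo, sub_zero, hB, hBfull, mul_comm]
    have e1 := ofReal_sq_integral_le_shiftEnergy hΩ.measurableSet (measurable_coe_Lp (w k))
      (integrableOn_filmL2 hfin _) hΦm hΦb (h k • ξ, t k) (hsup _ hk1)
    have e2 := ofReal_sq_integral_le_shiftEnergy hΩ.measurableSet (measurable_coe_Lp (w k))
      (integrableOn_filmL2 hfin _) hΦm hΦb (-(h k • ξ), t k) (hsup _ hk2)
    rw [hΦ2] at e1 e2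
    set I1 := ∫ x in film ω 1, w k x * (Φ (x - (h k • ξ, t k)) - Φ x) with hI1
    set I2 := ∫ x in film ω 1, w k x * (Φ (x - (-(h k • ξ), t k)) - Φ x) with hI2
    have hint : ∀ z, Integrable (fun x => w k x * (Φ (x - z) - Φ x))
        (volume.restrict (film ω 1)) := by
      intro z
      refine Integrable.mul_bdd (c := 2 * C) (integrableOn_filmL2 hfin _)
        ((hΦm.comp (by fun_prop)).sub hΦm).aestronglyMeasurable (Eventually.of_forall fun x => ?_)
      exact (abs_sub _ _).trans (by linarith [hΦb (x - z), hΦb x])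
    -- The two shifts have the same vertical component, so the terms -Φ(x) cancel in I1 - I2 and a
    -- purely horizontal quotient remains. Vertical oscillations of `w k` therefore do not enter.
    have hI : ∫ x in film ω 1, w k x * (Ψ k x.1 * (Ioi (t k)).indicator 1 x.2) =
        (h k)⁻¹ * (I1 - I2) := by
      rw [hI1, hI2, ← integral_sub (hint _) (hint _), ← integral_const_mul]
      refine setIntegral_congr_fun hΩ.measurableSet fun x hx => ?_
      have hx1 : x.2 < 1 := hx.2.2
      have hi : (Ioi (t k)).indicator (1 : ℝ → ℝ) x.2 =
          (Ioo 0 (1 - t k)).indicator 1 (x.2 - t k) := by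
        by_cases h5 : t k < x.2 <;> simp [indicator, h5, hx1]
      simp only [hΦ, hΨ, hi, Prod.fst_sub, Prod.snd_sub, smul_eq_mul, sub_neg_eq_add]
      ring
    have hsq : (I1 - I2) ^ 2 ≤ 2 * (I1 ^ 2 + I2 ^ 2) := by nlinarith [sq_nonneg (I1 + I2)]
    have hh2 : 0 < 2 * h k ^ 2 := by have := hpos k; positivity
    rw [hI]
    have h7 : ((h k)⁻¹ * (I1 - I2)) ^ 2 ≤ (2 * h k ^ 2)⁻¹ * (4 * (I1 ^ 2 + I2 ^ 2)) := by
      rw [mul_pow, mul_inv, inv_pow]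
      have : 0 ≤ (h k ^ 2)⁻¹ := by positivity
      nlinarith
    refine (ENNReal.ofReal_le_ofReal h7).trans ?_
    rw [ENNReal.ofReal_mul (by positivity), ENNReal.ofReal_inv_of_pos hh2,
      ENNReal.ofReal_mul (p := 4) (by norm_num), ENNReal.ofReal_add (by positivity) (by positivity),
      ENNReal.div_eq_inv_mul]
    calc (ENNReal.ofReal (2 * h k ^ 2))⁻¹ * (ENNReal.ofReal 4 *
          (ENNReal.ofReal (I1 ^ 2) + ENNReal.ofReal (I2 ^ 2)))
        ≤ (ENNReal.ofReal (2 * h k ^ 2))⁻¹ * (ENNReal.ofReal 4 *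
          (shiftEnergy (film ω 1) (w k) (h k • ξ, t k) * (ENNReal.ofReal (1 - t k) * B) +
          shiftEnergy (film ω 1) (w k) (-(h k • ξ), t k) * (ENNReal.ofReal (1 - t k) * B))) := by
          gcongr
      _ = _ := by
          rw [show ENNReal.ofReal 4 = 4 by simp]
          ring
  have hfinal := ofReal_sq_le_liminf_mul hlim (ENNReal.mul_ne_top (by norm_num) hBtop) hineq
  set q : ℕ → ℝ≥0∞ := fun k => (shiftEnergy (film ω 1) (w k) (h k • ξ, t k) +
        shiftEnergy (film ω 1) (w k) (-(h k • ξ), t k)) / ENNReal.ofReal (2 * h k ^ 2) with hq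
  -- Since q may be infinite or irregular, the convergent factor is pulled out along the indices at
  -- which q is close to its lower limit.
  have hprod : liminf (fun k => q k * ENNReal.ofReal (1 - t k)) atTop ≤
      ENNReal.ofReal (1 - t₀) * liminf q atTop := by
    by_cases htop : liminf q atTop = ∞
    · rw [htop, ENNReal.mul_top (by simpa using ht₀)]
      exact le_top
    · refine ENNReal.le_of_forall_pos_le_add fun δ hδ _ => ?_
      have hlim2 : Tendsto (fun k => ENNReal.ofReal (1 - t k)) atTop
          (𝓝 (ENNReal.ofReal (1 - t₀))) :=
        (ENNReal.continuous_ofReal.tendsto _).comp (tendsto_const_nhds.sub ht)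
      have hfreq : ∀ c, liminf q atTop < c → c ≠ ∞ →
          liminf (fun k => q k * ENNReal.ofReal (1 - t k)) atTop ≤ ENNReal.ofReal (1 - t₀) * c := by
        intro c hc hctop
        have hlim3 : Tendsto (fun k => c * ENNReal.ofReal (1 - t k)) atTop
            (𝓝 (c * ENNReal.ofReal (1 - t₀))) := ENNReal.Tendsto.const_mul hlim2 (Or.inr hctop)
        rw [mul_comm, ← hlim3.limsup_eq]
        refine liminf_le_limsup_of_frequently_le ?_
        exact (frequently_lt_of_liminf_lt (by isBoundedDefault) hc).mono fun k hk => mul_le_mul_left hk.le _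
      have hc : liminf q atTop < liminf q atTop + δ :=
        ENNReal.lt_add_right htop (by simpa using hδ.ne')
      refine (hfreq _ hc (ENNReal.add_ne_top.2 ⟨htop, ENNReal.coe_ne_top⟩)).trans ?_
      rw [mul_add]
      gcongr
      refine mul_le_of_le_one_left bot_le ?_
      exact ENNReal.ofReal_le_one.2 (by linarith)
  -- The squared limit carries 4(1 - t₀)². Of this, 4(1 - t₀) cancels against the right side, where
  -- 1 - t₀ comes from the norm of the cut-off test function.
  have h8 : ENNReal.ofReal ((-2 * (1 - t₀) * D) ^ 2) =
      4 * ENNReal.ofReal (1 - t₀) * (ENNReal.ofReal (1 - t₀) * ENNReal.ofReal (D ^ 2)) := by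
    rw [show (-2 * (1 - t₀) * D) ^ 2 = (4 * (1 - t₀)) * ((1 - t₀) * D ^ 2) by ring,
      ENNReal.ofReal_mul (by linarith), ENNReal.ofReal_mul (by norm_num),
      ENNReal.ofReal_mul (by linarith)]
    simp
  rw [h8] at hfinal
  have h9 := hfinal.trans (mul_le_mul_left hprod _)
  have hc0 : 4 * ENNReal.ofReal (1 - t₀) ≠ 0 := by
    simp [ht₀]
  have hct : 4 * ENNReal.ofReal (1 - t₀) ≠ ∞ := ENNReal.mul_ne_top (by norm_num) ENNReal.ofReal_ne_top
  rw [show ENNReal.ofReal (1 - t₀) * liminf q atTop * (4 * B) =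
    4 * ENNReal.ofReal (1 - t₀) * (liminf q atTop * B) by ring] at h9
  exact (ENNReal.mul_le_mul_iff_right hc0 hct).1 h9

/-! ### Constants -/

/-- `∫ (1 + |ξ|²) ^ (-a)` over `ℝⁿ`. -/
noncomputable def japaneseIntegral (n : ℕ) (a : ℝ) : ℝ :=
  Real.pi ^ ((n : ℝ) / 2) * Real.Gamma (a - n / 2) / Real.Gamma a

/-- A nonzero Bochner integral certifies integrability, which is why c must be positive. Closed
formulas for real integrals thus carry over without a separate integrability proof. -/
theorem lintegral_ofReal_of_integral_eq {α : Type*} [MeasurableSpace α] {μ : Measure α}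
    {f : α → ℝ} {c : ℝ} (hc : 0 < c) (hf : 0 ≤ᵐ[μ] f) (h : ∫ x, f x ∂μ = c) :
    ∫⁻ x, ENNReal.ofReal (f x) ∂μ = ENNReal.ofReal c := by
  have hi : Integrable f μ := by
    by_contra hn
    rw [integral_undef hn] at h
    exact hc.ne h
  rw [← ofReal_integral_eq_lintegral_ofReal hi hf, h]

theorem lintegral_gamma {a r : ℝ} (ha : 0 < a) (hr : 0 < r) :
    ∫⁻ u in Ioi (0 : ℝ), ENNReal.ofReal (u ^ (a - 1) * Real.exp (-(r * u))) =
      ENNReal.ofReal (r ^ (-a) * Real.Gamma a) := by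
  have hG := Real.Gamma_pos_of_pos ha
  refine lintegral_ofReal_of_integral_eq (by positivity) ?_ ?_
  · filter_upwards [ae_restrict_mem measurableSet_Ioi] with u hu
    have : 0 < u := hu
    simp only [Pi.zero_apply]
    positivity
  · rw [Real.integral_rpow_mul_exp_neg_mul_Ioi ha hr, one_div, Real.inv_rpow hr.le,
      Real.rpow_neg hr.le]

theorem japaneseIntegral_pos {n : ℕ} {a : ℝ} (ha : (n : ℝ) / 2 < a) : 0 < japaneseIntegral n a := by
  have h0 : (0 : ℝ) ≤ (n : ℝ) / 2 := by positivity
  have h1 := Real.Gamma_pos_of_pos (sub_pos.2 ha)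
  have h2 := Real.Gamma_pos_of_pos (h0.trans_lt ha)
  have := Real.pi_pos
  unfold japaneseIntegral
  positivity

theorem continuousAt_japaneseIntegral {n : ℕ} {a : ℝ} (ha : (n : ℝ) / 2 < a) :
    ContinuousAt (japaneseIntegral n) a := by
  have h0 : (0 : ℝ) ≤ (n : ℝ) / 2 := by positivity
  have hc : ∀ {b : ℝ}, 0 < b → ContinuousAt Real.Gamma b := fun {b} hb =>
    (Real.differentiableAt_Gamma fun m => by
      have : (0 : ℝ) ≤ m := m.cast_nonneg
      linarith).continuousAt
  unfold japaneseIntegral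
  refine ContinuousAt.div (continuousAt_const.mul ?_) (hc (h0.trans_lt ha))
    (Real.Gamma_pos_of_pos (h0.trans_lt ha)).ne'
  exact ContinuousAt.comp (f := fun a : ℝ => a - n / 2) (hc (sub_pos.2 ha)) (by fun_prop)

/-- Write Γ(a)(1+|ξ|²)^(-a) as the integral of u^(a-1) exp(-(1+|ξ|²)u) over u > 0, exchange the
integrals and integrate the Gaussian in ξ; what is left is π^(n/2) Γ(a - n/2). The closed form gives
finiteness, positivity, continuity in the exponent and the special values of the constants at once.
-/
theorem lintegral_japanese {n : ℕ} {a : ℝ} (ha : (n : ℝ) / 2 < a) :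
    ∫⁻ ξ : Plane n, ENNReal.ofReal ((1 + ‖ξ‖ ^ 2) ^ (-a)) =
      ENNReal.ofReal (japaneseIntegral n a) := by
  have h0 : (0 : ℝ) ≤ (n : ℝ) / 2 := by positivity
  have ha0 : 0 < a := h0.trans_lt ha
  have hG := Real.Gamma_pos_of_pos ha0
  have hG' := Real.Gamma_pos_of_pos (sub_pos.2 ha)
  have hgauss : ∀ u : ℝ, 0 < u → ∫⁻ ξ : Plane n, ENNReal.ofReal (Real.exp (-u * ‖ξ‖ ^ 2)) =
      ENNReal.ofReal ((Real.pi / u) ^ ((n : ℝ) / 2)) := by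
    intro u hu
    have := Real.pi_pos
    refine lintegral_ofReal_of_integral_eq (by positivity)
      (Eventually.of_forall fun _ => (Real.exp_pos _).le) ?_
    rw [GaussianFourier.integral_rexp_neg_mul_sq_norm hu]
    simp
  have hmain : ENNReal.ofReal (Real.Gamma a) *
      ∫⁻ ξ : Plane n, ENNReal.ofReal ((1 + ‖ξ‖ ^ 2) ^ (-a)) =
      ENNReal.ofReal (Real.pi ^ ((n : ℝ) / 2) * Real.Gamma (a - n / 2)) := by
    calc ENNReal.ofReal (Real.Gamma a) * ∫⁻ ξ : Plane n, ENNReal.ofReal ((1 + ‖ξ‖ ^ 2) ^ (-a))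
        = ∫⁻ ξ : Plane n, ∫⁻ u in Ioi (0 : ℝ),
            ENNReal.ofReal (u ^ (a - 1) * Real.exp (-((1 + ‖ξ‖ ^ 2) * u))) := by
          rw [← lintegral_const_mul' _ _ ENNReal.ofReal_ne_top]
          refine lintegral_congr fun ξ => ?_
          rw [lintegral_gamma ha0 (by positivity), ← ENNReal.ofReal_mul hG.le, mul_comm]
      _ = ∫⁻ u in Ioi (0 : ℝ), ∫⁻ ξ : Plane n,
            ENNReal.ofReal (u ^ (a - 1) * Real.exp (-((1 + ‖ξ‖ ^ 2) * u))) := by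
          rw [lintegral_lintegral_swap]
          fun_prop
      _ = ∫⁻ u in Ioi (0 : ℝ), ENNReal.ofReal (Real.pi ^ ((n : ℝ) / 2)) *
            ENNReal.ofReal (u ^ (a - n / 2 - 1) * Real.exp (-(1 * u))) := by
          refine setLIntegral_congr_fun measurableSet_Ioi fun u hu => ?_
          have hu0 : 0 < u := hu
          have h1 : ∀ ξ : Plane n, ENNReal.ofReal (u ^ (a - 1) * Real.exp (-((1 + ‖ξ‖ ^ 2) * u))) =
              ENNReal.ofReal (u ^ (a - 1) * Real.exp (-u)) *
                ENNReal.ofReal (Real.exp (-u * ‖ξ‖ ^ 2)) := by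
            intro ξ
            rw [← ENNReal.ofReal_mul (by positivity), mul_assoc, ← Real.exp_add]
            congr 3
            ring
          simp_rw [h1]
          rw [lintegral_const_mul' _ _ ENNReal.ofReal_ne_top, hgauss u hu0,
            ← ENNReal.ofReal_mul (by positivity),
            ← ENNReal.ofReal_mul (by have := Real.pi_pos; positivity),
            Real.div_rpow Real.pi_pos.le hu0.le, one_mul,
            show a - (n : ℝ) / 2 - 1 = (a - 1) - (n : ℝ) / 2 by ring, Real.rpow_sub hu0 (a - 1)]
          congr 1
          field_simp
      _ = _ := by
          rw [lintegral_const_mul' _ _ ENNReal.ofReal_ne_top, lintegral_gamma (sub_pos.2 ha)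
            one_pos, ← ENNReal.ofReal_mul (by have := Real.pi_pos; positivity), Real.one_rpow,
            one_mul]
  rw [japaneseIntegral, ENNReal.ofReal_div_of_pos hG, ← hmain, mul_comm,
    ENNReal.mul_div_cancel_right (by simpa using hG) ENNReal.ofReal_ne_top]

theorem lintegral_ker_eq_japanese {s : ℝ} (hs : -(1 / 2) < s) :
    ∫⁻ ξ : Plane n, ENNReal.ofReal (ker n s ξ) =
      ENNReal.ofReal (japaneseIntegral n (((n : ℝ) + 1) / 2 + s)) := by
  unfold ker
  exact lintegral_japanese (by linarith)

theorem integrable_ker {s : ℝ} (hs : -(1 / 2) < s) : Integrable (ker n s) := by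
  refine ⟨(measurable_ker s).aestronglyMeasurable, ?_⟩
  rw [hasFiniteIntegral_iff_ofReal (Eventually.of_forall fun ξ => (ker_pos s ξ).le),
    lintegral_ker_eq_japanese hs]
  exact ENNReal.ofReal_lt_top

theorem integral_ker {s : ℝ} (hs : -(1 / 2) < s) :
    ∫ ξ : Plane n, ker n s ξ = japaneseIntegral n (((n : ℝ) + 1) / 2 + s) := by
  rw [integral_eq_lintegral_of_nonneg_ae (Eventually.of_forall fun ξ => (ker_pos s ξ).le)
    (measurable_ker s).aestronglyMeasurable, lintegral_ker_eq_japanese hs, ENNReal.toReal_ofReal]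
  exact (japaneseIntegral_pos (by linarith)).le

/-- The admissible exponents reach down to -1/2: second moments of the kernel involve s - 1 with s >
1/2, and error terms involve s - α with α - s < 1/2. -/
theorem constC_eq {s : ℝ} (hs : -(1 / 2) < s) :
    constC n s = japaneseIntegral n (((n : ℝ) + 1) / 2 + s) := by
  rw [← integral_ker hs, constC]
  refine integral_congr_ae (Eventually.of_forall fun ξ => ?_)
  simp only [ker]
  rw [Real.rpow_neg (by positivity), one_div]

theorem constC_pos {s : ℝ} (hs : -(1 / 2) < s) : 0 < constC n s := by
  rw [constC_eq hs]; exact japaneseIntegral_pos (by linarith)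

theorem lintegral_ker {s : ℝ} (hs : -(1 / 2) < s) :
    ∫⁻ ξ : Plane n, ENNReal.ofReal (ker n s ξ) = ENNReal.ofReal (constC n s) := by
  rw [lintegral_ker_eq_japanese hs, constC_eq hs]

theorem continuousAt_constC {s : ℝ} (hs : -(1 / 2) < s) : ContinuousAt (constC n) s := by
  have h1 : ContinuousAt (fun s : ℝ => japaneseIntegral n (((n : ℝ) + 1) / 2 + s)) s :=
    ContinuousAt.comp (f := fun s : ℝ => ((n : ℝ) + 1) / 2 + s)
      (continuousAt_japaneseIntegral (by linarith)) (by fun_prop)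
  refine h1.congr ?_
  filter_upwards [lt_mem_nhds hs] with r hr
  exact (constC_eq hr).symm

/-- As |ξ|² = (1+|ξ|²) - 1, a second moment of the kernel is a difference of two masses. Questions
about K thereby reduce to questions about C. -/
theorem sq_mul_ker (s : ℝ) (ξ : Plane n) : ‖ξ‖ ^ 2 * ker n s ξ = ker n (s - 1) ξ - ker n s ξ := by
  have h : ker n (s - 1) ξ = (1 + ‖ξ‖ ^ 2) * ker n s ξ := by
    unfold ker
    rw [show -(((n : ℝ) + 1) / 2 + (s - 1)) = 1 + -(((n : ℝ) + 1) / 2 + s) by ring,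
      Real.rpow_add (by positivity), Real.rpow_one]
  rw [h]; ring

theorem integral_sq_mul_ker {s : ℝ} (hs : 1 / 2 < s) :
    ∫ ξ : Plane n, ‖ξ‖ ^ 2 * ker n s ξ = constC n (s - 1) - constC n s := by
  simp_rw [sq_mul_ker]
  rw [integral_sub (integrable_ker (by linarith)) (integrable_ker (by linarith)),
    integral_ker (by linarith), integral_ker (by linarith), constC_eq (by linarith),
    constC_eq (by linarith)]

theorem constK_eq {s : ℝ} (hs : 1 / 2 < s) :
    constK n s = 1 / ((3 - 2 * s) * n) * (constC n (s - 1) - constC n s) := by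
  rw [← integral_sq_mul_ker hs, constK]
  congr 1
  refine integral_congr_ae (Eventually.of_forall fun ξ => ?_)
  simp only [ker]
  rw [Real.rpow_neg (by positivity), div_eq_mul_inv]

theorem lintegral_sq_mul_ker {s : ℝ} (hs : 1 / 2 < s) :
    ∫⁻ ξ : Plane n, ENNReal.ofReal (ker n s ξ) * ENNReal.ofReal (‖ξ‖ ^ 2) =
      ENNReal.ofReal (constC n (s - 1) - constC n s) := by
  rw [← integral_sq_mul_ker hs, ofReal_integral_eq_lintegral_ofReal]
  · refine lintegral_congr fun ξ => ?_
    rw [mul_comm, ENNReal.ofReal_mul (by positivity)]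
  · simp_rw [sq_mul_ker]
    exact (integrable_ker (by linarith)).sub (integrable_ker (by linarith))
  · exact Eventually.of_forall fun ξ => mul_nonneg (by positivity) (ker_pos s ξ).le

theorem continuousAt_constC_sub {s : ℝ} (hs : 1 / 2 < s) :
    ContinuousAt (fun s => constC n (s - 1) - constC n s) s :=
  (ContinuousAt.comp (f := fun s : ℝ => s - 1) (continuousAt_constC (by linarith))
    (by fun_prop)).sub (continuousAt_constC (by linarith))

/-- Both terms are brought to the denominator Γ(a+1) by Γ(x+1) = xΓ(x); the coefficients a and a -
n/2 then differ by n/2. -/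
theorem japaneseIntegral_sub {a : ℝ} (ha : (n : ℝ) / 2 < a) :
    japaneseIntegral n a - japaneseIntegral n (a + 1) =
      n / 2 * (Real.pi ^ ((n : ℝ) / 2) * Real.Gamma (a - n / 2) / Real.Gamma (a + 1)) := by
  have h0 : (0 : ℝ) ≤ (n : ℝ) / 2 := by positivity
  have ha0 : 0 < a := h0.trans_lt ha
  have hG := (Real.Gamma_pos_of_pos ha0).ne'
  unfold japaneseIntegral
  rw [show a + 1 - (n : ℝ) / 2 = (a - n / 2) + 1 by ring, Real.Gamma_add_one ha0.ne',
    Real.Gamma_add_one (sub_pos.2 ha).ne']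
  have := ha0.ne'
  field_simp
  ring

theorem constC_sub_pos (hn : 1 ≤ n) {s : ℝ} (hs : 1 / 2 < s) :
    0 < constC n (s - 1) - constC n s := by
  have hn' : (1 : ℝ) ≤ n := by exact_mod_cast hn
  rw [constC_eq (by linarith), constC_eq (by linarith),
    show ((n : ℝ) + 1) / 2 + s = ((n : ℝ) + 1) / 2 + (s - 1) + 1 by ring,
    japaneseIntegral_sub (by linarith)]
  have h1 := Real.Gamma_pos_of_pos (s := ((n : ℝ) + 1) / 2 + (s - 1) - n / 2) (by linarith)
  have h2 := Real.Gamma_pos_of_pos (s := ((n : ℝ) + 1) / 2 + (s - 1) + 1) (by linarith)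
  have := Real.pi_pos
  positivity

theorem constK_pos (hn : 1 ≤ n) {s : ℝ} (hs : 1 / 2 < s) (hs' : s < 3 / 2) : 0 < constK n s := by
  have hn' : (1 : ℝ) ≤ n := by exact_mod_cast hn
  have h1 : 0 < 3 - 2 * s := by linarith
  have := constC_sub_pos hn hs
  rw [constK_eq hs]
  positivity

theorem sphereArea_eq (k : ℕ) (hk : 1 ≤ k) :
    sphereArea k = k * (Real.pi ^ ((k : ℝ) / 2) / Real.Gamma ((k : ℝ) / 2 + 1)) := by
  have : Nonempty (Fin k) := ⟨⟨0, hk⟩⟩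
  have hG := Real.Gamma_pos_of_pos (s := (k : ℝ) / 2 + 1) (by positivity)
  rw [sphereArea, Measure.real, Measure.toSphere_apply_univ, EuclideanSpace.volume_ball]
  have hsq : Real.sqrt Real.pi ^ k = Real.pi ^ ((k : ℝ) / 2) := by
    rw [Real.sqrt_eq_rpow, ← Real.rpow_natCast, ← Real.rpow_mul Real.pi_pos.le]
    congr 1
    ring
  simp only [finrank_euclideanSpace, Fintype.card_fin, ENNReal.ofReal_one, one_pow, one_mul,
    ENNReal.toReal_mul, ENNReal.toReal_natCast, hsq]
  rw [ENNReal.toReal_ofReal (by have := Real.pi_pos; positivity)]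

theorem constC_one_half (hn : 1 ≤ n) : constC n (1 / 2) = sphereArea n / n := by
  have hn' : (0 : ℝ) < n := by exact_mod_cast hn
  rw [constC_eq (by norm_num), sphereArea_eq n hn, japaneseIntegral,
    show ((n : ℝ) + 1) / 2 + 1 / 2 = n / 2 + 1 by ring, add_sub_cancel_left, Real.Gamma_one, mul_one]
  field_simp

theorem pi_rpow_half_succ : Real.pi ^ (((n + 1 : ℕ) : ℝ) / 2) =
    Real.pi ^ ((n : ℝ) / 2) * Real.sqrt Real.pi := by
  rw [Real.sqrt_eq_rpow, ← Real.rpow_add Real.pi_pos]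
  congr 1
  push_cast
  ring

theorem constC_one : constC n 1 = sphereArea (n + 1) / (2 * ((n : ℝ) + 1)) := by
  have h3 : Real.Gamma (1 / 2 + 1) = 1 / 2 * Real.sqrt Real.pi := by
    rw [Real.Gamma_add_one (by norm_num), Real.Gamma_one_half_eq]
  rw [constC_eq (by norm_num), sphereArea_eq (n + 1) (by omega), japaneseIntegral,
    pi_rpow_half_succ, show ((n : ℝ) + 1) / 2 + 1 - n / 2 = 1 / 2 + 1 by ring, h3]
  push_cast
  field_simp

theorem constK_one (hn : 1 ≤ n) : constK n 1 = sphereArea (n + 1) / (2 * ((n : ℝ) + 1)) := by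
  have hn' : (0 : ℝ) < n := by exact_mod_cast hn
  rw [constK_eq (by norm_num), constC_eq (by norm_num), constC_eq (by norm_num),
    sphereArea_eq (n + 1) (by omega), pi_rpow_half_succ,
    show ((n : ℝ) + 1) / 2 + (1 - 1) = ((n : ℝ) + 1) / 2 by ring,
    japaneseIntegral_sub (by linarith), show ((n : ℝ) + 1) / 2 - n / 2 = 1 / 2 by ring,
    Real.Gamma_one_half_eq]
  push_cast
  field_simp
  norm_num

theorem sphereArea_pos (k : ℕ) (hk : 1 ≤ k) : 0 < sphereArea k := by
  rw [sphereArea_eq k hk]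
  have hG := Real.Gamma_pos_of_pos (s := (k : ℝ) / 2 + 1) (by positivity)
  have hk' : (0 : ℝ) < k := by exact_mod_cast hk
  have := Real.pi_pos
  positivity

/-- Quadratic moments of a radial kernel are isotropic. -/
theorem lintegral_radial_inner_sq {k : Plane n → ℝ≥0∞} (hk : Measurable k)
    (hrad : ∀ ξ η, ‖ξ‖ = ‖η‖ → k ξ = k η) (g : Plane n) :
    n * ∫⁻ ξ, k ξ * ENNReal.ofReal (inner ℝ ξ g ^ 2) =
      ENNReal.ofReal (‖g‖ ^ 2) * ∫⁻ ξ, k ξ * ENNReal.ofReal (‖ξ‖ ^ 2) := by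
  set A : Plane n → ℝ≥0∞ := fun g => ∫⁻ ξ, k ξ * ENNReal.ofReal (inner ℝ ξ g ^ 2) with hA
  have hrot : ∀ g g' : Plane n, ‖g‖ = ‖g'‖ → A g = A g' := by
    intro g g' hgg
    -- Reflection in the hyperplane orthogonal to g - g' carries g to g' because their norms agree,
    -- and it preserves Lebesgue measure and the radial kernel.
    set R := (Submodule.span ℝ {g - g'})ᗮ.reflection with hR
    have hRg : R g = g' := Submodule.reflection_sub hgg
    have h1 := (R.measurePreserving).lintegral_comp_emb R.toHomeomorph.measurableEmbedding
      (fun ξ => k ξ * ENNReal.ofReal (inner ℝ ξ g' ^ 2))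
    rw [hA]
    simp only
    rw [← h1]
    refine lintegral_congr fun ξ => ?_
    rw [← hRg, LinearIsometryEquiv.inner_map_map, hrad (R ξ) ξ (R.norm_map ξ)]
  have hsc : ∀ i : Fin n, A g = ENNReal.ofReal (‖g‖ ^ 2) * A (EuclideanSpace.single i 1) := by
    intro i
    rw [hrot g (‖g‖ • EuclideanSpace.single i 1) (by simp [norm_smul]), hA]
    simp only
    rw [← lintegral_const_mul' _ _ ENNReal.ofReal_ne_top]
    refine lintegral_congr fun ξ => ?_
    rw [inner_smul_right, mul_pow, ENNReal.ofReal_mul (by positivity)]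
    ring
  have hsum : ∑ i : Fin n, A (EuclideanSpace.single i 1) =
      ∫⁻ ξ, k ξ * ENNReal.ofReal (‖ξ‖ ^ 2) := by
    rw [hA]
    simp only
    rw [← lintegral_finsetSum]
    · refine lintegral_congr fun ξ => ?_
      rw [← Finset.mul_sum, ← ENNReal.ofReal_sum_of_nonneg (fun _ _ => sq_nonneg _),
        EuclideanSpace.norm_sq_eq]
      simp [EuclideanSpace.inner_single_right]
    · intro i _
      fun_prop
  calc (n : ℝ≥0∞) * A g = ∑ i : Fin n, A g := by simp
    _ = ∑ i : Fin n, ENNReal.ofReal (‖g‖ ^ 2) * A (EuclideanSpace.single i 1) :=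
        Finset.sum_congr rfl fun i _ => hsc i
    _ = _ := by rw [← Finset.mul_sum, hsum]

/-! ### Weak derivatives -/

section WeakDeriv

variable {E : Type*} [NormedAddCommGroup E] [NormedSpace ℝ E] [FiniteDimensional ℝ E]
  [MeasureSpace E] [BorelSpace E] [IsFiniteMeasureOnCompacts (volume : Measure E)] {U : Set E}

theorem integrable_mul_test {f : E → ℝ} (hf : IntegrableOn f U) {φ : E → ℝ}
    (hφ : φ ∈ testSubmodule U) : Integrable (fun x => f x * φ x) (volume.restrict U) := by
  obtain ⟨C, hC⟩ := exists_bound_of_mem_testSubmodule hφ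
  exact Integrable.mul_bdd (c := C) hf hφ.1.continuous.aestronglyMeasurable
    (Eventually.of_forall fun x => hC x)

theorem integrable_mul_fderiv_test {f : E → ℝ} (hf : IntegrableOn f U) {φ : E → ℝ}
    (hφ : φ ∈ testSubmodule U) (e : E) :
    Integrable (fun x => f x * fderiv ℝ φ x e) (volume.restrict U) := by
  have hc : Continuous fun x => fderiv ℝ φ x e :=
    (hφ.1.continuous_fderiv (by simp)).clm_apply continuous_const
  obtain ⟨C, hC⟩ := hc.bounded_above_of_compact_support (hφ.2.1.fderiv_apply ℝ e)
  exact Integrable.mul_bdd (c := C) hf hc.aestronglyMeasurable (Eventually.of_forall fun x => hC x)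

/-- Riesz representation of the functional φ ↦ -∫ f ∂φ, which the hypothesis bounds in L². -/
theorem exists_weakDirDeriv {f : E → ℝ} (hf : IntegrableOn f U) (e : E) {M : ℝ≥0∞} (hM : M ≠ ∞)
    (h : ∀ φ ∈ testSubmodule U, ENNReal.ofReal ((∫ x in U, f x * fderiv ℝ φ x e) ^ 2) ≤
      M * ∫⁻ x in U, ENNReal.ofReal (φ x ^ 2)) :
    ∃ g : Lp ℝ 2 ((volume : Measure E).restrict U), HasWeakDirDeriv U e f g ∧
      ∫⁻ x in U, ENNReal.ofReal (|g x| ^ 2) ≤ M := by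
  have hdiff : ∀ φ ∈ testSubmodule U, Differentiable ℝ φ := fun φ hφ =>
    hφ.1.differentiable (by simp)
  let ℓ : testSubmodule U →ₗ[ℝ] ℝ :=
    { toFun := fun φ => -∫ x in U, f x * fderiv ℝ (φ : E → ℝ) x e
      map_add' := fun φ ψ => by
        rw [← neg_add, ← integral_add (integrable_mul_fderiv_test hf φ.2 e)
          (integrable_mul_fderiv_test hf ψ.2 e)]
        congr 1
        refine integral_congr_ae (Eventually.of_forall fun x => ?_)
        simp only [Submodule.coe_add]
        rw [fderiv_add (hdiff φ φ.2 x) (hdiff ψ ψ.2 x), add_apply, mul_add]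
      map_smul' := fun c φ => by
        rw [RingHom.id_apply, smul_eq_mul, mul_neg, ← integral_const_mul]
        congr 1
        refine integral_congr_ae (Eventually.of_forall fun x => ?_)
        simp only [Submodule.coe_smul]
        rw [fderiv_const_smul (hdiff φ φ.2 x), smul_apply, smul_eq_mul]
        ring }
  obtain ⟨g, hg, hgM⟩ := exists_L2_repr ℓ hM (fun φ => by
    have := h φ φ.2
    simpa [ℓ] using this)
  refine ⟨g, fun φ h1 h2 h3 => ?_, hgM⟩
  rw [← hg ⟨φ, h1, h2, h3⟩]
  simp [ℓ]

theorem HasWeakDirDeriv.ae_eq (hU : IsOpen U) {e : E} {f g₁ g₂ : E → ℝ}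
    (h₁ : HasWeakDirDeriv U e f g₁) (h₂ : HasWeakDirDeriv U e f g₂) (hi₁ : IntegrableOn g₁ U)
    (hi₂ : IntegrableOn g₂ U) : ∀ᵐ x ∂(volume.restrict U), g₁ x = g₂ x := by
  have := ae_eq_zero_of_integral_test hU (hi₁.sub hi₂) fun φ hφ => ?_
  · filter_upwards [this] with x hx
    exact sub_eq_zero.1 hx
  · simp_rw [Pi.sub_apply, sub_mul]
    rw [integral_sub (integrable_mul_test hi₁ hφ) (integrable_mul_test hi₂ hφ), ← neg_inj,
      neg_sub', ← h₁ φ hφ.1 hφ.2.1 hφ.2.2, ← h₂ φ hφ.1 hφ.2.1 hφ.2.2]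
    simp

end WeakDeriv

theorem verticalDirichlet_le (hfin : volume ω ≠ ∞) (v : FilmL2 ω) {M : ℝ≥0∞}
    (h : ∀ φ ∈ testSubmodule (film ω 1),
      ENNReal.ofReal ((∫ x in film ω 1, v x * fderiv ℝ φ x (0, 1)) ^ 2) ≤
      M * ∫⁻ x in film ω 1, ENNReal.ofReal (φ x ^ 2)) : verticalDirichlet ω v ≤ M := by
  by_cases hM : M = ∞
  · rw [hM]; exact le_top
  obtain ⟨g, hg, hgM⟩ := exists_weakDirDeriv (integrableOn_filmL2 hfin v) (0, 1) hM h
  exact (iInf₂_le g hg).trans hgM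

/-- The directions in which `u` has a weak derivative in `L²`. -/
def weakDirections (hfin : volume ω ≠ ∞) (u : PlaneL2 ω) : Submodule ℝ (Plane n) where
  carrier := {ξ | ∃ g : PlaneL2 ω, HasWeakDirDeriv ω ξ u g}
  add_mem' := by
    rintro ξ η ⟨g, hg⟩ ⟨g', hg'⟩
    refine ⟨g + g', fun φ h1 h2 h3 => ?_⟩
    have hφ : φ ∈ testSubmodule ω := ⟨h1, h2, h3⟩
    have e1 : ∫ x in ω, (g + g' : PlaneL2 ω) x * φ x = ∫ x in ω, (g x * φ x + g' x * φ x) := by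
      refine integral_congr_ae ?_
      filter_upwards [Lp.coeFn_add g g'] with x hx
      rw [hx, Pi.add_apply, add_mul]
    have hu := integrableOn_planeL2 hfin u
    simp_rw [map_add, mul_add]
    rw [e1, integral_add (integrable_mul_fderiv_test hu hφ ξ) (integrable_mul_fderiv_test hu hφ η),
      integral_add (integrable_mul_test (integrableOn_planeL2 hfin g) hφ)
        (integrable_mul_test (integrableOn_planeL2 hfin g') hφ), hg φ h1 h2 h3, hg' φ h1 h2 h3,
      neg_add]
  zero_mem' := by
    refine ⟨0, fun φ _ _ _ => ?_⟩
    have e1 : ∫ x in ω, (0 : PlaneL2 ω) x * φ x = 0 := by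
      rw [← integral_zero (Plane n) ℝ (μ := volume.restrict ω)]
      refine integral_congr_ae ?_
      filter_upwards [Lp.coeFn_zero ℝ 2 ((volume : Measure (Plane n)).restrict ω)] with x hx
      rw [hx]; simp
    rw [e1]
    simp
  smul_mem' := by
    rintro c ξ ⟨g, hg⟩
    refine ⟨c • g, fun φ h1 h2 h3 => ?_⟩
    have e1 : ∫ x in ω, (c • g : PlaneL2 ω) x * φ x = c * ∫ x in ω, g x * φ x := by
      rw [← integral_const_mul]
      refine integral_congr_ae ?_
      filter_upwards [Lp.coeFn_smul c g] with x hx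
      rw [hx, Pi.smul_apply, smul_eq_mul, mul_assoc]
    have e2 : ∫ x in ω, u x * fderiv ℝ φ x (c • ξ) = c * ∫ x in ω, u x * fderiv ℝ φ x ξ := by
      rw [← integral_const_mul]
      refine integral_congr_ae (Eventually.of_forall fun x => ?_)
      simp only [map_smul, smul_eq_mul]
      ring
    rw [e1, e2, hg φ h1 h2 h3, mul_neg]

theorem mem_weakDirections {hfin : volume ω ≠ ∞} {u : PlaneL2 ω} {ξ : Plane n} :
    ξ ∈ weakDirections hfin u ↔ ∃ g : PlaneL2 ω, HasWeakDirDeriv ω ξ u g := Iff.rfl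

theorem sum_smul_single (ξ : Plane n) :
    ∑ i : Fin n, ξ i • EuclideanSpace.single i (1 : ℝ) = ξ := by
  have := (EuclideanSpace.basisFun (Fin n) ℝ).sum_repr ξ
  simpa using this

theorem hasWeakDirDeriv_inner (hfin : volume ω ≠ ∞) (u : PlaneL2 ω) {G : Plane n → Plane n}
    (hG : ∀ i, IntegrableOn (fun x => G x i) ω)
    (h : ∀ i : Fin n, HasWeakDirDeriv ω (EuclideanSpace.single i (1 : ℝ)) u (fun x => G x i))
    (ξ : Plane n) : HasWeakDirDeriv ω ξ u (fun x => inner ℝ ξ (G x)) := by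
  intro φ h1 h2 h3
  have hφ : φ ∈ testSubmodule ω := ⟨h1, h2, h3⟩
  have hu := integrableOn_planeL2 hfin u
  have e1 : ∀ x, u x * fderiv ℝ φ x ξ =
      ∑ i : Fin n, ξ i * (u x * fderiv ℝ φ x (EuclideanSpace.single i 1)) := by
    intro x
    conv_lhs => rw [← sum_smul_single ξ]
    rw [map_sum, Finset.mul_sum]
    refine Finset.sum_congr rfl fun i _ => ?_
    rw [map_smul, smul_eq_mul]; ring
  have e2 : ∀ x, inner ℝ ξ (G x) * φ x = ∑ i : Fin n, ξ i * (G x i * φ x) := by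
    intro x
    rw [PiLp.inner_apply, Finset.sum_mul]
    refine Finset.sum_congr rfl fun i _ => ?_
    simp only [RCLike.inner_apply, conj_trivial]
    ring
  simp_rw [e1, e2]
  rw [integral_finsetSum _ fun i _ => (integrable_mul_fderiv_test hu hφ _).const_mul _,
    integral_finsetSum _ fun i _ => (integrable_mul_test (hG i) hφ).const_mul _,
    ← Finset.sum_neg_distrib]
  refine Finset.sum_congr rfl fun i _ => ?_
  rw [integral_const_mul, integral_const_mul, h i φ h1 h2 h3, mul_neg]

/-- Bounds on directional derivatives, integrated against an isotropic kernel, control the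
Dirichlet integral. -/
theorem planarDirichlet_le_of_directional (hω : IsOpen ω) (hfin : volume ω ≠ ∞) (u : PlaneL2 ω)
    {k m : Plane n → ℝ≥0∞} (hk : Measurable k) (hm : Measurable m) {c : ℝ} (hc : 0 < c)
    (hkc : ∀ g : Plane n, ∫⁻ ξ, k ξ * ENNReal.ofReal (inner ℝ ξ g ^ 2) =
      ENNReal.ofReal (c * ‖g‖ ^ 2))
    (hbound : ∀ ξ, ∀ φ ∈ testSubmodule ω, ENNReal.ofReal ((∫ x in ω, u x * fderiv ℝ φ x ξ) ^ 2) ≤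
      m ξ * ∫⁻ x in ω, ENNReal.ofReal (φ x ^ 2)) :
    ENNReal.ofReal c * planarDirichlet ω u ≤ ∫⁻ ξ, k ξ * m ξ := by
  by_cases htop : ∫⁻ ξ, k ξ * m ξ = ∞
  · rw [htop]; exact le_top
  have hui := integrableOn_planeL2 hfin u
  have hmem : ∀ ξ, m ξ ≠ ∞ → ξ ∈ weakDirections hfin u := by
    intro ξ hξ
    obtain ⟨g, hg, _⟩ := exists_weakDirDeriv hui ξ hξ (hbound ξ)
    exact ⟨g, hg⟩
  -- A vector g orthogonal to every direction with a weak derivative satisfies k(ξ)(ξ·g)² = 0 for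
  -- almost every ξ, since m is finite almost everywhere on {k ≠ 0}. The moment identity then gives
  -- c|g|² = 0.
  have hfull : weakDirections hfin u = ⊤ := by
    rw [← Submodule.orthogonal_eq_bot_iff]
    by_contra hne
    obtain ⟨g, hg, hg0⟩ := Submodule.exists_mem_ne_zero_of_ne_bot hne
    have h1 := ae_lt_top (hk.mul hm) htop
    have h2 : ∫⁻ ξ, k ξ * ENNReal.ofReal (inner ℝ ξ g ^ 2) = 0 := by
      rw [lintegral_eq_zero_iff (by fun_prop)]
      filter_upwards [h1] with ξ hξ
      by_cases hkξ : k ξ = 0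
      · simp [hkξ]
      · have : m ξ ≠ ∞ := by
          intro h
          rw [Pi.mul_apply, h, ENNReal.mul_top hkξ] at hξ
          exact lt_irrefl _ hξ
        have h3 := (Submodule.mem_orthogonal _ g).1 hg ξ (hmem ξ this)
        simp [h3]
    rw [hkc, ENNReal.ofReal_eq_zero] at h2
    have : 0 < ‖g‖ := norm_pos_iff.2 hg0
    have : 0 < c * ‖g‖ ^ 2 := by positivity
    linarith
  have hall : ∀ i : Fin n, ∃ g : PlaneL2 ω,
      HasWeakDirDeriv ω (EuclideanSpace.single i (1 : ℝ)) u g := fun i => by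
    rw [← mem_weakDirections (hfin := hfin), hfull]; trivial
  choose g hg using hall
  have hGm : MemLp (fun x => ∑ i : Fin n, g i x • EuclideanSpace.single i (1 : ℝ)) 2
      (volume.restrict ω) := by
    refine memLp_finsetSum _ fun i _ => ?_
    exact (ContinuousLinearMap.toSpanSingleton ℝ
      (EuclideanSpace.single i (1 : ℝ))).comp_memLp' (Lp.memLp (g i))
  have hGi : ∀ x i, (∑ j : Fin n, g j x • EuclideanSpace.single j (1 : ℝ) : Plane n) i = g i x := by
    intro x i
    simp [Pi.single_apply]
  set G := hGm.toLp with hGdef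
  have hGae : ∀ᵐ x ∂((volume : Measure (Plane n)).restrict ω), ∀ i, G x i = g i x := by
    filter_upwards [hGm.coeFn_toLp] with x hx i
    rw [hx, hGi]
  have hGint : ∀ i, IntegrableOn (fun x => G x i) ω := by
    intro i
    refine (integrableOn_planeL2 hfin (g i)).congr ?_
    filter_upwards [hGae] with x hx
    exact (hx i).symm
  have hGw : ∀ i : Fin n, HasWeakDirDeriv ω (EuclideanSpace.single i (1 : ℝ)) u
      (fun x => G x i) := by
    intro i φ h1 h2 h3
    rw [hg i φ h1 h2 h3]
    congr 1
    refine integral_congr_ae ?_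
    filter_upwards [hGae] with x hx
    rw [hx i]
  have hGsm : Measurable G := (Lp.stronglyMeasurable G).measurable
  -- By uniqueness of weak derivatives, the derivative in direction ξ that obeys the bound m ξ is
  -- the component of the assembled gradient G.
  have hdir : ∀ ξ, ∫⁻ x in ω, ENNReal.ofReal (inner ℝ ξ (G x) ^ 2) ≤ m ξ := by
    intro ξ
    by_cases hξ : m ξ = ∞
    · rw [hξ]; exact le_top
    obtain ⟨g', hg', hgM⟩ := exists_weakDirDeriv hui ξ hξ (hbound ξ)
    have hinner : IntegrableOn (fun x => inner ℝ ξ (G x)) ω := by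
      simp_rw [PiLp.inner_apply]
      refine integrable_finsetSum _ fun i _ => ?_
      simpa using (hGint i).mul_const (ξ i)
    have := HasWeakDirDeriv.ae_eq hω hg' (hasWeakDirDeriv_inner hfin u hGint hGw ξ)
      (integrableOn_planeL2 hfin g') hinner
    refine le_trans (le_of_eq (lintegral_congr_ae ?_)) hgM
    filter_upwards [this] with x hx
    rw [hx, sq_abs]
  calc ENNReal.ofReal c * planarDirichlet ω u
      ≤ ENNReal.ofReal c * ∫⁻ x in ω, ENNReal.ofReal (‖G x‖ ^ 2) := by
        gcongr
        exact iInf₂_le G hGw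
    _ = ∫⁻ x in ω, ∫⁻ ξ, k ξ * ENNReal.ofReal (inner ℝ ξ (G x) ^ 2) := by
        rw [← lintegral_const_mul' _ _ ENNReal.ofReal_ne_top]
        refine lintegral_congr fun x => ?_
        rw [hkc, ENNReal.ofReal_mul hc.le]
    _ = ∫⁻ ξ, k ξ * ∫⁻ x in ω, ENNReal.ofReal (inner ℝ ξ (G x) ^ 2) := by
        rw [lintegral_lintegral_swap (by fun_prop)]
        refine lintegral_congr fun ξ => ?_
        rw [lintegral_const_mul _ (by fun_prop)]
    _ ≤ ∫⁻ ξ, k ξ * m ξ := lintegral_mono fun ξ => mul_le_mul_right (hdir ξ) _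

/-! ### Lower bounds -/

theorem mul_le_liminf_mul {a b : ℕ → ℝ≥0∞} {a₀ b₀ : ℝ≥0∞} (ha : Tendsto a atTop (𝓝 a₀))
    (hb : b₀ ≤ liminf b atTop) : a₀ * b₀ ≤ liminf (fun k => a k * b k) atTop := by
  rw [← ha.liminf_eq]
  exact (mul_le_mul_right hb _).trans ENNReal.le_liminf_mul

/-- Fatou's lemma in both variables. -/
theorem lintegral_lintegral_le_liminf {α β : Type*} [MeasurableSpace α] [MeasurableSpace β]
    {μ : Measure α} {ν : Measure β} [SFinite ν] {f : ℕ → α → β → ℝ≥0∞} {g : α → β → ℝ≥0∞}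
    (hf : ∀ k, Measurable fun p : α × β => f k p.1 p.2)
    (h : ∀ᵐ x ∂μ, ∀ᵐ y ∂ν, g x y ≤ liminf (fun k => f k x y) atTop) :
    ∫⁻ x, ∫⁻ y, g x y ∂ν ∂μ ≤ liminf (fun k => ∫⁻ x, ∫⁻ y, f k x y ∂ν ∂μ) atTop := by
  calc ∫⁻ x, ∫⁻ y, g x y ∂ν ∂μ
      ≤ ∫⁻ x, ∫⁻ y, liminf (fun k => f k x y) atTop ∂ν ∂μ := by
        refine lintegral_mono_ae ?_
        filter_upwards [h] with x hx
        exact lintegral_mono_ae hx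
    _ ≤ ∫⁻ x, liminf (fun k => ∫⁻ y, f k x y ∂ν) atTop ∂μ :=
        lintegral_mono fun x => lintegral_liminf_le fun k => (hf k).comp measurable_prodMk_left
    _ ≤ _ := lintegral_liminf_le fun k => (hf k).lintegral_prod_right'

theorem tendsto_ofReal_ker {σ : ℕ → ℝ} {s₀ : ℝ} (hσ : Tendsto σ atTop (𝓝 s₀)) (ξ : Plane n) :
    Tendsto (fun k => ENNReal.ofReal (ker n (σ k) ξ)) atTop (𝓝 (ENNReal.ofReal (ker n s₀ ξ))) := by
  refine (ENNReal.continuous_ofReal.tendsto _).comp ?_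
  unfold ker
  have : Tendsto (fun k => -(((n : ℝ) + 1) / 2 + σ k)) atTop (𝓝 (-(((n : ℝ) + 1) / 2 + s₀))) :=
    (tendsto_const_nhds.add hσ).neg
  exact (Real.continuousAt_const_rpow (by positivity)).tendsto.comp this

theorem tendsto_ofReal_rpow {σ : ℕ → ℝ} {s₀ t : ℝ} (hσ : Tendsto σ atTop (𝓝 s₀)) (ht : 0 < t) :
    Tendsto (fun k => ENNReal.ofReal (t ^ σ k)) atTop (𝓝 (ENNReal.ofReal (t ^ s₀))) :=
  (ENNReal.continuous_ofReal.tendsto _).comp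
    ((Real.continuousAt_const_rpow ht.ne').tendsto.comp hσ)

theorem measurable_shiftEnergy_film (hω : IsOpen ω) (v : FilmL2 ω) :
    Measurable (shiftEnergy (film ω 1) v) :=
  measurable_shiftEnergy (measurableSet_film hω.measurableSet 1) (measurable_coe_Lp v)

theorem filmEnergy_eq_ker (hω : IsOpen ω) {ε : ℝ} (hε : 0 < ε) (s : ℝ) (v : FilmL2 ω) :
    filmEnergy ω s ε v = ENNReal.ofReal (2 * ε ^ (1 - 2 * s)) * ∫⁻ t in Ioo (0 : ℝ) 1,
        ∫⁻ ξ : Plane n, ENNReal.ofReal (t ^ (-(1 + 2 * s))) * (ENNReal.ofReal (ker n s ξ) *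
          shiftEnergy (film ω 1) v ((ε * t) • ξ, t)) := by
  rw [filmEnergy, gagliardo_eq_ker hω.measurableSet hε s (measurable_coe_Lp v)]
  simp_rw [lintegral_const_mul' _ _ ENNReal.ofReal_ne_top]

theorem ofReal_mul_div_ofReal {a b : ℝ} (ha : 0 ≤ a) (hb : 0 < b) (x : ℝ≥0∞) :
    ENNReal.ofReal (a * b) * x / ENNReal.ofReal b = ENNReal.ofReal a * x := by
  rw [ENNReal.ofReal_mul ha, mul_right_comm, ENNReal.mul_div_cancel_right (by simpa using hb)
    ENNReal.ofReal_ne_top]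

/-- For fixed t and ξ the shift (εtξ, t) tends to (0, t), along which increments are lower
semicontinuous. Fatou in (t, ξ) follows, and the mass of the limit kernel in ξ is the constant C. -/
theorem vertical_le_liminf (hω : IsOpen ω) (hfin : volume ω ≠ ∞) {ε σ : ℕ → ℝ} {s₀ : ℝ}
    (hpos : ∀ k, 0 < ε k) (hε : Tendsto ε atTop (𝓝 0)) (hσ : Tendsto σ atTop (𝓝 s₀)) (hs₀ : 0 ≤ s₀)
    {w : ℕ → FilmL2 ω} {v : FilmL2 ω} (hw : WeakTendsto w v) :
    ENNReal.ofReal (constC n s₀) * verticalEnergy ω s₀ v ≤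
      liminf (fun k => filmEnergy ω (σ k) (ε k) (w k) /
        ENNReal.ofReal (ε k ^ (1 - 2 * σ k))) atTop := by
  have h1 : ∀ k, filmEnergy ω (σ k) (ε k) (w k) / ENNReal.ofReal (ε k ^ (1 - 2 * σ k)) =
      ENNReal.ofReal 2 * ∫⁻ t in Ioo (0 : ℝ) 1,
        ∫⁻ ξ : Plane n, ENNReal.ofReal (t ^ (-(1 + 2 * σ k))) * (ENNReal.ofReal (ker n (σ k) ξ) *
          shiftEnergy (film ω 1) (w k) ((ε k * t) • ξ, t)) := by
    intro k
    have := hpos k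
    rw [filmEnergy_eq_ker hω (hpos k), ofReal_mul_div_ofReal (by norm_num) (by positivity)]
  simp_rw [h1]
  rw [verticalEnergy_eq hω.measurableSet, vertForm]
  have h2 : ENNReal.ofReal (constC n s₀) * (2 * ∫⁻ t in Ioo (0 : ℝ) 1,
      ENNReal.ofReal (t ^ (-(1 + 2 * s₀))) * shiftEnergy (film ω 1) v (0, t)) =
      ENNReal.ofReal 2 * ∫⁻ t in Ioo (0 : ℝ) 1, ∫⁻ ξ : Plane n,
        ENNReal.ofReal (t ^ (-(1 + 2 * s₀))) * (ENNReal.ofReal (ker n s₀ ξ) *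
          shiftEnergy (film ω 1) v (0, t)) := by
    rw [mul_left_comm, ← lintegral_const_mul' _ _ ENNReal.ofReal_ne_top]
    congr 1
    · simp
    refine lintegral_congr fun t => ?_
    rw [lintegral_const_mul' _ _ ENNReal.ofReal_ne_top, lintegral_mul_const _ (by fun_prop),
      lintegral_ker (by linarith)]
    ring
  rw [h2]
  refine mul_le_liminf_mul tendsto_const_nhds (lintegral_lintegral_le_liminf (fun k => ?_) ?_)
  · have := measurable_shiftEnergy_film hω (w k)
    fun_prop
  · filter_upwards [ae_restrict_mem measurableSet_Ioo] with t ht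
    refine Eventually.of_forall fun ξ => ?_
    refine mul_le_liminf_mul (tendsto_ofReal_rpow ((tendsto_const_nhds.add
      (hσ.const_mul 2)).neg) ht.1) (mul_le_liminf_mul (tendsto_ofReal_ker hσ ξ)
      (shiftEnergy_le_liminf hω hfin hw ?_))
    refine Tendsto.prodMk_nhds ?_ tendsto_const_nhds
    have := (hε.mul_const t).smul_const ξ
    simpa using this

theorem shiftEnergy_of_planar (hω : IsOpen ω) {v : FilmL2 ω} {u : PlaneL2 ω}
    (hu : ∀ᵐ x ∂((volume : Measure (Plane n × ℝ)).restrict (film ω 1)), v x = u x.1)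
    (z : Plane n) {t : ℝ} (ht : 0 ≤ t) :
    shiftEnergy (film ω 1) v (z, t) = ENNReal.ofReal (1 - t) * shiftEnergy ω u z := by
  rw [shiftEnergy_congr (measurableSet_film hω.measurableSet 1) hu,
    shiftEnergy_comp_fst hω.measurableSet (measurable_coe_Lp u) z ht]

theorem lintegral_one_sub : ∫⁻ t in Ioo (0 : ℝ) 1, ENNReal.ofReal (1 - t) = ENNReal.ofReal (1 / 2) := by
  refine lintegral_ofReal_of_integral_eq (by norm_num) ?_ ?_
  · filter_upwards [ae_restrict_mem measurableSet_Ioo] with t ht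
    simp only [Pi.zero_apply]; linarith [ht.2]
  · rw [← integral_Ioc_eq_integral_Ioo, ← intervalIntegral.integral_of_le zero_le_one,
      intervalIntegral.integral_sub (by simp) (by simp)]
    simp
    norm_num

/-- Here the horizontal shift is not rescaled. For fixed z the kernel tends to |z|^(-(n+1+2s₀)), the
increments of a planar limit are 1 - t times those of u, and 2∫(1 - t) dt = 1. -/
theorem planarEnergy_le_liminf (hω : IsOpen ω) (hfin : volume ω ≠ ∞) {ε σ : ℕ → ℝ} {s₀ : ℝ}
    (hpos : ∀ k, 0 < ε k) (hε : Tendsto ε atTop (𝓝 0)) (hσ : Tendsto σ atTop (𝓝 s₀)) (hs₀ : 0 ≤ s₀)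
    {w : ℕ → FilmL2 ω} {v : FilmL2 ω} (hw : WeakTendsto w v) {u : PlaneL2 ω}
    (hu : ∀ᵐ x ∂((volume : Measure (Plane n × ℝ)).restrict (film ω 1)), v x = u x.1) :
    planarEnergy ω s₀ u ≤
      liminf (fun k => filmEnergy ω (σ k) (ε k) (w k) / ENNReal.ofReal (ε k ^ 2)) atTop := by
  have h1 : ∀ k, filmEnergy ω (σ k) (ε k) (w k) / ENNReal.ofReal (ε k ^ 2) =
      ENNReal.ofReal 2 * ∫⁻ t in Ioo (0 : ℝ) 1, ∫⁻ z : Plane n,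
        ENNReal.ofReal (filmKernel n (σ k) (ε k) z t) * shiftEnergy (film ω 1) (w k) (z, t) := by
    intro k
    have := hpos k
    rw [filmEnergy, gagliardo_eq_half hω.measurableSet (hpos k) _ (measurable_coe_Lp _),
      ofReal_mul_div_ofReal (by norm_num) (by positivity)]
  simp_rw [h1]
  have h2 : planarEnergy ω s₀ u = ENNReal.ofReal 2 * ∫⁻ t in Ioo (0 : ℝ) 1, ∫⁻ z : Plane n,
      ENNReal.ofReal (1 / ‖z‖ ^ (((n : ℝ) + 1) + 2 * s₀)) * shiftEnergy (film ω 1) v (z, t) := by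
    rw [planarEnergy_eq hω.measurableSet]
    have : ∀ t ∈ Ioo (0 : ℝ) 1, ∫⁻ z : Plane n,
        ENNReal.ofReal (1 / ‖z‖ ^ (((n : ℝ) + 1) + 2 * s₀)) * shiftEnergy (film ω 1) v (z, t) =
        ENNReal.ofReal (1 - t) * ∫⁻ z : Plane n,
        ENNReal.ofReal (1 / ‖z‖ ^ (((n : ℝ) + 1) + 2 * s₀)) * shiftEnergy ω u z := by
      intro t ht
      rw [← lintegral_const_mul' _ _ ENNReal.ofReal_ne_top]
      refine lintegral_congr fun z => ?_
      rw [shiftEnergy_of_planar hω hu z ht.1.le]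
      ring
    rw [setLIntegral_congr_fun measurableSet_Ioo this, lintegral_mul_const _ (by fun_prop),
      lintegral_one_sub, ← mul_assoc, ← ENNReal.ofReal_mul (by norm_num)]
    norm_num
  rw [h2]
  refine mul_le_liminf_mul tendsto_const_nhds (lintegral_lintegral_le_liminf (fun k => ?_) ?_)
  · have := measurable_shiftEnergy_film hω (w k)
    have h3 : Measurable fun p : ℝ × Plane n => ENNReal.ofReal (filmKernel n (σ k) (ε k) p.2 p.1) :=
      ((measurable_filmKernel (σ k) (ε k)).comp measurable_swap).ennreal_ofReal
    exact h3.mul (by fun_prop)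
  · filter_upwards [ae_restrict_mem measurableSet_Ioo] with t ht
    refine Eventually.of_forall fun z => ?_
    -- At z = 0 the limit kernel is 0 by the convention for division by zero, and nothing is to be
    -- shown.
    by_cases hz : z = 0
    · have hp : ((n : ℝ) + 1) + 2 * s₀ ≠ 0 := by positivity
      simp [hz, Real.zero_rpow hp]
    refine mul_le_liminf_mul ?_ (shiftEnergy_le_liminf hω hfin hw tendsto_const_nhds)
    refine (ENNReal.continuous_ofReal.tendsto _).comp ?_
    have hz' : 0 < ‖z‖ := norm_pos_iff.2 hz
    unfold filmKernel
    refine tendsto_const_nhds.div ?_ (by positivity)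
    have e1 : Tendsto (fun k => Real.sqrt (‖z‖ ^ 2 + (ε k * t) ^ 2)) atTop (𝓝 ‖z‖) := by
      have := ((tendsto_const_nhds (x := ‖z‖ ^ 2)).add ((hε.mul_const t).pow 2)).sqrt
      simpa [Real.sqrt_sq hz'.le] using this
    exact e1.rpow (tendsto_const_nhds.add (hσ.const_mul 2)) (Or.inl hz'.ne')

/-- The substitution τ = t^p. For p = 2 - 2s it spreads the weight (2-2s)t^(1-2s), which
concentrates at t = 0 as s → 1, evenly over (0,1). -/
theorem lintegral_rpow_subst {p : ℝ} (hp : 0 < p) (g : ℝ → ℝ≥0∞) :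
    ∫⁻ t in Ioo (0 : ℝ) 1, ENNReal.ofReal (p * t ^ (p - 1)) * g t =
      ∫⁻ τ in Ioo (0 : ℝ) 1, g (τ ^ (1 / p)) := by
  have himg : (fun t : ℝ => t ^ p) '' Ioo 0 1 = Ioo 0 1 := by
    ext τ
    constructor
    · rintro ⟨t, ht, rfl⟩
      exact ⟨Real.rpow_pos_of_pos ht.1 _, Real.rpow_lt_one ht.1.le ht.2 hp⟩
    · intro hτ
      refine ⟨τ ^ (1 / p), ⟨Real.rpow_pos_of_pos hτ.1 _,
        Real.rpow_lt_one hτ.1.le hτ.2 (by positivity)⟩, ?_⟩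
      simp only
      rw [← Real.rpow_mul hτ.1.le, one_div_mul_cancel hp.ne', Real.rpow_one]
  conv_rhs => rw [← himg]
  rw [lintegral_image_eq_lintegral_abs_deriv_mul measurableSet_Ioo
    (f' := fun t => p * t ^ (p - 1))]
  · refine setLIntegral_congr_fun measurableSet_Ioo fun t ht => ?_
    have ht0 : 0 < t := ht.1
    rw [abs_of_pos (by positivity), ← Real.rpow_mul ht0.le, mul_one_div_cancel hp.ne',
      Real.rpow_one]
  · intro t ht
    exact (Real.hasDerivAt_rpow_const (Or.inl ht.1.ne')).hasDerivWithinAt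
  · intro x hx y hy h
    exact (Real.rpow_left_inj hx.1.le hy.1.le hp.ne').1 h

/-- An even kernel sees only the even part of q. Averaging over ±ξ costs nothing and supplies the
paired shifts needed for horizontal derivatives. -/
theorem lintegral_symmetrize {k q : Plane n → ℝ≥0∞} (hk : ∀ ξ, k (-ξ) = k ξ) (hkm : Measurable k)
    (hq : Measurable q) :
    ∫⁻ ξ, k ξ * q ξ = ∫⁻ ξ, k ξ * ((q ξ + q (-ξ)) / 2) := by
  have h1 : ∫⁻ ξ, k ξ * q (-ξ) = ∫⁻ ξ, k ξ * q ξ := by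
    rw [← lintegral_neg_eq_self]
    refine lintegral_congr fun ξ => ?_
    rw [neg_neg, hk]
  have h2 : ∀ ξ, k ξ * ((q ξ + q (-ξ)) / 2) = 2⁻¹ * (k ξ * q ξ + k ξ * q (-ξ)) := by
    intro ξ
    rw [ENNReal.div_eq_inv_mul]; ring
  simp_rw [h2]
  rw [lintegral_const_mul _ (by fun_prop), lintegral_add_left (by fun_prop), h1, ← two_mul,
    ← mul_assoc, ENNReal.inv_mul_cancel (by norm_num) (by norm_num), one_mul]

/-- If s₀ = 1 the exponent tends to infinity and all heights collapse to 0, which is why the limit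
is then local in x_d. Otherwise the heights have a positive limit. -/
theorem tendsto_rpow_one_div {σ : ℕ → ℝ} {s₀ τ : ℝ} (hσ1 : ∀ k, σ k < 1)
    (hσ : Tendsto σ atTop (𝓝 s₀)) (hτ : τ ∈ Ioo (0 : ℝ) 1) :
    Tendsto (fun k => τ ^ (1 / (2 - 2 * σ k))) atTop
      (𝓝 (if s₀ = 1 then 0 else τ ^ (1 / (2 - 2 * s₀)))) := by
  have hlim : Tendsto (fun k => 2 - 2 * σ k) atTop (𝓝 (2 - 2 * s₀)) :=
    tendsto_const_nhds.sub (hσ.const_mul 2)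
  split_ifs with h
  · have h1 : Tendsto (fun k => 2 - 2 * σ k) atTop (𝓝[>] 0) := by
      refine tendsto_nhdsGT_zero (fun k => by linarith [hσ1 k]) ?_
      rw [h] at hlim
      simpa using hlim
    have h2 : Tendsto (fun k => 1 / (2 - 2 * σ k)) atTop atTop := by
      simpa [one_div, Function.comp_def] using tendsto_inv_nhdsGT_zero.comp h1
    exact (tendsto_rpow_atTop_of_base_lt_one τ (by linarith [hτ.1]) hτ.2).comp h2
  · have h1 : 2 - 2 * s₀ ≠ 0 := fun h' => h (by linarith)
    exact (Real.continuousAt_const_rpow hτ.1.ne').tendsto.comp (tendsto_const_nhds.div hlim h1)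

/-- The seminorm in the variable `τ = t ^ (2 - 2 s)`. -/
theorem filmEnergy_div_eq_subst (hω : IsOpen ω) {ε s : ℝ} (hε : 0 < ε) (hs : s < 1)
    (v : FilmL2 ω) :
    filmEnergy ω s ε v / ENNReal.ofReal (ε ^ (1 - 2 * s) / (1 - s)) =
      ∫⁻ τ in Ioo (0 : ℝ) 1, ∫⁻ ξ : Plane n, ENNReal.ofReal (ker n s ξ) *
        (shiftEnergy (film ω 1) v ((ε * τ ^ (1 / (2 - 2 * s))) • ξ, τ ^ (1 / (2 - 2 * s))) /
          ENNReal.ofReal ((τ ^ (1 / (2 - 2 * s))) ^ 2)) := by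
  have h1 : 0 < 1 - s := by linarith
  have hpow : 0 < ε ^ (1 - 2 * s) := by positivity
  rw [← lintegral_rpow_subst (p := 2 - 2 * s) (by linarith) (fun t => ∫⁻ ξ : Plane n,
    ENNReal.ofReal (ker n s ξ) * (shiftEnergy (film ω 1) v ((ε * t) • ξ, t) /
      ENNReal.ofReal (t ^ 2))), filmEnergy_eq_ker hω hε,
    show 2 * ε ^ (1 - 2 * s) = (2 * (1 - s)) * (ε ^ (1 - 2 * s) / (1 - s)) by field_simp,
    ofReal_mul_div_ofReal (by linarith) (by positivity),
    ← lintegral_const_mul' _ _ ENNReal.ofReal_ne_top]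
  refine setLIntegral_congr_fun measurableSet_Ioo fun t ht => ?_
  have ht0 : 0 < t := ht.1
  rw [← lintegral_const_mul' _ _ ENNReal.ofReal_ne_top,
    ← lintegral_const_mul' _ _ ENNReal.ofReal_ne_top]
  refine lintegral_congr fun ξ => ?_
  have e1 : 2 * (1 - s) * t ^ (-(1 + 2 * s)) = (2 - 2 * s) * t ^ (2 - 2 * s - 1) * (t ^ 2)⁻¹ := by
    rw [← Real.rpow_natCast t 2, ← Real.rpow_neg ht0.le, mul_assoc (2 - 2 * s), ← Real.rpow_add ht0]
    push_cast
    ring_nf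
  rw [← mul_assoc, ← ENNReal.ofReal_mul (by linarith), e1, ENNReal.ofReal_mul (by
    have : 0 < 2 - 2 * s := by linarith
    positivity), ENNReal.ofReal_inv_of_pos (by positivity), ENNReal.div_eq_inv_mul]
  ring

/-- In the variable τ every height t tends to 0, and Q(εtξ, t)/t² is a squared difference quotient
whose direction becomes vertical because εtξ/t → 0. -/
theorem verticalDirichlet_le_liminf (hω : IsOpen ω) (hfin : volume ω ≠ ∞) {ε σ : ℕ → ℝ}
    (hpos : ∀ k, 0 < ε k) (hε : Tendsto ε atTop (𝓝 0)) (hσ : Tendsto σ atTop (𝓝 1))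
    (hσ1 : ∀ k, σ k < 1) {w : ℕ → FilmL2 ω} {v : FilmL2 ω} (hw : WeakTendsto w v) :
    ENNReal.ofReal (constC n 1) * verticalDirichlet ω v ≤
      liminf (fun k => filmEnergy ω (σ k) (ε k) (w k) /
        ENNReal.ofReal (ε k ^ (1 - 2 * σ k) / (1 - σ k))) atTop := by
  have h1 := fun k => filmEnergy_div_eq_subst hω (hpos k) (hσ1 k) (w k)
  simp_rw [h1]
  have h2 : ENNReal.ofReal (constC n 1) * verticalDirichlet ω v =
      ∫⁻ τ in Ioo (0 : ℝ) 1, ∫⁻ ξ : Plane n,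
        ENNReal.ofReal (ker n 1 ξ) * verticalDirichlet ω v := by
    rw [lintegral_mul_const _ (by fun_prop), lintegral_ker (by norm_num)]
    simp
  rw [h2]
  refine lintegral_lintegral_le_liminf (fun k => ?_) ?_
  · have := measurable_shiftEnergy_film hω (w k)
    fun_prop
  · filter_upwards [ae_restrict_mem measurableSet_Ioo] with τ hτ
    refine Eventually.of_forall fun ξ => mul_le_liminf_mul (tendsto_ofReal_ker hσ ξ) ?_
    have ht := tendsto_rpow_one_div hσ1 hσ hτ
    rw [if_pos rfl] at ht
    have htpos : ∀ k, 0 < τ ^ (1 / (2 - 2 * σ k)) := fun k => Real.rpow_pos_of_pos hτ.1 _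
    refine verticalDirichlet_le hfin v fun φ hφ =>
      sq_integral_vertical_le_liminf hω hfin hw htpos ht ?_ hφ
    have h3 : Tendsto (fun k => ε k • ξ) atTop (𝓝 0) := by
      simpa using hε.smul_const ξ
    refine h3.congr fun k => ?_
    rw [smul_smul, mul_comm (ε k), inv_mul_cancel_left₀ (htpos k).ne']

/-- This is ∫(1 - t)(2-2s)t^(1-2s) dt in the variable τ, the origin of the factor 3 - 2s in K. -/
theorem lintegral_one_sub_rpow {s₀ : ℝ} (hs₀ : s₀ ≤ 1) :
    ∫⁻ τ in Ioo (0 : ℝ) 1, ENNReal.ofReal (1 - (if s₀ = 1 then 0 else τ ^ (1 / (2 - 2 * s₀)))) =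
      ENNReal.ofReal (1 / (3 - 2 * s₀)) := by
  have h3 : 0 < 3 - 2 * s₀ := by linarith
  split_ifs with h
  · simp [h]
    norm_num
  have hs : s₀ < 1 := lt_of_le_of_ne hs₀ h
  have hp : 0 < 1 / (2 - 2 * s₀) := by
    have : 0 < 2 - 2 * s₀ := by linarith
    positivity
  refine lintegral_ofReal_of_integral_eq (by positivity) ?_ ?_
  · filter_upwards [ae_restrict_mem measurableSet_Ioo] with τ hτ
    simp only [Pi.zero_apply]
    linarith [Real.rpow_lt_one hτ.1.le hτ.2 hp]
  · rw [← integral_Ioc_eq_integral_Ioo, ← intervalIntegral.integral_of_le zero_le_one,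
      intervalIntegral.integral_sub (by simp) (intervalIntegral.intervalIntegrable_rpow'
        (by linarith)), integral_rpow (Or.inl (by linarith))]
    have : (2 - 2 * s₀) ≠ 0 := by linarith
    have h4 : 1 / (2 - 2 * s₀) + 1 ≠ 0 := by positivity
    rw [Real.one_rpow, Real.zero_rpow h4]
    simp only [intervalIntegral.integral_const, sub_zero, smul_eq_mul, mul_one]
    rw [div_add_one this, one_div_div, eq_div_iff h3.ne', show 1 + (2 - 2 * s₀) = 3 - 2 * s₀ by ring]
    field_simp
    ring

/-- The extra factor ε² turns increments into difference quotients with horizontal step εt. After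
symmetrization in ξ, each τ bounds the derivative in direction ξ with weight 1 - t₀(τ). The sum over
τ is a bound m(ξ), which the radial kernel averages into the Dirichlet integral. -/
theorem planarDirichlet_le_liminf (hn : 1 ≤ n) (hω : IsOpen ω) (hfin : volume ω ≠ ∞)
    {ε σ : ℕ → ℝ} {s₀ : ℝ} (hpos : ∀ k, 0 < ε k) (hε : Tendsto ε atTop (𝓝 0))
    (hσ : Tendsto σ atTop (𝓝 s₀)) (hσ1 : ∀ k, σ k < 1) (hs₀ : 1 / 2 < s₀) (hs₀1 : s₀ ≤ 1)
    {w : ℕ → FilmL2 ω} {v : FilmL2 ω} (hw : WeakTendsto w v) {u : PlaneL2 ω}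
    (hu : ∀ᵐ x ∂((volume : Measure (Plane n × ℝ)).restrict (film ω 1)), v x = u x.1) :
    ENNReal.ofReal (constK n s₀) * planarDirichlet ω u ≤
      liminf (fun k => filmEnergy ω (σ k) (ε k) (w k) /
        ENNReal.ofReal (ε k ^ (3 - 2 * σ k) / (1 - σ k))) atTop := by
  have hn' : (0 : ℝ) < n := by exact_mod_cast hn
  set t : ℕ → ℝ → ℝ := fun k τ => τ ^ (1 / (2 - 2 * σ k)) with ht
  set t₀ : ℝ → ℝ := fun τ => if s₀ = 1 then 0 else τ ^ (1 / (2 - 2 * s₀)) with ht₀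
  have htm : ∀ k, Measurable (t k) := fun k => by simp only [ht]; fun_prop
  have htpos : ∀ k, ∀ τ ∈ Ioo (0 : ℝ) 1, 0 < t k τ := fun k τ hτ => Real.rpow_pos_of_pos hτ.1 _
  set q : ℕ → ℝ → Plane n → ℝ≥0∞ := fun k τ ξ =>
    (shiftEnergy (film ω 1) (w k) ((ε k * t k τ) • ξ, t k τ) +
      shiftEnergy (film ω 1) (w k) (-((ε k * t k τ) • ξ), t k τ)) /
        ENNReal.ofReal (2 * (ε k * t k τ) ^ 2) with hq
  have hQm : ∀ k, Measurable (shiftEnergy (film ω 1) (w k)) :=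
    fun k => measurable_shiftEnergy_film hω (w k)
  have hqm : ∀ k, Measurable fun p : ℝ × Plane n => q k p.1 p.2 := by
    intro k
    have := hQm k
    have := htm k
    simp only [hq]
    fun_prop
  -- The factor 3 - 2s₀ compensates the total weight 1/(3 - 2s₀) of 1 - t₀ over (0,1).
  set m : Plane n → ℝ≥0∞ := fun ξ => ENNReal.ofReal (3 - 2 * s₀) *
    ∫⁻ τ in Ioo (0 : ℝ) 1, liminf (fun k => q k τ ξ) atTop with hm
  have hliminf_m : Measurable fun p : ℝ × Plane n => liminf (fun k => q k p.1 p.2) atTop :=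
    Measurable.liminf hqm
  have hmm : Measurable m := by
    simp only [hm]
    exact (Measurable.lintegral_prod_left' hliminf_m).const_mul _
  have h1 : ∀ k, filmEnergy ω (σ k) (ε k) (w k) /
      ENNReal.ofReal (ε k ^ (3 - 2 * σ k) / (1 - σ k)) = ∫⁻ τ in Ioo (0 : ℝ) 1, ∫⁻ ξ : Plane n,
        ENNReal.ofReal (ker n (σ k) ξ) * q k τ ξ := by
    intro k
    have e0 := hpos k
    have e1 : 0 < 1 - σ k := by linarith [hσ1 k]
    have hpow : 0 < ε k ^ (1 - 2 * σ k) := by positivity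
    have hpow' : 0 < ε k ^ (3 - 2 * σ k) := by positivity
    have e2 : (ε k ^ (1 - 2 * σ k) / (1 - σ k)) / (ε k ^ (3 - 2 * σ k) / (1 - σ k)) =
        (ε k ^ 2)⁻¹ := by
      rw [div_div_div_cancel_right₀ e1.ne', ← Real.rpow_sub e0, ← Real.rpow_natCast,
        ← Real.rpow_neg e0.le]
      congr 1
      push_cast
      ring
    rw [div_ofReal_eq_mul (b := ε k ^ (1 - 2 * σ k) / (1 - σ k)) (by positivity) (by positivity),
      e2, filmEnergy_div_eq_subst hω e0 (hσ1 k), mul_comm,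
      ← lintegral_const_mul' _ _ ENNReal.ofReal_ne_top]
    refine setLIntegral_congr_fun measurableSet_Ioo fun τ hτ => ?_
    have hQ := hQm k
    have e3 := htpos k τ hτ
    rw [lintegral_symmetrize (fun ξ => by simp [ker]) (by fun_prop) (by fun_prop),
      ← lintegral_const_mul' _ _ ENNReal.ofReal_ne_top]
    refine lintegral_congr fun ξ => ?_
    have e4 : ENNReal.ofReal (2 * (ε k * t k τ) ^ 2) =
        2 * (ENNReal.ofReal (ε k ^ 2) * ENNReal.ofReal (t k τ ^ 2)) := by
      rw [mul_pow, ENNReal.ofReal_mul (by norm_num), ENNReal.ofReal_mul (by positivity)]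
      simp
    have e5 : ENNReal.ofReal (ε k ^ 2) ≠ 0 := by simp [e0.ne']
    have e6 : ENNReal.ofReal (t k τ ^ 2) ≠ 0 := by simp [e3.ne']
    simp only [hq]
    rw [e4, smul_neg, ENNReal.ofReal_inv_of_pos (by positivity)]
    simp only [div_eq_mul_inv]
    rw [ENNReal.mul_inv (Or.inl (by norm_num)) (Or.inl (by norm_num)),
      ENNReal.mul_inv (Or.inl e5) (Or.inl ENNReal.ofReal_ne_top)]
    simp only [ht, one_div]
    ring_nf
  simp_rw [h1]
  have hbound : ∀ ξ, ∀ φ ∈ testSubmodule ω,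
      ENNReal.ofReal ((∫ x in ω, u x * fderiv ℝ φ x ξ) ^ 2) ≤
      m ξ * ∫⁻ x in ω, ENNReal.ofReal (φ x ^ 2) := by
    intro ξ φ hφ
    set D := ENNReal.ofReal ((∫ x in ω, u x * fderiv ℝ φ x ξ) ^ 2)
    set B := ∫⁻ x in ω, ENNReal.ofReal (φ x ^ 2) with hB
    have hBtop : B ≠ ∞ := by
      rw [hB, setLIntegral_sq_of_mem_testSubmodule hω.measurableSet hφ]
      exact lintegral_sq_ne_top_of_mem_testSubmodule hφ
    have e1 : ∀ τ ∈ Ioo (0 : ℝ) 1, ENNReal.ofReal (1 - t₀ τ) * D ≤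
        liminf (fun k => q k τ ξ) atTop * B := by
      intro τ hτ
      have hlim := tendsto_rpow_one_div hσ1 hσ hτ
      have ht1 : t₀ τ < 1 := by
        simp only [ht₀]
        split_ifs with h
        · exact one_pos
        · have : 0 < 2 - 2 * s₀ := by
            have := lt_of_le_of_ne hs₀1 h
            linarith
          exact Real.rpow_lt_one hτ.1.le hτ.2 (by positivity)
      refine sq_integral_horizontal_le_liminf hω hfin hw hu (h := fun k => ε k * t k τ)
        (t := fun k => t k τ) (fun k => mul_pos (hpos k) (htpos k τ hτ)) ?_
        (fun k => (htpos k τ hτ).le) hlim ht1 ξ hφ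
      simpa [ht] using hε.mul hlim
    have e2 : ENNReal.ofReal (1 / (3 - 2 * s₀)) * D ≤
        (∫⁻ τ in Ioo (0 : ℝ) 1, liminf (fun k => q k τ ξ) atTop) * B := by
      rw [← lintegral_one_sub_rpow hs₀1, ← lintegral_mul_const' _ _ ENNReal.ofReal_ne_top,
        ← lintegral_mul_const' _ _ hBtop]
      exact setLIntegral_mono' measurableSet_Ioo e1
    have e3 : 0 < 3 - 2 * s₀ := by linarith
    calc D = ENNReal.ofReal (3 - 2 * s₀) * (ENNReal.ofReal (1 / (3 - 2 * s₀)) * D) := by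
          rw [← mul_assoc, ← ENNReal.ofReal_mul e3.le, mul_one_div_cancel e3.ne']
          simp
      _ ≤ ENNReal.ofReal (3 - 2 * s₀) *
          ((∫⁻ τ in Ioo (0 : ℝ) 1, liminf (fun k => q k τ ξ) atTop) * B) := by gcongr
      _ = m ξ * B := by simp only [hm]; ring
  have hKpos := constK_pos hn hs₀ (by linarith)
  have e3 : 0 < 3 - 2 * s₀ := by linarith
  -- The second moment of the kernel divided by n is (3 - 2s₀)K; its first factor cancels later with
  -- the one put into m.
  have hmain := planarDirichlet_le_of_directional hω hfin u (k := fun ξ => ENNReal.ofReal (ker n s₀ ξ))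
    (by fun_prop) hmm (c := (3 - 2 * s₀) * constK n s₀) (by positivity) (fun g => by
      have e4 := lintegral_radial_inner_sq (k := fun ξ => ENNReal.ofReal (ker n s₀ ξ))
        (by fun_prop) (fun ξ η h => by simp [ker, h]) g
      rw [lintegral_sq_mul_ker hs₀, ← ENNReal.ofReal_mul (by positivity)] at e4
      have e5 : (n : ℝ≥0∞) = ENNReal.ofReal n := by simp
      have e6 : ENNReal.ofReal n ≠ 0 := by simp; omega
      refine (ENNReal.mul_right_inj e6 ENNReal.ofReal_ne_top).1 ?_
      rw [← e5, e4, e5, ← ENNReal.ofReal_mul hn'.le]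
      congr 1
      rw [constK_eq hs₀]
      have e7 := e3.ne'
      have e8 := hn'.ne'
      generalize 3 - 2 * s₀ = d at e7 ⊢
      field_simp) hbound
  have e4 : ∫⁻ ξ, ENNReal.ofReal (ker n s₀ ξ) * m ξ = ENNReal.ofReal (3 - 2 * s₀) *
      ∫⁻ τ in Ioo (0 : ℝ) 1, ∫⁻ ξ, ENNReal.ofReal (ker n s₀ ξ) *
        liminf (fun k => q k τ ξ) atTop := by
    rw [lintegral_lintegral_swap (by fun_prop), ← lintegral_const_mul' _ _ ENNReal.ofReal_ne_top]
    refine lintegral_congr fun ξ => ?_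
    simp only [hm]
    rw [lintegral_const_mul' _ _ ENNReal.ofReal_ne_top]
    ring
  rw [e4, ENNReal.ofReal_mul e3.le, mul_assoc] at hmain
  refine ((ENNReal.mul_le_mul_iff_right (by simpa using e3) ENNReal.ofReal_ne_top).1 hmain).trans ?_
  refine lintegral_lintegral_le_liminf (fun k => ?_) ?_
  · have := hqm k
    fun_prop
  · exact Eventually.of_forall fun τ => Eventually.of_forall fun ξ =>
      mul_le_liminf_mul (tendsto_ofReal_ker hσ ξ) le_rfl

/-! ### Lower bound at the critical exponent -/

/-- Write z = ε^τ ξ with ξ in the annulus 1 < |ξ| < e. A given z is reached only for τ in an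
interval of length 1/|log ε|, which the factor |log ε| compensates. Only lengths between ε and e are
kept; they carry the logarithm. -/
theorem lintegral_dyadic_le {ε : ℝ} (hε : 0 < ε) (hε1 : ε < 1) {g : Plane n → ℝ≥0∞}
    (hg : Measurable g) :
    ∫⁻ τ in Ioo (0 : ℝ) 1, ∫⁻ ξ in {ξ : Plane n | 1 < ‖ξ‖ ∧ ‖ξ‖ < Real.exp 1},
      ENNReal.ofReal (|Real.log ε| * (ε ^ τ) ^ n) * g (ε ^ τ • ξ) ≤ ∫⁻ z, g z := by
  set A : Set (Plane n) := {ξ : Plane n | 1 < ‖ξ‖ ∧ ‖ξ‖ < Real.exp 1} with hA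
  have hAm : MeasurableSet A :=
    (measurableSet_lt measurable_const measurable_norm).inter
      (measurableSet_lt measurable_norm measurable_const)
  have hlog : Real.log ε < 0 := Real.log_neg hε hε1
  have habs : 0 < |Real.log ε| := abs_pos.2 hlog.ne
  have hind : Measurable (A.indicator (1 : Plane n → ℝ≥0∞)) := measurable_one.indicator hAm
  have h1 : ∀ τ : ℝ, ∫⁻ ξ in A, ENNReal.ofReal (|Real.log ε| * (ε ^ τ) ^ n) * g (ε ^ τ • ξ) =
      ∫⁻ z, ENNReal.ofReal |Real.log ε| * (A.indicator 1 ((ε ^ τ)⁻¹ • z) * g z) := by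
    intro τ
    have hp : 0 < ε ^ τ := Real.rpow_pos_of_pos hε τ
    rw [lintegral_dilation hp, ← lintegral_indicator hAm,
      ← lintegral_const_mul' _ _ ENNReal.ofReal_ne_top]
    refine lintegral_congr fun ξ => ?_
    rw [smul_smul, inv_mul_cancel₀ hp.ne', one_smul]
    by_cases hξ : ξ ∈ A
    · simp only [indicator_of_mem hξ, Pi.one_apply, one_mul]
      rw [ENNReal.ofReal_mul (abs_nonneg _)]
      ring
    · simp [hξ]
  simp_rw [h1]
  rw [lintegral_lintegral_swap (by fun_prop)]
  refine lintegral_mono fun z => ?_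
  simp_rw [← mul_assoc]
  rw [lintegral_mul_const _ (by fun_prop), lintegral_const_mul _ (by fun_prop)]
  refine mul_le_of_le_one_left bot_le ?_
  have h2 : ∫⁻ τ in Ioo (0 : ℝ) 1, A.indicator (1 : Plane n → ℝ≥0∞) ((ε ^ τ)⁻¹ • z) ≤
      ENNReal.ofReal (1 / |Real.log ε|) := by
    by_cases hz : z = 0
    · have : (0 : Plane n) ∉ A := by simp [hA]
      simp [hz, this]
    have hz' : 0 < ‖z‖ := norm_pos_iff.2 hz
    -- Taking logarithms, the annulus condition on ε^(-τ)z says that τ lies in this interval.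
    set I := Ioo (-Real.log ‖z‖ / |Real.log ε|) ((1 - Real.log ‖z‖) / |Real.log ε|) with hI
    calc ∫⁻ τ in Ioo (0 : ℝ) 1, A.indicator (1 : Plane n → ℝ≥0∞) ((ε ^ τ)⁻¹ • z)
        ≤ ∫⁻ τ, A.indicator (1 : Plane n → ℝ≥0∞) ((ε ^ τ)⁻¹ • z) := setLIntegral_le_lintegral _ _
      _ ≤ ∫⁻ τ, I.indicator 1 τ := by
          refine lintegral_mono fun τ => ?_
          by_cases h : (ε ^ τ)⁻¹ • z ∈ A
          · have hp : 0 < ε ^ τ := Real.rpow_pos_of_pos hε τ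
            have h3 : Real.log ‖(ε ^ τ)⁻¹ • z‖ = Real.log ‖z‖ + τ * |Real.log ε| := by
              rw [norm_smul, norm_inv, Real.norm_of_nonneg hp.le, Real.log_mul (by positivity)
                hz'.ne', Real.log_inv, Real.log_rpow hε, abs_of_neg hlog]
              ring
            have h4 : 0 < Real.log ‖(ε ^ τ)⁻¹ • z‖ := Real.log_pos h.1
            have h5 : Real.log ‖(ε ^ τ)⁻¹ • z‖ < 1 := by
              rw [Real.log_lt_iff_lt_exp (by linarith [h.1])]
              exact h.2
            rw [h3] at h4 h5
            have : τ ∈ I := ⟨by rw [div_lt_iff₀ habs]; linarith, by rw [lt_div_iff₀ habs]; linarith⟩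
            simp [this, h]
          · simp [h]
      _ = ENNReal.ofReal (1 / |Real.log ε|) := by
          rw [lintegral_indicator_one measurableSet_Ioo, Real.volume_Ioo]
          congr 1
          ring
  calc ENNReal.ofReal |Real.log ε| * ∫⁻ τ in Ioo (0 : ℝ) 1,
        A.indicator (1 : Plane n → ℝ≥0∞) ((ε ^ τ)⁻¹ • z)
      ≤ ENNReal.ofReal |Real.log ε| * ENNReal.ofReal (1 / |Real.log ε|) := by gcongr
    _ = 1 := by
        rw [← ENNReal.ofReal_mul habs.le, mul_one_div_cancel habs.ne']
        simp

/-- In polar coordinates the integrand is 1/r on 1 < r < e, so the radial integral is log e = 1. -/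
theorem lintegral_annulus (hn : 1 ≤ n) :
    ∫⁻ ξ : Plane n, {ξ : Plane n | 1 < ‖ξ‖ ∧ ‖ξ‖ < Real.exp 1}.indicator
      (fun ξ => ENNReal.ofReal (1 / ‖ξ‖ ^ n)) ξ = ENNReal.ofReal (sphereArea n) := by
  have : Nonempty (Fin n) := ⟨⟨0, hn⟩⟩
  set f : ℝ → ℝ := (Ioo 1 (Real.exp 1)).indicator fun r => 1 / r ^ n with hf
  have h1 : ∀ ξ : Plane n, {ξ : Plane n | 1 < ‖ξ‖ ∧ ‖ξ‖ < Real.exp 1}.indicator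
      (fun ξ => ENNReal.ofReal (1 / ‖ξ‖ ^ n)) ξ = ENNReal.ofReal (f ‖ξ‖) := by
    intro ξ
    by_cases h : 1 < ‖ξ‖ ∧ ‖ξ‖ < Real.exp 1 <;> simp [hf, indicator, h]
  simp_rw [h1]
  refine lintegral_ofReal_of_integral_eq (sphereArea_pos n hn) (Eventually.of_forall fun ξ => ?_) ?_
  · simp only [hf, Pi.zero_apply]
    exact indicator_nonneg (fun r hr => by have : 0 < r := by linarith [hr.1]
                                           positivity) _
  rw [integral_fun_norm_addHaar (volume : Measure (Plane n)) f, sphereArea,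
    Measure.toSphere_real_apply_univ]
  have h2 : ∫ y in Ioi (0 : ℝ), y ^ (Module.finrank ℝ (Plane n) - 1) • f y = 1 := by
    have h3 : ∀ y ∈ Ioi (0 : ℝ), y ^ (Module.finrank ℝ (Plane n) - 1) • f y =
        (Ioo 1 (Real.exp 1)).indicator (fun r => r⁻¹) y := by
      intro y hy
      have hy0 : y ≠ 0 := (ne_of_gt hy)
      by_cases h : y ∈ Ioo 1 (Real.exp 1)
      · simp only [hf, indicator_of_mem h, finrank_euclideanSpace, Fintype.card_fin, smul_eq_mul]
        obtain ⟨k, rfl⟩ : ∃ k, n = k + 1 := ⟨n - 1, by omega⟩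
        rw [Nat.add_sub_cancel, pow_succ]
        field_simp
      · simp [hf, h]
    rw [setIntegral_congr_fun measurableSet_Ioi h3, integral_indicator measurableSet_Ioo,
      Measure.restrict_restrict measurableSet_Ioo]
    have h4 : Ioo 1 (Real.exp 1) ∩ Ioi (0 : ℝ) = Ioo 1 (Real.exp 1) :=
      inter_eq_left.2 fun x hx => lt_trans one_pos hx.1
    have h5 : (1 : ℝ) ≤ Real.exp 1 := Real.one_le_exp zero_le_one
    rw [h4, ← integral_Ioc_eq_integral_Ioo, ← intervalIntegral.integral_of_le h5,
      integral_inv_of_pos one_pos (Real.exp_pos 1)]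
    simp
  rw [h2]
  simp

-- For 0 < τ < 1 the step ε^τ tends to 0, and so does the height ε^(1-τ)t relative to it. At every
-- intermediate scale the kernel is asymptotically |ξ|^(-(n+2)), and the paired quotients bound the
-- directional derivatives. All scales τ contribute equally, which accounts for the logarithm; the
-- height t enters only through the weight 1 - t.
set_option maxHeartbeats 400000 in
theorem planarDirichlet_le_liminf_log (hn : 1 ≤ n) (hω : IsOpen ω) (hfin : volume ω ≠ ∞)
    {ε : ℕ → ℝ} (hpos : ∀ k, 0 < ε k) (hε : Tendsto ε atTop (𝓝 0))
    {w : ℕ → FilmL2 ω} {v : FilmL2 ω} (hw : WeakTendsto w v) {u : PlaneL2 ω}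
    (hu : ∀ᵐ x ∂((volume : Measure (Plane n × ℝ)).restrict (film ω 1)), v x = u x.1) :
    ENNReal.ofReal (sphereArea n / n) * planarDirichlet ω u ≤
      liminf (fun k => filmEnergy ω (1 / 2) (ε k) (w k) /
        ENNReal.ofReal (ε k ^ 2 * |Real.log (ε k)|)) atTop := by
  have hn' : (0 : ℝ) < n := by exact_mod_cast hn
  set A : Set (Plane n) := {ξ : Plane n | 1 < ‖ξ‖ ∧ ‖ξ‖ < Real.exp 1} with hA
  have hAm : MeasurableSet A :=
    (measurableSet_lt measurable_const measurable_norm).inter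
      (measurableSet_lt measurable_norm measurable_const)
  have hApos : ∀ ξ ∈ A, 0 < ‖ξ‖ := fun ξ hξ => lt_trans one_pos hξ.1
  set κ : ℕ → ℝ → ℝ → Plane n → ℝ := fun k t τ ξ =>
    1 / Real.sqrt (‖ξ‖ ^ 2 + (ε k ^ (1 - τ) * t) ^ 2) ^ (((n : ℝ) + 1) + 2 * (1 / 2)) with hκ
  have hQm : ∀ k, Measurable (shiftEnergy (film ω 1) (w k)) :=
    fun k => measurable_shiftEnergy_film hω (w k)
  set q : ℕ → ℝ → ℝ → Plane n → ℝ≥0∞ := fun k t τ ξ =>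
    (shiftEnergy (film ω 1) (w k) ((ε k ^ τ) • ξ, t) +
      shiftEnergy (film ω 1) (w k) (-((ε k ^ τ) • ξ), t)) /
        ENNReal.ofReal (2 * (ε k ^ τ) ^ 2) with hq
  have hpm : ∀ k, Measurable fun p : (ℝ × ℝ) × Plane n => ε k ^ p.1.2 := fun k => by
    have := hpos k
    have h1 : Continuous fun r : ℝ => ε k ^ r := Real.continuous_const_rpow this.ne'
    exact h1.measurable.comp (by fun_prop)
  have hpm' : ∀ k, Measurable fun p : (ℝ × ℝ) × Plane n => ε k ^ (1 - p.1.2) := fun k => by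
    have := hpos k
    have h1 : Continuous fun r : ℝ => ε k ^ (1 - r) :=
      (Real.continuous_const_rpow this.ne').comp (by fun_prop)
    exact h1.measurable.comp (by fun_prop)
  have hqm : ∀ k, Measurable fun p : (ℝ × ℝ) × Plane n => q k p.1.1 p.1.2 p.2 := by
    intro k
    have := hQm k
    have := hpm k
    simp only [hq]
    fun_prop
  have hκm : ∀ k, Measurable fun p : (ℝ × ℝ) × Plane n => κ k p.1.1 p.1.2 p.2 := by
    intro k
    have := hpm' k
    simp only [hκ]
    fun_prop
  -- The factor 2 compensates ∫(1 - t) dt = 1/2.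
  set m : Plane n → ℝ≥0∞ := fun ξ => ENNReal.ofReal 2 *
    ∫⁻ p in Ioo (0 : ℝ) 1 ×ˢ Ioo (0 : ℝ) 1, liminf (fun k => q k p.1 p.2 ξ) atTop with hm
  have hliminf_m : Measurable fun p : (ℝ × ℝ) × Plane n =>
    liminf (fun k => q k p.1.1 p.1.2 p.2) atTop := Measurable.liminf hqm
  have hmm : Measurable m := by
    simp only [hm]
    exact (Measurable.lintegral_prod_left' hliminf_m).const_mul _
  have hsq : MeasurableSet (Ioo (0 : ℝ) 1 ×ˢ Ioo (0 : ℝ) 1) :=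
    measurableSet_Ioo.prod measurableSet_Ioo
  have hbound : ∀ ξ, ∀ φ ∈ testSubmodule ω,
      ENNReal.ofReal ((∫ x in ω, u x * fderiv ℝ φ x ξ) ^ 2) ≤
      m ξ * ∫⁻ x in ω, ENNReal.ofReal (φ x ^ 2) := by
    intro ξ φ hφ
    set D := ENNReal.ofReal ((∫ x in ω, u x * fderiv ℝ φ x ξ) ^ 2)
    set B := ∫⁻ x in ω, ENNReal.ofReal (φ x ^ 2) with hB
    have hBtop : B ≠ ∞ := by
      rw [hB, setLIntegral_sq_of_mem_testSubmodule hω.measurableSet hφ]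
      exact lintegral_sq_ne_top_of_mem_testSubmodule hφ
    have e1 : ∀ p ∈ Ioo (0 : ℝ) 1 ×ˢ Ioo (0 : ℝ) 1, ENNReal.ofReal (1 - p.1) * D ≤
        liminf (fun k => q k p.1 p.2 ξ) atTop * B := by
      rintro ⟨t, τ⟩ ⟨ht, hτ⟩
      refine sq_integral_horizontal_le_liminf hω hfin hw hu (h := fun k => ε k ^ τ)
        (t := fun _ => t) (fun k => Real.rpow_pos_of_pos (hpos k) τ) ?_
        (fun k => ht.1.le) tendsto_const_nhds ht.2 ξ hφ
      have := hε.rpow_const (p := τ) (Or.inr hτ.1.le)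
      rwa [Real.zero_rpow hτ.1.ne'] at this
    have e0 : ∫⁻ p in Ioo (0 : ℝ) 1 ×ˢ Ioo (0 : ℝ) 1, ENNReal.ofReal (1 - p.1) =
        ENNReal.ofReal (1 / 2) := by
      rw [Measure.volume_eq_prod, ← Measure.prod_restrict, lintegral_prod _ (by fun_prop)]
      simp only [lintegral_const, Measure.restrict_apply_univ, Real.volume_Ioo]
      simpa using lintegral_one_sub
    have e2 : ENNReal.ofReal (1 / 2) * D ≤
        (∫⁻ p in Ioo (0 : ℝ) 1 ×ˢ Ioo (0 : ℝ) 1, liminf (fun k => q k p.1 p.2 ξ) atTop) * B := by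
      rw [← e0, ← lintegral_mul_const' _ _ ENNReal.ofReal_ne_top, ← lintegral_mul_const' _ _ hBtop]
      exact setLIntegral_mono' hsq e1
    calc D = ENNReal.ofReal 2 * (ENNReal.ofReal (1 / 2) * D) := by
          rw [← mul_assoc, ← ENNReal.ofReal_mul (by norm_num)]
          norm_num
      _ ≤ ENNReal.ofReal 2 *
          ((∫⁻ p in Ioo (0 : ℝ) 1 ×ˢ Ioo (0 : ℝ) 1, liminf (fun k => q k p.1 p.2 ξ) atTop) * B) := by
          gcongr
      _ = m ξ * B := by simp only [hm]; ring
  -- The limit kernel on the annulus; its second moment is the area of the unit sphere.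
  set k₀ : Plane n → ℝ≥0∞ := A.indicator fun ξ => ENNReal.ofReal (1 / ‖ξ‖ ^ (n + 2)) with hk₀
  have hk₀m : Measurable k₀ := by
    refine Measurable.indicator ?_ hAm
    fun_prop
  have hmain := planarDirichlet_le_of_directional hω hfin u (k := k₀) hk₀m hmm
    (c := sphereArea n / n) (by have := sphereArea_pos n hn; positivity) (fun g => by
      have e4 := lintegral_radial_inner_sq (k := k₀) hk₀m (fun ξ η h => by
        simp [hk₀, hA, indicator, h]) g
      have e7 : ∫⁻ ξ, k₀ ξ * ENNReal.ofReal (‖ξ‖ ^ 2) = ENNReal.ofReal (sphereArea n) := by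
        rw [← lintegral_annulus hn]
        refine lintegral_congr fun ξ => ?_
        by_cases h : ξ ∈ A
        · have h' := h
          simp only [hA] at h'
          have := hApos ξ h
          simp only [hk₀, indicator_of_mem h, indicator_of_mem h']
          rw [← ENNReal.ofReal_mul (by positivity), pow_add]
          congr 1
          field_simp
        · have h' := h
          simp only [hA] at h'
          simp only [hk₀, indicator_of_notMem h, indicator_of_notMem h', zero_mul]
      rw [e7, ← ENNReal.ofReal_mul (by positivity)] at e4
      have e5 : (n : ℝ≥0∞) = ENNReal.ofReal n := by simp
      have e6 : ENNReal.ofReal n ≠ 0 := by simp; omega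
      refine (ENNReal.mul_right_inj e6 ENNReal.ofReal_ne_top).1 ?_
      rw [← e5, e4, e5, ← ENNReal.ofReal_mul hn'.le]
      congr 1
      field_simp) hbound
  have e4 : ∫⁻ ξ, k₀ ξ * m ξ = ENNReal.ofReal 2 *
      ∫⁻ p in Ioo (0 : ℝ) 1 ×ˢ Ioo (0 : ℝ) 1, ∫⁻ ξ, k₀ ξ *
        liminf (fun k => q k p.1 p.2 ξ) atTop := by
    rw [lintegral_lintegral_swap (by fun_prop), ← lintegral_const_mul' _ _ ENNReal.ofReal_ne_top]
    refine lintegral_congr fun ξ => ?_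
    simp only [hm]
    have : k₀ ξ ≠ ∞ := by
      by_cases h : ξ ∈ A <;> simp [hk₀, h]
    rw [lintegral_const_mul' _ _ this]
    ring
  rw [e4] at hmain
  refine hmain.trans ?_
  -- The energy is bounded below by the part carried by the lengths ε^τ|ξ|; the normalization
  -- removes the factor |log ε|.
  have hlow : ∀ᶠ k in atTop, ENNReal.ofReal 2 * ∫⁻ p in Ioo (0 : ℝ) 1 ×ˢ Ioo (0 : ℝ) 1,
      ∫⁻ ξ, A.indicator (fun ξ => ENNReal.ofReal (κ k p.1 p.2 ξ)) ξ * q k p.1 p.2 ξ ≤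
      filmEnergy ω (1 / 2) (ε k) (w k) / ENNReal.ofReal (ε k ^ 2 * |Real.log (ε k)|) := by
    filter_upwards [hε.eventually_lt_const one_pos] with k hk1
    have e0 := hpos k
    have hlog : 0 < |Real.log (ε k)| := abs_pos.2 (Real.log_neg e0 hk1).ne
    have hQ := hQm k
    have hind : Measurable fun p : (ℝ × ℝ) × Plane n =>
        A.indicator (fun ξ => ENNReal.ofReal (κ k p.1.1 p.1.2 ξ)) p.2 := by
      have e9 : MeasurableSet {p : (ℝ × ℝ) × Plane n | p.2 ∈ A} := hAm.preimage measurable_snd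
      exact ((hκm k).ennreal_ofReal).indicator e9
    have hmeas : Measurable fun p : ℝ × ℝ => ∫⁻ ξ,
        A.indicator (fun ξ => ENNReal.ofReal (κ k p.1 p.2 ξ)) ξ * q k p.1 p.2 ξ :=
      (hind.mul (hqm k)).lintegral_prod_right'
    rw [filmEnergy, gagliardo_eq_half hω.measurableSet e0 _ (measurable_coe_Lp _),
      show 2 * ε k ^ 2 = 2 / |Real.log (ε k)| * (ε k ^ 2 * |Real.log (ε k)|) by field_simp,
      ofReal_mul_div_ofReal (by positivity) (by positivity),
      Measure.volume_eq_prod, ← Measure.prod_restrict, lintegral_prod _ hmeas.aemeasurable,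
      div_eq_mul_inv 2, ENNReal.ofReal_mul (by norm_num), mul_assoc,
      ← lintegral_const_mul' (ENNReal.ofReal |Real.log (ε k)|⁻¹) _ ENNReal.ofReal_ne_top]
    refine mul_le_mul_right (setLIntegral_mono' measurableSet_Ioo fun t ht => ?_) _
    have hfk : Measurable fun z : Plane n => ENNReal.ofReal (filmKernel n (1 / 2) (ε k) z t) :=
      ((measurable_filmKernel (n := n) (1 / 2) (ε k)).comp
        (measurable_prodMk_right (y := t))).ennreal_ofReal
    have hg : Measurable fun z : Plane n => ENNReal.ofReal (filmKernel n (1 / 2) (ε k) z t) *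
        shiftEnergy (film ω 1) (w k) (z, t) := hfk.mul (by fun_prop)
    refine le_trans ?_ (mul_le_mul_right (lintegral_dyadic_le e0 hk1 hg) _)
    rw [← lintegral_const_mul' _ _ ENNReal.ofReal_ne_top]
    refine setLIntegral_mono' measurableSet_Ioo fun τ hτ => ?_
    have hp : 0 < ε k ^ τ := Real.rpow_pos_of_pos e0 τ
    have e2 : ∀ ξ ∈ A, (ε k ^ τ) ^ n * filmKernel n (1 / 2) (ε k) (ε k ^ τ • ξ) t =
        ((ε k ^ τ) ^ 2)⁻¹ * κ k t τ ξ := by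
      intro ξ hξ
      have hξ0 := hApos ξ hξ
      have h1 : ε k ^ (1 - τ) = ε k / ε k ^ τ := by rw [Real.rpow_sub e0, Real.rpow_one]
      have h2 : Real.sqrt (‖ε k ^ τ • ξ‖ ^ 2 + (ε k * t) ^ 2) =
          ε k ^ τ * Real.sqrt (‖ξ‖ ^ 2 + (ε k ^ (1 - τ) * t) ^ 2) := by
        rw [h1, norm_smul, Real.norm_of_nonneg hp.le, show (ε k ^ τ * ‖ξ‖) ^ 2 + (ε k * t) ^ 2 =
          (ε k ^ τ) ^ 2 * (‖ξ‖ ^ 2 + (ε k / ε k ^ τ * t) ^ 2) by field_simp,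
          Real.sqrt_mul (by positivity), Real.sqrt_sq hp.le]
      have h3 : 0 < Real.sqrt (‖ξ‖ ^ 2 + (ε k ^ (1 - τ) * t) ^ 2) := by positivity
      simp only [filmKernel, hκ]
      rw [h2, Real.mul_rpow hp.le h3.le]
      have h4 : (ε k ^ τ) ^ (((n : ℝ) + 1) + 2 * (1 / 2)) = (ε k ^ τ) ^ n * (ε k ^ τ) ^ 2 := by
        rw [← pow_add, ← Real.rpow_natCast (ε k ^ τ) (n + 2)]
        congr 1
        push_cast
        ring
      rw [h4]
      have h5 : 0 < Real.sqrt (‖ξ‖ ^ 2 + (ε k ^ (1 - τ) * t) ^ 2) ^ (((n : ℝ) + 1) + 2 * (1 / 2)) := by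
        positivity
      field_simp
    have e3' : Measurable fun ξ => κ k t τ ξ := by
      simp only [hκ]
      fun_prop
    have e3 : Measurable (A.indicator fun ξ => ENNReal.ofReal (κ k t τ ξ)) :=
      e3'.ennreal_ofReal.indicator hAm
    have e5 : ∫⁻ ξ, A.indicator (fun ξ => ENNReal.ofReal (κ k t τ ξ)) ξ * q k t τ ξ =
        ENNReal.ofReal ((ε k ^ τ) ^ 2)⁻¹ * ∫⁻ ξ, A.indicator (fun ξ => ENNReal.ofReal (κ k t τ ξ)) ξ *
          shiftEnergy (film ω 1) (w k) (ε k ^ τ • ξ, t) := by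
      have e6 : ∀ ξ, A.indicator (fun ξ => ENNReal.ofReal (κ k t τ ξ)) (-ξ) =
          A.indicator (fun ξ => ENNReal.ofReal (κ k t τ ξ)) ξ := fun ξ => by
        simp only [hA, hκ, indicator, mem_ofPred_eq, norm_neg]
      have e7 : Measurable fun ξ => shiftEnergy (film ω 1) (w k) (ε k ^ τ • ξ, t) := by fun_prop
      rw [lintegral_symmetrize e6 e3 e7, ← lintegral_const_mul' _ _ ENNReal.ofReal_ne_top]
      refine lintegral_congr fun ξ => ?_
      simp only [hq]
      rw [smul_neg, ENNReal.ofReal_mul (by norm_num), ENNReal.ofReal_inv_of_pos (by positivity)]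
      simp only [div_eq_mul_inv]
      rw [ENNReal.mul_inv (Or.inl (by norm_num)) (Or.inl (by norm_num))]
      simp only [ENNReal.ofReal_ofNat]
      ring
    rw [e5, ← lintegral_indicator hAm, ← lintegral_const_mul' _ _ ENNReal.ofReal_ne_top,
      ← lintegral_const_mul' _ _ ENNReal.ofReal_ne_top]
    refine lintegral_mono fun ξ => ?_
    by_cases hξ : ξ ∈ A
    · simp only [indicator_of_mem hξ]
      rw [← mul_assoc, ← mul_assoc, ← mul_assoc]
      refine mul_le_mul_left (le_of_eq ?_) _
      have h6 : 0 ≤ filmKernel n (1 / 2) (ε k) (ε k ^ τ • ξ) t := by unfold filmKernel; positivity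
      rw [← ENNReal.ofReal_mul (by positivity), ← ENNReal.ofReal_mul (by positivity),
        ← ENNReal.ofReal_mul (by positivity), ← e2 ξ hξ]
      congr 1
      field_simp
    · simp [hξ]
  refine le_trans (mul_le_liminf_mul tendsto_const_nhds (lintegral_lintegral_le_liminf
    (f := fun k (p : ℝ × ℝ) ξ =>
      A.indicator (fun ξ => ENNReal.ofReal (κ k p.1 p.2 ξ)) ξ * q k p.1 p.2 ξ)
    (fun k => ?_) ?_)) (liminf_le_liminf hlow)
  · refine Measurable.mul ?_ (hqm k)
    have e9 : MeasurableSet {p : (ℝ × ℝ) × Plane n | p.2 ∈ A} := hAm.preimage measurable_snd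
    exact ((hκm k).ennreal_ofReal).indicator e9
  · filter_upwards [ae_restrict_mem hsq] with p hp
    refine Eventually.of_forall fun ξ => mul_le_liminf_mul ?_ le_rfl
    by_cases hξ : ξ ∈ A
    · simp only [hk₀, indicator_of_mem hξ]
      refine (ENNReal.continuous_ofReal.tendsto _).comp ?_
      have hξ0 := hApos ξ hξ
      have h1 : Tendsto (fun k => ε k ^ (1 - p.2)) atTop (𝓝 0) := by
        have h2 : 0 < 1 - p.2 := by linarith [hp.2.2]
        have := hε.rpow_const (p := 1 - p.2) (Or.inr h2.le)
        rwa [Real.zero_rpow h2.ne'] at this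
      have h3 : Tendsto (fun k => Real.sqrt (‖ξ‖ ^ 2 + (ε k ^ (1 - p.2) * p.1) ^ 2)) atTop
          (𝓝 ‖ξ‖) := by
        have := ((tendsto_const_nhds (x := ‖ξ‖ ^ 2)).add ((h1.mul_const p.1).pow 2)).sqrt
        simpa [Real.sqrt_sq hξ0.le] using this
      have h4 : ‖ξ‖ ^ (n + 2) = ‖ξ‖ ^ (((n : ℝ) + 1) + 2 * (1 / 2)) := by
        rw [← Real.rpow_natCast]
        congr 1
        push_cast
        ring
      simp only [hκ]
      rw [h4]
      exact tendsto_const_nhds.div (h3.rpow tendsto_const_nhds (Or.inl hξ0.ne')) (by positivity)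
    · simp [hk₀, hξ]

/-! ### Lipschitz domains -/

section Domains

/-- Inside a chart of a Lipschitz domain the domain is preserved by motions along the direction
of the chart, up to errors controlled by the length of the motion. -/
theorem mem_of_mem_chart {ν : Plane n} (hν : ‖ν‖ = 1) {K : ℝ≥0} {γ : Plane n → ℝ}
    (hγ : LipschitzWith K γ) {p : Plane n} {r : ℝ}
    (h : ∀ y ∈ Metric.ball p r, (y ∈ ω ↔ γ (y - (inner ℝ ν y) • ν) < inner ℝ ν y))
    {y : Plane n} (hy : y ∈ ω) (hyp : y ∈ Metric.ball p r) {a : ℝ} {e : Plane n}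
    (he : (K + 1) * ‖e‖ ≤ a) (hz : y + a • ν + e ∈ Metric.ball p r) : y + a • ν + e ∈ ω := by
  rw [h _ hz]
  have h1 := (h y hyp).1 hy
  have hνν : inner ℝ ν ν = (1 : ℝ) := by rw [real_inner_self_eq_norm_sq, hν]; norm_num
  have h2 : inner ℝ ν (y + a • ν + e) = inner ℝ ν y + a + inner ℝ ν e := by
    rw [inner_add_right, inner_add_right, inner_smul_right, hνν, mul_one]
  have h3 : -‖e‖ ≤ inner ℝ ν e := by
    have := abs_real_inner_le_norm ν e
    rw [hν, one_mul] at this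
    exact neg_le_of_abs_le this
  have h4 : ‖e - (inner ℝ ν e) • ν‖ ≤ ‖e‖ := by
    have h5 : ‖e - (inner ℝ ν e) • ν‖ ^ 2 = ‖e‖ ^ 2 - (inner ℝ ν e) ^ 2 := by
      rw [norm_sub_sq_real, norm_smul, hν, inner_smul_right, real_inner_comm ν e, mul_one,
        Real.norm_eq_abs, sq_abs]
      ring
    nlinarith [sq_nonneg (inner ℝ ν e : ℝ), norm_nonneg e, norm_nonneg (e - (inner ℝ ν e : ℝ) • ν)]
  have h6 : γ (y + a • ν + e - (inner ℝ ν (y + a • ν + e) : ℝ) • ν) ≤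
      γ (y - (inner ℝ ν y) • ν) + K * ‖e‖ := by
    have h7 := hγ.dist_le_mul (y + a • ν + e - (inner ℝ ν (y + a • ν + e) : ℝ) • ν)
      (y - (inner ℝ ν y) • ν)
    rw [Real.dist_eq, dist_eq_norm] at h7
    have h8 : y + a • ν + e - (inner ℝ ν (y + a • ν + e) : ℝ) • ν - (y - (inner ℝ ν y : ℝ) • ν) =
        e - (inner ℝ ν e : ℝ) • ν := by
      rw [h2]; module
    rw [h8] at h7
    have h9 := (abs_le.1 h7).2
    nlinarith [K.coe_nonneg]
  rw [h2] at h6 ⊢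
  linarith

/-- A bounded Lipschitz domain is compressed into itself, with a gap proportional to the
displacement, by the flow of a smooth field. -/
theorem exists_inward_field (hω : IsOpen ω) (hbdd : Bornology.IsBounded ω)
    (hlip : HasLipschitzBoundary ω) :
    ∃ X : Plane n → Plane n, ContDiff ℝ ((⊤ : ℕ∞) : WithTop ℕ∞) X ∧ HasCompactSupport X ∧
      ∃ c > 0, ∃ δ₀ > 0, ∀ δ ∈ Ioo 0 δ₀, ∀ x ∈ ω, Metric.closedBall (x + δ • X x) (c * δ) ⊆ ω := by
  classical
  choose! ν hν K γ hγ r hr hchart using hlip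
  have hbump : ∀ p ∈ frontier ω, ∃ χ : Plane n → ℝ, ContDiff ℝ ((⊤ : ℕ∞) : WithTop ℕ∞) χ ∧
      HasCompactSupport χ ∧ (∀ x, χ x ∈ Icc (0 : ℝ) 1) ∧
      (∀ x ∈ Metric.ball p (r p / 4), χ x = 1) ∧ ∀ x ∉ Metric.ball p (r p / 2), χ x = 0 := by
    intro p hp
    have h1 := hr p hp
    let f : ContDiffBump p := ⟨r p / 4, r p / 2, by linarith, by linarith⟩
    refine ⟨f, f.contDiff, f.hasCompactSupport, fun x => ⟨f.nonneg, f.le_one⟩, fun x hx => ?_,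
      fun x hx => ?_⟩
    · exact f.one_of_mem_closedBall (Metric.ball_subset_closedBall hx)
    · exact f.zero_of_le_dist (by simpa using hx)
  choose! χ hχs hχc hχ01 hχ1 hχ0 using hbump
  have hcomp : IsCompact (frontier ω) :=
    (Metric.isCompact_of_isClosed_isBounded isClosed_closure hbdd.closure).of_isClosed_subset
      isClosed_frontier frontier_subset_closure
  obtain ⟨t, ht, hcov⟩ := hcomp.elim_nhds_subcover (fun p => Metric.ball p (r p / 4))
    (fun p hp => Metric.ball_mem_nhds p (by have := hr p hp; linarith))
  set V := ⋃ p ∈ t, Metric.ball p (r p / 4) with hV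
  have hVo : IsOpen V := isOpen_biUnion fun p _ => Metric.isOpen_ball
  have hcl : IsCompact (closure ω \ V) :=
    (Metric.isCompact_of_isClosed_isBounded isClosed_closure hbdd.closure).diff hVo
  -- What the small chart balls leave uncovered is a compact subset of the open set, where a fixed
  -- margin is available.
  have hclω : closure ω \ V ⊆ ω := by
    intro x hx
    by_contra hxω
    exact hx.2 (hcov ⟨hx.1, fun h => hxω (interior_subset h)⟩)
  obtain ⟨l, hl, hthick⟩ := hcl.exists_thickening_subset_open hω hclω
  obtain ⟨ρ, hρ, hρr⟩ : ∃ ρ : ℝ, 0 < ρ ∧ ∀ p ∈ t, ρ ≤ r p / 2 := by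
    rcases t.eq_empty_or_nonempty with h | h
    · exact ⟨1, one_pos, by simp [h]⟩
    · obtain ⟨q, hq, hq'⟩ := t.exists_min_image (fun p => r p / 2) h
      exact ⟨r q / 2, by have := hr q (ht q hq); linarith, hq'⟩
  set M : ℝ := ∑ p ∈ t, (K p : ℝ) with hM
  have hM0 : 0 ≤ M := Finset.sum_nonneg fun p _ => (K p).coe_nonneg
  set N : ℝ := t.card + 1 with hN
  have hN0 : 0 < N := by positivity
  have hstep : ∀ x, ∀ S ⊆ t, ‖∑ p ∈ S, χ p x • ν p‖ ≤ S.card := by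
    intro x S hS
    refine (norm_sum_le _ _).trans ?_
    rw [Finset.card_eq_sum_ones, Nat.cast_sum]
    refine Finset.sum_le_sum fun p hp => ?_
    have h1 := hχ01 p (ht p (hS hp)) x
    rw [norm_smul, hν p (ht p (hS hp)), mul_one, Real.norm_of_nonneg h1.1, Nat.cast_one]
    exact h1.2
  -- The field adds up the chart directions, cut off smoothly. An error of size δ/(M+1), with M
  -- dominating every Lipschitz constant, is absorbed by one full step of length δ. The bound on δ
  -- keeps the whole motion, of length at most δN, inside the charts and within the interior margin.
  refine ⟨fun x => ∑ p ∈ t, χ p x • ν p, ?_, ?_, 1 / (M + 1), by positivity,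
    min l ρ / N, by positivity, ?_⟩
  · exact ContDiff.sum fun p hp => (hχs p (ht p hp)).smul contDiff_const
  · have : (fun x => ∑ p ∈ t, χ p x • ν p) = ∑ p ∈ t, fun x => χ p x • ν p := by
      ext1 x; simp
    rw [this]
    refine Finset.sum_induction _ HasCompactSupport (fun f g hf hg => hf.add hg)
      HasCompactSupport.zero fun p hp => (hχc p (ht p hp)).smul_right
  intro δ hδ x hx z hz
  have hδ0 : 0 < δ := hδ.1
  have hδN : δ * N < min l ρ := (lt_div_iff₀ hN0).1 hδ.2
  have hδl : δ * N < l := hδN.trans_le (min_le_left _ _)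
  have hδρ : δ * N < ρ := hδN.trans_le (min_le_right _ _)
  set e := z - (x + δ • ∑ p ∈ t, χ p x • ν p) with he
  have hez : z = x + δ • ∑ p ∈ t, χ p x • ν p + e := by rw [he]; abel
  have he1 : ‖e‖ ≤ 1 / (M + 1) * δ := by
    rw [he, ← dist_eq_norm]; exact hz
  have he2 : (M + 1) * ‖e‖ ≤ δ := by
    calc (M + 1) * ‖e‖ ≤ (M + 1) * (1 / (M + 1) * δ) := by gcongr
      _ = δ := by field_simp
  have he3 : ‖e‖ ≤ δ := by nlinarith [norm_nonneg e]
  by_cases hxV : x ∈ V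
  · obtain ⟨q, hq, hxq⟩ : ∃ q ∈ t, x ∈ Metric.ball q (r q / 4) := by simpa [hV] using hxV
    have hχq : χ q x = 1 := hχ1 q (ht q hq) x hxq
    have hrq := hr q (ht q hq)
    have hball : ∀ p ∈ t, x ∈ Metric.ball p (r p / 2) → ∀ S ⊆ t.erase q, ∀ b ∈ Icc (0 : ℝ) δ,
        ‖b • ν q‖ ≤ δ → ∀ e' : Plane n, ‖e'‖ ≤ ‖e‖ → 
        x + δ • ∑ p ∈ S, χ p x • ν p + b • ν q + e' ∈ Metric.ball p (r p) := by
      intro p hp hxp S hS b hb hbν e' he'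
      rw [Metric.mem_ball, dist_eq_norm] at hxp ⊢
      have h1 := hstep x S (hS.trans (Finset.erase_subset _ _))
      have h2 : (S.card : ℝ) + 1 ≤ t.card := by
        have := Finset.card_le_card hS
        rw [Finset.card_erase_of_mem hq] at this
        have h3 : 0 < t.card := Finset.card_pos.2 ⟨q, hq⟩
        exact_mod_cast (by omega : S.card + 1 ≤ t.card)
      have h4 : ‖δ • ∑ p ∈ S, χ p x • ν p‖ ≤ δ * S.card := by
        rw [norm_smul, Real.norm_of_nonneg hδ0.le]; gcongr
      have h5 : ‖x + δ • ∑ p ∈ S, χ p x • ν p + b • ν q + e' - p‖ ≤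
          ‖x - p‖ + ‖δ • ∑ p ∈ S, χ p x • ν p‖ + ‖b • ν q‖ + ‖e'‖ := by
        have h6 : x + δ • ∑ p ∈ S, χ p x • ν p + b • ν q + e' - p =
          (x - p) + δ • ∑ p ∈ S, χ p x • ν p + b • ν q + e' := by abel
        rw [h6]
        exact (norm_add_le _ _).trans (add_le_add_left ((norm_add_le _ _).trans
          (add_le_add_left (norm_add_le _ _) _)) _)
      have h7 := hρr p hp
      have h8 : δ * S.card + δ + δ ≤ δ * N := by rw [hN]; nlinarith
      linarith
    have hK : ∀ p ∈ t, (K p : ℝ) ≤ M := fun p hp =>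
      Finset.single_le_sum (f := fun p => (K p : ℝ)) (fun p _ => (K p).coe_nonneg) hp
    have hνq : ‖δ • ν q‖ ≤ δ := by
      rw [norm_smul, hν q (ht q hq), mul_one, Real.norm_of_nonneg hδ0.le]
    -- The motion is made one chart at a time. The first move is the full step along ν q together
    -- with the error e, available because χ q x = 1. The other moves are free of error, and each is
    -- either trivial or takes place inside its own chart.
    have hmain : ∀ S ⊆ t.erase q, x + δ • ∑ p ∈ S, χ p x • ν p + δ • ν q + e ∈ ω := by
      intro S
      induction S using Finset.induction_on with
      | empty =>
        intro hS
        have h1 := hball q hq (Metric.ball_subset_ball (by linarith) hxq) ∅ hS δ ⟨hδ0.le, le_rfl⟩ hνq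
          e le_rfl
        simp only [Finset.sum_empty, smul_zero, add_zero] at h1 ⊢
        refine mem_of_mem_chart (hν q (ht q hq)) (hγ q (ht q hq)) (hchart q (ht q hq)) hx
          (Metric.ball_subset_ball (by linarith) hxq) ?_ h1
        have := hK q hq
        nlinarith [norm_nonneg e]
      | insert p S hpS ih =>
        intro hS
        have hS' : S ⊆ t.erase q := (Finset.subset_insert _ _).trans hS
        have h1 := ih hS'
        have hpt : p ∈ t := Finset.mem_of_mem_erase (hS (Finset.mem_insert_self _ _))
        by_cases hxp : x ∈ Metric.ball p (r p / 2)
        · have h2 := hball p hpt hxp S hS' δ ⟨hδ0.le, le_rfl⟩ hνq e le_rfl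
          have h3 := hball p hpt hxp _ hS δ ⟨hδ0.le, le_rfl⟩ hνq e le_rfl
          have h4 : x + δ • ∑ p ∈ insert p S, χ p x • ν p + δ • ν q + e =
              (x + δ • ∑ p ∈ S, χ p x • ν p + δ • ν q + e) + (δ * χ p x) • ν p + 0 := by
            rw [Finset.sum_insert hpS]; module
          rw [h4] at h3 ⊢
          refine mem_of_mem_chart (hν p (ht p hpt)) (hγ p (ht p hpt)) (hchart p (ht p hpt)) h1
            h2 ?_ h3
          have := (hχ01 p (ht p hpt) x).1
          simp only [norm_zero, mul_zero]
          positivity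
        · rw [Finset.sum_insert hpS, hχ0 p (ht p hpt) x hxp, zero_smul, zero_add]
          exact h1
    have h1 := hmain _ subset_rfl
    rw [hez, ← Finset.add_sum_erase t _ hq, hχq]
    convert h1 using 1
    module
  -- Away from the small chart balls the total displacement is below the margin l.
  · refine hthick (Metric.mem_thickening_iff.2 ⟨x, ⟨subset_closure hx, hxV⟩, ?_⟩)
    rw [dist_eq_norm, hez]
    have h1 : x + δ • ∑ p ∈ t, χ p x • ν p + e - x = δ • ∑ p ∈ t, χ p x • ν p + e := by abel
    rw [h1]
    refine (norm_add_le _ _).trans_lt ?_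
    rw [norm_smul, Real.norm_of_nonneg hδ0.le]
    have h2 := hstep x t subset_rfl
    have h3 : δ * ‖∑ p ∈ t, χ p x • ν p‖ ≤ δ * t.card := by gcongr
    have h4 : δ * N = δ * t.card + δ := by rw [hN]; ring
    linarith

/-- Lebesgue measure is a multiple of n-dimensional Hausdorff measure, and preimages under an
antilipschitz map enlarge the latter by at most K^n. No Jacobian has to be computed. -/
theorem lintegral_comp_le_of_antilipschitz {T : Plane n → Plane n} {K : ℝ≥0}
    (hT : AntilipschitzWith K T) (hTm : Measurable T) {h : Plane n → ℝ≥0∞} (hh : Measurable h) :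
    ∫⁻ x, h (T x) ≤ (K : ℝ≥0∞) ^ n * ∫⁻ x, h x := by
  have h1 : (μH[(n : ℝ)] : Measure (Plane n)).IsAddHaarMeasure := by
    simpa using isAddHaarMeasure_hausdorffMeasure (E := Plane n)
  have h2 := Measure.isAddLeftInvariant_eq_smul (volume : Measure (Plane n)) (μH[(n : ℝ)])
  have h3 : Measure.map T volume ≤ (K : ℝ≥0∞) ^ n • (volume : Measure (Plane n)) := by
    refine Measure.le_iff.2 fun s hs => ?_
    rw [Measure.map_apply hTm hs, Measure.smul_apply, h2, Measure.smul_apply, Measure.smul_apply]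
    have h3 := hT.hausdorffMeasure_preimage_le n.cast_nonneg s
    rw [smul_comm]
    refine (smul_le_smul_of_nonneg_left h3 zero_le).trans (le_of_eq ?_)
    simp
  calc ∫⁻ x, h (T x) = ∫⁻ x, h x ∂(Measure.map T volume) := (lintegral_map hh hTm).symm
    _ ≤ ∫⁻ x, h x ∂((K : ℝ≥0∞) ^ n • (volume : Measure (Plane n))) := lintegral_mono' h3 le_rfl
    _ = (K : ℝ≥0∞) ^ n * ∫⁻ x, h x := by rw [lintegral_smul_measure, smul_eq_mul]

end Domains

/-! ### Mollification composed with a compression of the domain -/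

section Mollify

variable {E : Type*} [NormedAddCommGroup E] [NormedSpace ℝ E] [FiniteDimensional ℝ E]
  [MeasureSpace E] [BorelSpace E] [(volume : Measure E).IsAddHaarMeasure]

/-- The mollification of `v` by a smooth bump function. -/
noncomputable def mollify (φ : ContDiffBump (0 : E)) (v : E → ℝ) : E → ℝ :=
  convolution (φ.normed volume) v (ContinuousLinearMap.lsmul ℝ ℝ) volume

variable (φ : ContDiffBump (0 : E)) {U : Set E} {v : E → ℝ}

set_option linter.unusedSectionVars false in
theorem mollify_apply (v : E → ℝ) (y : E) :
    mollify φ v y = ∫ p, φ.normed volume p * v (y - p) := rfl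

theorem contDiff_mollify (hv : LocallyIntegrable v) :
    ContDiff ℝ ((⊤ : ℕ∞) : WithTop ℕ∞) (mollify φ v) :=
  φ.hasCompactSupport_normed.contDiff_convolution_left _ φ.contDiff_normed hv

theorem integrable_mollify (hv : LocallyIntegrable v) (y : E) :
    Integrable fun p => φ.normed volume p * v (y - p) :=
  φ.hasCompactSupport_normed.convolutionExists_left (ContinuousLinearMap.lsmul ℝ ℝ)
    φ.continuous_normed hv y

theorem lintegral_normed : ∫⁻ p, ENNReal.ofReal (φ.normed volume p) = 1 := by
  rw [← ofReal_integral_eq_lintegral_ofReal φ.integrable_normed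
    (Eventually.of_forall φ.nonneg_normed), φ.integral_normed, ENNReal.ofReal_one]

theorem normed_eq_zero {p : E} (hp : φ.rOut ≤ ‖p‖) : φ.normed volume p = 0 := by
  have : p ∉ Function.support (φ.normed volume) := by
    rw [φ.support_normed_eq]; simpa using hp
  simpa using this

/-- Jensen's inequality for the mollifier as a probability density, obtained from Cauchy-Schwarz by
splitting the density into two square roots. -/
theorem ofReal_sq_integral_normed_le {g : E → ℝ} (hg : Measurable g) :
    ENNReal.ofReal ((∫ p, φ.normed volume p * g p) ^ 2) ≤
      ∫⁻ p, ENNReal.ofReal (φ.normed volume p) * ENNReal.ofReal (g p ^ 2) := by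
  have hm : Measurable (φ.normed volume) := φ.continuous_normed.measurable
  have h1 := ofReal_sq_integral_mul_le (μ := volume)
    (f := fun p => Real.sqrt (φ.normed volume p)) (g := fun p => Real.sqrt (φ.normed volume p) * g p)
    (by fun_prop) (by fun_prop)
  have h2 : ∀ p, Real.sqrt (φ.normed volume p) ^ 2 = φ.normed volume p := fun p =>
    Real.sq_sqrt (φ.nonneg_normed p)
  have h3 : ∀ p, Real.sqrt (φ.normed volume p) * (Real.sqrt (φ.normed volume p) * g p) =
      φ.normed volume p * g p := fun p => by rw [← mul_assoc, ← sq, h2]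
  simp_rw [mul_pow, h2, h3, lintegral_normed, one_mul] at h1
  refine h1.trans_eq (lintegral_congr fun p => ?_)
  rw [ENNReal.ofReal_mul (φ.nonneg_normed p)]

theorem mollify_sub (hv : LocallyIntegrable v) {w : E → ℝ} (hw : LocallyIntegrable w) (y : E) :
    mollify φ v y - mollify φ w y = mollify φ (v - w) y := by
  simp only [mollify_apply]
  rw [← integral_sub (integrable_mollify φ hv y) (integrable_mollify φ hw y)]
  simp only [Pi.sub_apply, mul_sub]

theorem mollify_sub_mollify (hv : LocallyIntegrable v) (y z : E) :
    mollify φ v y - mollify φ v z = ∫ p, φ.normed volume p * (v (y - p) - v (z - p)) := by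
  simp only [mollify_apply]
  rw [← integral_sub (integrable_mollify φ hv y) (integrable_mollify φ hv z)]
  simp only [mul_sub]

/-- The derivative falls on the bump, and the reflected bump centred at y is an admissible test
function as soon as the closed ball around y lies in U. This margin makes the extension of v by zero
harmless. -/
theorem fderiv_mollify (hU : MeasurableSet U) {e : E} {g : E → ℝ}
    (hv : LocallyIntegrable (U.indicator v)) (h : HasWeakDirDeriv U e v g) {y : E}
    (hy : Metric.closedBall y φ.rOut ⊆ U) :
    fderiv ℝ (mollify φ (U.indicator v)) y e = mollify φ (U.indicator g) y := by
  have hc1 : ContDiff ℝ 1 (φ.normed (volume : Measure E)) := φ.contDiff_normed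
  have h1 := φ.hasCompactSupport_normed.hasFDerivAt_convolution_left
    (ContinuousLinearMap.lsmul ℝ ℝ) hc1 hv y
  have hcf : HasCompactSupport (fderiv ℝ (φ.normed (volume : Measure E))) :=
    φ.hasCompactSupport_normed.fderiv ℝ
  have h2 : ConvolutionExistsAt (fderiv ℝ (φ.normed (volume : Measure E))) (U.indicator v) y
      ((ContinuousLinearMap.lsmul ℝ ℝ : ℝ →L[ℝ] ℝ →L[ℝ] ℝ).precompL E) volume :=
    hcf.convolutionExists_left _ (hc1.continuous_fderiv one_ne_zero) hv y
  have h3 : fderiv ℝ (mollify φ (U.indicator v)) y e =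
      ∫ p, fderiv ℝ (φ.normed (volume : Measure E)) p e * U.indicator v (y - p) := by
    rw [mollify, h1.fderiv, convolution, ContinuousLinearMap.integral_apply h2]
    rfl
  set ψ : E → ℝ := fun q => φ.normed volume (y - q) with hψ
  have hψs : ContDiff ℝ ((⊤ : ℕ∞) : WithTop ℕ∞) ψ :=
    φ.contDiff_normed.comp (contDiff_const.sub contDiff_id)
  have hsupp : tsupport ψ ⊆ Metric.closedBall y φ.rOut := by
    refine closure_minimal (fun q hq => ?_) Metric.isClosed_closedBall
    by_contra h'
    refine hq (normed_eq_zero φ ?_)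
    rw [Metric.mem_closedBall, dist_eq_norm, not_le, norm_sub_rev] at h'
    exact h'.le
  have hψc : HasCompactSupport ψ :=
    (isCompact_closedBall y φ.rOut).of_isClosed_subset (isClosed_tsupport _) hsupp
  have hder : ∀ q, fderiv ℝ ψ q e = - fderiv ℝ (φ.normed (volume : Measure E)) (y - q) e := by
    intro q
    have h4 : HasFDerivAt ψ ((fderiv ℝ (φ.normed (volume : Measure E)) (y - q)).comp
        (-ContinuousLinearMap.id ℝ E)) q :=
      ((hc1.differentiable one_ne_zero).differentiableAt.hasFDerivAt).comp q
        ((hasFDerivAt_id q).const_sub y)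
    rw [h4.fderiv]
    simp
  have h5 := h ψ hψs hψc (hsupp.trans hy)
  rw [h3, mollify_apply, ← integral_sub_left_eq_self _ volume y,
    ← integral_sub_left_eq_self (fun p => φ.normed volume p * U.indicator g (y - p)) volume y]
  simp only [sub_sub_cancel]
  rw [← integral_indicator hU, ← integral_indicator hU, ← integral_neg] at h5
  rw [← neg_inj, ← integral_neg, ← integral_neg]
  refine Eq.trans (integral_congr_ae (Eventually.of_forall fun q => ?_)) (h5.trans
    (integral_congr_ae (Eventually.of_forall fun q => ?_)))
  · by_cases hq : q ∈ U <;> simp [hq, hder, mul_comm]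
  · by_cases hq : q ∈ U <;> simp [hq, hψ, mul_comm]

/-- Composition with `S` expands volumes by a factor at most `κ`. -/
def CompressesVolume (S : E → E) (κ : ℝ≥0∞) : Prop :=
  ∀ h : E → ℝ≥0∞, Measurable h → ∫⁻ x, h (S x) ≤ κ * ∫⁻ x, h x

variable {S : E → E} {κ : ℝ≥0∞}

/-- For each p the volume bound applies to a translate of h; the mollifier has unit mass. -/
theorem CompressesVolume.lintegral_normed_le (hS : CompressesVolume S κ) (hSm : Measurable S)
    {h : E → ℝ≥0∞} (hh : Measurable h) :
    ∫⁻ x, ∫⁻ p, ENNReal.ofReal (φ.normed volume p) * h (S x - p) ≤ κ * ∫⁻ x, h x := by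
  have hm : Measurable (φ.normed volume) := φ.continuous_normed.measurable
  rw [lintegral_lintegral_swap (by fun_prop)]
  calc ∫⁻ p, ∫⁻ x, ENNReal.ofReal (φ.normed volume p) * h (S x - p)
      ≤ ∫⁻ p, ENNReal.ofReal (φ.normed volume p) * (κ * ∫⁻ x, h x) := by
        refine lintegral_mono fun p => ?_
        rw [lintegral_const_mul' _ _ ENNReal.ofReal_ne_top]
        have h1 := hS (fun y => h (y - p)) (by fun_prop)
        rw [lintegral_sub_right_eq_self h p] at h1
        gcongr
    _ = κ * ∫⁻ x, h x := by
        rw [lintegral_mul_const _ (by fun_prop), lintegral_normed, one_mul]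

theorem CompressesVolume.lintegral_mollify_sq_le (hS : CompressesVolume S κ) (hSm : Measurable S)
    {g : E → ℝ} (hg : Measurable g) :
    ∫⁻ x, ENNReal.ofReal (mollify φ g (S x) ^ 2) ≤ κ * ∫⁻ x, ENNReal.ofReal (g x ^ 2) := by
  refine le_trans (lintegral_mono fun x => ?_) (hS.lintegral_normed_le φ hSm
    (h := fun x => ENNReal.ofReal (g x ^ 2)) (by fun_prop))
  exact ofReal_sq_integral_normed_le φ (by fun_prop)

/-- Around each compressed point a full ball lies in U, so the averaged increments are increments of
v between points of U. The shift z must become one fixed shift z', as happens for vertical shifts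
under a map that is affine in the last variable. -/
theorem CompressesVolume.shiftEnergy_mollify_le (hS : CompressesVolume S κ) (hSm : Measurable S)
    (hU : MeasurableSet U) (hv : Measurable v) (hvi : LocallyIntegrable (U.indicator v))
    (hball : ∀ x ∈ U, Metric.closedBall (S x) φ.rOut ⊆ U) {z z' : E}
    (hz : ∀ x, S (x + z) = S x + z') :
    shiftEnergy U (fun x => mollify φ (U.indicator v) (S x)) z ≤ κ * shiftEnergy U v z' := by
  have hi : Measurable (U.indicator (1 : E → ℝ≥0∞)) := measurable_one.indicator hU
  rw [shiftEnergy_eq_lintegral hU, shiftEnergy_eq_lintegral hU]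
  refine le_trans (lintegral_mono fun x => ?_) (hS.lintegral_normed_le φ hSm (by fun_prop))
  by_cases h1 : x ∈ U
  swap
  · simp [h1]
  by_cases h2 : x + z ∈ U
  swap
  · simp [h2]
  simp only [indicator_of_mem h1, indicator_of_mem h2, Pi.one_apply, one_mul]
  rw [mollify_sub_mollify φ hvi]
  refine (ofReal_sq_integral_normed_le φ ((hv.indicator hU).comp (by fun_prop) |>.sub
    ((hv.indicator hU).comp (by fun_prop)))).trans (lintegral_mono fun p => ?_)
  by_cases hp : φ.rOut ≤ ‖p‖
  · simp [normed_eq_zero φ hp]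
  · have h3 : S x - p ∈ U := hball x h1 (by simpa [dist_eq_norm] using (not_le.1 hp).le)
    have h4 : S (x + z) - p ∈ U := hball _ h2 (by simpa [dist_eq_norm] using (not_le.1 hp).le)
    have h5 : S x - p + z' = S (x + z) - p := by rw [hz]; abel
    simp only [h5, indicator_of_mem h3, indicator_of_mem h4, Pi.one_apply, one_mul, Pi.sub_apply,
      Function.comp_apply, le_refl]

/-- Both points are displaced by the same p, so only S x - S y enters the kernel, at the cost of C.
Each of the two integrations costs a factor κ. -/
theorem CompressesVolume.lintegral_lintegral_mollify_le (hS : CompressesVolume S κ)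
    (hSm : Measurable S) (hU : MeasurableSet U) (hv : Measurable v)
    (hvi : LocallyIntegrable (U.indicator v))
    (hball : ∀ x ∈ U, Metric.closedBall (S x) φ.rOut ⊆ U) {k : E → ℝ≥0∞} (hk : Measurable k)
    {C : ℝ≥0∞} (hkC : ∀ x y, k (x - y) ≤ C * k (S x - S y)) :
    ∫⁻ x in U, ∫⁻ y in U, k (x - y) * ENNReal.ofReal
      ((mollify φ (U.indicator v) (S x) - mollify φ (U.indicator v) (S y)) ^ 2) ≤
    C * κ ^ 2 * ∫⁻ x in U, ∫⁻ y in U, k (x - y) * ENNReal.ofReal ((v x - v y) ^ 2) := by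
  have hi : Measurable (U.indicator (1 : E → ℝ≥0∞)) := measurable_one.indicator hU
  have hm : Measurable (φ.normed volume) := φ.continuous_normed.measurable
  have hvU := hv.indicator hU
  set H : E → E → ℝ≥0∞ := fun a b => U.indicator 1 a * (U.indicator 1 b *
    (k (a - b) * ENNReal.ofReal ((v a - v b) ^ 2))) with hH
  have hHm : Measurable fun q : E × E => H q.1 q.2 := by fun_prop
  have hHe : ∫⁻ x in U, ∫⁻ y in U, k (x - y) * ENNReal.ofReal ((v x - v y) ^ 2) =
      ∫⁻ x, ∫⁻ y, H x y := by
    rw [← lintegral_indicator hU]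
    refine lintegral_congr fun x => ?_
    by_cases hx : x ∈ U
    · simp only [hH, indicator_of_mem hx, Pi.one_apply, one_mul]
      rw [← lintegral_indicator hU]
      refine lintegral_congr fun y => ?_
      by_cases hy : y ∈ U <;> simp [hy]
    · simp [hH, hx]
  have hpt : ∀ x ∈ U, ∀ y ∈ U, k (x - y) * ENNReal.ofReal
      ((mollify φ (U.indicator v) (S x) - mollify φ (U.indicator v) (S y)) ^ 2) ≤
      C * ∫⁻ p, ENNReal.ofReal (φ.normed volume p) * H (S x - p) (S y - p) := by
    intro x hx y hy
    rw [mollify_sub_mollify φ hvi]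
    have h1 := ofReal_sq_integral_normed_le φ
      (g := fun p => U.indicator v (S x - p) - U.indicator v (S y - p))
      ((hvU.comp (by fun_prop)).sub (hvU.comp (by fun_prop)))
    refine (mul_le_mul' (hkC x y) h1).trans ?_
    rw [mul_assoc]
    gcongr
    rw [← lintegral_const_mul _ (by
      have : Measurable fun p => U.indicator v (S x - p) := hvU.comp (by fun_prop)
      have : Measurable fun p => U.indicator v (S y - p) := hvU.comp (by fun_prop)
      fun_prop)]
    refine lintegral_mono fun p => ?_
    by_cases hp : φ.rOut ≤ ‖p‖
    · simp [normed_eq_zero φ hp]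
    · have h3 : S x - p ∈ U := hball x hx (by simpa [dist_eq_norm] using (not_le.1 hp).le)
      have h4 : S y - p ∈ U := hball y hy (by simpa [dist_eq_norm] using (not_le.1 hp).le)
      simp only [hH, indicator_of_mem h3, indicator_of_mem h4, Pi.one_apply, one_mul,
        sub_sub_sub_cancel_right]
      exact le_of_eq (by ring)
  rw [hHe]
  have hHs : ∀ p, Measurable fun q : E × E => H (S q.1 - p) (S q.2 - p) := fun p =>
    hHm.comp
      (show Measurable fun q : E × E => (S q.1 - p, S q.2 - p) by fun_prop)
  have hHp : Measurable fun q : (E × E) × E => ENNReal.ofReal (φ.normed volume q.2) *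
      H (S q.1.1 - q.2) (S q.1.2 - q.2) :=
    (hm.comp measurable_snd).ennreal_ofReal.mul (hHm.comp
      (show Measurable fun q : (E × E) × E => (S q.1.1 - q.2, S q.1.2 - q.2) by fun_prop))
  have hT : ∀ p, ∫⁻ x, ∫⁻ y, H (S x - p) (S y - p) ≤ κ ^ 2 * ∫⁻ x, ∫⁻ y, H x y := by
    intro p
    have h1 : ∀ a, ∫⁻ y, H a (S y - p) ≤ κ * ∫⁻ y, H a y := by
      intro a
      have hm' : Measurable fun b => H a b := hHm.comp measurable_prodMk_left
      have h2 := hS (fun y => H a (y - p)) (hm'.comp (by fun_prop))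
      rwa [lintegral_sub_right_eq_self (fun b => H a b) p] at h2
    have hm2 : Measurable fun a => ∫⁻ y, H a y := hHm.lintegral_prod_right'
    have h3 := hS (fun x => ∫⁻ y, H (x - p) y) (hm2.comp (by fun_prop))
    rw [lintegral_sub_right_eq_self (fun a => ∫⁻ y, H a y) p] at h3
    calc ∫⁻ x, ∫⁻ y, H (S x - p) (S y - p) ≤ ∫⁻ x, κ * ∫⁻ y, H (S x - p) y :=
          lintegral_mono fun x => h1 _
      _ = κ * ∫⁻ x, ∫⁻ y, H (S x - p) y := lintegral_const_mul _ (hm2.comp (by fun_prop))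
      _ ≤ κ * (κ * ∫⁻ x, ∫⁻ y, H x y) := by gcongr
      _ = κ ^ 2 * ∫⁻ x, ∫⁻ y, H x y := by ring
  calc _ ≤ ∫⁻ x in U, ∫⁻ y in U, C * ∫⁻ p, ENNReal.ofReal (φ.normed volume p) *
        H (S x - p) (S y - p) :=
        setLIntegral_mono' hU fun x hx => setLIntegral_mono' hU fun y hy => hpt x hx y hy
    _ ≤ ∫⁻ x, ∫⁻ y, C * ∫⁻ p, ENNReal.ofReal (φ.normed volume p) * H (S x - p) (S y - p) :=
        (setLIntegral_le_lintegral _ _).trans (lintegral_mono fun x => setLIntegral_le_lintegral _ _)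
    _ = C * ∫⁻ q : E × E, (∫⁻ p, ENNReal.ofReal (φ.normed volume p) *
        H (S q.1 - p) (S q.2 - p)) ∂(volume.prod volume) := by
        have h5 : Measurable fun q : E × E => ∫⁻ p, ENNReal.ofReal (φ.normed volume p) *
          H (S q.1 - p) (S q.2 - p) := hHp.lintegral_prod_right'
        rw [← lintegral_const_mul _ h5, lintegral_prod _ (h5.const_mul C).aemeasurable]
    _ = C * ∫⁻ p, ENNReal.ofReal (φ.normed volume p) * ∫⁻ x, ∫⁻ y, H (S x - p) (S y - p) := by
        rw [lintegral_lintegral_swap hHp.aemeasurable]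
        congr 1
        refine lintegral_congr fun p => ?_
        rw [lintegral_const_mul' _ _ ENNReal.ofReal_ne_top, lintegral_prod _ (hHs p).aemeasurable]
    _ ≤ C * ∫⁻ p, ENNReal.ofReal (φ.normed volume p) * (κ ^ 2 * ∫⁻ x, ∫⁻ y, H x y) := by
        gcongr with p
        exact hT p
    _ = C * κ ^ 2 * ∫⁻ x, ∫⁻ y, H x y := by
        rw [lintegral_mul_const _ (by fun_prop), lintegral_normed, one_mul, mul_assoc]

theorem ofReal_add_add_sq_le (a b c : ℝ) : ENNReal.ofReal ((a + b + c) ^ 2) ≤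
    3 * (ENNReal.ofReal (a ^ 2) + ENNReal.ofReal (b ^ 2) + ENNReal.ofReal (c ^ 2)) := by
  rw [← ENNReal.ofReal_add (sq_nonneg _) (sq_nonneg _),
    ← ENNReal.ofReal_add (by positivity) (sq_nonneg _),
    show (3 : ℝ≥0∞) = ENNReal.ofReal 3 by simp, ← ENNReal.ofReal_mul (by norm_num)]
  refine ENNReal.ofReal_le_ofReal ?_
  nlinarith [sq_nonneg (a - b), sq_nonneg (b - c), sq_nonneg (a - c)]

set_option linter.unusedSectionVars false in
theorem memLp_indicator (hU : MeasurableSet U) (hv : Measurable v)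
    (hv2 : ∫⁻ x in U, ENNReal.ofReal (v x ^ 2) ≠ ∞) : MemLp (U.indicator v) 2 volume := by
  have hind : ∀ x, ENNReal.ofReal (U.indicator v x ^ 2) =
      U.indicator (fun x => ENNReal.ofReal (v x ^ 2)) x := fun x => by
    by_cases hx : x ∈ U <;> simp [hx]
  refine ⟨(hv.indicator hU).aestronglyMeasurable, ?_⟩
  rw [eLpNorm_lt_top_iff_lintegral_rpow_enorm_lt_top (by simp) (by simp)]
  have h1 : ∀ x, ‖U.indicator v x‖ₑ ^ ENNReal.toReal 2 =
      U.indicator (fun x => ENNReal.ofReal (v x ^ 2)) x := fun x => by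
    rw [← hind, ← sq_abs, ENNReal.ofReal_pow (abs_nonneg _), Real.enorm_eq_ofReal_abs]
    simp
  simp_rw [h1]
  rw [lintegral_indicator hU]
  exact hv2.lt_top

/-- Mollification after a compression close to the identity is close to the identity in `L²`. -/
theorem exists_mollify_close (hU : MeasurableSet U) (hfin : volume U ≠ ∞) (hv : Measurable v)
    (hv2 : ∫⁻ x in U, ENNReal.ofReal (v x ^ 2) ≠ ∞) {ρ : ℝ} (hρ : 0 < ρ) :
    ∃ η > 0, ∀ (φ : ContDiffBump (0 : E)) (S : E → E), Measurable S → CompressesVolume S 2 →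
      φ.rOut ≤ η → (∀ x ∈ U, dist (S x) x ≤ η) →
      ∫⁻ x in U, ENNReal.ofReal ((mollify φ (U.indicator v) (S x) - v x) ^ 2) ≤
        ENNReal.ofReal ρ := by
  have hvU := hv.indicator hU
  have hmem := memLp_indicator hU hv hv2
  set m : ℝ := (volume U).toReal with hm
  have hm' : volume U = ENNReal.ofReal m := (ENNReal.ofReal_toReal hfin).symm
  have hm0 : 0 ≤ m := ENNReal.toReal_nonneg
  -- The error is split into three parts of size at most ρ/9, as squaring the sum costs a factor 3.
  -- The part composed with S costs another factor 2, hence ρ/18.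
  set β : ℝ := Real.sqrt (ρ / 18) with hβ
  have hβ0 : 0 < β := Real.sqrt_pos.2 (by positivity)
  have hβ2 : β ^ 2 = ρ / 18 := Real.sq_sqrt (by positivity)
  obtain ⟨g, hgc, hgle, hgcont, hgmem⟩ := hmem.exists_hasCompactSupport_eLpNorm_sub_le (by simp)
    (ε := ENNReal.ofReal β) (by simpa using hβ0)
  have hgm := hgcont.measurable
  have hgi : LocallyIntegrable g := hgcont.locallyIntegrable
  have hvi : LocallyIntegrable (U.indicator v) := hmem.locallyIntegrable (by norm_num)
  have hd : ∫⁻ x, ENNReal.ofReal ((U.indicator v - g) x ^ 2) ≤ ENNReal.ofReal (ρ / 18) := by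
    have h1 : ∫⁻ x, ENNReal.ofReal ((U.indicator v - g) x ^ 2) =
        eLpNorm (U.indicator v - g) 2 volume ^ 2 := by
      rw [eLpNorm_eq_lintegral_rpow_enorm_toReal (by simp) (by simp), ← ENNReal.rpow_natCast,
        ← ENNReal.rpow_mul]
      simp only [ENNReal.toReal_ofNat, Nat.cast_ofNat]
      rw [show (1 / 2 * 2 : ℝ) = 1 by norm_num, ENNReal.rpow_one]
      refine lintegral_congr fun x => ?_
      rw [← sq_abs, ENNReal.ofReal_pow (abs_nonneg _), Real.enorm_eq_ofReal_abs]
      simp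
    rw [h1, ← hβ2, ENNReal.ofReal_pow hβ0.le]
    gcongr
  set θ : ℝ := Real.sqrt (ρ / (9 * (m + 1))) with hθ
  have hθ0 : 0 < θ := Real.sqrt_pos.2 (by positivity)
  have hθ2 : θ ^ 2 = ρ / (9 * (m + 1)) := Real.sq_sqrt (by positivity)
  obtain ⟨η, hη, hηg⟩ := Metric.uniformContinuous_iff.1
    (hgc.uniformContinuous_of_continuous hgcont) θ hθ0
  -- Compression and mollification each displace by at most η/4, together less than the modulus η of
  -- uniform continuity of g.
  refine ⟨η / 4, by positivity, fun φ S hSm hS hφ hSd => ?_⟩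
  have hunif : ∀ x ∈ U, |mollify φ g (S x) - g x| ≤ θ := by
    intro x hx
    have h1 : g x = ∫ p, φ.normed volume p * g x := by
      rw [integral_mul_const, φ.integral_normed, one_mul]
    rw [mollify_apply, h1, ← integral_sub (integrable_mollify φ hgi _)
      (φ.integrable_normed.mul_const _), ← Real.norm_eq_abs]
    have h2 : ∫ p, φ.normed volume p * θ = θ := by
      rw [integral_mul_const, φ.integral_normed, one_mul]
    rw [← h2]
    refine norm_integral_le_of_norm_le (φ.integrable_normed.mul_const _)
      (Eventually.of_forall fun p => ?_)
    rw [← mul_sub, norm_mul, Real.norm_of_nonneg (φ.nonneg_normed p)]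
    by_cases hp : φ.rOut ≤ ‖p‖
    · simp [normed_eq_zero φ hp]
    · refine mul_le_mul_of_nonneg_left ?_ (φ.nonneg_normed p)
      have h3 : dist (S x - p) x < η := by
        have h4 := hSd x hx
        rw [dist_eq_norm] at h4 ⊢
        have h5 : S x - p - x = (S x - x) - p := by abel
        rw [h5]
        have := norm_sub_le (S x - x) p
        linarith
      have h6 := hηg h3
      rw [dist_eq_norm] at h6
      exact h6.le
  have hA : ∫⁻ x in U, ENNReal.ofReal (mollify φ (U.indicator v - g) (S x) ^ 2) ≤
      ENNReal.ofReal (ρ / 9) := by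
    refine (setLIntegral_le_lintegral _ _).trans ((hS.lintegral_mollify_sq_le φ hSm
      (hvU.sub hgm)).trans ?_)
    calc 2 * ∫⁻ x, ENNReal.ofReal ((U.indicator v - g) x ^ 2) ≤ 2 * ENNReal.ofReal (ρ / 18) := by
          gcongr
      _ = ENNReal.ofReal (ρ / 9) := by
          rw [show (2 : ℝ≥0∞) = ENNReal.ofReal 2 by simp, ← ENNReal.ofReal_mul (by norm_num)]
          congr 1; ring
  have hB : ∫⁻ x in U, ENNReal.ofReal ((mollify φ g (S x) - g x) ^ 2) ≤ ENNReal.ofReal (ρ / 9) := by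
    calc ∫⁻ x in U, ENNReal.ofReal ((mollify φ g (S x) - g x) ^ 2)
        ≤ ∫⁻ x in U, ENNReal.ofReal (θ ^ 2) :=
          setLIntegral_mono' hU fun x hx => ENNReal.ofReal_le_ofReal
            (sq_le_sq' (abs_le.1 (hunif x hx)).1 (abs_le.1 (hunif x hx)).2)
      _ = ENNReal.ofReal (θ ^ 2 * m) := by
          rw [setLIntegral_const, hm', ENNReal.ofReal_mul (sq_nonneg _)]
      _ ≤ ENNReal.ofReal (ρ / 9) := by
          refine ENNReal.ofReal_le_ofReal ?_
          rw [hθ2, div_mul_eq_mul_div, div_le_div_iff₀ (by positivity) (by norm_num)]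
          nlinarith
  have hC : ∫⁻ x in U, ENNReal.ofReal ((g x - v x) ^ 2) ≤ ENNReal.ofReal (ρ / 9) := by
    calc ∫⁻ x in U, ENNReal.ofReal ((g x - v x) ^ 2)
        = ∫⁻ x in U, ENNReal.ofReal ((U.indicator v - g) x ^ 2) := by
          refine setLIntegral_congr_fun hU fun x hx => ?_
          simp only [Pi.sub_apply, indicator_of_mem hx]
          congr 1; ring
      _ ≤ ∫⁻ x, ENNReal.ofReal ((U.indicator v - g) x ^ 2) := setLIntegral_le_lintegral _ _
      _ ≤ ENNReal.ofReal (ρ / 18) := hd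
      _ ≤ ENNReal.ofReal (ρ / 9) := ENNReal.ofReal_le_ofReal (by linarith)
  have hmm : Continuous (mollify φ (U.indicator v - g)) :=
    (contDiff_mollify φ (hvi.sub hgi)).continuous
  have hmg : Continuous (mollify φ g) := (contDiff_mollify φ hgi).continuous
  have hmm' := hmm.measurable
  have hmg' := hmg.measurable
  calc ∫⁻ x in U, ENNReal.ofReal ((mollify φ (U.indicator v) (S x) - v x) ^ 2)
      ≤ ∫⁻ x in U, 3 * (ENNReal.ofReal (mollify φ (U.indicator v - g) (S x) ^ 2) +
        ENNReal.ofReal ((mollify φ g (S x) - g x) ^ 2) + ENNReal.ofReal ((g x - v x) ^ 2)) := by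
        refine lintegral_mono fun x => ?_
        refine le_trans (le_of_eq ?_) (ofReal_add_add_sq_le _ _ _)
        rw [← mollify_sub φ hvi hgi]
        congr 2; ring
    _ = 3 * ((∫⁻ x in U, ENNReal.ofReal (mollify φ (U.indicator v - g) (S x) ^ 2)) +
        (∫⁻ x in U, ENNReal.ofReal ((mollify φ g (S x) - g x) ^ 2)) +
        ∫⁻ x in U, ENNReal.ofReal ((g x - v x) ^ 2)) := by
        rw [lintegral_const_mul _ (by fun_prop), lintegral_add_left (by fun_prop),
          lintegral_add_left (by fun_prop)]
    _ ≤ 3 * (ENNReal.ofReal (ρ / 9) + ENNReal.ofReal (ρ / 9) + ENNReal.ofReal (ρ / 9)) := by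
        gcongr
    _ = ENNReal.ofReal ρ := by
        rw [← ENNReal.ofReal_add (by positivity) (by positivity),
          ← ENNReal.ofReal_add (by positivity) (by positivity),
          show (3 : ℝ≥0∞) = ENNReal.ofReal 3 by simp, ← ENNReal.ofReal_mul (by norm_num)]
        congr 1; ring

end Mollify

/-! ### Smooth approximation with control of the energies. -/

section Compression

/-- Smooth compressions of a Lipschitz domain into itself, arbitrarily close to the identity. -/
theorem exists_compression (hω : IsOpen ω) (hbdd : Bornology.IsBounded ω)
    (hlip : HasLipschitzBoundary ω) {ρ : ℝ} (hρ : 0 < ρ) :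
    ∃ (T : Plane n → Plane n) (K L : ℝ≥0), ContDiff ℝ ((⊤ : ℕ∞) : WithTop ℕ∞) T ∧
      AntilipschitzWith K T ∧ LipschitzWith L T ∧ (K : ℝ) ^ n ≤ 1 + ρ ∧
      (1 ≤ L ∧ (L : ℝ) ^ (n + 3) ≤ 1 + ρ) ∧
      (∀ x, dist (T x) x ≤ ρ) ∧ ∃ r ∈ Ioo 0 ρ, ∀ x ∈ ω, Metric.closedBall (T x) r ⊆ ω := by
  obtain ⟨X, hXs, hXc, c, hc, δ₀, hδ₀, hX⟩ := exists_inward_field hω hbdd hlip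
  obtain ⟨Λ, hΛ⟩ := ContDiff.lipschitzWith_of_hasCompactSupport (n := 1) hXc (hXs.of_le (by simp))
    one_ne_zero
  obtain ⟨B, hB⟩ := hXc.exists_bound_of_continuous hXs.continuous
  have hlim : Tendsto (fun δ : ℝ => ((1 - δ * Λ)⁻¹) ^ n) (𝓝[>] 0) (𝓝 1) := by
    have h1 : ContinuousAt (fun δ : ℝ => ((1 - δ * Λ)⁻¹) ^ n) 0 := by
      refine ContinuousAt.pow (ContinuousAt.inv₀ (by fun_prop) (by simp)) n
    have h2 := h1.tendsto
    simp only [zero_mul, sub_zero, inv_one, one_pow] at h2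
    exact h2.mono_left nhdsWithin_le_nhds
  have hlim2 : Tendsto (fun δ : ℝ => (1 + δ * Λ) ^ (n + 3)) (𝓝[>] 0) (𝓝 1) := by
    have h1 : Continuous (fun δ : ℝ => (1 + δ * Λ) ^ (n + 3)) := by fun_prop
    have h2 := h1.tendsto 0
    simp only [zero_mul, add_zero, one_pow] at h2
    exact h2.mono_left nhdsWithin_le_nhds
  have hsmall : ∀ a : ℝ, ∀ b : ℝ, 0 < b → ∀ᶠ δ in 𝓝[>] (0 : ℝ), δ * a < b := by
    intro a b hb
    have h1 : Continuous (fun δ : ℝ => δ * a) := by fun_prop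
    have h2 := h1.tendsto 0
    rw [zero_mul] at h2
    exact (h2.mono_left nhdsWithin_le_nhds).eventually_lt_const hb
  -- Every requirement holds for small δ > 0; δΛ < 1 is the one that makes the perturbed identity
  -- antilipschitz.
  obtain ⟨δ, h1, h2, h3, h4, h5, h6, h7⟩ := ((hlim.eventually_lt_const (by linarith : 1 < 1 + ρ)).and
    ((hlim2.eventually_lt_const (by linarith : 1 < 1 + ρ)).and ((hsmall Λ 1 one_pos).and
    ((hsmall B ρ hρ).and ((hsmall c ρ hρ).and ((hsmall 1 δ₀ hδ₀).and
    self_mem_nhdsWithin)))))).exists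
  have hδ : 0 < δ := h7
  have hK : 0 < 1 - δ * Λ := by linarith
  have hTlip : ∀ x y, ‖δ • X x - δ • X y‖ ≤ δ * Λ * ‖x - y‖ := by
    intro x y
    rw [← smul_sub, norm_smul, Real.norm_of_nonneg hδ.le, mul_assoc]
    have := hΛ.dist_le_mul x y
    rw [dist_eq_norm, dist_eq_norm] at this
    gcongr
  refine ⟨fun x => x + δ • X x, ((1 - δ * Λ)⁻¹).toNNReal, (1 + δ * Λ).toNNReal,
    contDiff_id.add (hXs.const_smul δ), ?_, ?_, ?_, ⟨?_, ?_⟩, ?_, c * δ, ⟨by positivity, ?_⟩,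
    fun x hx => hX δ ⟨hδ, by simpa using h6⟩ x hx⟩
  · refine AntilipschitzWith.of_le_mul_dist fun x y => ?_
    rw [Real.coe_toNNReal _ (by positivity), dist_eq_norm, dist_eq_norm]
    rw [inv_mul_eq_div, le_div_iff₀ hK]
    have h8 : x - y = (x + δ • X x - (y + δ • X y)) - (δ • X x - δ • X y) := by abel
    have h9 := norm_sub_le (x + δ • X x - (y + δ • X y)) (δ • X x - δ • X y)
    rw [← h8] at h9
    linarith [hTlip x y]
  · refine LipschitzWith.of_dist_le_mul fun x y => ?_
    rw [Real.coe_toNNReal _ (by positivity), dist_eq_norm, dist_eq_norm]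
    have h8 : x + δ • X x - (y + δ • X y) = (x - y) + (δ • X x - δ • X y) := by abel
    rw [h8]
    refine (norm_add_le _ _).trans ?_
    linarith [hTlip x y]
  · rw [Real.coe_toNNReal _ (by positivity)]; exact h1.le
  · rw [Real.one_le_toNNReal]
    have : 0 ≤ δ * Λ := by positivity
    linarith
  · rw [Real.coe_toNNReal _ (by positivity)]; exact h2.le
  · intro x
    rw [dist_eq_norm, add_sub_cancel_left, norm_smul, Real.norm_of_nonneg hδ.le]
    exact (mul_le_mul_of_nonneg_left (hB x) hδ.le).trans h4.le
  · linarith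

theorem hasCompactSupport_mollify_comp {E : Type*} [NormedAddCommGroup E] [NormedSpace ℝ E]
    [FiniteDimensional ℝ E] [MeasureSpace E] [BorelSpace E] [(volume : Measure E).IsAddHaarMeasure]
    (φ : ContDiffBump (0 : E)) {U : Set E} (hU : Bornology.IsBounded U) {S : E → E} {K : ℝ≥0}
    (hS : AntilipschitzWith K S) (v : E → ℝ) :
    HasCompactSupport fun x => mollify φ (U.indicator v) (S x) := by
  obtain ⟨R, hR⟩ := hU.subset_closedBall 0
  have h1 : Bornology.IsBounded (S ⁻¹' Metric.closedBall 0 (R + φ.rOut)) :=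
    hS.isBounded_preimage Metric.isBounded_closedBall
  refine HasCompactSupport.intro (Metric.isCompact_of_isClosed_isBounded isClosed_closure h1.closure)
    fun x hx => ?_
  rw [mollify_apply, integral_eq_zero_of_ae]
  refine Eventually.of_forall fun p => ?_
  by_cases hp : φ.rOut ≤ ‖p‖
  · simp [normed_eq_zero φ hp]
  · have h2 : S x - p ∉ U := by
      intro h3
      refine hx (subset_closure ?_)
      have h4 := hR h3
      simp only [mem_preimage, Metric.mem_closedBall, dist_zero_right] at h4 ⊢
      have h5 := norm_add_le (S x - p) p
      rw [sub_add_cancel] at h5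
      linarith
    simp [h2]

theorem norm_sq_eq_sum_single (l : Plane n →L[ℝ] ℝ) :
    ‖l‖ ^ 2 = ∑ i, l (EuclideanSpace.single i (1 : ℝ)) ^ 2 := by
  obtain ⟨g, rfl⟩ := (InnerProductSpace.toDual ℝ (Plane n)).surjective l
  rw [LinearIsometryEquiv.norm_map, EuclideanSpace.norm_sq_eq]
  refine Finset.sum_congr rfl fun i _ => ?_
  rw [InnerProductSpace.toDual_apply_apply, EuclideanSpace.inner_single_right]
  simp

theorem contDiffBump_rOut {E : Type*} [NormedAddCommGroup E] {r : ℝ} (hr : 0 < r) :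
    ∃ φ : ContDiffBump (0 : E), φ.rOut = r :=
  ⟨⟨r / 2, r, by positivity, by linarith⟩, rfl⟩

/-- Approximation of planar functions by smooth functions, with control of the energies. -/
theorem exists_smooth_plane (hω : IsOpen ω) (hbdd : Bornology.IsBounded ω)
    (hlip : HasLipschitzBoundary ω) {w : Plane n → ℝ} (hw : Measurable w)
    (hw2 : ∫⁻ x in ω, ENNReal.ofReal (w x ^ 2) ≠ ∞) {ρ : ℝ} (hρ : 0 < ρ) :
    ∃ f : Plane n → ℝ, ContDiff ℝ ((⊤ : ℕ∞) : WithTop ℕ∞) f ∧ HasCompactSupport f ∧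
      ∫⁻ x in ω, ENNReal.ofReal ((f x - w x) ^ 2) ≤ ENNReal.ofReal ρ ∧
      (∀ s ∈ Icc (0 : ℝ) 1, ∫⁻ x in ω, ∫⁻ y in ω,
        ENNReal.ofReal (1 / ‖x - y‖ ^ (((n : ℝ) + 1) + 2 * s)) * ENNReal.ofReal ((f x - f y) ^ 2) ≤
        ENNReal.ofReal (1 + ρ) * ∫⁻ x in ω, ∫⁻ y in ω,
        ENNReal.ofReal (1 / ‖x - y‖ ^ (((n : ℝ) + 1) + 2 * s)) * ENNReal.ofReal ((w x - w y) ^ 2)) ∧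
      ∀ G : Plane n → Plane n, Measurable G →
        (∀ i, HasWeakDirDeriv ω (EuclideanSpace.single i (1 : ℝ)) w (fun x => G x i)) →
        ∫⁻ x in ω, ENNReal.ofReal (‖fderiv ℝ f x‖ ^ 2) ≤
          ENNReal.ofReal (1 + ρ) * ∫⁻ x in ω, ENNReal.ofReal (‖G x‖ ^ 2) := by
  have hωm := hω.measurableSet
  have hfin : volume ω ≠ ∞ := hbdd.measure_lt_top.ne
  obtain ⟨η, hη, hclose⟩ := exists_mollify_close hωm hfin hw hw2 hρ
  -- The losses multiply to at most (1+α)³, which is at most 1 + 7α because α ≤ 1.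
  set α : ℝ := min (min 1 ρ / 7) η with hα
  have hα0 : 0 < α := by positivity
  have hα1 : α ≤ 1 / 7 := (min_le_left _ _).trans (by have := min_le_left 1 ρ; linarith)
  have hα2 : α ≤ ρ / 7 := (min_le_left _ _).trans (by have := min_le_right 1 ρ; linarith)
  have hα3 : α ≤ η := min_le_right _ _
  obtain ⟨T, K, L, hTs, hTK, hTL, hK, ⟨hL1, hL⟩, hTd, r, hr, hball⟩ :=
    exists_compression hω hbdd hlip hα0
  obtain ⟨φ, hφ⟩ := contDiffBump_rOut (E := Plane n) hr.1
  have hTm : Measurable T := hTs.continuous.measurable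
  have hcomp : CompressesVolume T (ENNReal.ofReal (1 + α)) := by
    intro h hh
    refine (lintegral_comp_le_of_antilipschitz hTK hTm hh).trans ?_
    gcongr
    rw [← ENNReal.ofReal_coe_nnreal, ← ENNReal.ofReal_pow K.coe_nonneg]
    exact ENNReal.ofReal_le_ofReal hK
  have hcomp2 : CompressesVolume T 2 := by
    intro h hh
    refine (hcomp h hh).trans ?_
    gcongr
    rw [show (2 : ℝ≥0∞) = ENNReal.ofReal 2 by simp]
    exact ENNReal.ofReal_le_ofReal (by linarith)
  have hwi : LocallyIntegrable (ω.indicator w) :=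
    (memLp_indicator hωm hw hw2).locallyIntegrable (by norm_num)
  rw [← hφ] at hball
  have hms := contDiff_mollify φ hwi
  refine ⟨fun x => mollify φ (ω.indicator w) (T x), hms.comp hTs,
    hasCompactSupport_mollify_comp φ hbdd hTK w, ?_, ?_, ?_⟩
  · exact hclose φ T hTm hcomp2 (by rw [hφ]; linarith [hr.2]) fun x _ => (hTd x).trans hα3
  · intro s hs
    have hL0 : (0 : ℝ) < L := lt_of_lt_of_le one_pos (by exact_mod_cast hL1)
    have h1 := hcomp.lintegral_lintegral_mollify_le φ hTm hωm hw hwi hball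
      (k := fun z => ENNReal.ofReal (1 / ‖z‖ ^ (((n : ℝ) + 1) + 2 * s))) (by fun_prop)
      (C := ENNReal.ofReal (1 + α)) (fun x y => by
        rw [← ENNReal.ofReal_mul (by positivity)]
        refine ENNReal.ofReal_le_ofReal ?_
        have hp : 0 < (n : ℝ) + 1 + 2 * s := by have := hs.1; positivity
        rcases eq_or_ne x y with rfl | hxy
        · simp [Real.zero_rpow hp.ne']
        have h2 : 0 < ‖x - y‖ := norm_pos_iff.2 (sub_ne_zero.2 hxy)
        have h3 : 0 < ‖T x - T y‖ := norm_pos_iff.2 (sub_ne_zero.2 (hTK.injective.ne hxy))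
        have h4 : ‖T x - T y‖ ≤ L * ‖x - y‖ := by
          have := hTL.dist_le_mul x y
          rwa [dist_eq_norm, dist_eq_norm] at this
        -- As L ≥ 1 and s ≤ 1, the single power n + 3 controls the distortion of the kernels of all
        -- orders.
        have h5 : (L : ℝ) ^ ((n : ℝ) + 1 + 2 * s) ≤ 1 + α := by
          refine le_trans ?_ hL
          rw [← Real.rpow_natCast]
          refine Real.rpow_le_rpow_of_exponent_le (by exact_mod_cast hL1) ?_
          push_cast
          linarith [hs.2]
        rw [mul_one_div, div_le_div_iff₀ (by positivity) (by positivity), one_mul]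
        calc ‖T x - T y‖ ^ ((n : ℝ) + 1 + 2 * s) ≤ (L * ‖x - y‖) ^ ((n : ℝ) + 1 + 2 * s) := by
              gcongr
          _ = (L : ℝ) ^ ((n : ℝ) + 1 + 2 * s) * ‖x - y‖ ^ ((n : ℝ) + 1 + 2 * s) :=
              Real.mul_rpow hL0.le h2.le
          _ ≤ _ := by gcongr)
    refine h1.trans ?_
    gcongr
    rw [← ENNReal.ofReal_pow (by linarith), ← ENNReal.ofReal_mul (by linarith)]
    refine ENNReal.ofReal_le_ofReal ?_
    nlinarith [mul_pos hα0 hα0]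
  · intro G hG hGw
    have hGi : ∀ i, Measurable fun x => G x i := fun i => by fun_prop
    have hpt : ∀ x ∈ ω, ENNReal.ofReal
        (‖fderiv ℝ (fun x => mollify φ (ω.indicator w) (T x)) x‖ ^ 2) ≤
        ENNReal.ofReal ((L : ℝ) ^ 2) * ∑ i, ENNReal.ofReal
          (mollify φ (ω.indicator fun x => G x i) (T x) ^ 2) := by
      intro x hx
      have h1 : fderiv ℝ (fun x => mollify φ (ω.indicator w) (T x)) x =
          (fderiv ℝ (mollify φ (ω.indicator w)) (T x)).comp (fderiv ℝ T x) :=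
        fderiv_comp x (hms.differentiable (by simp)).differentiableAt
          (hTs.differentiable (by simp)).differentiableAt
      have h2 : ‖fderiv ℝ T x‖ ≤ L := norm_fderiv_le_of_lipschitz ℝ hTL
      have h3 : ‖fderiv ℝ (mollify φ (ω.indicator w)) (T x)‖ ^ 2 =
          ∑ i, mollify φ (ω.indicator fun x => G x i) (T x) ^ 2 := by
        rw [norm_sq_eq_sum_single]
        refine Finset.sum_congr rfl fun i _ => ?_
        rw [fderiv_mollify φ hωm hwi (hGw i) (hball x hx)]
      rw [← ENNReal.ofReal_sum_of_nonneg (fun i _ => sq_nonneg _),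
        ← ENNReal.ofReal_mul (by positivity), ← h3, ← mul_pow, h1]
      refine ENNReal.ofReal_le_ofReal (pow_le_pow_left₀ (norm_nonneg _) ?_ 2)
      refine (ContinuousLinearMap.opNorm_comp_le _ _).trans ?_
      rw [mul_comm]
      gcongr
    have hL2 : (L : ℝ) ^ 2 ≤ 1 + α :=
      (pow_le_pow_right₀ (by exact_mod_cast hL1) (by omega)).trans hL
    calc ∫⁻ x in ω, ENNReal.ofReal (‖fderiv ℝ (fun x => mollify φ (ω.indicator w) (T x)) x‖ ^ 2)
        ≤ ∫⁻ x in ω, ENNReal.ofReal ((L : ℝ) ^ 2) * ∑ i, ENNReal.ofReal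
          (mollify φ (ω.indicator fun x => G x i) (T x) ^ 2) := setLIntegral_mono' hωm hpt
      _ ≤ ∫⁻ x, ENNReal.ofReal ((L : ℝ) ^ 2) * ∑ i, ENNReal.ofReal
          (mollify φ (ω.indicator fun x => G x i) (T x) ^ 2) := setLIntegral_le_lintegral _ _
      _ = ENNReal.ofReal ((L : ℝ) ^ 2) * ∑ i, ∫⁻ x, ENNReal.ofReal
          (mollify φ (ω.indicator fun x => G x i) (T x) ^ 2) := by
          have hmm : ∀ i, Measurable fun x => mollify φ (ω.indicator fun x => G x i) (T x) := by
            intro i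
            have h1 : Measurable (ω.indicator fun x => G x i) := (hGi i).indicator hωm
            have h2 : Measurable (φ.normed (volume : Measure (Plane n))) :=
              φ.continuous_normed.measurable
            have h3 : StronglyMeasurable fun q : Plane n × Plane n =>
              φ.normed volume q.2 * ω.indicator (fun x => G x i) (T q.1 - q.2) :=
              ((h2.comp measurable_snd).mul (h1.comp (by fun_prop))).stronglyMeasurable
            exact h3.integral_prod_right'.measurable
          rw [lintegral_const_mul' _ _ ENNReal.ofReal_ne_top, lintegral_finsetSum]
          intro i _
          exact ((hmm i).pow_const 2).ennreal_ofReal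
      _ ≤ ENNReal.ofReal (1 + α) * ∑ i, ENNReal.ofReal (1 + α) *
          ∫⁻ x, ENNReal.ofReal (ω.indicator (fun x => G x i) x ^ 2) := by
          gcongr with i
          exact hcomp.lintegral_mollify_sq_le φ hTm ((hGi i).indicator hωm)
      _ = ENNReal.ofReal (1 + α) * (ENNReal.ofReal (1 + α) *
          ∫⁻ x in ω, ENNReal.ofReal (‖G x‖ ^ 2)) := by
          rw [← Finset.mul_sum]
          congr 2
          rw [← lintegral_finsetSum _ (fun i _ =>
            (((hGi i).indicator hωm).pow_const 2).ennreal_ofReal), ← lintegral_indicator hωm]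
          refine lintegral_congr fun x => ?_
          by_cases hx : x ∈ ω
          · simp only [indicator_of_mem hx]
            rw [EuclideanSpace.norm_sq_eq, ENNReal.ofReal_sum_of_nonneg (fun i _ => sq_nonneg _)]
            simp
          · simp [hx]
      _ ≤ ENNReal.ofReal (1 + ρ) * ∫⁻ x in ω, ENNReal.ofReal (‖G x‖ ^ 2) := by
          rw [← mul_assoc, ← ENNReal.ofReal_mul (by linarith)]
          gcongr
          nlinarith

theorem isBounded_film (hbdd : Bornology.IsBounded ω) : Bornology.IsBounded (film ω 1) :=
  hbdd.prod (Metric.isBounded_Ioo 0 1)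

/-- The substitution r = ct produces the factor c^(2s) ≤ 1 and shortens the interval to (0, c). -/
theorem vertForm_comp_scale_le {s : ℝ} (hs : 0 ≤ s) {c : ℝ} (hc : c ∈ Ioo (0 : ℝ) 1)
    (v : Plane n × ℝ → ℝ) :
    ∫⁻ t in Ioo (0 : ℝ) 1, ENNReal.ofReal (t ^ (-(1 + 2 * s))) *
        shiftEnergy (film ω 1) v (0, c * t) ≤
      ∫⁻ t in Ioo (0 : ℝ) 1, ENNReal.ofReal (t ^ (-(1 + 2 * s))) *
        shiftEnergy (film ω 1) v (0, t) := by
  have hc0 : 0 < c := hc.1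
  have h1 := lintegral_Ioo_scale hc0 (fun t => ENNReal.ofReal (t ^ (-(1 + 2 * s))) *
    shiftEnergy (film ω 1) v (0, t)) 1
  calc _ ≤ ENNReal.ofReal c * ∫⁻ t in Ioo (0 : ℝ) 1, ENNReal.ofReal ((c * t) ^ (-(1 + 2 * s))) *
        shiftEnergy (film ω 1) v (0, c * t) := by
        rw [← lintegral_const_mul' _ _ ENNReal.ofReal_ne_top]
        refine setLIntegral_mono' measurableSet_Ioo fun t ht => ?_
        have ht0 : 0 < t := ht.1
        rw [← mul_assoc, ← ENNReal.ofReal_mul hc0.le]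
        gcongr
        rw [Real.mul_rpow hc0.le ht0.le, ← mul_assoc]
        refine le_mul_of_one_le_left (by positivity) ?_
        nth_rewrite 1 [← Real.rpow_one c]
        rw [← Real.rpow_add hc0]
        exact Real.one_le_rpow_of_pos_of_le_one_of_nonpos hc0 hc.2.le (by linarith)
    _ = _ := h1.symm
    _ ≤ _ := lintegral_mono_set (Ioo_subset_Ioo_right (by linarith [hc.2]))

/-- Approximation of functions on the film by smooth functions, with control of the vertical
energies. -/
theorem exists_smooth_film (hω : IsOpen ω) (hbdd : Bornology.IsBounded ω)
    (hlip : HasLipschitzBoundary ω) {v : Plane n × ℝ → ℝ} (hv : Measurable v)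
    (hv2 : ∫⁻ x in film ω 1, ENNReal.ofReal (v x ^ 2) ≠ ∞) {ρ : ℝ} (hρ : 0 < ρ) :
    ∃ f : Plane n × ℝ → ℝ, ContDiff ℝ ((⊤ : ℕ∞) : WithTop ℕ∞) f ∧ HasCompactSupport f ∧
      ∫⁻ x in film ω 1, ENNReal.ofReal ((f x - v x) ^ 2) ≤ ENNReal.ofReal ρ ∧
      (∀ s, 0 ≤ s → vertForm ω s f ≤ ENNReal.ofReal (1 + ρ) * vertForm ω s v) ∧
      ∀ g : Plane n × ℝ → ℝ, Measurable g →
        HasWeakDirDeriv (film ω 1) ((0 : Plane n), (1 : ℝ)) v g →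
        ∫⁻ x in film ω 1, ENNReal.ofReal (fderiv ℝ f x (0, 1) ^ 2) ≤
          ENNReal.ofReal (1 + ρ) * ∫⁻ x in film ω 1, ENNReal.ofReal (g x ^ 2) := by
  have hU := measurableSet_film hω.measurableSet 1
  have hUb := isBounded_film hbdd
  have hfin : volume (film ω 1) ≠ ∞ := hUb.measure_lt_top.ne
  obtain ⟨η, hη, hclose⟩ := exists_mollify_close hU hfin hv hv2 hρ
  set α : ℝ := min (min 1 ρ / 7) η with hα
  have hα0 : 0 < α := by positivity
  have hα1 : α ≤ 1 / 7 := (min_le_left _ _).trans (by have := min_le_left 1 ρ; linarith)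
  have hα2 : α ≤ ρ / 7 := (min_le_left _ _).trans (by have := min_le_right 1 ρ; linarith)
  have hα3 : α ≤ η := min_le_right _ _
  obtain ⟨T, K, L, hTs, hTK, hTL, hK, -, hTd, r, hr, hball⟩ :=
    exists_compression hω hbdd hlip (by positivity : 0 < α / 4)
  have hr0 : 0 < r := hr.1
  have hr1 : r < α / 4 := hr.2
  obtain ⟨φ, hφ⟩ := contDiffBump_rOut (E := Plane n × ℝ) hr.1
  -- The vertical map t ↦ ct + r sends (0,1) onto (r, 1 - r), leaving room for the mollification
  -- radius r at both ends.
  set c : ℝ := 1 - 2 * r with hc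
  have hc0 : 0 < c := by rw [hc]; linarith
  have hc1 : c < 1 := by rw [hc]; linarith
  set S : Plane n × ℝ → Plane n × ℝ := fun x => (T x.1, c * x.2 + r) with hS
  have hSs : ContDiff ℝ ((⊤ : ℕ∞) : WithTop ℕ∞) S :=
    (hTs.comp contDiff_fst).prodMk ((contDiff_const.mul contDiff_snd).add contDiff_const)
  have hTm : Measurable T := hTs.continuous.measurable
  have hSm : Measurable S := hSs.continuous.measurable
  have hSK : AntilipschitzWith (max K c⁻¹.toNNReal) S := by
    refine AntilipschitzWith.of_le_mul_dist fun x y => ?_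
    rw [Prod.dist_eq, Prod.dist_eq]
    refine max_le ?_ ?_
    · refine (hTK.le_mul_dist x.1 y.1).trans ?_
      gcongr
      · exact_mod_cast le_max_left _ _
      · exact le_max_left _ _
    · calc dist x.2 y.2 = c⁻¹ * dist (c * x.2 + r) (c * y.2 + r) := by
            rw [Real.dist_eq, Real.dist_eq, add_sub_add_right_eq_sub, ← mul_sub, abs_mul,
              abs_of_pos hc0]
            field_simp
        _ = (c⁻¹.toNNReal : ℝ) * dist (c * x.2 + r) (c * y.2 + r) := by
            rw [Real.coe_toNNReal _ (by positivity)]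
        _ ≤ _ := by
            gcongr
            · exact_mod_cast le_max_right _ _
            · exact le_max_right _ _
  have hcomp0 : CompressesVolume S (ENNReal.ofReal (1 + α)) := by
    intro h hh
    have h1 : ∀ x : Plane n, ∫⁻ t : ℝ, h (T x, c * t + r) =
        ENNReal.ofReal c⁻¹ * ∫⁻ t : ℝ, h (T x, t) := by
      intro x
      have hm : Measurable fun t : ℝ => h (T x, t + r) := by fun_prop
      rw [← lintegral_map (μ := volume) (g := fun t : ℝ => c * t) hm (by fun_prop),
        Real.map_volume_mul_left hc0.ne', lintegral_smul_measure, abs_of_pos (inv_pos.2 hc0),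
        lintegral_add_right_eq_self (fun t => h (T x, t)) r, smul_eq_mul]
    have h2 : ∀ t : ℝ, ∫⁻ x, h (T x, t) ≤ ENNReal.ofReal (1 + α / 4) * ∫⁻ x, h (x, t) := by
      intro t
      refine (lintegral_comp_le_of_antilipschitz hTK hTm
        (h := fun x => h (x, t)) (by fun_prop)).trans ?_
      gcongr
      rw [← ENNReal.ofReal_coe_nnreal, ← ENNReal.ofReal_pow K.coe_nonneg]
      exact ENNReal.ofReal_le_ofReal hK
    rw [Measure.volume_eq_prod, lintegral_prod _ (by fun_prop), lintegral_prod_symm _ (by fun_prop)]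
    simp only [hS, h1]
    rw [lintegral_const_mul' _ _ ENNReal.ofReal_ne_top, lintegral_lintegral_swap (by fun_prop)]
    calc ENNReal.ofReal c⁻¹ * ∫⁻ t, ∫⁻ x, h (T x, t)
        ≤ ENNReal.ofReal c⁻¹ * ∫⁻ t, ENNReal.ofReal (1 + α / 4) * ∫⁻ x, h (x, t) := by
          gcongr with t
          exact h2 t
      _ = ENNReal.ofReal (c⁻¹ * (1 + α / 4)) * ∫⁻ t, ∫⁻ x, h (x, t) := by
          rw [lintegral_const_mul' _ _ ENNReal.ofReal_ne_top, ← mul_assoc,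
            ENNReal.ofReal_mul (by positivity)]
      _ ≤ ENNReal.ofReal (1 + α) * ∫⁻ t, ∫⁻ x, h (x, t) := by
          gcongr
          rw [inv_mul_le_iff₀ hc0]
          nlinarith
  have hcomp : CompressesVolume S (ENNReal.ofReal (1 + ρ)) := fun h hh =>
    (hcomp0 h hh).trans (by gcongr; linarith)
  have hcomp2 : CompressesVolume S 2 := fun h hh => (hcomp0 h hh).trans (by
    gcongr
    rw [show (2 : ℝ≥0∞) = ENNReal.ofReal 2 by simp]
    exact ENNReal.ofReal_le_ofReal (by linarith))
  have hvi : LocallyIntegrable ((film ω 1).indicator v) :=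
    (memLp_indicator hU hv hv2).locallyIntegrable (by norm_num)
  have hball' : ∀ x ∈ film ω 1, Metric.closedBall (S x) φ.rOut ⊆ film ω 1 := by
    intro x hx y hy
    have hx2 := hx.2
    rw [hφ, Metric.mem_closedBall, Prod.dist_eq, max_le_iff, Real.dist_eq, abs_le] at hy
    refine ⟨hball x.1 hx.1 hy.1, ?_, ?_⟩
    · have := mul_pos hc0 hx2.1
      linarith [hy.2.1]
    · have : c * x.2 < c * 1 := by have := hx2.2; gcongr
      linarith [hy.2.2]
  have hms := contDiff_mollify φ hvi
  refine ⟨fun x => mollify φ ((film ω 1).indicator v) (S x), hms.comp hSs,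
    hasCompactSupport_mollify_comp φ hUb hSK v, ?_, ?_, ?_⟩
  · refine hclose φ S hSm hcomp2 (by rw [hφ]; linarith) fun x hx => ?_
    rw [Prod.dist_eq]
    refine max_le ((hTd x.1).trans (by linarith)) ?_
    rw [Real.dist_eq, abs_le]
    have hx2 := hx.2
    constructor
    · nlinarith [hx2.1, hx2.2]
    · nlinarith [hx2.1, hx2.2]
  · intro s hs
    rw [vertForm, vertForm, mul_left_comm]
    gcongr
    refine le_trans ?_ (mul_le_mul_right (vertForm_comp_scale_le hs ⟨hc0, hc1⟩ v) _)
    rw [← lintegral_const_mul' _ _ ENNReal.ofReal_ne_top]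
    refine lintegral_mono fun t => ?_
    rw [mul_left_comm]
    gcongr
    refine hcomp.shiftEnergy_mollify_le φ hSm hU hv hvi hball' fun x => ?_
    simp only [hS, Prod.fst_add, Prod.snd_add, add_zero, Prod.mk_add_mk, Prod.mk.injEq, true_and]
    ring
  · intro g hg hgw
    have hpt : ∀ x ∈ film ω 1, ENNReal.ofReal
        (fderiv ℝ (fun x => mollify φ ((film ω 1).indicator v) (S x)) x (0, 1) ^ 2) ≤
        ENNReal.ofReal (mollify φ ((film ω 1).indicator g) (S x) ^ 2) := by
      intro x hx
      have h0 : HasFDerivAt T (fderiv ℝ T x.1) x.1 :=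
        (hTs.differentiable (by simp)).differentiableAt.hasFDerivAt
      have h1 : HasFDerivAt S (((fderiv ℝ T x.1).comp (ContinuousLinearMap.fst ℝ _ ℝ)).prod
          (c • ContinuousLinearMap.snd ℝ (Plane n) ℝ)) x :=
        (h0.comp x hasFDerivAt_fst).prodMk ((hasFDerivAt_snd.const_mul c).add_const r)
      have h2 : fderiv ℝ (fun x => mollify φ ((film ω 1).indicator v) (S x)) x (0, 1) =
          c * fderiv ℝ (mollify φ ((film ω 1).indicator v)) (S x) (0, 1) := by
        have h3 := ((hms.differentiable (by simp)).differentiableAt (x := S x)).hasFDerivAt.comp x h1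
        have h4 : fderiv ℝ (fun x => mollify φ ((film ω 1).indicator v) (S x)) x = _ := h3.fderiv
        rw [h4]
        simp only [ContinuousLinearMap.comp_apply, ContinuousLinearMap.prod_apply,
          ContinuousLinearMap.coe_fst', map_zero, smul_apply,
          ContinuousLinearMap.coe_snd']
        rw [show ((0 : Plane n), c • (1 : ℝ)) = c • ((0 : Plane n), (1 : ℝ)) by simp, map_smul,
          smul_eq_mul]
      rw [h2, fderiv_mollify φ hU hvi hgw (hball' x hx), mul_pow]
      refine ENNReal.ofReal_le_ofReal (mul_le_of_le_one_left (sq_nonneg _) ?_)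
      exact pow_le_one₀ hc0.le hc1.le
    refine (setLIntegral_mono' hU hpt).trans ((setLIntegral_le_lintegral _ _).trans
      ((hcomp.lintegral_mollify_sq_le φ hSm (hg.indicator hU)).trans ?_))
    refine mul_le_mul_right ?_ _
    rw [← lintegral_indicator hU]
    refine lintegral_mono fun x => ?_
    by_cases hx : x ∈ film ω 1 <;> simp [hx]

end Compression

/-! ### Upper bounds for smooth functions: first term -/

section UpperFirst

theorem lintegral_rpow_sub_one {b : ℝ} (hb : 0 < b) :
    ∫⁻ t in Ioo (0 : ℝ) 1, ENNReal.ofReal (t ^ (b - 1)) = ENNReal.ofReal (1 / b) := by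
  refine lintegral_ofReal_of_integral_eq (by positivity) ?_ ?_
  · filter_upwards [ae_restrict_mem measurableSet_Ioo] with t ht
    exact Real.rpow_nonneg ht.1.le _
  · rw [← integral_Ioc_eq_integral_Ioo, ← intervalIntegral.integral_of_le zero_le_one,
      integral_rpow (Or.inl (by linarith))]
    simp [hb.ne']

theorem exists_lipschitz_bound {E : Type*} [NormedAddCommGroup E] [NormedSpace ℝ E] {f : E → ℝ}
    (hf : ContDiff ℝ ((⊤ : ℕ∞) : WithTop ℕ∞) f) (hc : HasCompactSupport f) :
    ∃ D : ℝ, 0 < D ∧ ∀ x y, |f x - f y| ≤ D * ‖x - y‖ ∧ |f x - f y| ≤ D := by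
  obtain ⟨Λ, hΛ⟩ := ContDiff.lipschitzWith_of_hasCompactSupport (n := 1) hc (hf.of_le (by simp))
    one_ne_zero
  obtain ⟨B, hB⟩ := hc.exists_bound_of_continuous hf.continuous
  have hB0 : 0 ≤ B := (norm_nonneg _).trans (hB 0)
  refine ⟨Λ + 2 * B + 1, by positivity, fun x y => ⟨?_, ?_⟩⟩
  · have h1 := hΛ.dist_le_mul x y
    rw [Real.dist_eq, dist_eq_norm] at h1
    nlinarith [norm_nonneg (x - y)]
  · have h1 : |f x - f y| ≤ |f x| + |f y| := abs_sub _ _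
    have h2 := hB x
    have h3 := hB y
    rw [Real.norm_eq_abs] at h2 h3
    linarith [Λ.coe_nonneg]

theorem add_sq_le_of_pos {η : ℝ} (hη : 0 < η) (p q : ℝ) :
    (p + q) ^ 2 ≤ (1 + η) * p ^ 2 + (1 + 1 / η) * q ^ 2 := by
  have h1 : 2 * p * q ≤ η * p ^ 2 + 1 / η * q ^ 2 := by
    have h2 := sq_nonneg (η * p - q)
    have h3 : η * p ^ 2 + 1 / η * q ^ 2 - 2 * p * q = (η * p - q) ^ 2 / η := by
      field_simp
      ring
    have h4 : 0 ≤ (η * p - q) ^ 2 / η := by positivity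
    linarith
  nlinarith

/-- Interpolation: the Lipschitz bound is used for r ≤ 1, the uniform bound for r ≥ 1. -/
theorem sq_le_rpow_of_le {D a r α : ℝ} (hD : 0 ≤ D) (hr : 0 ≤ r) (h1 : |a| ≤ D * r) (h2 : |a| ≤ D)
    (hα : α ∈ Ioc (0 : ℝ) 1) : a ^ 2 ≤ D ^ 2 * r ^ (2 * α) := by
  have h3 : |a| ≤ D * r ^ α := by
    rcases hr.eq_or_lt with h | h
    · rw [← h, Real.zero_rpow hα.1.ne']; rwa [← h] at h1
    rcases le_total r 1 with h4 | h4
    · refine h1.trans (mul_le_mul_of_nonneg_left ?_ hD)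
      nth_rewrite 1 [← Real.rpow_one r]
      exact Real.rpow_le_rpow_of_exponent_ge h h4 hα.2
    · exact h2.trans (le_mul_of_one_le_right hD (Real.one_le_rpow h4 hα.1.le))
  calc a ^ 2 = |a| ^ 2 := (sq_abs a).symm
    _ ≤ (D * r ^ α) ^ 2 := by gcongr
    _ = D ^ 2 * r ^ (2 * α) := by
        rw [mul_pow, ← Real.rpow_natCast (r ^ α) 2, ← Real.rpow_mul hr]
        congr 2
        push_cast
        ring

/-- Splitting of the increments of a smooth function into vertical and horizontal parts. -/
theorem exists_shiftEnergy_film_le (hω : IsOpen ω) (hfin : volume ω ≠ ∞) {f : Plane n × ℝ → ℝ}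
    (hf : ContDiff ℝ ((⊤ : ℕ∞) : WithTop ℕ∞) f) (hc : HasCompactSupport f) :
    ∃ D : ℝ, 0 ≤ D ∧ (∀ t, shiftEnergy (film ω 1) f (0, t) ≤ ENNReal.ofReal (D * t ^ 2)) ∧
      ∀ α ∈ Ioc (0 : ℝ) 1, ∀ η > 0, ∀ z t, shiftEnergy (film ω 1) f (z, t) ≤
        ENNReal.ofReal (1 + η) * shiftEnergy (film ω 1) f (0, t) +
        ENNReal.ofReal ((1 + 1 / η) * D * ‖z‖ ^ (2 * α)) := by
  have hU := measurableSet_film hω.measurableSet 1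
  have hUfin : volume (film ω 1) ≠ ∞ := by
    rw [film, Measure.volume_eq_prod, Measure.prod_prod]
    exact ENNReal.mul_ne_top hfin (by simp)
  obtain ⟨D, hD, hfD⟩ := exists_lipschitz_bound hf hc
  set m : ℝ := (volume (film ω 1)).toReal with hm
  have hm' : volume (film ω 1) = ENNReal.ofReal m := (ENNReal.ofReal_toReal hUfin).symm
  have hm0 : 0 ≤ m := ENNReal.toReal_nonneg
  have hfm : Measurable f := hf.continuous.measurable
  refine ⟨D ^ 2 * m, by positivity, fun t => ?_, fun α hα η hη z t => ?_⟩
  · calc shiftEnergy (film ω 1) f (0, t)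
        ≤ ∫⁻ x in film ω 1 ∩ (fun x => x + ((0 : Plane n), t)) ⁻¹' film ω 1,
          ENNReal.ofReal (D ^ 2 * t ^ 2) := by
          refine lintegral_mono fun x => ENNReal.ofReal_le_ofReal ?_
          have h1 := (hfD (x + (0, t)) x).1
          rw [add_sub_cancel_left] at h1
          have h2 : ‖((0 : Plane n), t)‖ = |t| := by simp [Prod.norm_def]
          rw [h2] at h1
          rw [← sq_abs, ← sq_abs t, ← mul_pow]
          gcongr
      _ ≤ ∫⁻ x in film ω 1, ENNReal.ofReal (D ^ 2 * t ^ 2) := lintegral_mono_set inter_subset_left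
      _ = ENNReal.ofReal (D ^ 2 * m * t ^ 2) := by
          rw [setLIntegral_const, hm', ← ENNReal.ofReal_mul (by positivity)]
          congr 1; ring
  · have hpt : ∀ x, ENNReal.ofReal ((f (x + (z, t)) - f x) ^ 2) ≤
        ENNReal.ofReal (1 + η) * ENNReal.ofReal ((f (x + (0, t)) - f x) ^ 2) +
        ENNReal.ofReal ((1 + 1 / η) * (D ^ 2 * ‖z‖ ^ (2 * α))) := by
      intro x
      rw [← ENNReal.ofReal_mul (by positivity), ← ENNReal.ofReal_add (by positivity) (by positivity)]
      refine ENNReal.ofReal_le_ofReal ?_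
      have h1 := add_sq_le_of_pos hη (f (x + (0, t)) - f x) (f (x + (z, t)) - f (x + (0, t)))
      have h2 := hfD (x + (z, t)) (x + (0, t))
      have h3 : ‖x + (z, t) - (x + (0, t))‖ = ‖z‖ := by simp [Prod.norm_def]
      rw [h3] at h2
      have h4 := sq_le_rpow_of_le hD.le (norm_nonneg z) h2.1 h2.2 hα
      have h5 : 0 ≤ 1 + 1 / η := by positivity
      have h6 := mul_le_mul_of_nonneg_left h4 h5
      rw [show f (x + (0, t)) - f x + (f (x + (z, t)) - f (x + (0, t))) = f (x + (z, t)) - f x by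
        ring] at h1
      linarith
    -- The film is a product, so the intermediate point x + (0, t) of the splitting stays inside.
    have hsub : film ω 1 ∩ (fun x => x + (z, t)) ⁻¹' film ω 1 ⊆
        film ω 1 ∩ (fun x => x + ((0 : Plane n), t)) ⁻¹' film ω 1 := by
      rintro x ⟨hx, hx'⟩
      refine ⟨hx, ?_, ?_⟩
      · simpa using hx.1
      · simpa using hx'.2
    calc shiftEnergy (film ω 1) f (z, t)
        ≤ ∫⁻ x in film ω 1 ∩ (fun x => x + ((0 : Plane n), t)) ⁻¹' film ω 1,
          ENNReal.ofReal ((f (x + (z, t)) - f x) ^ 2) := lintegral_mono_set hsub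
      _ ≤ ∫⁻ x in film ω 1 ∩ (fun x => x + ((0 : Plane n), t)) ⁻¹' film ω 1,
          (ENNReal.ofReal (1 + η) * ENNReal.ofReal ((f (x + (0, t)) - f x) ^ 2) +
          ENNReal.ofReal ((1 + 1 / η) * (D ^ 2 * ‖z‖ ^ (2 * α)))) := lintegral_mono fun x => hpt x
      _ = ENNReal.ofReal (1 + η) * shiftEnergy (film ω 1) f (0, t) +
          ENNReal.ofReal ((1 + 1 / η) * (D ^ 2 * ‖z‖ ^ (2 * α))) *
          volume (film ω 1 ∩ (fun x => x + ((0 : Plane n), t)) ⁻¹' film ω 1) := by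
          rw [lintegral_add_right _ measurable_const,
            lintegral_const_mul' _ _ ENNReal.ofReal_ne_top, setLIntegral_const, shiftEnergy]
      _ ≤ ENNReal.ofReal (1 + η) * shiftEnergy (film ω 1) f (0, t) +
          ENNReal.ofReal ((1 + 1 / η) * (D ^ 2 * ‖z‖ ^ (2 * α))) * ENNReal.ofReal m := by
          rw [← hm']
          gcongr
          exact inter_subset_left
      _ = _ := by
          rw [← ENNReal.ofReal_mul (by positivity)]
          congr 2
          ring

theorem norm_rpow_mul_ker_le (s : ℝ) {α : ℝ} (hα : 0 ≤ α) (ξ : Plane n) :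
    ‖ξ‖ ^ (2 * α) * ker n s ξ ≤ ker n (s - α) ξ := by
  have h1 : ker n (s - α) ξ = (1 + ‖ξ‖ ^ 2) ^ α * ker n s ξ := by
    unfold ker
    rw [← Real.rpow_add (by positivity)]
    congr 1
    ring
  rw [h1]
  refine mul_le_mul_of_nonneg_right ?_ (ker_pos s ξ).le
  rw [Real.rpow_mul (norm_nonneg _)]
  refine Real.rpow_le_rpow (by positivity) ?_ hα
  rw [show (2 : ℝ) = ((2 : ℕ) : ℝ) by norm_num, Real.rpow_natCast]
  linarith

theorem filmEnergy_congr_ker (hω : IsOpen ω) {ε : ℝ} (hε : 0 < ε) (s : ℝ) {v : FilmL2 ω}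
    {f : Plane n × ℝ → ℝ} (hvf : v =ᵐ[volume.restrict (film ω 1)] f) :
    filmEnergy ω s ε v = ENNReal.ofReal (2 * ε ^ (1 - 2 * s)) * ∫⁻ t in Ioo (0 : ℝ) 1,
        ∫⁻ ξ : Plane n, ENNReal.ofReal (t ^ (-(1 + 2 * s))) * (ENNReal.ofReal (ker n s ξ) *
          shiftEnergy (film ω 1) f ((ε * t) • ξ, t)) := by
  rw [filmEnergy_eq_ker hω hε]
  simp_rw [shiftEnergy_congr (measurableSet_film hω.measurableSet 1) hvf]

/-- The vertical part of the increments gives `vertForm`, and the horizontal error is of order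
|εtξ|^(2α). The condition s < α makes the error integrable in t near 0; the condition α < s + 1/2
makes it integrable in ξ at infinity. -/
theorem exists_filmEnergy_le (hω : IsOpen ω) (hfin : volume ω ≠ ∞) {f : Plane n × ℝ → ℝ}
    (hf : ContDiff ℝ ((⊤ : ℕ∞) : WithTop ℕ∞) f) (hc : HasCompactSupport f) {v : FilmL2 ω}
    (hvf : v =ᵐ[volume.restrict (film ω 1)] f) :
    ∃ D : ℝ, 0 ≤ D ∧ ∀ α ∈ Ioc (0 : ℝ) 1, ∀ η > 0, ∀ ε > 0, ∀ s ∈ Ioo (0 : ℝ) 1,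
      s < α → α - s < 1 / 2 →
      filmEnergy ω s ε v / ENNReal.ofReal (ε ^ (1 - 2 * s)) ≤
        ENNReal.ofReal ((1 + η) * constC n s) * vertForm ω s f +
        ENNReal.ofReal ((1 + 1 / η) * D * ε ^ (2 * α) * (constC n (s - α) / (α - s))) := by
  obtain ⟨D, hD, -, hDf⟩ := exists_shiftEnergy_film_le hω hfin hf hc
  refine ⟨D, hD, fun α hα η hη ε hε s hs hsα hαs => ?_⟩
  have hfm : Measurable f := hf.continuous.measurable
  have hQm : Measurable (shiftEnergy (film ω 1) f) :=
    measurable_shiftEnergy (measurableSet_film hω.measurableSet 1) hfm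
  have hC : 0 < constC n (s - α) := constC_pos (by linarith)
  have hC' : 0 < constC n s := constC_pos (by linarith [hs.1])
  rw [filmEnergy_congr_ker hω hε s hvf, ofReal_mul_div_ofReal (by norm_num) (by positivity)]
  have hpt : ∀ t ∈ Ioo (0 : ℝ) 1, ∫⁻ ξ : Plane n, ENNReal.ofReal (t ^ (-(1 + 2 * s))) *
      (ENNReal.ofReal (ker n s ξ) * shiftEnergy (film ω 1) f ((ε * t) • ξ, t)) ≤
      ENNReal.ofReal ((1 + η) * constC n s) * (ENNReal.ofReal (t ^ (-(1 + 2 * s))) *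
        shiftEnergy (film ω 1) f (0, t)) +
      ENNReal.ofReal ((1 + 1 / η) * D * ε ^ (2 * α) * constC n (s - α)) *
        ENNReal.ofReal (t ^ (2 * (α - s) - 1)) := by
    intro t ht
    have ht0 : 0 < t := ht.1
    have h1 : ∀ ξ : Plane n, ENNReal.ofReal (t ^ (-(1 + 2 * s))) *
        (ENNReal.ofReal (ker n s ξ) * shiftEnergy (film ω 1) f ((ε * t) • ξ, t)) ≤
        ENNReal.ofReal (1 + η) * (ENNReal.ofReal (t ^ (-(1 + 2 * s))) *
          shiftEnergy (film ω 1) f (0, t)) * ENNReal.ofReal (ker n s ξ) +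
        ENNReal.ofReal ((1 + 1 / η) * D * ε ^ (2 * α) * t ^ (2 * (α - s) - 1)) *
          ENNReal.ofReal (ker n (s - α) ξ) := by
      intro ξ
      calc _ ≤ ENNReal.ofReal (t ^ (-(1 + 2 * s))) * (ENNReal.ofReal (ker n s ξ) *
            (ENNReal.ofReal (1 + η) * shiftEnergy (film ω 1) f (0, t) +
            ENNReal.ofReal ((1 + 1 / η) * D * ‖(ε * t) • ξ‖ ^ (2 * α)))) := by
            gcongr
            exact hDf α hα η hη _ _
        _ = ENNReal.ofReal (1 + η) * (ENNReal.ofReal (t ^ (-(1 + 2 * s))) *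
            shiftEnergy (film ω 1) f (0, t)) * ENNReal.ofReal (ker n s ξ) +
            ENNReal.ofReal (t ^ (-(1 + 2 * s))) * (ENNReal.ofReal (ker n s ξ) *
            ENNReal.ofReal ((1 + 1 / η) * D * ‖(ε * t) • ξ‖ ^ (2 * α))) := by ring
        _ ≤ _ := by
            refine add_le_add le_rfl ?_
            have h0 := (ker_pos s ξ).le
            rw [← ENNReal.ofReal_mul h0, ← ENNReal.ofReal_mul (by positivity),
              ← ENNReal.ofReal_mul (by positivity)]
            refine ENNReal.ofReal_le_ofReal ?_
            have h2 : t ^ (2 * (α - s) - 1) = t ^ (-(1 + 2 * s)) * t ^ (2 * α) := by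
              rw [← Real.rpow_add ht0]; congr 1; ring
            have h3 : ‖(ε * t) • ξ‖ ^ (2 * α) = ε ^ (2 * α) * t ^ (2 * α) * ‖ξ‖ ^ (2 * α) := by
              rw [norm_smul, Real.norm_of_nonneg (by positivity),
                Real.mul_rpow (by positivity) (norm_nonneg _), Real.mul_rpow hε.le ht0.le]
            rw [h2, h3]
            calc t ^ (-(1 + 2 * s)) * (ker n s ξ * ((1 + 1 / η) * D *
                  (ε ^ (2 * α) * t ^ (2 * α) * ‖ξ‖ ^ (2 * α))))
                = (1 + 1 / η) * D * ε ^ (2 * α) * (t ^ (-(1 + 2 * s)) * t ^ (2 * α)) *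
                  (‖ξ‖ ^ (2 * α) * ker n s ξ) := by ring
              _ ≤ _ := by
                gcongr
                exact norm_rpow_mul_ker_le s hα.1.le ξ
    refine (lintegral_mono h1).trans (le_of_eq ?_)
    have hkm := (measurable_ker (n := n) s).ennreal_ofReal
    have hkm' := (measurable_ker (n := n) (s - α)).ennreal_ofReal
    rw [lintegral_add_left (by fun_prop), lintegral_const_mul _ hkm,
      lintegral_const_mul _ hkm', lintegral_ker (by linarith [hs.1]),
      lintegral_ker (by linarith), ENNReal.ofReal_mul (p := 1 + η) (by positivity),
      ENNReal.ofReal_mul (p := (1 + 1 / η) * D * ε ^ (2 * α)) (by positivity),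
      ENNReal.ofReal_mul (p := (1 + 1 / η) * D * ε ^ (2 * α)) (by positivity)]
    ring
  calc _ ≤ ENNReal.ofReal 2 * ∫⁻ t in Ioo (0 : ℝ) 1, (ENNReal.ofReal ((1 + η) * constC n s) *
        (ENNReal.ofReal (t ^ (-(1 + 2 * s))) * shiftEnergy (film ω 1) f (0, t)) +
        ENNReal.ofReal ((1 + 1 / η) * D * ε ^ (2 * α) * constC n (s - α)) *
        ENNReal.ofReal (t ^ (2 * (α - s) - 1))) := by
        gcongr 1
        exact setLIntegral_mono' measurableSet_Ioo hpt
    _ = _ := by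
        rw [lintegral_add_left (by fun_prop), lintegral_const_mul' _ _ ENNReal.ofReal_ne_top,
          lintegral_const_mul' _ _ ENNReal.ofReal_ne_top,
          lintegral_rpow_sub_one (by linarith : 0 < 2 * (α - s)), vertForm, mul_add,
          ← ENNReal.ofReal_mul (by positivity), ← ENNReal.ofReal_mul (by positivity)]
        congr 1
        · simp only [ENNReal.ofReal_ofNat]; ring
        · congr 1
          have : α - s ≠ 0 := by linarith
          field_simp

/-- Vertical increments of a smooth function are O(t²), which dominates the singular weight for all
exponents below some s₁ < 1. -/
theorem tendsto_vertForm (hω : IsOpen ω) (hfin : volume ω ≠ ∞) {f : Plane n × ℝ → ℝ}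
    (hf : ContDiff ℝ ((⊤ : ℕ∞) : WithTop ℕ∞) f) (hc : HasCompactSupport f) {s : ℝ → ℝ} {s₀ : ℝ}
    (hs : Tendsto s (𝓝[>] 0) (𝓝 s₀)) (hs₀ : s₀ < 1) :
    Tendsto (fun ε => vertForm ω (s ε) f) (𝓝[>] 0) (𝓝 (vertForm ω s₀ f)) ∧
      vertForm ω s₀ f ≠ ∞ := by
  obtain ⟨D, hD, hDt, -⟩ := exists_shiftEnergy_film_le hω hfin hf hc
  have hfm : Measurable f := hf.continuous.measurable
  have hQm : Measurable (shiftEnergy (film ω 1) f) :=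
    measurable_shiftEnergy (measurableSet_film hω.measurableSet 1) hfm
  obtain ⟨s₁, hs01, hs1⟩ := exists_between hs₀
  set b : ℝ := 2 - 2 * s₁ with hb
  have hb0 : 0 < b := by rw [hb]; linarith
  have hbound : ∀ r ≤ s₁, ∀ t ∈ Ioo (0 : ℝ) 1, ENNReal.ofReal (t ^ (-(1 + 2 * r))) *
      shiftEnergy (film ω 1) f (0, t) ≤ ENNReal.ofReal D * ENNReal.ofReal (t ^ (b - 1)) := by
    intro r hr t ht
    have ht0 : 0 < t := ht.1
    refine (mul_le_mul_right (hDt t) _).trans ?_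
    rw [← ENNReal.ofReal_mul (by positivity), ← ENNReal.ofReal_mul hD]
    refine ENNReal.ofReal_le_ofReal ?_
    have h1 : t ^ (-(1 + 2 * r)) ≤ t ^ (-(1 + 2 * s₁)) :=
      Real.rpow_le_rpow_of_exponent_ge ht0 ht.2.le (by linarith)
    have h2 : t ^ (b - 1) = t ^ (-(1 + 2 * s₁)) * t ^ 2 := by
      rw [← Real.rpow_natCast t 2, ← Real.rpow_add ht0]
      congr 1
      push_cast
      rw [hb]; ring
    rw [h2]
    calc _ ≤ t ^ (-(1 + 2 * s₁)) * (D * t ^ 2) := by gcongr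
      _ = _ := by ring
  have hfinb : ∫⁻ t in Ioo (0 : ℝ) 1, ENNReal.ofReal D * ENNReal.ofReal (t ^ (b - 1)) ≠ ∞ := by
    rw [lintegral_const_mul' _ _ ENNReal.ofReal_ne_top, lintegral_rpow_sub_one hb0]
    exact ENNReal.mul_ne_top ENNReal.ofReal_ne_top ENNReal.ofReal_ne_top
  constructor
  · refine ENNReal.Tendsto.const_mul ?_ (Or.inr (by simp))
    refine tendsto_lintegral_filter_of_dominated_convergence
      (fun t => ENNReal.ofReal D * ENNReal.ofReal (t ^ (b - 1))) ?_ ?_ hfinb ?_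
    · exact Eventually.of_forall fun ε => by fun_prop
    · filter_upwards [hs.eventually_lt_const hs01] with ε hε
      filter_upwards [ae_restrict_mem measurableSet_Ioo] with t ht
      exact hbound _ hε.le t ht
    · filter_upwards [ae_restrict_mem measurableSet_Ioo] with t ht
      refine ENNReal.Tendsto.mul_const ?_ (Or.inr ?_)
      · refine (ENNReal.continuous_ofReal.tendsto _).comp ?_
        exact (Real.continuousAt_const_rpow ht.1.ne').tendsto.comp
          ((tendsto_const_nhds.add (tendsto_const_nhds.mul hs)).neg)
      · exact ((hDt t).trans_lt ENNReal.ofReal_lt_top).ne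
  · refine ENNReal.mul_ne_top (by simp) ?_
    exact ((setLIntegral_mono' measurableSet_Ioo (hbound s₀ hs01.le)).trans_lt hfinb.lt_top).ne

/-- With the splitting parameter η = ε^α the coefficient (1 + 1/η)ε^(2α) vanishes, and so does η
itself. -/
theorem tendsto_error_first {s : ℝ → ℝ} {s₀ α : ℝ} (hs : Tendsto s (𝓝[>] 0) (𝓝 s₀))
    (hα : 0 < α) (hα' : α - s₀ < 1 / 2) (D : ℝ) :
    Tendsto (fun ε : ℝ => (1 + 1 / ε ^ α) * D * ε ^ (2 * α) * constC n (s ε - α)) (𝓝[>] 0)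
      (𝓝 0) := by
  have h1 : Tendsto (fun ε : ℝ => ε ^ α) (𝓝[>] 0) (𝓝 0) := by
    have := (Real.continuousAt_rpow_const 0 α (Or.inr hα.le)).tendsto
    rw [Real.zero_rpow hα.ne'] at this
    exact this.mono_left nhdsWithin_le_nhds
  have h2 : Tendsto (fun ε : ℝ => constC n (s ε - α)) (𝓝[>] 0) (𝓝 (constC n (s₀ - α))) :=
    (continuousAt_constC (by linarith)).tendsto.comp (hs.sub_const α)
  have h3 : Tendsto (fun ε : ℝ => (ε ^ α * ε ^ α + ε ^ α) * D * constC n (s ε - α)) (𝓝[>] 0)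
      (𝓝 ((0 * 0 + 0) * D * constC n (s₀ - α))) :=
    (((h1.mul h1).add h1).mul_const D).mul h2
  rw [show (0 * 0 + 0) * D * constC n (s₀ - α) = 0 by ring] at h3
  refine h3.congr' ?_
  filter_upwards [self_mem_nhdsWithin] with ε hε
  have hε' : 0 < ε := hε
  have h4 : ε ^ (2 * α) = ε ^ α * ε ^ α := by rw [← Real.rpow_add hε']; congr 1; ring
  have h5 : 0 < ε ^ α := by positivity
  rw [h4]
  field_simp

theorem limsup_filmEnergy_le_vertForm (hω : IsOpen ω) (hfin : volume ω ≠ ∞) {f : Plane n × ℝ → ℝ}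
    (hf : ContDiff ℝ ((⊤ : ℕ∞) : WithTop ℕ∞) f) (hc : HasCompactSupport f) {v : FilmL2 ω}
    (hvf : v =ᵐ[volume.restrict (film ω 1)] f) {s : ℝ → ℝ} {s₀ : ℝ}
    (hs01 : ∀ ε, 0 < ε → s ε ∈ Ioo (0 : ℝ) 1)
    (hs : Tendsto s (𝓝[>] 0) (𝓝 s₀)) (hs₀ : 0 ≤ s₀) (hs₀' : s₀ < 1) :
    limsup (fun ε => filmEnergy ω (s ε) ε v / ENNReal.ofReal (ε ^ (1 - 2 * s ε))) (𝓝[>] 0) ≤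
      ENNReal.ofReal (constC n s₀) * vertForm ω s₀ f := by
  obtain ⟨D, hD, hDf⟩ := exists_filmEnergy_le hω hfin hf hc hvf
  obtain ⟨hV, hVfin⟩ := tendsto_vertForm hω hfin hf hc hs hs₀'
  obtain ⟨α, hα1, hα2⟩ : ∃ α, s₀ < α ∧ α < min 1 (s₀ + 1 / 2) :=
    exists_between (lt_min hs₀' (by linarith))
  have hα3 : α < 1 := hα2.trans_le (min_le_left _ _)
  have hα4 : α < s₀ + 1 / 2 := hα2.trans_le (min_le_right _ _)
  have hα0 : 0 < α := by linarith
  have h1 : Tendsto (fun ε : ℝ => ε ^ α) (𝓝[>] 0) (𝓝 0) := by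
    have := (Real.continuousAt_rpow_const 0 α (Or.inr hα0.le)).tendsto
    rw [Real.zero_rpow hα0.ne'] at this
    exact this.mono_left nhdsWithin_le_nhds
  have hlim1 : Tendsto (fun ε => ENNReal.ofReal ((1 + ε ^ α) * constC n (s ε))) (𝓝[>] 0)
      (𝓝 (ENNReal.ofReal (constC n s₀))) := by
    refine (ENNReal.continuous_ofReal.tendsto _).comp ?_
    have h2 := (h1.const_add 1).mul ((continuousAt_constC (n := n)
      (by linarith : -(1 / 2) < s₀)).tendsto.comp hs)
    rwa [add_zero, one_mul] at h2
  have hlim2 : Tendsto (fun ε => ENNReal.ofReal ((1 + 1 / ε ^ α) * D * ε ^ (2 * α) *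
      (constC n (s ε - α) / (α - s ε)))) (𝓝[>] 0) (𝓝 0) := by
    rw [← ENNReal.ofReal_zero]
    refine (ENNReal.continuous_ofReal.tendsto _).comp ?_
    have h2 := (tendsto_error_first (n := n) hs hα0 (by linarith) D).mul
      ((tendsto_const_nhds.sub hs).inv₀ (by linarith : α - s₀ ≠ 0))
    rw [zero_mul] at h2
    refine h2.congr fun ε => ?_
    rw [div_eq_mul_inv (constC n (s ε - α)), ← mul_assoc]
  have hlim := (ENNReal.Tendsto.mul hlim1 (Or.inr hVfin) hV (Or.inr ENNReal.ofReal_ne_top)).add hlim2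
  rw [add_zero] at hlim
  rw [← hlim.limsup_eq]
  refine limsup_le_limsup ?_
  filter_upwards [self_mem_nhdsWithin, hs.eventually_lt_const hα1,
    hs.eventually_const_lt (by linarith : α - 1 / 2 < s₀)] with ε hε h2 h3
  have hε' : 0 < ε := hε
  exact hDf α ⟨hα0, hα3.le⟩ (ε ^ α) (by positivity) ε hε' (s ε) (hs01 ε hε') h2 (by linarith)

/-- The fundamental theorem of calculus on vertical segments, which stay in the film, and
Cauchy-Schwarz in the parameter of the segment. -/
theorem shiftEnergy_vertical_le (hω : IsOpen ω) {f : Plane n × ℝ → ℝ}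
    (hf : ContDiff ℝ ((⊤ : ℕ∞) : WithTop ℕ∞) f) (t : ℝ) :
    shiftEnergy (film ω 1) f (0, t) ≤ ENNReal.ofReal (t ^ 2) *
      ∫⁻ x in film ω 1, ENNReal.ofReal (fderiv ℝ f x (0, 1) ^ 2) := by
  have hU := measurableSet_film hω.measurableSet 1
  have hi : Measurable ((film ω 1).indicator (1 : Plane n × ℝ → ℝ≥0∞)) :=
    measurable_one.indicator hU
  set g : Plane n × ℝ → ℝ := fun x => fderiv ℝ f x (0, 1) with hg
  have hgc : Continuous g := (hf.continuous_fderiv (by simp)).clm_apply continuous_const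
  have hgm : Measurable g := hgc.measurable
  have hgt : ∀ y, fderiv ℝ f y (0, t) = t * g y := fun y => by
    simpa [hg] using (fderiv ℝ f y).map_smul t ((0 : Plane n), (1 : ℝ))
  have hpt : ∀ x, ENNReal.ofReal ((f (x + (0, t)) - f x) ^ 2) ≤
      ENNReal.ofReal (t ^ 2) * ∫⁻ τ in Ioo (0 : ℝ) 1, ENNReal.ofReal (g (x + τ • (0, t)) ^ 2) := by
    intro x
    have hder : ∀ τ : ℝ, HasDerivAt (fun τ : ℝ => f (x + τ • ((0 : Plane n), t)))
        (t * g (x + τ • (0, t))) τ := by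
      intro τ
      have h1 : HasFDerivAt f (fderiv ℝ f (x + τ • ((0 : Plane n), t))) (x + τ • (0, t)) :=
        (hf.differentiable (by simp)).differentiableAt.hasFDerivAt
      have h2 : HasDerivAt (fun τ : ℝ => x + τ • ((0 : Plane n), t)) ((1 : ℝ) • (0, t)) τ :=
        ((hasDerivAt_id τ).smul_const _).const_add x
      have h3 := h1.comp_hasDerivAt τ h2
      rw [one_smul, hgt] at h3
      exact h3
    have hcont : Continuous fun τ : ℝ => t * g (x + τ • ((0 : Plane n), t)) := by fun_prop
    have h4 := intervalIntegral.integral_eq_sub_of_hasDerivAt (a := 0) (b := 1)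
      (fun τ _ => hder τ) (hcont.intervalIntegrable _ _)
    rw [one_smul, zero_smul, add_zero, intervalIntegral.integral_of_le zero_le_one,
      integral_Ioc_eq_integral_Ioo] at h4
    rw [← h4]
    have h5 := ofReal_sq_integral_mul_le (μ := volume.restrict (Ioo (0 : ℝ) 1))
      (f := fun _ => t) (g := fun τ => g (x + τ • ((0 : Plane n), t)))
      (by fun_prop) (by fun_prop)
    refine h5.trans (le_of_eq ?_)
    simp
  have hQ : ∀ τ ∈ Ioo (0 : ℝ) 1, ∫⁻ x, (film ω 1).indicator 1 x * (film ω 1).indicator 1 (x + (0, t)) *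
      ENNReal.ofReal (g (x + τ • (0, t)) ^ 2) ≤ 
      ∫⁻ x in film ω 1, ENNReal.ofReal (g x ^ 2) := by
    intro τ hτ
    rw [← lintegral_indicator hU]
    refine le_trans (lintegral_mono fun x => ?_) (lintegral_add_right_eq_self
      ((film ω 1).indicator fun x => ENNReal.ofReal (g x ^ 2)) (τ • ((0 : Plane n), t))).le
    by_cases h1 : x ∈ film ω 1
    swap
    · simp [h1]
    by_cases h2 : x + (0, t) ∈ film ω 1
    swap
    · simp [h2]
    have h3 : x + τ • ((0 : Plane n), t) ∈ film ω 1 := by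
      refine ⟨by simpa using h1.1, ?_⟩
      have h4 := h1.2
      have h5 := h2.2
      simp only [Prod.snd_add, Prod.smul_snd, smul_eq_mul] at h5 ⊢
      constructor
      · nlinarith [h4.1, h5.1, hτ.1, hτ.2]
      · nlinarith [h4.2, h5.2, hτ.1, hτ.2]
    simp only [indicator_of_mem h1, indicator_of_mem h2, indicator_of_mem h3, Pi.one_apply, one_mul,
      le_refl]
  rw [shiftEnergy_eq_lintegral hU]
  calc ∫⁻ x, (film ω 1).indicator 1 x * (film ω 1).indicator 1 (x + (0, t)) *
        ENNReal.ofReal ((f (x + (0, t)) - f x) ^ 2)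
      ≤ ∫⁻ x, ENNReal.ofReal (t ^ 2) * ∫⁻ τ in Ioo (0 : ℝ) 1,
        (film ω 1).indicator 1 x * (film ω 1).indicator 1 (x + (0, t)) *
        ENNReal.ofReal (g (x + τ • (0, t)) ^ 2) := by
        refine lintegral_mono fun x => ?_
        rw [lintegral_const_mul _ (by fun_prop), mul_left_comm]
        gcongr
        exact hpt x
    _ = ENNReal.ofReal (t ^ 2) * ∫⁻ τ in Ioo (0 : ℝ) 1, ∫⁻ x,
        (film ω 1).indicator 1 x * (film ω 1).indicator 1 (x + (0, t)) *
        ENNReal.ofReal (g (x + τ • (0, t)) ^ 2) := by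
        rw [lintegral_const_mul' _ _ ENNReal.ofReal_ne_top, lintegral_lintegral_swap]
        fun_prop
    _ ≤ ENNReal.ofReal (t ^ 2) * ∫⁻ τ in Ioo (0 : ℝ) 1,
        ∫⁻ x in film ω 1, ENNReal.ofReal (g x ^ 2) := by
        refine mul_le_mul_right (setLIntegral_mono' measurableSet_Ioo fun τ hτ => ?_) _
        exact hQ τ hτ
    _ = ENNReal.ofReal (t ^ 2) * ∫⁻ x in film ω 1, ENNReal.ofReal (g x ^ 2) := by simp

/-- Insert the quadratic bound on vertical increments and use 2(1-s) ∫ t^(1-2s) dt = 1. -/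
theorem one_sub_mul_vertForm_le (hω : IsOpen ω) {f : Plane n × ℝ → ℝ}
    (hf : ContDiff ℝ ((⊤ : ℕ∞) : WithTop ℕ∞) f) {s : ℝ} (hs : s < 1) :
    ENNReal.ofReal (1 - s) * vertForm ω s f ≤
      ∫⁻ x in film ω 1, ENNReal.ofReal (fderiv ℝ f x (0, 1) ^ 2) := by
  set B := ∫⁻ x in film ω 1, ENNReal.ofReal (fderiv ℝ f x (0, 1) ^ 2) with hB
  have hb : 0 < 2 - 2 * s := by linarith
  calc ENNReal.ofReal (1 - s) * vertForm ω s f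
      ≤ ENNReal.ofReal (1 - s) * (2 * ∫⁻ t in Ioo (0 : ℝ) 1,
        ENNReal.ofReal (t ^ (2 - 2 * s - 1)) * B) := by
        rw [vertForm]
        refine mul_le_mul_right (mul_le_mul_right
          (setLIntegral_mono' measurableSet_Ioo fun t ht => ?_) _) _
        have ht0 : 0 < t := ht.1
        refine (mul_le_mul_right (shiftEnergy_vertical_le hω hf t) _).trans (le_of_eq ?_)
        rw [← mul_assoc, ← ENNReal.ofReal_mul (by positivity), ← Real.rpow_natCast t 2,
          ← Real.rpow_add ht0]
        congr 3
        push_cast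
        ring
    _ = B := by
        rw [lintegral_mul_const _ (by fun_prop), lintegral_rpow_sub_one hb, ← mul_assoc, ← mul_assoc,
          show (2 : ℝ≥0∞) = ENNReal.ofReal 2 by simp, ← ENNReal.ofReal_mul (by linarith),
          ← ENNReal.ofReal_mul (by nlinarith), show (1 - s) * 2 * (1 / (2 - 2 * s)) = 1 by
            rw [mul_one_div, show (1 - s) * 2 = 2 - 2 * s by ring, div_self hb.ne']]
        simp

/-- Here α = 1, so the error carries the factor 1/(1-s), exactly the one removed by the
normalization. -/
theorem limsup_filmEnergy_le_verticalDirichlet (hω : IsOpen ω) (hfin : volume ω ≠ ∞)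
    {f : Plane n × ℝ → ℝ} (hf : ContDiff ℝ ((⊤ : ℕ∞) : WithTop ℕ∞) f) (hc : HasCompactSupport f)
    {v : FilmL2 ω} (hvf : v =ᵐ[volume.restrict (film ω 1)] f) {s : ℝ → ℝ}
    (hs01 : ∀ ε, 0 < ε → s ε ∈ Ioo (0 : ℝ) 1) (hs : Tendsto s (𝓝[>] 0) (𝓝 1))
    (hB : ∫⁻ x in film ω 1, ENNReal.ofReal (fderiv ℝ f x (0, 1) ^ 2) ≠ ∞) :
    limsup (fun ε => filmEnergy ω (s ε) ε v / ENNReal.ofReal (ε ^ (1 - 2 * s ε) / (1 - s ε)))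
      (𝓝[>] 0) ≤
      ENNReal.ofReal (constC n 1) * ∫⁻ x in film ω 1, ENNReal.ofReal (fderiv ℝ f x (0, 1) ^ 2) := by
  obtain ⟨D, hD, hDf⟩ := exists_filmEnergy_le hω hfin hf hc hvf
  set B := ∫⁻ x in film ω 1, ENNReal.ofReal (fderiv ℝ f x (0, 1) ^ 2)
  have h1 : Tendsto (fun ε : ℝ => ε ^ (1 : ℝ)) (𝓝[>] 0) (𝓝 0) := by
    simp only [Real.rpow_one]
    exact tendsto_id.mono_left nhdsWithin_le_nhds
  have hlim1 : Tendsto (fun ε => ENNReal.ofReal ((1 + ε ^ (1 : ℝ)) * constC n (s ε))) (𝓝[>] 0)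
      (𝓝 (ENNReal.ofReal (constC n 1))) := by
    refine (ENNReal.continuous_ofReal.tendsto _).comp ?_
    have h2 := (h1.const_add 1).mul ((continuousAt_constC (n := n)
      (by norm_num : -(1 / 2) < (1 : ℝ))).tendsto.comp hs)
    rwa [add_zero, one_mul] at h2
  have hlim2 : Tendsto (fun ε => ENNReal.ofReal ((1 + 1 / ε ^ (1 : ℝ)) * D * ε ^ (2 * (1 : ℝ)) *
      constC n (s ε - 1))) (𝓝[>] 0) (𝓝 0) := by
    rw [← ENNReal.ofReal_zero]
    exact (ENNReal.continuous_ofReal.tendsto _).comp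
      (tendsto_error_first (n := n) hs one_pos (by norm_num) D)
  have hlim := (ENNReal.Tendsto.mul_const hlim1 (Or.inr hB)).add hlim2
  rw [add_zero] at hlim
  rw [← hlim.limsup_eq]
  refine limsup_le_limsup ?_
  filter_upwards [self_mem_nhdsWithin, hs.eventually_const_lt (by norm_num : (1 / 2 : ℝ) < 1)]
    with ε hε h3
  have hε' : 0 < ε := hε
  have hs1 := hs01 ε hε'
  have hs2 : 0 < 1 - s ε := by linarith [hs1.2]
  have h4 := hDf 1 ⟨one_pos, le_rfl⟩ (ε ^ (1 : ℝ)) (by positivity) ε hε' (s ε) hs1 hs1.2 (by linarith)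
  have hC : 0 < constC n (s ε) := constC_pos (by linarith)
  rw [div_ofReal_eq_mul (b := ε ^ (1 - 2 * s ε)) (by positivity) (by positivity),
    show ε ^ (1 - 2 * s ε) / (ε ^ (1 - 2 * s ε) / (1 - s ε)) = 1 - s ε by field_simp]
  refine (mul_le_mul_left h4 _).trans ?_
  rw [add_mul]
  refine add_le_add ?_ (le_of_eq ?_)
  · rw [mul_assoc, mul_comm (vertForm ω (s ε) f)]
    gcongr
    exact one_sub_mul_vertForm_le hω hf hs1.2
  · rw [← ENNReal.ofReal_mul' hs2.le]
    congr 1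
    field_simp

end UpperFirst

/-! ### Upper bounds for smooth functions: second term -/

section UpperSecond

theorem lintegral_ball_radial (hn : 1 ≤ n) {h : ℝ → ℝ} {R : ℝ} (h0 : ∀ y ∈ Ioo 0 R, 0 ≤ h y)
    (hi : IntegrableOn (fun y => y ^ (n - 1) * h y) (Ioo 0 R)) :
    ∫⁻ z in Metric.ball (0 : Plane n) R, ENNReal.ofReal (h ‖z‖) =
      ENNReal.ofReal (sphereArea n * ∫ y in Ioo 0 R, y ^ (n - 1) * h y) := by
  have : Nonempty (Fin n) := ⟨⟨0, hn⟩⟩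
  set f : ℝ → ℝ := (Ioo 0 R).indicator h with hf
  have h1 : ∫⁻ z in Metric.ball (0 : Plane n) R, ENNReal.ofReal (h ‖z‖) =
      ∫⁻ z : Plane n, ENNReal.ofReal (f ‖z‖) := by
    rw [← lintegral_indicator Metric.isOpen_ball.measurableSet]
    refine lintegral_congr_ae ?_
    have : ∀ᵐ z : Plane n, z ≠ 0 := Measure.ae_ne volume 0
    filter_upwards [this] with z hz
    have hz0 : 0 < ‖z‖ := norm_pos_iff.2 hz
    by_cases hzR : ‖z‖ < R <;> simp [hf, indicator, hzR, hz0]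
  have h2 : ∀ y ∈ Ioi (0 : ℝ), y ^ (Module.finrank ℝ (Plane n) - 1) • f y =
      (Ioo 0 R).indicator (fun y => y ^ (n - 1) * h y) y := by
    intro y _
    by_cases hy : y ∈ Ioo 0 R
    · simp only [hf, indicator_of_mem hy, finrank_euclideanSpace, Fintype.card_fin, smul_eq_mul]
    · simp [hf, hy]
  have hint : Integrable (fun z : Plane n => f ‖z‖) := by
    rw [integrable_fun_norm_addHaar (volume : Measure (Plane n)),
      integrableOn_congr_fun h2 measurableSet_Ioi]
    exact (hi.integrable_indicator measurableSet_Ioo).integrableOn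
  rw [h1, ← ofReal_integral_eq_lintegral_ofReal hint (Eventually.of_forall fun z =>
    indicator_nonneg h0 _), integral_fun_norm_addHaar (volume : Measure (Plane n)) f,
    setIntegral_congr_fun measurableSet_Ioi h2, integral_indicator measurableSet_Ioo,
    Measure.restrict_restrict measurableSet_Ioo,
    inter_eq_left.2 (show Ioo 0 R ⊆ Ioi 0 from fun y hy => hy.1), sphereArea,
    Measure.toSphere_real_apply_univ]
  simp only [finrank_euclideanSpace, Fintype.card_fin, nsmul_eq_mul, smul_eq_mul, mul_assoc]

theorem lintegral_ball_rpow_ne_top (hn : 1 ≤ n) {b R : ℝ} (hb : 0 < b) :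
    ∫⁻ z in Metric.ball (0 : Plane n) R, ENNReal.ofReal (‖z‖ ^ (b - n)) ≠ ∞ := by
  have h1 : ∀ y ∈ Ioo 0 R, y ^ (n - 1) * y ^ (b - n) = y ^ (b - 1) := by
    intro y hy
    rw [← Real.rpow_natCast, ← Real.rpow_add hy.1, Nat.cast_sub hn]
    congr 1
    push_cast
    ring
  rw [lintegral_ball_radial hn (h := fun y => y ^ (b - n)) (fun y hy => Real.rpow_nonneg hy.1.le _)]
  · exact ENNReal.ofReal_ne_top
  · rw [integrableOn_congr_fun h1 measurableSet_Ioo]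
    rcases le_total R 0 with hR | hR
    · simp [hR]
    exact ((intervalIntegrable_iff_integrableOn_Ioo_of_le hR).1
      (intervalIntegral.intervalIntegrable_rpow' (by linarith)))

/-- In polar coordinates the integrand is at most y/(y² + a²), with primitive log(y² + a²)/2; the
end point 0 produces -log a. -/
theorem lintegral_ball_log_le (hn : 1 ≤ n) {a R : ℝ} (hR : 0 < R) (ha : 0 < a) (ha1 : a ≤ 1) :
    ∫⁻ z in Metric.ball (0 : Plane n) R,
      ENNReal.ofReal (1 / Real.sqrt (‖z‖ ^ 2 + a ^ 2) ^ (n + 2)) * ENNReal.ofReal (‖z‖ ^ 2) ≤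
      ENNReal.ofReal (sphereArea n * (Real.log (R ^ 2 + 1) / 2 - Real.log a)) := by
  have hσ := sphereArea_pos n hn
  have hpos : ∀ y : ℝ, 0 < y ^ 2 + a ^ 2 := fun y => by positivity
  have hcont : Continuous fun y : ℝ => 1 / Real.sqrt (y ^ 2 + a ^ 2) ^ (n + 2) * y ^ 2 :=
    (continuous_const.div (by fun_prop) fun y => (by have := hpos y; positivity)).mul (by fun_prop)
  have hcont2 : Continuous fun y : ℝ => y / (y ^ 2 + a ^ 2) :=
    continuous_id.div (by fun_prop) fun y => (hpos y).ne'
  have hi : IntegrableOn (fun y => y ^ (n - 1) * (1 / Real.sqrt (y ^ 2 + a ^ 2) ^ (n + 2) * y ^ 2))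
      (Ioo 0 R) :=
    ((by fun_prop : Continuous _).integrableOn_Icc (a := 0) (b := R)).mono_set Ioo_subset_Icc_self
  have hi2 : IntegrableOn (fun y : ℝ => y / (y ^ 2 + a ^ 2)) (Ioo 0 R) :=
    (hcont2.integrableOn_Icc (a := 0) (b := R)).mono_set Ioo_subset_Icc_self
  simp_rw [← ENNReal.ofReal_mul' (sq_nonneg _)]
  rw [lintegral_ball_radial hn (h := fun y => 1 / Real.sqrt (y ^ 2 + a ^ 2) ^ (n + 2) * y ^ 2)
    (fun y _ => by positivity) hi]
  refine ENNReal.ofReal_le_ofReal (mul_le_mul_of_nonneg_left ?_ hσ.le)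
  have h1 : ∫ y in Ioo 0 R, y ^ (n - 1) * (1 / Real.sqrt (y ^ 2 + a ^ 2) ^ (n + 2) * y ^ 2) ≤
      ∫ y in Ioo 0 R, y / (y ^ 2 + a ^ 2) := by
    refine setIntegral_mono_on hi hi2 measurableSet_Ioo fun y hy => ?_
    have hy0 : 0 < y := hy.1
    have h2 : y ≤ Real.sqrt (y ^ 2 + a ^ 2) := Real.le_sqrt_of_sq_le (by nlinarith)
    have h3 : 0 < Real.sqrt (y ^ 2 + a ^ 2) := hy0.trans_le h2
    have h4 : Real.sqrt (y ^ 2 + a ^ 2) ^ 2 = y ^ 2 + a ^ 2 := Real.sq_sqrt (hpos y).le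
    obtain ⟨k, rfl⟩ : ∃ k, n = k + 1 := ⟨n - 1, by omega⟩
    rw [Nat.add_sub_cancel]
    generalize Real.sqrt (y ^ 2 + a ^ 2) = q at h2 h3 h4 ⊢
    rw [← h4]
    have h5 : y ^ (k + 1) ≤ q ^ (k + 1) := by gcongr
    rw [one_div_mul_eq_div, mul_div_assoc', div_le_div_iff₀ (by positivity) (by positivity)]
    calc y ^ k * y ^ 2 * q ^ 2 = y ^ (k + 1) * (y * q ^ 2) := by ring
      _ ≤ q ^ (k + 1) * (y * q ^ 2) := by gcongr
      _ = y * q ^ (k + 1 + 2) := by ring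
  refine h1.trans ?_
  have h6 : ∀ y ∈ uIcc 0 R, HasDerivAt (fun y : ℝ => Real.log (y ^ 2 + a ^ 2) / 2)
      (y / (y ^ 2 + a ^ 2)) y := by
    intro y _
    have h7 := (((hasDerivAt_pow 2 y).add_const (a ^ 2)).log (hpos y).ne').div_const 2
    refine h7.congr_deriv ?_
    simp only [Nat.cast_ofNat, Nat.add_one_sub_one, pow_one]
    ring
  have h8 := intervalIntegral.integral_eq_sub_of_hasDerivAt h6 (hcont2.intervalIntegrable _ _)
  rw [intervalIntegral.integral_of_le hR.le, integral_Ioc_eq_integral_Ioo] at h8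
  rw [h8]
  have h9 : Real.log (R ^ 2 + a ^ 2) ≤ Real.log (R ^ 2 + 1) :=
    Real.log_le_log (hpos R) (by nlinarith)
  have h10 : Real.log (0 ^ 2 + a ^ 2) = 2 * Real.log a := by
    rw [zero_pow two_ne_zero, zero_add, Real.log_pow]; norm_num
  rw [h10]
  linarith

/-- Bounds for the increments of a smooth planar function. -/
theorem exists_shiftEnergy_planar_le (hbdd : Bornology.IsBounded ω)
    {f : Plane n → ℝ} (hf : ContDiff ℝ ((⊤ : ℕ∞) : WithTop ℕ∞) f) (hc : HasCompactSupport f) :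
    ∃ D R : ℝ, 0 ≤ D ∧ 1 ≤ R ∧ (∀ z, shiftEnergy ω f z ≤ ENNReal.ofReal (D * ‖z‖ ^ 2)) ∧
      (∀ z, R ≤ ‖z‖ → shiftEnergy ω f z = 0) ∧
      ∀ β ∈ Icc (0 : ℝ) 1, ∀ z, shiftEnergy ω f z ≤
        (∫⁻ x in ω, ENNReal.ofReal (fderiv ℝ f x z ^ 2)) + ENNReal.ofReal (D * ‖z‖ ^ (2 + β)) := by
  obtain ⟨A, hA, hfA⟩ := exists_lipschitz_bound hf hc
  have hcd : HasCompactSupport (fderiv ℝ f) := hc.fderiv ℝ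
  have hfd : ContDiff ℝ 1 (fderiv ℝ f) := (contDiff_infty_iff_fderiv.1 hf).2.of_le (by simp)
  obtain ⟨C, hC⟩ := ContDiff.lipschitzWith_of_hasCompactSupport hcd hfd one_ne_zero
  obtain ⟨B, hB⟩ := hcd.exists_bound_of_continuous hfd.continuous
  have hB0 : 0 ≤ B := (norm_nonneg _).trans (hB 0)
  set m : ℝ := (volume ω).toReal with hm
  have hm' : volume ω = ENNReal.ofReal m := (ENNReal.ofReal_toReal hbdd.measure_lt_top.ne).symm
  have hm0 : 0 ≤ m := ENNReal.toReal_nonneg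
  obtain ⟨r, hr⟩ := hbdd.subset_closedBall 0
  -- C is the Lipschitz constant of the derivative: C(A+B)|z|³ bounds the squared increment minus
  -- the squared derivative, which is used for |z| ≤ 1. For |z| ≥ 1 the Lipschitz bound A²|z|² alone
  -- suffices.
  set D : ℝ := C * (A + B) + A ^ 2 with hD
  have hD0 : 0 ≤ D := by positivity
  have hAD : A ^ 2 ≤ D := by rw [hD]; have : 0 ≤ C * (A + B) := by positivity
                             linarith
  have hconst : ∀ (z : Plane n) (a : ℝ), 0 ≤ a →
      ∫⁻ x in ω ∩ (fun x => x + z) ⁻¹' ω, ENNReal.ofReal (D * a) ≤ ENNReal.ofReal (D * m * a) := by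
    intro z a ha
    rw [setLIntegral_const]
    calc _ ≤ ENNReal.ofReal (D * a) * volume ω := by gcongr; exact inter_subset_left
      _ = ENNReal.ofReal (D * m * a) := by
        rw [hm', ← ENNReal.ofReal_mul (by positivity)]
        congr 1; ring
  refine ⟨D * m, max 1 (2 * r + 1), by positivity, le_max_left _ _, fun z => ?_, fun z hz => ?_,
    fun β hβ z => ?_⟩
  · refine le_trans (lintegral_mono fun x => ENNReal.ofReal_le_ofReal ?_)
      (hconst z (‖z‖ ^ 2) (by positivity))
    have h1 := (hfA (x + z) x).1
    rw [add_sub_cancel_left] at h1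
    calc (f (x + z) - f x) ^ 2 = |f (x + z) - f x| ^ 2 := (sq_abs _).symm
      _ ≤ (A * ‖z‖) ^ 2 := by gcongr
      _ = A ^ 2 * ‖z‖ ^ 2 := by ring
      _ ≤ D * ‖z‖ ^ 2 := by gcongr
  · have h1 : ω ∩ (fun x => x + z) ⁻¹' ω = ∅ := by
      refine eq_empty_of_forall_notMem fun x hx => ?_
      have h2 := hr hx.1
      have h3 := hr hx.2
      rw [mem_closedBall_zero_iff] at h2 h3
      have h4 := norm_sub_le (x + z) x
      rw [add_sub_cancel_left] at h4
      have h5 := le_max_right 1 (2 * r + 1)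
      linarith
    rw [shiftEnergy, h1]
    simp
  · have hpt : ∀ x, ENNReal.ofReal ((f (x + z) - f x) ^ 2) ≤
        ENNReal.ofReal (fderiv ℝ f x z ^ 2) + ENNReal.ofReal (D * ‖z‖ ^ (2 + β)) := by
      intro x
      rw [← ENNReal.ofReal_add (sq_nonneg _) (by positivity)]
      refine ENNReal.ofReal_le_ofReal ?_
      have h1 := (hfA (x + z) x).1
      rw [add_sub_cancel_left] at h1
      have h2 : |fderiv ℝ f x z| ≤ B * ‖z‖ := ((fderiv ℝ f x).le_opNorm z).trans
        (by gcongr; exact hB x)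
      have h3 : |f (x + z) - f x - fderiv ℝ f x z| ≤ C * ‖z‖ * ‖z‖ := by
        have h4 := (convex_closedBall x ‖z‖).norm_image_sub_le_of_norm_fderiv_le' (𝕜 := ℝ) (f := f)
          (φ := fderiv ℝ f x) (C := C * ‖z‖) (x := x) (y := x + z)
          (fun y _ => (hf.differentiable (by simp)).differentiableAt) (fun y hy => by
            have h5 := hC.dist_le_mul y x
            rw [dist_eq_norm (fderiv ℝ f y)] at h5
            exact h5.trans (by gcongr; exact hy)) (Metric.mem_closedBall_self (norm_nonneg z))
            (by simp)
        rwa [add_sub_cancel_left] at h4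
      rcases le_total ‖z‖ 1 with hz | hz
      · have h5 : (f (x + z) - f x) ^ 2 - fderiv ℝ f x z ^ 2 ≤ C * (A + B) * ‖z‖ ^ 3 := by
          calc (f (x + z) - f x) ^ 2 - fderiv ℝ f x z ^ 2
              = (f (x + z) - f x - fderiv ℝ f x z) * (f (x + z) - f x + fderiv ℝ f x z) := by ring
            _ ≤ |f (x + z) - f x - fderiv ℝ f x z| * |f (x + z) - f x + fderiv ℝ f x z| := by
                rw [← abs_mul]; exact le_abs_self _
            _ ≤ (C * ‖z‖ * ‖z‖) * (A * ‖z‖ + B * ‖z‖) := by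
                gcongr
                exact (abs_add_le _ _).trans (add_le_add h1 h2)
            _ = _ := by ring
        have h6 : ‖z‖ ^ 3 ≤ ‖z‖ ^ (2 + β) := by
          rcases (norm_nonneg z).eq_or_lt with h | h
          · rw [← h, Real.zero_rpow (by linarith [hβ.1])]; norm_num
          rw [← Real.rpow_natCast]
          exact Real.rpow_le_rpow_of_exponent_ge h hz (by push_cast; linarith [hβ.2])
        have h7 : C * (A + B) * ‖z‖ ^ 3 ≤ D * ‖z‖ ^ (2 + β) := by
          gcongr
          rw [hD]; nlinarith
        linarith
      · have h5 : (f (x + z) - f x) ^ 2 ≤ D * ‖z‖ ^ (2 + β) := by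
          calc (f (x + z) - f x) ^ 2 = |f (x + z) - f x| ^ 2 := (sq_abs _).symm
            _ ≤ (A * ‖z‖) ^ 2 := by gcongr
            _ = A ^ 2 * ‖z‖ ^ 2 := by ring
            _ ≤ D * ‖z‖ ^ (2 + β) := by
                gcongr
                rw [← Real.rpow_natCast]
                exact Real.rpow_le_rpow_of_exponent_le hz (by push_cast; linarith [hβ.1])
        nlinarith [sq_nonneg (fderiv ℝ f x z)]
    calc shiftEnergy ω f z ≤ ∫⁻ x in ω ∩ (fun x => x + z) ⁻¹' ω,
          (ENNReal.ofReal (fderiv ℝ f x z ^ 2) + ENNReal.ofReal (D * ‖z‖ ^ (2 + β))) :=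
          lintegral_mono fun x => hpt x
      _ = (∫⁻ x in ω ∩ (fun x => x + z) ⁻¹' ω, ENNReal.ofReal (fderiv ℝ f x z ^ 2)) +
          ∫⁻ x in ω ∩ (fun x => x + z) ⁻¹' ω, ENNReal.ofReal (D * ‖z‖ ^ (2 + β)) :=
          lintegral_add_right _ measurable_const
      _ ≤ _ := add_le_add (lintegral_mono_set inter_subset_left) (hconst z _ (by positivity))

theorem lintegral_fderiv_sq_ne_top (hbdd : Bornology.IsBounded ω)
    {f : Plane n → ℝ} (hf : ContDiff ℝ ((⊤ : ℕ∞) : WithTop ℕ∞) f) (hc : HasCompactSupport f) :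
    ∫⁻ x in ω, ENNReal.ofReal (‖fderiv ℝ f x‖ ^ 2) ≠ ∞ := by
  obtain ⟨B, hB⟩ := (hc.fderiv ℝ).exists_bound_of_continuous (hf.continuous_fderiv (by simp))
  have h1 : ∫⁻ x in ω, ENNReal.ofReal (‖fderiv ℝ f x‖ ^ 2) ≤ ∫⁻ x in ω, ENNReal.ofReal (B ^ 2) :=
    lintegral_mono fun x => ENNReal.ofReal_le_ofReal (pow_le_pow_left₀ (norm_nonneg _) (hB x) 2)
  refine (h1.trans_lt ?_).ne
  rw [setLIntegral_const]
  exact ENNReal.mul_lt_top ENNReal.ofReal_lt_top hbdd.measure_lt_top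

/-- Averaging of the squared directional derivatives against a radial kernel. -/
theorem lintegral_radial_fderiv_sq {f : Plane n → ℝ}
    (hf : ContDiff ℝ ((⊤ : ℕ∞) : WithTop ℕ∞) f) {k : Plane n → ℝ≥0∞} (hk : Measurable k)
    (hrad : ∀ ξ η, ‖ξ‖ = ‖η‖ → k ξ = k η) :
    n * ∫⁻ ξ, k ξ * ∫⁻ x in ω, ENNReal.ofReal (fderiv ℝ f x ξ ^ 2) =
      (∫⁻ x in ω, ENNReal.ofReal (‖fderiv ℝ f x‖ ^ 2)) * ∫⁻ ξ, k ξ * ENNReal.ofReal (‖ξ‖ ^ 2) := by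
  have hfc : Continuous (fderiv ℝ f) := hf.continuous_fderiv (by simp)
  have hjoint : Measurable fun q : Plane n × Plane n => fderiv ℝ f q.2 q.1 :=
    ((hfc.comp continuous_snd).clm_apply continuous_fst).measurable
  have hx : ∀ ξ, Measurable fun x => fderiv ℝ f x ξ := fun ξ =>
    (hfc.clm_apply continuous_const).measurable
  have h1 : ∫⁻ ξ, k ξ * ∫⁻ x in ω, ENNReal.ofReal (fderiv ℝ f x ξ ^ 2) =
      ∫⁻ x in ω, ∫⁻ ξ, k ξ * ENNReal.ofReal (fderiv ℝ f x ξ ^ 2) := by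
    rw [← lintegral_lintegral_swap]
    · refine lintegral_congr fun ξ => ?_
      have := hx ξ
      rw [lintegral_const_mul _ (by fun_prop)]
    · exact ((hk.comp measurable_fst).mul (hjoint.pow_const 2).ennreal_ofReal).aemeasurable
  have hnorm : Measurable fun x => ‖fderiv ℝ f x‖ := hfc.norm.measurable
  rw [h1, ← lintegral_mul_const _ (by fun_prop), ← lintegral_const_mul' _ _ (by simp)]
  refine lintegral_congr fun x => ?_
  obtain ⟨g, hg⟩ := (InnerProductSpace.toDual ℝ (Plane n)).surjective (fderiv ℝ f x)
  have h2 := lintegral_radial_inner_sq hk hrad g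
  have h3 : ‖fderiv ℝ f x‖ = ‖g‖ := by rw [← hg, LinearIsometryEquiv.norm_map]
  have h4 : ∀ ξ, fderiv ℝ f x ξ = inner ℝ ξ g := fun ξ => by
    rw [← hg, InnerProductSpace.toDual_apply_apply, real_inner_comm]
  simp_rw [h4, h3]
  exact h2

variable {f : Plane n → ℝ} {v : FilmL2 ω}

theorem shiftEnergy_of_planar_fun (hω : IsOpen ω) (hfm : Measurable f)
    (hvf : v =ᵐ[volume.restrict (film ω 1)] fun x => f x.1) (z : Plane n) {t : ℝ} (ht : 0 ≤ t) :
    shiftEnergy (film ω 1) v (z, t) = ENNReal.ofReal (1 - t) * shiftEnergy ω f z := by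
  rw [shiftEnergy_congr (measurableSet_film hω.measurableSet 1) hvf,
    shiftEnergy_comp_fst hω.measurableSet hfm z ht]

theorem filmEnergy_of_planar (hω : IsOpen ω) (hfm : Measurable f)
    (hvf : v =ᵐ[volume.restrict (film ω 1)] fun x => f x.1) {ε : ℝ} (hε : 0 < ε) (s : ℝ) :
    filmEnergy ω s ε v / ENNReal.ofReal (ε ^ 2) = ENNReal.ofReal 2 * ∫⁻ t in Ioo (0 : ℝ) 1,
      ENNReal.ofReal (1 - t) * ∫⁻ z : Plane n, ENNReal.ofReal (filmKernel n s ε z t) *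
        shiftEnergy ω f z := by
  rw [filmEnergy, gagliardo_eq_half hω.measurableSet hε _ (measurable_coe_Lp _),
    ofReal_mul_div_ofReal (by norm_num) (by positivity)]
  congr 1
  refine setLIntegral_congr_fun measurableSet_Ioo fun t ht => ?_
  rw [← lintegral_const_mul' _ _ ENNReal.ofReal_ne_top]
  refine lintegral_congr fun z => ?_
  rw [shiftEnergy_of_planar_fun hω hfm hvf z ht.1.le]
  ring

/-- Dropping the vertical distance increases the kernel, and the weight in t has 2∫(1 - t) dt = 1.
-/
theorem filmEnergy_of_planar_le (hω : IsOpen ω) (hfm : Measurable f)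
    (hvf : v =ᵐ[volume.restrict (film ω 1)] fun x => f x.1) {ε s : ℝ} (hε : 0 < ε) (hs : 0 ≤ s) :
    filmEnergy ω s ε v / ENNReal.ofReal (ε ^ 2) ≤
      ∫⁻ z : Plane n, ENNReal.ofReal (1 / ‖z‖ ^ (((n : ℝ) + 1) + 2 * s)) * shiftEnergy ω f z := by
  rw [filmEnergy_of_planar hω hfm hvf hε]
  set P := ∫⁻ z : Plane n, ENNReal.ofReal (1 / ‖z‖ ^ (((n : ℝ) + 1) + 2 * s)) * shiftEnergy ω f z
  calc _ ≤ ENNReal.ofReal 2 * ∫⁻ t in Ioo (0 : ℝ) 1, ENNReal.ofReal (1 - t) * P := by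
        refine mul_le_mul_right (lintegral_mono fun t => mul_le_mul_right
          (lintegral_mono fun z => ?_) _) _
        rcases eq_or_ne z 0 with rfl | hz
        · simp [shiftEnergy]
        have hz' : 0 < ‖z‖ := norm_pos_iff.2 hz
        gcongr
        rw [filmKernel]
        gcongr
        exact Real.le_sqrt_of_sq_le (by nlinarith [sq_nonneg (ε * t)])
    _ = P := by
        rw [lintegral_mul_const _ (by fun_prop), lintegral_one_sub, ← mul_assoc,
          ← ENNReal.ofReal_mul (by norm_num)]
        norm_num

/-- The energy is bounded by the planar one with the same exponent, and dominated convergence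
applies. The increments are O(|z|²) and vanish for large z, so the integrand is O(|z|^(1-2s-n)),
integrable near 0 because s₀ < 1/2. -/
theorem limsup_filmEnergy_le_planar (hn : 1 ≤ n) (hω : IsOpen ω) (hbdd : Bornology.IsBounded ω)
    (hf : ContDiff ℝ ((⊤ : ℕ∞) : WithTop ℕ∞) f) (hc : HasCompactSupport f)
    (hvf : v =ᵐ[volume.restrict (film ω 1)] fun x => f x.1) {s : ℝ → ℝ} {s₀ : ℝ}
    (hs01 : ∀ ε, 0 < ε → s ε ∈ Ioo (0 : ℝ) 1)
    (hs : Tendsto s (𝓝[>] 0) (𝓝 s₀)) (hs₀ : 0 ≤ s₀) (hs₀' : s₀ < 1 / 2) :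
    limsup (fun ε => filmEnergy ω (s ε) ε v / ENNReal.ofReal (ε ^ 2)) (𝓝[>] 0) ≤
      ∫⁻ z : Plane n, ENNReal.ofReal (1 / ‖z‖ ^ (((n : ℝ) + 1) + 2 * s₀)) * shiftEnergy ω f z ∧
    ∫⁻ z : Plane n, ENNReal.ofReal (1 / ‖z‖ ^ (((n : ℝ) + 1) + 2 * s₀)) * shiftEnergy ω f z ≠ ∞ := by
  have hfm : Measurable f := hf.continuous.measurable
  obtain ⟨D, R, hD, hR, hQ, hQ0, -⟩ := exists_shiftEnergy_planar_le hbdd hf hc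
  have hQm : Measurable (shiftEnergy ω f) := measurable_shiftEnergy hω.measurableSet hfm
  obtain ⟨s₁, hs1, hs1'⟩ := exists_between hs₀'
  have hn' : (1 : ℝ) ≤ n := by exact_mod_cast hn
  have hbound : ∀ r, 0 ≤ r → r ≤ s₁ → ∀ z : Plane n,
      ENNReal.ofReal (1 / ‖z‖ ^ (((n : ℝ) + 1) + 2 * r)) * shiftEnergy ω f z ≤
      (Metric.ball (0 : Plane n) R).indicator (fun z => ENNReal.ofReal D *
        (ENNReal.ofReal (‖z‖ ^ ((1 - 2 * s₁) - n)) + 1)) z := by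
    intro r hr0 hr z
    by_cases hz : z ∈ Metric.ball (0 : Plane n) R
    swap
    · rw [hQ0 z (by simpa using hz)]; simp
    rw [indicator_of_mem hz]
    rcases eq_or_ne z 0 with rfl | hz0
    · simp [shiftEnergy]
    have hz' : 0 < ‖z‖ := norm_pos_iff.2 hz0
    refine (mul_le_mul_right (hQ z) _).trans ?_
    rw [← ENNReal.ofReal_one, ← ENNReal.ofReal_add (by positivity) zero_le_one,
      ← ENNReal.ofReal_mul (by positivity), ← ENNReal.ofReal_mul hD]
    refine ENNReal.ofReal_le_ofReal ?_
    have h1 : 1 / ‖z‖ ^ (((n : ℝ) + 1) + 2 * r) * (D * ‖z‖ ^ 2) = D * ‖z‖ ^ ((1 - 2 * r) - n) := by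
      rw [one_div, ← Real.rpow_neg hz'.le, ← Real.rpow_natCast, mul_left_comm, ← Real.rpow_add hz']
      congr 2
      push_cast
      ring
    rw [h1]
    gcongr
    rcases le_total ‖z‖ 1 with h | h
    · have h2 : ‖z‖ ^ ((1 - 2 * r) - n) ≤ ‖z‖ ^ ((1 - 2 * s₁) - n) :=
        Real.rpow_le_rpow_of_exponent_ge hz' h (by linarith)
      linarith
    · have h2 : ‖z‖ ^ ((1 - 2 * r) - n) ≤ 1 := Real.rpow_le_one_of_one_le_of_nonpos h (by linarith)
      have h3 : 0 ≤ ‖z‖ ^ ((1 - 2 * s₁) - n) := by positivity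
      linarith
  have hfinb : ∫⁻ z, (Metric.ball (0 : Plane n) R).indicator (fun z => ENNReal.ofReal D *
        (ENNReal.ofReal (‖z‖ ^ ((1 - 2 * s₁) - n)) + 1)) z ≠ ∞ := by
    rw [lintegral_indicator Metric.isOpen_ball.measurableSet,
      lintegral_const_mul' _ _ ENNReal.ofReal_ne_top, lintegral_add_right _ measurable_const]
    refine ENNReal.mul_ne_top ENNReal.ofReal_ne_top (ENNReal.add_ne_top.2
      ⟨lintegral_ball_rpow_ne_top hn (by linarith), ?_⟩)
    rw [setLIntegral_const, one_mul]
    exact Metric.isBounded_ball.measure_lt_top.ne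
  constructor
  · have hlim : Tendsto (fun ε => ∫⁻ z : Plane n, ENNReal.ofReal
        (1 / ‖z‖ ^ (((n : ℝ) + 1) + 2 * s ε)) * shiftEnergy ω f z) (𝓝[>] 0)
        (𝓝 (∫⁻ z : Plane n, ENNReal.ofReal (1 / ‖z‖ ^ (((n : ℝ) + 1) + 2 * s₀)) *
          shiftEnergy ω f z)) := by
      refine tendsto_lintegral_filter_of_dominated_convergence _ ?_ ?_ hfinb ?_
      · exact Eventually.of_forall fun ε => by fun_prop
      · filter_upwards [hs.eventually_lt_const hs1, self_mem_nhdsWithin] with ε hε hε0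
        exact Eventually.of_forall fun z => hbound _ (hs01 ε hε0).1.le hε.le z
      · refine Eventually.of_forall fun z => ?_
        rcases eq_or_ne z 0 with rfl | hz0
        · simp [shiftEnergy]
        have hz' : 0 < ‖z‖ := norm_pos_iff.2 hz0
        refine ENNReal.Tendsto.mul_const ((ENNReal.continuous_ofReal.tendsto _).comp ?_)
          (Or.inr ((hQ z).trans_lt ENNReal.ofReal_lt_top).ne)
        simp only [one_div]
        refine Tendsto.inv₀ ?_ (by positivity)
        exact (Real.continuousAt_const_rpow hz'.ne').tendsto.comp
          (tendsto_const_nhds.add (tendsto_const_nhds.mul hs))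
    rw [← hlim.limsup_eq]
    refine limsup_le_limsup ?_
    filter_upwards [self_mem_nhdsWithin] with ε hε
    exact filmEnergy_of_planar_le hω hfm hvf hε (hs01 ε hε).1.le
  · exact ((lintegral_mono (hbound s₀ hs₀ hs1.le)).trans_lt hfinb.lt_top).ne

/-- The quadratic part of the increments, averaged over the radial kernel, gives (3-2s)K times the
Dirichlet integral. The remainder |εtξ|^(2+β) is of lower order in ε and integrable in ξ because β <
2s - 1. The weight (1-t)t^(1-2s) integrates to 1/((2-2s)(3-2s)), which explains the division by 1 -
s in the scale. -/
theorem exists_filmEnergy_planar_le (hn : 1 ≤ n) (hω : IsOpen ω) (hbdd : Bornology.IsBounded ω)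
    (hf : ContDiff ℝ ((⊤ : ℕ∞) : WithTop ℕ∞) f) (hc : HasCompactSupport f)
    (hvf : v =ᵐ[volume.restrict (film ω 1)] fun x => f x.1) :
    ∃ D : ℝ, 0 ≤ D ∧ ∀ β ∈ Icc (0 : ℝ) 1, ∀ ε > 0, ∀ s ∈ Ioo (0 : ℝ) 1, β < 2 * s - 1 →
      filmEnergy ω s ε v / ENNReal.ofReal (ε ^ (3 - 2 * s) / (1 - s)) ≤
        ENNReal.ofReal (constK n s) * (∫⁻ x in ω, ENNReal.ofReal (‖fderiv ℝ f x‖ ^ 2)) +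
        ENNReal.ofReal (D * ε ^ β * constC n (s - (1 + β / 2))) := by
  have hfm : Measurable f := hf.continuous.measurable
  have hn' : (0 : ℝ) < n := by exact_mod_cast hn
  obtain ⟨D, R, hD, hR, -, -, hQ⟩ := exists_shiftEnergy_planar_le hbdd hf hc
  have hQm : Measurable (shiftEnergy ω f) := measurable_shiftEnergy hω.measurableSet hfm
  refine ⟨D, hD, fun β hβ ε hε s hs hsβ => ?_⟩
  have hs1 : 0 < 1 - s := by linarith [hs.2]
  have hs2 : 1 / 2 < s := by linarith [hβ.1]
  have hs3 : 0 < 3 - 2 * s := by linarith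
  have hK := constK_pos hn hs2 (by linarith)
  have hC : 0 < constC n (s - (1 + β / 2)) := constC_pos (by linarith)
  set B := ∫⁻ x in ω, ENNReal.ofReal (‖fderiv ℝ f x‖ ^ 2) with hB
  have hBfin : B ≠ ∞ := lintegral_fderiv_sq_ne_top hbdd hf hc
  set M : Plane n → ℝ≥0∞ := fun ξ => ∫⁻ x in ω, ENNReal.ofReal (fderiv ℝ f x ξ ^ 2) with hM
  have hMhom : ∀ (c : ℝ) (ξ : Plane n), M (c • ξ) = ENNReal.ofReal (c ^ 2) * M ξ := by
    intro c ξ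
    simp only [hM]
    rw [← lintegral_const_mul' _ _ ENNReal.ofReal_ne_top]
    refine lintegral_congr fun x => ?_
    rw [map_smul, smul_eq_mul, mul_pow, ENNReal.ofReal_mul (sq_nonneg _)]
  have hMm : Measurable M := by
    have hfc : Continuous (fderiv ℝ f) := hf.continuous_fderiv (by simp)
    have hjoint : Measurable fun q : Plane n × Plane n => fderiv ℝ f q.2 q.1 :=
      ((hfc.comp continuous_snd).clm_apply continuous_fst).measurable
    exact ((hjoint.pow_const 2).ennreal_ofReal).lintegral_prod_right'
  have hkm := (measurable_ker (n := n) s).ennreal_ofReal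
  have hkm' := (measurable_ker (n := n) (s - (1 + β / 2))).ennreal_ofReal
  have hmain : ∫⁻ ξ : Plane n, ENNReal.ofReal (ker n s ξ) * M ξ =
      ENNReal.ofReal ((3 - 2 * s) * constK n s) * B := by
    have h1 := lintegral_radial_fderiv_sq (ω := ω) hf hkm (fun ξ η h => by simp [ker, h])
    rw [lintegral_sq_mul_ker hs2] at h1
    have h2 : (n : ℝ≥0∞) ≠ 0 := by simp; omega
    refine (ENNReal.mul_right_inj h2 (by simp)).1 ?_
    rw [h1, ← mul_assoc, show (n : ℝ≥0∞) = ENNReal.ofReal n by simp, ← ENNReal.ofReal_mul hn'.le,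
      mul_comm]
    congr 2
    rw [constK_eq hs2]
    have := hs3.ne'
    generalize 3 - 2 * s = d at this ⊢
    field_simp
  have hpt : ∀ t ∈ Ioo (0 : ℝ) 1, ∫⁻ ξ : Plane n, ENNReal.ofReal (t ^ (-(1 + 2 * s))) *
      (ENNReal.ofReal (ker n s ξ) * shiftEnergy (film ω 1) v ((ε * t) • ξ, t)) ≤
      ENNReal.ofReal (ε ^ 2 * ((3 - 2 * s) * constK n s)) * B *
        ENNReal.ofReal (t ^ (2 - 2 * s - 1) * (1 - t)) +
      ENNReal.ofReal (ε ^ 2 * (D * ε ^ β * constC n (s - (1 + β / 2)))) *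
        ENNReal.ofReal (t ^ (2 - 2 * s - 1)) := by
    intro t ht
    have ht0 : 0 < t := ht.1
    have ht1 : 0 < 1 - t := by linarith [ht.2]
    have e1 : t ^ (2 - 2 * s - 1) = t ^ (-(1 + 2 * s)) * t ^ 2 := by
      rw [← Real.rpow_natCast t 2, ← Real.rpow_add ht0]; congr 1; push_cast; ring
    have h1 : ∀ ξ : Plane n, ENNReal.ofReal (t ^ (-(1 + 2 * s))) *
        (ENNReal.ofReal (ker n s ξ) * shiftEnergy (film ω 1) v ((ε * t) • ξ, t)) ≤
        ENNReal.ofReal (ε ^ 2 * (t ^ (2 - 2 * s - 1) * (1 - t))) *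
          (ENNReal.ofReal (ker n s ξ) * M ξ) +
        ENNReal.ofReal (ε ^ 2 * (D * ε ^ β) * t ^ (2 - 2 * s - 1)) *
          ENNReal.ofReal (ker n (s - (1 + β / 2)) ξ) := by
      intro ξ
      have hk0 := (ker_pos s ξ).le
      rw [shiftEnergy_of_planar_fun hω hfm hvf _ ht0.le]
      calc _ ≤ ENNReal.ofReal (t ^ (-(1 + 2 * s))) * (ENNReal.ofReal (ker n s ξ) *
            (ENNReal.ofReal (1 - t) * (ENNReal.ofReal ((ε * t) ^ 2) * M ξ +
            ENNReal.ofReal (D * ‖(ε * t) • ξ‖ ^ (2 + β))))) := by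
            rw [← hMhom]
            gcongr
            exact hQ β hβ _
        _ = ENNReal.ofReal (t ^ (-(1 + 2 * s))) * ENNReal.ofReal (1 - t) *
            ENNReal.ofReal ((ε * t) ^ 2) * (ENNReal.ofReal (ker n s ξ) * M ξ) +
            ENNReal.ofReal (t ^ (-(1 + 2 * s))) * (ENNReal.ofReal (ker n s ξ) *
            (ENNReal.ofReal (1 - t) * ENNReal.ofReal (D * ‖(ε * t) • ξ‖ ^ (2 + β)))) := by ring
        _ ≤ _ := by
            refine add_le_add (le_of_eq ?_) ?_
            · rw [← ENNReal.ofReal_mul (by positivity), ← ENNReal.ofReal_mul (by positivity), e1]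
              congr 2
              ring
            · rw [← ENNReal.ofReal_mul ht1.le, ← ENNReal.ofReal_mul hk0,
                ← ENNReal.ofReal_mul (by positivity), ← ENNReal.ofReal_mul (by positivity)]
              refine ENNReal.ofReal_le_ofReal ?_
              have h3 : ‖(ε * t) • ξ‖ ^ (2 + β) = ε ^ (2 : ℕ) * ε ^ β * (t ^ (2 : ℕ) * t ^ β) *
                  ‖ξ‖ ^ (2 * (1 + β / 2)) := by
                rw [norm_smul, Real.norm_of_nonneg (by positivity),
                  Real.mul_rpow (by positivity) (norm_nonneg _), Real.mul_rpow hε.le ht0.le,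
                  Real.rpow_add hε, Real.rpow_add ht0, Real.rpow_two, Real.rpow_two]
                congr 2
                ring
              rw [h3, e1]
              have h4 := norm_rpow_mul_ker_le s (α := 1 + β / 2) (by linarith [hβ.1]) ξ
              have h5 : t ^ β ≤ 1 := Real.rpow_le_one ht0.le ht.2.le hβ.1
              have h6 : (1 - t) * t ^ β ≤ 1 := mul_le_one₀ (by linarith) (by positivity) h5
              calc t ^ (-(1 + 2 * s)) * (ker n s ξ * ((1 - t) * (D * (ε ^ (2 : ℕ) * ε ^ β *
                    (t ^ (2 : ℕ) * t ^ β) * ‖ξ‖ ^ (2 * (1 + β / 2))))))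
                  = ((1 - t) * t ^ β) * (ε ^ (2 : ℕ) * (D * ε ^ β) * (t ^ (-(1 + 2 * s)) * t ^ 2) *
                    (‖ξ‖ ^ (2 * (1 + β / 2)) * ker n s ξ)) := by ring
                _ ≤ 1 * (ε ^ (2 : ℕ) * (D * ε ^ β) * (t ^ (-(1 + 2 * s)) * t ^ 2) *
                    ker n (s - (1 + β / 2)) ξ) := by gcongr
                _ = _ := by rw [one_mul]
    refine (lintegral_mono h1).trans (le_of_eq ?_)
    rw [lintegral_add_left (by fun_prop), lintegral_const_mul' _ _ ENNReal.ofReal_ne_top,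
      lintegral_const_mul' _ _ ENNReal.ofReal_ne_top, hmain, lintegral_ker (by linarith)]
    congr 1
    · rw [ENNReal.ofReal_mul (p := ε ^ 2) (by positivity),
        ENNReal.ofReal_mul (p := ε ^ 2) (q := (3 - 2 * s) * constK n s) (by positivity)]
      ring
    · rw [← ENNReal.ofReal_mul (by positivity), ← ENNReal.ofReal_mul (by positivity)]
      congr 1
      ring
  have hI1 : ∫⁻ t in Ioo (0 : ℝ) 1, ENNReal.ofReal (t ^ (2 - 2 * s - 1) * (1 - t)) =
      ENNReal.ofReal (1 / (2 - 2 * s) - 1 / (3 - 2 * s)) := by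
    have hpos : 0 < 1 / (2 - 2 * s) - 1 / (3 - 2 * s) := by
      rw [sub_pos]; exact one_div_lt_one_div_of_lt (by linarith) (by linarith)
    refine lintegral_ofReal_of_integral_eq hpos ?_ ?_
    · filter_upwards [ae_restrict_mem measurableSet_Ioo] with t ht
      exact mul_nonneg (Real.rpow_nonneg ht.1.le _) (by linarith [ht.2])
    · have h1 : ∀ t ∈ Ioo (0 : ℝ) 1, t ^ (2 - 2 * s - 1) * (1 - t) =
          t ^ (2 - 2 * s - 1) - t ^ (3 - 2 * s - 1) := by
        intro t ht
        rw [mul_sub, mul_one, show 3 - 2 * s - 1 = (2 - 2 * s - 1) + 1 by ring,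
          Real.rpow_add_one ht.1.ne']
      rw [setIntegral_congr_fun measurableSet_Ioo h1, ← integral_Ioc_eq_integral_Ioo,
        ← intervalIntegral.integral_of_le zero_le_one, intervalIntegral.integral_sub
        (intervalIntegral.intervalIntegrable_rpow' (by linarith))
        (intervalIntegral.intervalIntegrable_rpow' (by linarith)),
        integral_rpow (Or.inl (by linarith)), integral_rpow (Or.inl (by linarith))]
      rw [Real.one_rpow, Real.one_rpow, Real.zero_rpow (by linarith), Real.zero_rpow (by linarith)]
      ring_nf
  have hsum : filmEnergy ω s ε v ≤ ENNReal.ofReal (2 * ε ^ (1 - 2 * s)) *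
      (ENNReal.ofReal (ε ^ 2 * ((3 - 2 * s) * constK n s)) * B *
        ENNReal.ofReal (1 / (2 - 2 * s) - 1 / (3 - 2 * s)) +
      ENNReal.ofReal (ε ^ 2 * (D * ε ^ β * constC n (s - (1 + β / 2)))) *
        ENNReal.ofReal (1 / (2 - 2 * s))) := by
    rw [filmEnergy_eq_ker hω hε]
    refine mul_le_mul_right ((setLIntegral_mono' measurableSet_Ioo hpt).trans (le_of_eq ?_)) _
    rw [lintegral_add_left (by fun_prop),
      lintegral_const_mul' _ _ (ENNReal.mul_ne_top ENNReal.ofReal_ne_top hBfin),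
      lintegral_const_mul' _ _ ENNReal.ofReal_ne_top, hI1, lintegral_rpow_sub_one (by linarith)]
  have hε3 : ε ^ (3 - 2 * s) = ε ^ (1 - 2 * s) * ε ^ 2 := by
    rw [← Real.rpow_natCast ε 2, ← Real.rpow_add hε]; congr 1; push_cast; ring
  refine ENNReal.div_le_of_le_mul (hsum.trans (le_of_eq ?_))
  have hs4 : 0 < 1 / (2 - 2 * s) - 1 / (3 - 2 * s) := by
    rw [sub_pos]; exact one_div_lt_one_div_of_lt (by linarith) (by linarith)
  have hs5 : 0 < 2 - 2 * s := by linarith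
  rw [mul_add, add_mul]
  congr 1
  · rw [mul_right_comm _ B, ← mul_assoc, ← ENNReal.ofReal_mul (by positivity),
      ← ENNReal.ofReal_mul (by positivity), mul_right_comm _ B, ← ENNReal.ofReal_mul (by positivity)]
    congr 2
    rw [hε3]
    have h1 : 1 / (2 - 2 * s) - 1 / (3 - 2 * s) = 1 / (2 * (1 - s) * (3 - 2 * s)) := by
      rw [show 2 - 2 * s = 2 * (1 - s) by ring, div_sub_div _ _ (by positivity) hs3.ne']
      congr 1
      ring
    rw [h1]
    have h2 := hs3.ne'
    have h3 := hs1.ne'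
    generalize 3 - 2 * s = d at h2 ⊢
    generalize 1 - s = e at h3 ⊢
    field_simp
  · rw [← ENNReal.ofReal_mul (by positivity), ← ENNReal.ofReal_mul (by positivity),
      ← ENNReal.ofReal_mul (by positivity)]
    congr 1
    rw [hε3, show 2 - 2 * s = 2 * (1 - s) by ring]
    have h3 := hs1.ne'
    generalize 1 - s = e at h3 ⊢
    field_simp

theorem limsup_filmEnergy_le_planarDirichlet (hn : 1 ≤ n) (hω : IsOpen ω)
    (hbdd : Bornology.IsBounded ω)
    (hf : ContDiff ℝ ((⊤ : ℕ∞) : WithTop ℕ∞) f) (hc : HasCompactSupport f)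
    (hvf : v =ᵐ[volume.restrict (film ω 1)] fun x => f x.1) {s : ℝ → ℝ} {s₀ : ℝ}
    (hs01 : ∀ ε, 0 < ε → s ε ∈ Ioo (0 : ℝ) 1)
    (hs : Tendsto s (𝓝[>] 0) (𝓝 s₀)) (hs₀ : 1 / 2 < s₀) (hs₀' : s₀ ≤ 1) :
    limsup (fun ε => filmEnergy ω (s ε) ε v / ENNReal.ofReal (ε ^ (3 - 2 * s ε) / (1 - s ε)))
      (𝓝[>] 0) ≤
      ENNReal.ofReal (constK n s₀) * ∫⁻ x in ω, ENNReal.ofReal (‖fderiv ℝ f x‖ ^ 2) := by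
  obtain ⟨D, hD, hDf⟩ := exists_filmEnergy_planar_le hn hω hbdd hf hc hvf
  have hB := lintegral_fderiv_sq_ne_top hbdd hf hc
  -- At s₀ the requirement β < 2s - 1 reads β < 2β, so it persists for nearby exponents.
  set β : ℝ := s₀ - 1 / 2 with hβ
  have hβ0 : 0 < β := by rw [hβ]; linarith
  have h1 : Tendsto (fun ε : ℝ => ε ^ β) (𝓝[>] 0) (𝓝 0) := by
    have := (Real.continuousAt_rpow_const 0 β (Or.inr hβ0.le)).tendsto
    rw [Real.zero_rpow hβ0.ne'] at this
    exact this.mono_left nhdsWithin_le_nhds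
  have hlim1 : Tendsto (fun ε => ENNReal.ofReal (constK n (s ε))) (𝓝[>] 0)
      (𝓝 (ENNReal.ofReal (constK n s₀))) := by
    refine (ENNReal.continuous_ofReal.tendsto _).comp ?_
    have h2 : ContinuousAt (fun s => 1 / ((3 - 2 * s) * n) * (constC n (s - 1) - constC n s)) s₀ := by
      refine ContinuousAt.mul (ContinuousAt.div (by fun_prop) (by fun_prop) ?_)
        (continuousAt_constC_sub hs₀)
      have : (0 : ℝ) < n := by exact_mod_cast hn
      have : 0 < 3 - 2 * s₀ := by linarith
      positivity
    rw [constK_eq hs₀]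
    refine (h2.tendsto.comp hs).congr' ?_
    filter_upwards [hs.eventually_const_lt hs₀] with ε hε
    simp only [Function.comp_apply]
    rw [constK_eq hε]
  have hlim2 : Tendsto (fun ε => ENNReal.ofReal (D * ε ^ β * constC n (s ε - (1 + β / 2)))) (𝓝[>] 0)
      (𝓝 0) := by
    rw [← ENNReal.ofReal_zero]
    refine (ENNReal.continuous_ofReal.tendsto _).comp ?_
    have h3 : Tendsto (fun ε => constC n (s ε - (1 + β / 2))) (𝓝[>] 0)
        (𝓝 (constC n (s₀ - (1 + β / 2)))) :=
      (continuousAt_constC (by rw [hβ]; linarith)).tendsto.comp (hs.sub_const _)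
    have h2 := (h1.const_mul D).mul h3
    rwa [mul_zero, zero_mul] at h2
  have hlim := (ENNReal.Tendsto.mul_const hlim1 (Or.inr hB)).add hlim2
  rw [add_zero] at hlim
  rw [← hlim.limsup_eq]
  refine limsup_le_limsup ?_
  filter_upwards [self_mem_nhdsWithin,
    hs.eventually_const_lt (by linarith : (s₀ / 2 + 1 / 4) < s₀)] with ε hε h3
  exact hDf β ⟨hβ0.le, by rw [hβ]; linarith⟩ ε hε (s ε) (hs01 ε hε) (by rw [hβ]; linarith)

end UpperSecond

/-! ### Upper bound at the critical exponent -/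

section UpperLog

variable {f : Plane n → ℝ} {v : FilmL2 ω}

/-- At height t the kernel is regularized at the length εt, and the planar integral grows like
-log(εt); the cubic remainder of the increments stays integrable. The part -log t is at most
2t^(-1/2), so its integral over t contributes only a constant. -/
theorem exists_filmEnergy_log_le (hn : 1 ≤ n) (hω : IsOpen ω) (hbdd : Bornology.IsBounded ω)
    (hf : ContDiff ℝ ((⊤ : ℕ∞) : WithTop ℕ∞) f) (hc : HasCompactSupport f)
    (hvf : v =ᵐ[volume.restrict (film ω 1)] fun x => f x.1) :
    ∃ (c : ℝ) (A : ℝ≥0∞), A ≠ ∞ ∧ ∀ ε ∈ Ioo (0 : ℝ) 1,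
      filmEnergy ω (1 / 2) ε v / ENNReal.ofReal (ε ^ 2) ≤
        ENNReal.ofReal (sphereArea n / n * (c + |Real.log ε|)) *
          (∫⁻ x in ω, ENNReal.ofReal (‖fderiv ℝ f x‖ ^ 2)) + A := by
  have hfm : Measurable f := hf.continuous.measurable
  have hn' : (0 : ℝ) < n := by exact_mod_cast hn
  have hσ := sphereArea_pos n hn
  obtain ⟨D, R, hD, hR, -, hQ0, hQ⟩ := exists_shiftEnergy_planar_le hbdd hf hc
  have hR0 : 0 < R := by linarith
  set B := ∫⁻ x in ω, ENNReal.ofReal (‖fderiv ℝ f x‖ ^ 2) with hB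
  have hBfin : B ≠ ∞ := lintegral_fderiv_sq_ne_top hbdd hf hc
  set M : Plane n → ℝ≥0∞ := fun ξ => ∫⁻ x in ω, ENNReal.ofReal (fderiv ℝ f x ξ ^ 2) with hM
  set b := Metric.ball (0 : Plane n) R with hb
  have hbm : MeasurableSet b := Metric.isOpen_ball.measurableSet
  set E₀ := ∫⁻ z in b, ENNReal.ofReal (‖z‖ ^ ((1 : ℝ) - n)) with hE₀
  have hE₀fin : E₀ ≠ ∞ := lintegral_ball_rpow_ne_top hn one_pos
  set c : ℝ := Real.log (R ^ 2 + 1) / 2 with hc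
  have hc0 : 0 ≤ c := by
    have := Real.log_nonneg (by nlinarith : 1 ≤ R ^ 2 + 1)
    positivity
  have hσn : 0 < sphereArea n / n := by positivity
  have hinner : ∀ a ∈ Ioc (0 : ℝ) 1, ∫⁻ z : Plane n,
      ENNReal.ofReal (1 / Real.sqrt (‖z‖ ^ 2 + a ^ 2) ^ (n + 2)) * shiftEnergy ω f z ≤
      ENNReal.ofReal (sphereArea n / n * (c - Real.log a)) * B + ENNReal.ofReal D * E₀ := by
    intro a ha
    have ha0 : 0 < a := ha.1
    set k : Plane n → ℝ≥0∞ := b.indicator fun z =>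
      ENNReal.ofReal (1 / Real.sqrt (‖z‖ ^ 2 + a ^ 2) ^ (n + 2)) with hk
    have hkm : Measurable k := Measurable.indicator (by fun_prop) hbm
    have h1 : ∀ z, ENNReal.ofReal (1 / Real.sqrt (‖z‖ ^ 2 + a ^ 2) ^ (n + 2)) * shiftEnergy ω f z ≤
        k z * M z + ENNReal.ofReal D * b.indicator (fun z => ENNReal.ofReal (‖z‖ ^ ((1 : ℝ) - n))) z := by
      intro z
      by_cases hz : z ∈ b
      swap
      · rw [hQ0 z (by simpa [hb] using hz)]; simp
      simp only [hk, indicator_of_mem hz]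
      refine (mul_le_mul_right (hQ 1 ⟨zero_le_one, le_rfl⟩ z) _).trans ?_
      rw [mul_add]
      refine add_le_add le_rfl ?_
      rw [← ENNReal.ofReal_mul (by positivity), ← ENNReal.ofReal_mul hD]
      refine ENNReal.ofReal_le_ofReal ?_
      rcases eq_or_ne z 0 with rfl | hz0
      · rw [norm_zero, Real.zero_rpow (by norm_num), mul_zero, mul_zero]
        exact mul_nonneg hD (Real.rpow_nonneg le_rfl _)
      have hz' : 0 < ‖z‖ := norm_pos_iff.2 hz0
      have h2 : ‖z‖ ≤ Real.sqrt (‖z‖ ^ 2 + a ^ 2) := Real.le_sqrt_of_sq_le (by nlinarith)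
      calc 1 / Real.sqrt (‖z‖ ^ 2 + a ^ 2) ^ (n + 2) * (D * ‖z‖ ^ ((2 : ℝ) + 1))
          ≤ 1 / ‖z‖ ^ (n + 2) * (D * ‖z‖ ^ ((2 : ℝ) + 1)) := by gcongr
        _ = D * ‖z‖ ^ ((1 : ℝ) - n) := by
            rw [one_div, ← Real.rpow_natCast, ← Real.rpow_neg hz'.le, mul_left_comm,
              ← Real.rpow_add hz']
            congr 2
            push_cast
            ring
    refine (lintegral_mono h1).trans ?_
    rw [lintegral_add_right _ ((Measurable.indicator (by fun_prop) hbm).const_mul _),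
      lintegral_const_mul' _ _ ENNReal.ofReal_ne_top, lintegral_indicator hbm]
    refine add_le_add ?_ le_rfl
    have h3 := lintegral_radial_fderiv_sq (ω := ω) hf hkm (fun ξ η h => by
      simp [hk, hb, indicator, h])
    have h4 : ∫⁻ ξ, k ξ * ENNReal.ofReal (‖ξ‖ ^ 2) ≤
        ENNReal.ofReal (sphereArea n * (c - Real.log a)) := by
      refine le_trans (le_of_eq ?_) (lintegral_ball_log_le hn hR0 ha0 ha.2)
      rw [← lintegral_indicator hbm]
      refine lintegral_congr fun ξ => ?_
      by_cases h : ξ ∈ b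
      · simp only [hk, indicator_of_mem h]
      · simp only [hk, indicator_of_notMem h, zero_mul]
    have h5 : (n : ℝ≥0∞) = ENNReal.ofReal n := by simp
    have h6 : (n : ℝ≥0∞) ≠ 0 := by simp; omega
    refine (ENNReal.mul_le_mul_iff_right h6 (by simp)).1 ?_
    rw [h3, ← mul_assoc, h5, ← ENNReal.ofReal_mul hn'.le, mul_comm B]
    refine (mul_le_mul_left h4 _).trans (le_of_eq ?_)
    congr 2
    field_simp
  refine ⟨c, ENNReal.ofReal 2 * (ENNReal.ofReal (sphereArea n / n * 2) * B * ENNReal.ofReal 2) +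
    ENNReal.ofReal D * E₀, ?_, fun ε hε => ?_⟩
  · exact ENNReal.add_ne_top.2 ⟨ENNReal.mul_ne_top ENNReal.ofReal_ne_top (ENNReal.mul_ne_top
      (ENNReal.mul_ne_top ENNReal.ofReal_ne_top hBfin) ENNReal.ofReal_ne_top),
      ENNReal.mul_ne_top ENNReal.ofReal_ne_top hE₀fin⟩
  have hε0 : 0 < ε := hε.1
  have hlog : |Real.log ε| = -Real.log ε := abs_of_neg (Real.log_neg hε0 hε.2)
  rw [filmEnergy_of_planar hω hfm hvf hε0]
  set L := ENNReal.ofReal (sphereArea n / n * (c + |Real.log ε|)) * B with hL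
  have hpt : ∀ t ∈ Ioo (0 : ℝ) 1, ENNReal.ofReal (1 - t) * ∫⁻ z : Plane n,
      ENNReal.ofReal (filmKernel n (1 / 2) ε z t) * shiftEnergy ω f z ≤
      ENNReal.ofReal (1 - t) * (L + ENNReal.ofReal D * E₀) +
        ENNReal.ofReal (sphereArea n / n * 2) * B * ENNReal.ofReal (t ^ ((1 / 2 : ℝ) - 1)) := by
    intro t ht
    have ht0 : 0 < t := ht.1
    have h1 := hinner (ε * t) ⟨by positivity, mul_le_one₀ hε.2.le ht0.le ht.2.le⟩
    have h2 : ∀ z : Plane n, filmKernel n (1 / 2) ε z t =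
        1 / Real.sqrt (‖z‖ ^ 2 + (ε * t) ^ 2) ^ (n + 2) := by
      intro z
      rw [filmKernel, ← Real.rpow_natCast (Real.sqrt _) (n + 2)]
      congr 2
      push_cast
      ring
    simp_rw [h2]
    have h3 : c - Real.log (ε * t) ≤ (c + |Real.log ε|) + 2 * t ^ ((1 / 2 : ℝ) - 1) := by
      rw [Real.log_mul hε0.ne' ht0.ne', hlog]
      have h4 := Real.log_le_rpow_div (x := t⁻¹) (by positivity) (by norm_num : (0 : ℝ) < 1 / 2)
      rw [Real.log_inv] at h4
      have h5 : (t⁻¹) ^ (1 / 2 : ℝ) / (1 / 2) = 2 * t ^ ((1 / 2 : ℝ) - 1) := by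
        rw [Real.inv_rpow ht0.le, ← Real.rpow_neg ht0.le]
        norm_num
        ring
      rw [h5] at h4
      linarith
    have h6 : ENNReal.ofReal (sphereArea n / n * (c - Real.log (ε * t))) * B ≤
        L + ENNReal.ofReal (sphereArea n / n * 2) * B * ENNReal.ofReal (t ^ ((1 / 2 : ℝ) - 1)) := by
      rw [hL, mul_right_comm _ B, ← add_mul, ← ENNReal.ofReal_mul (by positivity),
        ← ENNReal.ofReal_add (by positivity) (by positivity)]
      gcongr
      calc _ ≤ sphereArea n / n * ((c + |Real.log ε|) + 2 * t ^ ((1 / 2 : ℝ) - 1)) := by gcongr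
        _ = _ := by ring
    have h7 : ENNReal.ofReal (1 - t) ≤ 1 := by
      rw [ENNReal.ofReal_le_one]; linarith
    calc _ ≤ ENNReal.ofReal (1 - t) * ((L + ENNReal.ofReal (sphereArea n / n * 2) * B *
          ENNReal.ofReal (t ^ ((1 / 2 : ℝ) - 1))) + ENNReal.ofReal D * E₀) := by
          gcongr
          exact h1.trans (by gcongr)
      _ = ENNReal.ofReal (1 - t) * (L + ENNReal.ofReal D * E₀) + ENNReal.ofReal (1 - t) *
          (ENNReal.ofReal (sphereArea n / n * 2) * B * ENNReal.ofReal (t ^ ((1 / 2 : ℝ) - 1))) := by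
          ring
      _ ≤ _ := by
          refine add_le_add le_rfl ?_
          exact mul_le_of_le_one_left' h7
  refine (mul_le_mul_right (setLIntegral_mono' measurableSet_Ioo hpt) _).trans (le_of_eq ?_)
  rw [lintegral_add_left (by fun_prop), lintegral_mul_const _ (by fun_prop), lintegral_one_sub,
    lintegral_const_mul' _ _ (ENNReal.mul_ne_top ENNReal.ofReal_ne_top hBfin),
    lintegral_rpow_sub_one (by norm_num), mul_add, ← mul_assoc, ← ENNReal.ofReal_mul (by norm_num)]
  norm_num
  ring

theorem limsup_filmEnergy_log_le (hn : 1 ≤ n) (hω : IsOpen ω) (hbdd : Bornology.IsBounded ω)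
    (hf : ContDiff ℝ ((⊤ : ℕ∞) : WithTop ℕ∞) f) (hc : HasCompactSupport f)
    (hvf : v =ᵐ[volume.restrict (film ω 1)] fun x => f x.1) :
    limsup (fun ε => filmEnergy ω (1 / 2) ε v / ENNReal.ofReal (ε ^ 2 * |Real.log ε|)) (𝓝[>] 0) ≤
      ENNReal.ofReal (sphereArea n / n) * ∫⁻ x in ω, ENNReal.ofReal (‖fderiv ℝ f x‖ ^ 2) := by
  obtain ⟨c, A, hA, hle⟩ := exists_filmEnergy_log_le hn hω hbdd hf hc hvf
  have hB := lintegral_fderiv_sq_ne_top hbdd hf hc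
  set B := ∫⁻ x in ω, ENNReal.ofReal (‖fderiv ℝ f x‖ ^ 2)
  have hlog : Tendsto (fun ε : ℝ => |Real.log ε|) (𝓝[>] 0) atTop :=
    tendsto_abs_atBot_atTop.comp Real.tendsto_log_nhdsGT_zero
  have hinv := hlog.inv_tendsto_atTop
  have hlim1 : Tendsto (fun ε : ℝ => ENNReal.ofReal (sphereArea n / n * (c * |Real.log ε|⁻¹ + 1)))
      (𝓝[>] 0) (𝓝 (ENNReal.ofReal (sphereArea n / n))) := by
    refine (ENNReal.continuous_ofReal.tendsto _).comp ?_
    have h1 := ((hinv.const_mul c).add_const 1).const_mul (sphereArea n / n)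
    rwa [mul_zero, zero_add, mul_one] at h1
  have hlim2 : Tendsto (fun ε : ℝ => A * ENNReal.ofReal |Real.log ε|⁻¹) (𝓝[>] 0) (𝓝 0) := by
    have h1 := (ENNReal.continuous_ofReal.tendsto _).comp hinv
    rw [ENNReal.ofReal_zero] at h1
    have h2 := ENNReal.Tendsto.const_mul h1 (Or.inr hA)
    rwa [mul_zero] at h2
  have hlim := (ENNReal.Tendsto.mul_const hlim1 (Or.inr hB)).add hlim2
  rw [add_zero] at hlim
  rw [← hlim.limsup_eq]
  refine limsup_le_limsup ?_
  filter_upwards [self_mem_nhdsWithin, (tendsto_id.mono_left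
    (nhdsWithin_le_nhds (s := Ioi (0 : ℝ)))).eventually_lt_const one_pos] with ε hε hε1
  have hε0 : 0 < ε := hε
  have hl : 0 < |Real.log ε| := abs_pos.2 (Real.log_neg hε0 hε1).ne
  rw [div_ofReal_eq_mul (b := ε ^ 2) (by positivity) (by positivity),
    show ε ^ 2 / (ε ^ 2 * |Real.log ε|) = |Real.log ε|⁻¹ by field_simp]
  refine (mul_le_mul_left (hle ε ⟨hε0, hε1⟩) _).trans (le_of_eq ?_)
  rw [add_mul, mul_right_comm, ← ENNReal.ofReal_mul' (by positivity)]
  congr 3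
  field_simp

end UpperLog

/-! ### Functions that do not depend on the last variable -/

section Fubini

theorem restrict_film_eq_prod (ω : Set (Plane n)) :
    (volume : Measure (Plane n × ℝ)).restrict (film ω 1) =
      (volume.restrict ω).prod (volume.restrict (Ioo (0 : ℝ) 1)) := by
  rw [film, Measure.volume_eq_prod, Measure.prod_restrict]

theorem ae_film_of_ae_plane {p : Plane n → Prop} (h : ∀ᵐ x ∂(volume.restrict ω), p x) :
    ∀ᵐ x ∂((volume : Measure (Plane n × ℝ)).restrict (film ω 1)), p x.1 := by
  rw [restrict_film_eq_prod]
  exact Measure.quasiMeasurePreserving_fst.ae h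

theorem ae_ae_of_ae_film {p : Plane n × ℝ → Prop}
    (h : ∀ᵐ x ∂((volume : Measure (Plane n × ℝ)).restrict (film ω 1)), p x) :
    ∀ᵐ x ∂(volume.restrict ω), ∀ᵐ t ∂(volume.restrict (Ioo (0 : ℝ) 1)), p (x, t) := by
  rw [restrict_film_eq_prod] at h
  exact Measure.ae_ae_of_ae_prod h

theorem ae_restrict_Ioo_neBot : NeBot (ae ((volume : Measure ℝ).restrict (Ioo (0 : ℝ) 1))) := by
  rw [ae_neBot, Ne, Measure.restrict_eq_zero]
  simp

theorem ae_plane_of_ae_film {p : Plane n → Prop}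
    (h : ∀ᵐ x ∂((volume : Measure (Plane n × ℝ)).restrict (film ω 1)), p x.1) :
    ∀ᵐ x ∂(volume.restrict ω), p x := by
  have := ae_restrict_Ioo_neBot
  filter_upwards [ae_ae_of_ae_film h] with x hx
  exact eventually_const.1 hx

theorem lintegral_film_fst {g : Plane n → ℝ≥0∞} (hg : Measurable g) :
    ∫⁻ x in film ω 1, g x.1 = ∫⁻ x in ω, g x := by
  rw [lintegral_film (f := fun x => g x.1) (by fun_prop)]
  simp

/-- The functional `onPlanar J` on a function that does not depend on the last variable. -/
theorem onPlanar_eq {J : PlaneL2 ω → ℝ≥0∞} {v : FilmL2 ω} {w : PlaneL2 ω}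
    (h : ∀ᵐ x ∂((volume : Measure (Plane n × ℝ)).restrict (film ω 1)), v x = w x.1) :
    onPlanar J v = J w := by
  refine le_antisymm (iInf₂_le w h) (le_iInf₂ fun w' h' => ?_)
  have : w' = w := by
    refine Lp.ext (ae_plane_of_ae_film ?_)
    filter_upwards [h, h'] with x hx hx'
    rw [← hx, ← hx']
  rw [this]

theorem exists_of_onPlanar_ne_top {J : PlaneL2 ω → ℝ≥0∞} {v : FilmL2 ω} (h : onPlanar J v ≠ ∞) :
    ∃ w : PlaneL2 ω,
      ∀ᵐ x ∂((volume : Measure (Plane n × ℝ)).restrict (film ω 1)), v x = w x.1 := by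
  by_contra hcon
  rw [not_exists] at hcon
  refine h (iInf₂_eq_top.2 fun w hw => absurd hw (hcon w))

/-- For the exponent -1/2 the vertical kernel is constant, so vanishing vertical increments give
v(x', t) = v(x', r) for almost every (x', t, r). Freezing a good height r gives the planar
representative. -/
theorem exists_planar_of_shiftEnergy_eq_zero (hω : MeasurableSet ω) {v : FilmL2 ω}
    (h : ∀ᵐ t ∂((volume : Measure ℝ).restrict (Ioo (0 : ℝ) 1)),
      shiftEnergy (film ω 1) v (0, t) = 0) :
    ∃ w : PlaneL2 ω,
      ∀ᵐ x ∂((volume : Measure (Plane n × ℝ)).restrict (film ω 1)), v x = w x.1 := by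
  have hv : Measurable v := measurable_coe_Lp v
  have h0 : verticalEnergy ω (-1 / 2) v = 0 := by
    rw [verticalEnergy_eq hω, vertForm]
    rw [mul_eq_zero]
    right
    rw [lintegral_congr_ae (g := fun _ => 0)]
    · simp
    · filter_upwards [h] with t ht
      simp [ht]
  have h1 : ∫⁻ r in Ioo (0 : ℝ) 1, ∫⁻ x in film ω 1,
      ENNReal.ofReal (|v x - v (x.1, r)| ^ 2) = 0 := by
    rw [← h0, verticalEnergy, lintegral_lintegral_swap (by fun_prop),
      lintegral_film (f := fun x => ∫⁻ r in Ioo (0 : ℝ) 1,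
        ENNReal.ofReal (|v x - v (x.1, r)| ^ 2))]
    · norm_num
    · refine Measurable.lintegral_prod_right' (f := fun p : (Plane n × ℝ) × ℝ =>
        ENNReal.ofReal (|v p.1 - v (p.1.1, p.2)| ^ 2)) (by fun_prop)
  have h2 := (lintegral_eq_zero_iff (by
    refine Measurable.lintegral_prod_right' (f := fun p : ℝ × (Plane n × ℝ) =>
        ENNReal.ofReal (|v p.2 - v (p.2.1, p.1)| ^ 2)) (by fun_prop))).1 h1
  have := ae_restrict_Ioo_neBot
  obtain ⟨r, hr⟩ := h2.exists
  have h3 : ∀ᵐ x ∂((volume : Measure (Plane n × ℝ)).restrict (film ω 1)), v x = v (x.1, r) := by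
    filter_upwards [(lintegral_eq_zero_iff (by fun_prop)).1 hr] with x hx
    have : |v x - v (x.1, r)| ^ 2 ≤ 0 := ENNReal.ofReal_eq_zero.1 hx
    have := pow_eq_zero_iff (n := 2) two_ne_zero |>.1 (le_antisymm this (by positivity))
    linarith [abs_eq_zero.1 this]
  have hw0 : Measurable fun x => v (x, r) := by fun_prop
  have hmem : MemLp (fun x => v (x, r)) 2 (volume.restrict ω) := by
    refine ⟨hw0.aestronglyMeasurable, ?_⟩
    have hfst : MeasurePreserving (Prod.fst : Plane n × ℝ → Plane n)
        (volume.restrict (film ω 1)) (volume.restrict ω) := by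
      rw [restrict_film_eq_prod]
      have : IsProbabilityMeasure ((volume : Measure ℝ).restrict (Ioo (0 : ℝ) 1)) :=
        ⟨by simp⟩
      exact measurePreserving_fst
    rw [← eLpNorm_comp_measurePreserving hw0.aestronglyMeasurable hfst]
    refine lt_of_eq_of_lt ?_ (Lp.memLp v).2
    exact eLpNorm_congr_ae (h3.mono fun x hx => hx.symm)
  refine ⟨hmem.toLp, ?_⟩
  filter_upwards [h3, ae_film_of_ae_plane hmem.coeFn_toLp] with x hx hx'
  rw [hx, hx']

end Fubini

/-! ### Smooth representatives and test functions -/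

section Representatives

theorem lintegral_sq_Lp_ne_top {α : Type*} [MeasurableSpace α] {μ : Measure α} (v : Lp ℝ 2 μ) :
    ∫⁻ x, ENNReal.ofReal (v x ^ 2) ∂μ ≠ ∞ := by
  have := ofReal_norm_sq_eq_lintegral v
  simp_rw [sq_abs] at this
  rw [← this]
  exact ENNReal.ofReal_ne_top

theorem norm_sub_lt_of_lintegral {α : Type*} [MeasurableSpace α] {μ : Measure α} {u v : Lp ℝ 2 μ}
    {f : α → ℝ} (hu : u =ᵐ[μ] f) {ρ ρ' : ℝ} (hρ : 0 < ρ) (hρ' : ρ' < ρ ^ 2)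
    (h : ∫⁻ x, ENNReal.ofReal ((f x - v x) ^ 2) ∂μ ≤ ENNReal.ofReal ρ') : ‖u - v‖ < ρ := by
  have h1 : ENNReal.ofReal (‖u - v‖ ^ 2) ≤ ENNReal.ofReal ρ' := by
    rw [ofReal_norm_sq_eq_lintegral]
    refine le_trans (le_of_eq (lintegral_congr_ae ?_)) h
    filter_upwards [hu, Lp.coeFn_sub u v] with x hx hx'
    rw [hx', Pi.sub_apply, hx, sq_abs]
  have h2 : ‖u - v‖ ^ 2 < ρ ^ 2 := by
    have h3 := (ENNReal.ofReal_lt_ofReal_iff (by positivity)).2 hρ'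
    exact (ENNReal.ofReal_lt_ofReal_iff (by positivity)).1 (h1.trans_lt h3)
  exact lt_of_pow_lt_pow_left₀ 2 hρ.le h2

theorem exists_toLp_of_hasCompactSupport {E : Type*} [NormedAddCommGroup E] [MeasurableSpace E]
    [BorelSpace E] {α : Type*} [MeasurableSpace α] {μ : Measure α} [IsFiniteMeasure μ]
    {f : E → ℝ} (hf : Continuous f) (hc : HasCompactSupport f) {g : α → E} (hg : Measurable g) :
    ∃ u : Lp ℝ 2 μ, u =ᵐ[μ] fun x => f (g x) := by
  obtain ⟨B, hB⟩ := hc.exists_bound_of_continuous hf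
  have hm : MemLp (fun x => f (g x)) 2 μ :=
    memLp_two_of_bounded (hf.measurable.comp hg) (fun x => hB (g x))
  exact ⟨hm.toLp, hm.coeFn_toLp⟩

/-- One parameter handles both errors: its smallness against ρ² controls the distance, and
finiteness of the energy A turns the multiplicative loss into an additive one. -/
theorem exists_small_param {A : ℝ≥0∞} (hA : A ≠ ∞) {ρ : ℝ} (hρ : 0 < ρ) :
    ∃ ρ' : ℝ, 0 < ρ' ∧ ρ' < ρ ^ 2 ∧ ENNReal.ofReal (1 + ρ') * A ≤ A + ENNReal.ofReal ρ := by
  lift A to ℝ≥0 using hA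
  refine ⟨min (ρ ^ 2 / 2) (ρ / (A + 1)), by positivity,
    (min_le_left _ _).trans_lt (by linarith [pow_pos hρ 2]), ?_⟩
  rw [← ENNReal.ofReal_coe_nnreal, ← ENNReal.ofReal_mul (by positivity),
    ← ENNReal.ofReal_add (by positivity) hρ.le]
  refine ENNReal.ofReal_le_ofReal ?_
  have h1 : min (ρ ^ 2 / 2) (ρ / (A + 1)) ≤ ρ / (A + 1) := min_le_right _ _
  have h2 : ρ / (A + 1) * (A : ℝ) ≤ ρ := by
    rw [div_mul_eq_mul_div, div_le_iff₀ (by positivity)]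
    nlinarith [A.2]
  have := mul_le_mul_of_nonneg_right h1 A.2
  change (1 + _) * (A : ℝ) ≤ _
  have h3 : min (ρ ^ 2 / 2) (ρ / (A + 1)) * (A : ℝ) ≤ ρ / (A + 1) * (A : ℝ) := this
  linarith

theorem exists_smooth_eq_on_bounded {E : Type*} [NormedAddCommGroup E] [NormedSpace ℝ E]
    [FiniteDimensional ℝ E] {U : Set E} (hU : Bornology.IsBounded U) (ℓ : E →L[ℝ] ℝ) :
    ∃ f : E → ℝ, ContDiff ℝ ((⊤ : ℕ∞) : WithTop ℕ∞) f ∧ HasCompactSupport f ∧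
      ∀ x ∈ U, f x = ℓ x := by
  obtain ⟨R, hR0, hR⟩ := hU.subset_ball_lt 0 0
  let χ : ContDiffBump (0 : E) := ⟨R, R + 1, hR0, by linarith⟩
  refine ⟨fun x => χ x * ℓ x, χ.contDiff.mul ℓ.contDiff, χ.hasCompactSupport.mul_right,
    fun x hx => ?_⟩
  simp only
  rw [χ.one_of_mem_closedBall (Metric.ball_subset_closedBall (hR hx)), one_mul]

end Representatives

/-! ### Functions on which the two terms do not vanish. -/

section Tests

theorem not_planar_of_snd (hω : IsOpen ω) (hne : ω.Nonempty) {v : FilmL2 ω}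
    (hv : v =ᵐ[volume.restrict (film ω 1)] fun x => x.2) :
    ¬ ∃ w : PlaneL2 ω,
      ∀ᵐ x ∂((volume : Measure (Plane n × ℝ)).restrict (film ω 1)), v x = w x.1 := by
  rintro ⟨w, hw⟩
  have h1 : ∀ᵐ x ∂((volume : Measure (Plane n × ℝ)).restrict (film ω 1)), x.2 = w x.1 := by
    filter_upwards [hv, hw] with x hx hx'
    rw [← hx, hx']
  have : NeBot (ae ((volume : Measure (Plane n)).restrict ω)) := by
    rw [ae_neBot, Ne, Measure.restrict_eq_zero]
    exact (hω.measure_pos volume hne).ne'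
  obtain ⟨x, hx⟩ := (ae_ae_of_ae_film h1).exists
  have := ae_restrict_Ioo_neBot
  have h2 : ∀ᵐ t ∂((volume : Measure ℝ).restrict (Ioo (0 : ℝ) 1)), t ≠ w x :=
    Measure.ae_ne _ _
  obtain ⟨t, ht, ht'⟩ := (hx.and h2).exists
  exact ht' ht

theorem ae_coord_ne (i : Fin n) (c : ℝ) : ∀ᵐ x : Plane n, x i ≠ c := by
  have h1 : ∀ᵐ y : Fin n → ℝ, y i ≠ c := by
    have := (Measure.quasiMeasurePreserving_eval (fun _ : Fin n => (volume : Measure ℝ)) i).ae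
      (p := fun t => t ≠ c) (Measure.ae_ne _ _)
    exact this
  exact (PiLp.volume_preserving_ofLp (Fin n)).quasiMeasurePreserving.ae h1

theorem planarEnergy_ne_zero_of_coord (hω : IsOpen ω) (hne : ω.Nonempty) (s : ℝ) {w : PlaneL2 ω}
    {i : Fin n} (hw : w =ᵐ[volume.restrict ω] fun x => x i) : planarEnergy ω s w ≠ 0 := by
  intro h0
  have hwm : Measurable w := measurable_coe_Lp w
  have h1 := (lintegral_eq_zero_iff (by
    refine Measurable.lintegral_prod_right' (f := fun p : Plane n × Plane n =>
        ENNReal.ofReal (|w p.1 - w p.2| ^ 2 / ‖p.1 - p.2‖ ^ (((n : ℝ) + 1) + 2 * s)))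
        (by fun_prop))).1 h0
  have : NeBot (ae ((volume : Measure (Plane n)).restrict ω)) := by
    rw [ae_neBot, Ne, Measure.restrict_eq_zero]
    exact (hω.measure_pos volume hne).ne'
  obtain ⟨x, hx⟩ := h1.exists
  obtain ⟨y, hy1, hy2, hy3⟩ := ((((lintegral_eq_zero_iff (by fun_prop)).1 hx).and
    (hw.and (ae_restrict_of_ae (ae_coord_ne i (w x))))).and
      (ae_restrict_of_ae (ae_coord_ne i (x i)))).exists.imp fun y hy =>
        (⟨hy.1.1, hy.1.2, hy.2⟩ : _ ∧ _ ∧ _)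
  have hxy : x ≠ y := fun h => hy3 (by rw [h])
  have h2 : 0 < |w x - w y| ^ 2 := by
    have : w x - w y ≠ 0 := fun h => hy2.2 (by linarith [hy2.1])
    positivity
  have h3 : 0 < ‖x - y‖ := norm_pos_iff.2 (sub_ne_zero.2 hxy)
  have h4 : |w x - w y| ^ 2 / ‖x - y‖ ^ (((n : ℝ) + 1) + 2 * s) ≤ 0 := ENNReal.ofReal_eq_zero.1 hy1
  have h5 : 0 < |w x - w y| ^ 2 / ‖x - y‖ ^ (((n : ℝ) + 1) + 2 * s) := by positivity
  linarith

theorem hasWeakDirDeriv_coord {U : Set (Plane n)} {w : Plane n → ℝ}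
    {i : Fin n} (hw : w =ᵐ[volume.restrict U] fun x => x i) :
    HasWeakDirDeriv U (EuclideanSpace.single i (1 : ℝ)) w fun _ => 1 := by
  intro φ hφ hc hU
  set e : Plane n := EuclideanSpace.single i (1 : ℝ)
  have hd : Continuous fun x => fderiv ℝ φ x e :=
    (hφ.continuous_fderiv (by simp)).clm_apply continuous_const
  have hdc : HasCompactSupport fun x => fderiv ℝ φ x e := hc.fderiv_apply ℝ e
  let L : Plane n →L[ℝ] ℝ := EuclideanSpace.proj i
  have hL : ∀ x, L x = x i := fun _ => rfl
  have h1 := integral_mul_fderiv_eq_neg_fderiv_mul_of_integrable (μ := (volume : Measure (Plane n)))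
    (f := fun x => L x) (g := φ) (v := e)
    (by
      simp only [ContinuousLinearMap.fderiv]
      exact (continuous_const.mul hφ.continuous).integrable_of_hasCompactSupport hc.mul_left)
    ((L.continuous.mul hd).integrable_of_hasCompactSupport hdc.mul_left)
    ((L.continuous.mul hφ.continuous).integrable_of_hasCompactSupport hc.mul_left)
    (fun x _ => L.differentiableAt) (fun x _ => hφ.differentiable (by simp) x)
  have h2 : ∫ x in U, w x * fderiv ℝ φ x e = ∫ x in U, L x * fderiv ℝ φ x e := by
    refine integral_congr_ae ?_
    filter_upwards [hw] with x hx
    rw [hx, hL]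
  have hs : Function.support φ ⊆ U := (subset_tsupport φ).trans hU
  have hs' : Function.support (fun x => fderiv ℝ φ x e) ⊆ U := by
    refine Subset.trans (fun x hx => ?_) hU
    exact support_fderiv_subset ℝ (f := φ) fun h => hx (by simp [h])
  rw [h2, setIntegral_eq_integral_of_forall_compl_eq_zero, h1,
    setIntegral_eq_integral_of_forall_compl_eq_zero]
  · have hLd : ∀ x, fderiv ℝ (fun x => L x) x e = 1 := fun x => by
      rw [L.fderiv]
      simp [L, e]
    simp_rw [hLd]
  · intro x hx
    simp [Function.notMem_support.1 fun h => hx (hs h)]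
  · intro x hx
    rw [Function.notMem_support.1 fun h => hx (hs' h), mul_zero]

/-- By uniqueness the i-th component of any weak gradient is 1, so the Dirichlet integral is at
least the volume of ω. -/
theorem planarDirichlet_ne_zero_of_coord (hω : IsOpen ω) (hfin : volume ω ≠ ∞) (hne : ω.Nonempty)
    {w : PlaneL2 ω} {i : Fin n} (hw : w =ᵐ[volume.restrict ω] fun x => x i) :
    planarDirichlet ω w ≠ 0 := by
  have := isFiniteMeasure_restrict_plane hfin
  refine ((hω.measure_pos volume hne).trans_le (le_iInf₂ fun G hG => ?_)).ne'
  have hGi : IntegrableOn (fun x => G x i) ω :=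
    ((EuclideanSpace.proj (𝕜 := ℝ) i : Plane n →L[ℝ] ℝ).integrable_comp
      ((Lp.memLp G).integrable (by norm_num)))
  have h1 := (hG i).ae_eq hω (hasWeakDirDeriv_coord hw) hGi
    (integrableOn_const hfin)
  calc volume ω = ∫⁻ _ in ω, 1 := by simp
    _ ≤ ∫⁻ x in ω, ENNReal.ofReal (‖G x‖ ^ 2) := by
      refine lintegral_mono_ae ?_
      filter_upwards [h1] with x hx
      rw [← ENNReal.ofReal_one]
      refine ENNReal.ofReal_le_ofReal ?_
      have := PiLp.norm_apply_le (G x) i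
      rw [hx, norm_one] at this
      nlinarith

end Tests

/-! ### Assembling the expansions -/

section Expansion

theorem liminf_comp_le_limsup {f : ℝ → ℝ≥0∞} {ε : ℕ → ℝ} (hε : Tendsto ε atTop (𝓝[>] 0)) :
    liminf (fun k => f (ε k)) atTop ≤ limsup f (𝓝[>] 0) :=
  (liminf_le_limsup (u := fun k => f (ε k))).trans (limsup_le_limsup_of_le hε (u := f))

/-- Reduction of the expansion to lower bounds along sequences and to upper bounds on smooth
functions. -/
theorem isGammaExpansion_of_bounds (hn : 1 ≤ n) (hω : IsOpen ω) (hne : ω.Nonempty)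
    (hbdd : Bornology.IsBounded ω) {F : ℝ → FilmL2 ω → ℝ≥0∞} {a b : ℝ → ℝ}
    {F₁ : FilmL2 ω → ℝ≥0∞} {J : PlaneL2 ω → ℝ≥0∞}
    (ha : ∀ᶠ ε in 𝓝[>] (0 : ℝ), 0 < a ε) (hb : ∀ᶠ ε in 𝓝[>] (0 : ℝ), 0 < b ε)
    (hab : b =o[𝓝[>] (0 : ℝ)] a)
    (hinf₁ : ∀ ε : ℕ → ℝ, (∀ k, 0 < ε k) → Tendsto ε atTop (𝓝 0) → ∀ (v : FilmL2 ω)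
      (w : ℕ → FilmL2 ω), WeakTendsto w v →
      F₁ v ≤ liminf (fun k => F (ε k) (w k) / ENNReal.ofReal (a (ε k))) atTop)
    (hsup₁ : ∀ (v : FilmL2 ω) (ρ : ℝ), 0 < ρ → ∃ f : Plane n × ℝ → ℝ,
      ContDiff ℝ ((⊤ : ℕ∞) : WithTop ℕ∞) f ∧ HasCompactSupport f ∧
      ∫⁻ x in film ω 1, ENNReal.ofReal ((f x - v x) ^ 2) ≤ ENNReal.ofReal ρ ∧
      ∀ u : FilmL2 ω, u =ᵐ[volume.restrict (film ω 1)] f →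
        limsup (fun ε => F ε u / ENNReal.ofReal (a ε)) (𝓝[>] 0) ≤ ENNReal.ofReal (1 + ρ) * F₁ v)
    (hfin₁ : ∀ f : Plane n × ℝ → ℝ, ContDiff ℝ ((⊤ : ℕ∞) : WithTop ℕ∞) f → HasCompactSupport f →
      ∀ u : FilmL2 ω, u =ᵐ[volume.restrict (film ω 1)] f →
        limsup (fun ε => F ε u / ENNReal.ofReal (a ε)) (𝓝[>] 0) ≠ ∞)
    (hzero : F₁ 0 = 0)
    (hplanar : ∀ v, F₁ v = 0 → ∃ w : PlaneL2 ω,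
      ∀ᵐ x ∂((volume : Measure (Plane n × ℝ)).restrict (film ω 1)), v x = w x.1)
    (hinf₂ : ∀ ε : ℕ → ℝ, (∀ k, 0 < ε k) → Tendsto ε atTop (𝓝 0) → ∀ (v : FilmL2 ω)
      (w : ℕ → FilmL2 ω) (u : PlaneL2 ω), WeakTendsto w v →
      (∀ᵐ x ∂((volume : Measure (Plane n × ℝ)).restrict (film ω 1)), v x = u x.1) →
      J u ≤ liminf (fun k => F (ε k) (w k) / ENNReal.ofReal (b (ε k))) atTop)
    (hsup₂ : ∀ (w : PlaneL2 ω) (ρ : ℝ), 0 < ρ → ∃ f : Plane n → ℝ,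
      ContDiff ℝ ((⊤ : ℕ∞) : WithTop ℕ∞) f ∧ HasCompactSupport f ∧
      ∫⁻ x in ω, ENNReal.ofReal ((f x - w x) ^ 2) ≤ ENNReal.ofReal ρ ∧
      ∀ u : FilmL2 ω, (u =ᵐ[volume.restrict (film ω 1)] fun x => f x.1) →
        limsup (fun ε => F ε u / ENNReal.ofReal (b ε)) (𝓝[>] 0) ≤ ENNReal.ofReal (1 + ρ) * J w)
    (hfin₂ : ∀ f : Plane n → ℝ, ContDiff ℝ ((⊤ : ℕ∞) : WithTop ℕ∞) f → HasCompactSupport f →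
      ∀ u : FilmL2 ω, (u =ᵐ[volume.restrict (film ω 1)] fun x => f x.1) →
        limsup (fun ε => F ε u / ENNReal.ofReal (b ε)) (𝓝[>] 0) ≠ ∞)
    (hJ : ∀ (i : Fin n) (w : PlaneL2 ω), (w =ᵐ[volume.restrict ω] fun x => x i) → J w ≠ 0) :
    IsGammaExpansion F a F₁ b (onPlanar J) := by
  have hfin : volume ω ≠ ∞ := hbdd.measure_lt_top.ne
  have := isFiniteMeasure_restrict_film hfin
  have := isFiniteMeasure_restrict_plane hfin
  obtain ⟨ε₀, hε₀, hε₀'⟩ : ∃ ε : ℕ → ℝ, (∀ k, 0 < ε k) ∧ Tendsto ε atTop (𝓝 0) :=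
    ⟨fun k => 1 / ((k : ℝ) + 1), fun k => by positivity, tendsto_one_div_add_atTop_nhds_zero_nat⟩
  have hε₀'' := tendsto_nhdsGT_zero hε₀ hε₀'
  have hconst : ∀ u : FilmL2 ω, WeakTendsto (fun _ : ℕ => u) u := fun u l => tendsto_const_nhds
  have hclose : ∀ (v : FilmL2 ω) (w : PlaneL2 ω) (f : Plane n → ℝ) (ρ : ℝ),
      (∀ᵐ x ∂((volume : Measure (Plane n × ℝ)).restrict (film ω 1)), v x = w x.1) →
      Continuous f →
      ∫⁻ x in ω, ENNReal.ofReal ((f x - w x) ^ 2) ≤ ENNReal.ofReal ρ →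
      ∫⁻ x in film ω 1, ENNReal.ofReal ((f x.1 - v x) ^ 2) ≤ ENNReal.ofReal ρ := by
    intro v w f ρ hvw hf h
    have hwm : Measurable w := measurable_coe_Lp w
    have hfm := hf.measurable
    rw [← lintegral_film_fst (by fun_prop)] at h
    refine le_trans (le_of_eq (lintegral_congr_ae ?_)) h
    filter_upwards [hvw] with x hx
    rw [hx]
  refine isGammaExpansion_of_approx ha hb hab hinf₁ ?_ hzero ?_ ?_ ?_ ?_ ?_
  · intro v hv ρ hρ
    obtain ⟨ρ', hρ'0, hρ', hA⟩ := exists_small_param hv hρ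
    obtain ⟨f, hf, hc, hfv, hlim⟩ := hsup₁ v ρ' hρ'0
    obtain ⟨u, hu⟩ := exists_toLp_of_hasCompactSupport (μ := volume.restrict (film ω 1))
      hf.continuous hc measurable_id
    exact ⟨u, norm_sub_lt_of_lintegral hu hρ hρ' hfv, (hlim u hu).trans hA⟩
  · intro ε hpos hε v w hw hv
    obtain ⟨u, hu⟩ := hplanar v hv
    rw [onPlanar_eq hu]
    exact hinf₂ ε hpos hε v w u hw hu
  · intro v hv ρ hρ
    obtain ⟨w, hw⟩ := exists_of_onPlanar_ne_top hv
    obtain ⟨ρ', hρ'0, hρ', hA⟩ := exists_small_param hv hρ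
    obtain ⟨f, hf, hc, hfv, hlim⟩ := hsup₂ w ρ' hρ'0
    obtain ⟨u, hu⟩ := exists_toLp_of_hasCompactSupport (μ := volume.restrict (film ω 1))
      hf.continuous hc measurable_fst
    rw [onPlanar_eq hw] at hA ⊢
    exact ⟨u, norm_sub_lt_of_lintegral hu hρ hρ' (hclose v w f ρ' hw hf.continuous hfv),
      (hlim u hu).trans hA⟩
  -- Zeros of F₁ are planar, and their smooth planar approximants have finite energy at scale b even
  -- when J is infinite at the limit.
  · intro v hv ρ hρ
    obtain ⟨w, hw⟩ := hplanar v hv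
    obtain ⟨ρ', hρ'0, hρ', -⟩ := exists_small_param ENNReal.zero_ne_top hρ
    obtain ⟨f, hf, hc, hfv, -⟩ := hsup₂ w ρ' hρ'0
    obtain ⟨u, hu⟩ := exists_toLp_of_hasCompactSupport (μ := volume.restrict (film ω 1))
      hf.continuous hc measurable_fst
    exact ⟨u, norm_sub_lt_of_lintegral hu hρ hρ' (hclose v w f ρ' hw hf.continuous hfv),
      hfin₂ f hf hc u hu⟩
  -- The height x_d witnesses that the first term is not trivial: it is not planar, and comparing
  -- lower and upper bounds along its constant sequence shows that F₁ is finite on it. A horizontal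
  -- coordinate does the same for the second term.
  · obtain ⟨f, hf, hc, hfU⟩ := exists_smooth_eq_on_bounded (isBounded_film hbdd)
      (ContinuousLinearMap.snd ℝ (Plane n) ℝ)
    obtain ⟨u, hu⟩ := exists_toLp_of_hasCompactSupport (μ := volume.restrict (film ω 1))
      hf.continuous hc measurable_id
    refine ⟨u, fun h0 => ?_, ?_⟩
    · refine not_planar_of_snd hω hne ?_ (hplanar u h0)
      filter_upwards [hu, ae_restrict_mem (measurableSet_film hω.measurableSet 1)] with x hx hx'
      rw [hx]
      exact hfU x hx'
    · exact ne_top_of_le_ne_top (hfin₁ f hf hc u hu)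
        ((hinf₁ ε₀ hε₀ hε₀' u _ (hconst u)).trans (liminf_comp_le_limsup hε₀''))
  · obtain ⟨f, hf, hc, hfU⟩ := exists_smooth_eq_on_bounded hbdd
      (EuclideanSpace.proj (𝕜 := ℝ) (⟨0, hn⟩ : Fin n) : Plane n →L[ℝ] ℝ)
    obtain ⟨u, hu⟩ := exists_toLp_of_hasCompactSupport (μ := volume.restrict (film ω 1))
      hf.continuous hc measurable_fst
    obtain ⟨w, hw⟩ := exists_toLp_of_hasCompactSupport (μ := volume.restrict ω)
      hf.continuous hc measurable_id
    have huw : ∀ᵐ x ∂((volume : Measure (Plane n × ℝ)).restrict (film ω 1)), u x = w x.1 := by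
      filter_upwards [hu, ae_film_of_ae_plane hw] with x hx hx'
      rw [hx, hx']
      rfl
    refine ⟨u, ?_, ?_⟩
    · rw [onPlanar_eq huw]
      refine hJ ⟨0, hn⟩ w ?_
      filter_upwards [hw, ae_restrict_mem hω.measurableSet] with x hx hx'
      rw [hx]
      exact hfU x hx'
    · rw [onPlanar_eq huw]
      exact ne_top_of_le_ne_top (hfin₂ f hf hc u hu)
        ((hinf₂ ε₀ hε₀ hε₀' u _ w (hconst u) huw).trans (liminf_comp_le_limsup hε₀''))

end Expansion

/-! ### Zero sets of the first term and bounds for the Dirichlet integrals. -/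

section Terms

theorem vertForm_eq_zero (hω : MeasurableSet ω) {s : ℝ} {v : Plane n × ℝ → ℝ} (hv : Measurable v)
    (h : vertForm ω s v = 0) :
    ∀ᵐ t ∂((volume : Measure ℝ).restrict (Ioo (0 : ℝ) 1)), shiftEnergy (film ω 1) v (0, t) = 0 := by
  have hm : Measurable fun t : ℝ => shiftEnergy (film ω 1) v (0, t) :=
    (measurable_shiftEnergy (measurableSet_film hω 1) hv).comp (by fun_prop)
  rw [vertForm, mul_eq_zero] at h
  have h1 := (lintegral_eq_zero_iff (by fun_prop)).1 (h.resolve_left (by norm_num))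
  filter_upwards [h1, ae_restrict_mem measurableSet_Ioo] with t ht ht'
  refine (mul_eq_zero.1 ht).resolve_left ?_
  have : 0 < t ^ (-(1 + 2 * s)) := Real.rpow_pos_of_pos ht'.1 _
  simpa using this

theorem verticalEnergy_zero (hω : MeasurableSet ω) (s : ℝ) :
    verticalEnergy ω s (0 : FilmL2 ω) = 0 := by
  rw [verticalEnergy_eq hω, vertForm]
  have h : ∀ z, shiftEnergy (film ω 1) (0 : FilmL2 ω) z = 0 := fun z => by
    rw [shiftEnergy_congr (measurableSet_film hω 1) (Lp.coeFn_zero ℝ 2 _)]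
    simp [shiftEnergy]
  simp only [h, mul_zero, lintegral_zero]

theorem verticalDirichlet_zero : verticalDirichlet ω (0 : FilmL2 ω) = 0 := by
  refine le_antisymm ((iInf₂_le (0 : FilmL2 ω) ?_).trans ?_) (zero_le)
  · intro φ _ _ _
    have h := Lp.coeFn_zero ℝ 2 ((volume : Measure (Plane n × ℝ)).restrict (film ω 1))
    have h' : ∀ ψ : Plane n × ℝ → ℝ, ∫ x in film ω 1, (0 : FilmL2 ω) x * ψ x = 0 := fun ψ => by
      rw [integral_congr_ae (g := fun _ => (0 : ℝ))
        (h.mono fun x hx => by simp only [hx, Pi.zero_apply, zero_mul]), integral_zero]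
    rw [h', h', neg_zero]
  · rw [lintegral_congr_ae (g := fun _ => 0)]
    · simp
    · filter_upwards [Lp.coeFn_zero ℝ 2 ((volume : Measure (Plane n × ℝ)).restrict (film ω 1))]
        with x hx
      simp only [hx, Pi.zero_apply, abs_zero, ne_eq, OfNat.ofNat_ne_zero, not_false_eq_true,
        zero_pow, ENNReal.ofReal_zero]

/-- A bound against every candidate derivative passes to the infimum. The condition c ≠ 0 covers the
case without candidates, where the right side must be infinite. -/
theorem le_const_mul_verticalDirichlet {A : ℝ≥0∞} {c : ℝ≥0∞} (hc : c ≠ 0) (hc' : c ≠ ∞)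
    {v : FilmL2 ω}
    (h : ∀ g : Plane n × ℝ → ℝ, Measurable g →
      HasWeakDirDeriv (film ω 1) ((0 : Plane n), (1 : ℝ)) v g →
        A ≤ c * ∫⁻ x in film ω 1, ENNReal.ofReal (g x ^ 2)) :
    A ≤ c * verticalDirichlet ω v := by
  rw [mul_comm, ← ENNReal.div_le_iff hc hc']
  refine le_iInf₂ fun g hg => ?_
  rw [ENNReal.div_le_iff hc hc', mul_comm]
  simpa only [sq_abs] using h g (measurable_coe_Lp g) hg

theorem le_const_mul_planarDirichlet {A : ℝ≥0∞} {c : ℝ≥0∞} (hc : c ≠ 0) (hc' : c ≠ ∞)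
    {w : PlaneL2 ω}
    (h : ∀ G : Plane n → Plane n, Measurable G →
      (∀ i, HasWeakDirDeriv ω (EuclideanSpace.single i (1 : ℝ)) w (fun x => G x i)) →
        A ≤ c * ∫⁻ x in ω, ENNReal.ofReal (‖G x‖ ^ 2)) :
    A ≤ c * planarDirichlet ω w := by
  rw [mul_comm, ← ENNReal.div_le_iff hc hc']
  refine le_iInf₂ fun G hG => ?_
  rw [ENNReal.div_le_iff hc hc', mul_comm]
  exact h G (Lp.stronglyMeasurable G).measurable hG

theorem ofReal_one_add_ne_zero {ρ : ℝ} (hρ : 0 < ρ) : ENNReal.ofReal (1 + ρ) ≠ 0 := by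
  simpa using by linarith

/-- A function with zero vertical derivative does not depend on the last variable. -/
theorem exists_planar_of_verticalDirichlet_eq_zero (hω : IsOpen ω) (hbdd : Bornology.IsBounded ω)
    (hlip : HasLipschitzBoundary ω) {v : FilmL2 ω} (h : verticalDirichlet ω v = 0) :
    ∃ w : PlaneL2 ω,
      ∀ᵐ x ∂((volume : Measure (Plane n × ℝ)).restrict (film ω 1)), v x = w x.1 := by
  have hfin : volume ω ≠ ∞ := hbdd.measure_lt_top.ne
  have := isFiniteMeasure_restrict_film hfin
  refine exists_planar_of_shiftEnergy_eq_zero hω.measurableSet (Eventually.of_forall fun t => ?_)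
  have hex : ∀ k : ℕ, ∃ u : FilmL2 ω, ‖u - v‖ < 1 / ((k : ℝ) + 1) ∧
      shiftEnergy (film ω 1) u (0, t) = 0 := by
    intro k
    have hk : (0 : ℝ) < 1 / ((k : ℝ) + 1) := by positivity
    obtain ⟨ρ, hρ0, hρ, -⟩ := exists_small_param ENNReal.zero_ne_top hk
    obtain ⟨f, hf, hc, hfv, -, hg⟩ := exists_smooth_film hω hbdd hlip (measurable_coe_Lp v)
      (lintegral_sq_Lp_ne_top v) hρ0
    obtain ⟨u, hu⟩ := exists_toLp_of_hasCompactSupport (μ := volume.restrict (film ω 1))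
      hf.continuous hc measurable_id
    refine ⟨u, norm_sub_lt_of_lintegral hu hk hρ hfv, ?_⟩
    -- The multiplicative control of the energy makes the vertical derivative of the approximant
    -- vanish exactly, hence its vertical increments too; lower semicontinuity then transfers this
    -- to v.
    have h1 := le_const_mul_verticalDirichlet (ofReal_one_add_ne_zero hρ0)
      ENNReal.ofReal_ne_top hg
    rw [h, mul_zero] at h1
    have h2 := shiftEnergy_vertical_le hω hf t
    rw [le_antisymm h1 (zero_le), mul_zero] at h2
    rw [shiftEnergy_congr (measurableSet_film hω.measurableSet 1) hu]
    exact le_antisymm h2 (zero_le)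
  choose u hu hu0 using hex
  have hlim : Tendsto u atTop (𝓝 v) := by
    rw [tendsto_iff_norm_sub_tendsto_zero]
    exact squeeze_zero (fun _ => norm_nonneg _) (fun k => (hu k).le)
      tendsto_one_div_add_atTop_nhds_zero_nat
  have h3 := shiftEnergy_le_liminf hω hfin (weakTendsto_of_tendsto hlim)
    (tendsto_const_nhds (x := ((0 : Plane n), t)))
  simpa [hu0] using h3

end Terms

/-! ### Comparison of the scales. -/

section Scales

/-- The quotient is ε^(1+2s), at most ε for ε < 1 since s > 0; no lower bound on the exponents is
needed. -/
theorem rpow_isLittleO {s : ℝ → ℝ} (hs01 : ∀ ε, 0 < ε → s ε ∈ Ioo (0 : ℝ) 1) :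
    (fun ε : ℝ => ε ^ (2 : ℕ)) =o[𝓝[>] (0 : ℝ)] fun ε => ε ^ (1 - 2 * s ε) := by
  have hpos : ∀ᶠ ε : ℝ in 𝓝[>] 0, 0 < ε := eventually_mem_nhdsWithin
  have h1 : ∀ᶠ ε : ℝ in 𝓝[>] 0, ε < 1 := nhdsWithin_le_nhds (Iio_mem_nhds one_pos)
  rw [isLittleO_iff_tendsto' (hpos.mono fun ε hε h => absurd h (Real.rpow_pos_of_pos hε _).ne')]
  refine squeeze_zero' (g := fun ε => ε) (hpos.mono fun ε hε => by positivity) ?_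
    (tendsto_nhdsWithin_of_tendsto_nhds tendsto_id)
  filter_upwards [hpos, h1] with ε hε hε1
  rw [← Real.rpow_natCast, ← Real.rpow_sub hε]
  calc ε ^ (((2 : ℕ) : ℝ) - (1 - 2 * s ε)) ≤ ε ^ (1 : ℝ) :=
        Real.rpow_le_rpow_of_exponent_ge hε hε1.le (by
          have := (hs01 ε hε).1
          push_cast
          linarith)
    _ = ε := Real.rpow_one ε

theorem rpow_mul_isLittleO (s c : ℝ → ℝ) :
    (fun ε : ℝ => ε ^ (3 - 2 * s ε) / c ε) =o[𝓝[>] (0 : ℝ)] fun ε => ε ^ (1 - 2 * s ε) / c ε := by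
  have hpos : ∀ᶠ ε : ℝ in 𝓝[>] 0, 0 < ε := eventually_mem_nhdsWithin
  have h2 : (fun ε : ℝ => ε ^ (2 : ℕ)) =o[𝓝[>] (0 : ℝ)] fun _ => (1 : ℝ) := by
    rw [isLittleO_one_iff]
    have : Tendsto (fun ε : ℝ => ε ^ 2) (𝓝 0) (𝓝 (0 ^ 2)) := (continuous_pow 2).tendsto 0
    rw [zero_pow two_ne_zero] at this
    exact tendsto_nhdsWithin_of_tendsto_nhds this
  refine (h2.mul_isBigO (isBigO_refl (fun ε : ℝ => ε ^ (1 - 2 * s ε) / c ε) _)).congr' ?_ ?_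
  · filter_upwards [hpos] with ε hε
    rw [← mul_div_assoc, ← Real.rpow_natCast, ← Real.rpow_add hε]
    congr 2
    push_cast
    ring
  · exact Eventually.of_forall fun ε => one_mul _

theorem sq_mul_log_isLittleO :
    (fun ε : ℝ => ε ^ (2 : ℕ) * |Real.log ε|) =o[𝓝[>] (0 : ℝ)] fun _ => (1 : ℝ) := by
  rw [isLittleO_one_iff]
  have := (tendsto_log_mul_rpow_nhdsGT_zero (r := 2) two_pos).abs
  rw [abs_zero] at this
  refine this.congr' ?_
  filter_upwards [eventually_mem_nhdsWithin] with ε hε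
  rw [abs_mul, Real.rpow_two, abs_of_nonneg (by positivity : (0 : ℝ) ≤ ε ^ 2), mul_comm]

end Scales

/-! ### The four ranges of the exponent. -/

section Cases

theorem ofReal_mul_mul_comm {c : ℝ} {B D X : ℝ≥0∞} (h : B ≤ D * X) :
    ENNReal.ofReal c * B ≤ D * (ENNReal.ofReal c * X) := by
  calc ENNReal.ofReal c * B ≤ ENNReal.ofReal c * (D * X) := by gcongr
    _ = D * (ENNReal.ofReal c * X) := by ring

theorem exists_smooth_planarDirichlet (hω : IsOpen ω) (hbdd : Bornology.IsBounded ω)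
    (hlip : HasLipschitzBoundary ω) {F : ℝ → FilmL2 ω → ℝ≥0∞} {b : ℝ → ℝ} {c : ℝ}
    (h : ∀ f : Plane n → ℝ, ContDiff ℝ ((⊤ : ℕ∞) : WithTop ℕ∞) f → HasCompactSupport f →
      ∀ u : FilmL2 ω, (u =ᵐ[volume.restrict (film ω 1)] fun x => f x.1) →
        limsup (fun ε => F ε u / ENNReal.ofReal (b ε)) (𝓝[>] 0) ≤
          ENNReal.ofReal c * ∫⁻ x in ω, ENNReal.ofReal (‖fderiv ℝ f x‖ ^ 2))
    (w : PlaneL2 ω) (ρ : ℝ) (hρ : 0 < ρ) : ∃ f : Plane n → ℝ,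
      ContDiff ℝ ((⊤ : ℕ∞) : WithTop ℕ∞) f ∧ HasCompactSupport f ∧
      ∫⁻ x in ω, ENNReal.ofReal ((f x - w x) ^ 2) ≤ ENNReal.ofReal ρ ∧
      ∀ u : FilmL2 ω, (u =ᵐ[volume.restrict (film ω 1)] fun x => f x.1) →
        limsup (fun ε => F ε u / ENNReal.ofReal (b ε)) (𝓝[>] 0) ≤
          ENNReal.ofReal (1 + ρ) * (ENNReal.ofReal c * planarDirichlet ω w) := by
  obtain ⟨f, hf, hc, hfw, -, hG⟩ := exists_smooth_plane hω hbdd hlip (measurable_coe_Lp w)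
    (lintegral_sq_Lp_ne_top w) hρ
  exact ⟨f, hf, hc, hfw, fun u hu => (h f hf hc u hu).trans (ofReal_mul_mul_comm
    (le_const_mul_planarDirichlet (ofReal_one_add_ne_zero hρ) ENNReal.ofReal_ne_top hG))⟩

/-- The first term has the same form for every limit s₀ < 1; only the bounds at scale b distinguish
the regimes below, at and above one half. -/
theorem isGammaExpansion_of_vertical (hn : 1 ≤ n) (hω : IsOpen ω) (hne : ω.Nonempty)
    (hbdd : Bornology.IsBounded ω) (hlip : HasLipschitzBoundary ω) {s : ℝ → ℝ} {s₀ : ℝ}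
    (hs01 : ∀ ε, 0 < ε → s ε ∈ Ioo (0 : ℝ) 1) (hs : Tendsto s (𝓝[>] (0 : ℝ)) (𝓝 s₀))
    (hs₀ : 0 ≤ s₀) (hs₀' : s₀ < 1) {b : ℝ → ℝ} {J : PlaneL2 ω → ℝ≥0∞}
    (hb : ∀ᶠ ε in 𝓝[>] (0 : ℝ), 0 < b ε)
    (hab : b =o[𝓝[>] (0 : ℝ)] fun ε => ε ^ (1 - 2 * s ε))
    (hinf₂ : ∀ ε : ℕ → ℝ, (∀ k, 0 < ε k) → Tendsto ε atTop (𝓝 0) → ∀ (v : FilmL2 ω)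
      (w : ℕ → FilmL2 ω) (u : PlaneL2 ω), WeakTendsto w v →
      (∀ᵐ x ∂((volume : Measure (Plane n × ℝ)).restrict (film ω 1)), v x = u x.1) →
      J u ≤ liminf (fun k => filmEnergy ω (s (ε k)) (ε k) (w k) / ENNReal.ofReal (b (ε k))) atTop)
    (hsup₂ : ∀ (w : PlaneL2 ω) (ρ : ℝ), 0 < ρ → ∃ f : Plane n → ℝ,
      ContDiff ℝ ((⊤ : ℕ∞) : WithTop ℕ∞) f ∧ HasCompactSupport f ∧
      ∫⁻ x in ω, ENNReal.ofReal ((f x - w x) ^ 2) ≤ ENNReal.ofReal ρ ∧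
      ∀ u : FilmL2 ω, (u =ᵐ[volume.restrict (film ω 1)] fun x => f x.1) →
        limsup (fun ε => filmEnergy ω (s ε) ε u / ENNReal.ofReal (b ε)) (𝓝[>] 0) ≤
          ENNReal.ofReal (1 + ρ) * J w)
    (hfin₂ : ∀ f : Plane n → ℝ, ContDiff ℝ ((⊤ : ℕ∞) : WithTop ℕ∞) f → HasCompactSupport f →
      ∀ u : FilmL2 ω, (u =ᵐ[volume.restrict (film ω 1)] fun x => f x.1) →
        limsup (fun ε => filmEnergy ω (s ε) ε u / ENNReal.ofReal (b ε)) (𝓝[>] 0) ≠ ∞)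
    (hJ : ∀ (i : Fin n) (w : PlaneL2 ω), (w =ᵐ[volume.restrict ω] fun x => x i) → J w ≠ 0) :
    IsGammaExpansion (fun ε => filmEnergy ω (s ε) ε) (fun ε => ε ^ (1 - 2 * s ε))
      (fun v => ENNReal.ofReal (constC n s₀) * verticalEnergy ω s₀ v) b (onPlanar J) := by
  have hfin : volume ω ≠ ∞ := hbdd.measure_lt_top.ne
  refine isGammaExpansion_of_bounds hn hω hne hbdd ?_ hb hab ?_ ?_ ?_ ?_ ?_ hinf₂ hsup₂ hfin₂ hJ
  · filter_upwards [eventually_mem_nhdsWithin] with ε hε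
    exact Real.rpow_pos_of_pos hε _
  · intro ε hpos hε v w hw
    exact vertical_le_liminf hω hfin hpos hε (hs.comp (tendsto_nhdsGT_zero hpos hε)) hs₀ hw
  · intro v ρ hρ
    obtain ⟨f, hf, hc, hfv, hV, -⟩ := exists_smooth_film hω hbdd hlip (measurable_coe_Lp v)
      (lintegral_sq_Lp_ne_top v) hρ
    refine ⟨f, hf, hc, hfv, fun u hu => ?_⟩
    rw [verticalEnergy_eq hω.measurableSet]
    exact (limsup_filmEnergy_le_vertForm hω hfin hf hc hu hs01 hs hs₀ hs₀').trans
      (ofReal_mul_mul_comm (hV s₀ hs₀))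
  · intro f hf hc u hu
    exact ne_top_of_le_ne_top
      (ENNReal.mul_ne_top ENNReal.ofReal_ne_top (tendsto_vertForm hω hfin hf hc hs hs₀').2)
      (limsup_filmEnergy_le_vertForm hω hfin hf hc hu hs01 hs hs₀ hs₀')
  · rw [verticalEnergy_zero hω.measurableSet, mul_zero]
  · intro v hv
    have hC : 0 < constC n s₀ := constC_pos (by linarith)
    have h0 : vertForm ω s₀ v = 0 := by
      rw [← verticalEnergy_eq hω.measurableSet]
      exact (mul_eq_zero.1 hv).resolve_left (by simpa using hC)
    exact exists_planar_of_shiftEnergy_eq_zero hω.measurableSet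
      (vertForm_eq_zero hω.measurableSet (measurable_coe_Lp v) h0)

theorem planarDirichlet_term_ne_zero (hω : IsOpen ω) (hne : ω.Nonempty)
    (hbdd : Bornology.IsBounded ω) {c : ℝ} (hc : 0 < c) (i : Fin n) (w : PlaneL2 ω)
    (hw : w =ᵐ[volume.restrict ω] fun x => x i) :
    ENNReal.ofReal c * planarDirichlet ω w ≠ 0 :=
  mul_ne_zero (by simpa using hc)
    (planarDirichlet_ne_zero_of_coord hω hbdd.measure_lt_top.ne hne hw)

theorem planarEnergy_eq_lintegral_mul (s : ℝ) {w : PlaneL2 ω} :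
    planarEnergy ω s w = ∫⁻ x in ω, ∫⁻ y in ω,
      ENNReal.ofReal (1 / ‖x - y‖ ^ (((n : ℝ) + 1) + 2 * s)) *
        ENNReal.ofReal ((w x - w y) ^ 2) := by
  rw [planarEnergy]
  refine lintegral_congr fun x => lintegral_congr fun y => ?_
  rw [← ENNReal.ofReal_mul (by positivity), sq_abs, one_div_mul_eq_div]

theorem lintegral_shiftEnergy_eq (hω : MeasurableSet ω) (s : ℝ) {f : Plane n → ℝ}
    (hf : Measurable f) :
    ∫⁻ z : Plane n, ENNReal.ofReal (1 / ‖z‖ ^ (((n : ℝ) + 1) + 2 * s)) * shiftEnergy ω f z =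
      ∫⁻ x in ω, ∫⁻ y in ω,
        ENNReal.ofReal (1 / ‖x - y‖ ^ (((n : ℝ) + 1) + 2 * s)) *
          ENNReal.ofReal ((f x - f y) ^ 2) := by
  rw [← lintegral_lintegral_eq_shiftEnergy hω hf (by fun_prop)]
  refine lintegral_congr fun x => lintegral_congr fun y => ?_
  rw [norm_sub_rev, ← neg_sub (f y) (f x), neg_sq]

/-- The expansion for exponents below one half. -/
theorem isGammaExpansion_subcritical (hn : 1 ≤ n) (hω : IsOpen ω) (hne : ω.Nonempty)
    (hbdd : Bornology.IsBounded ω) (hlip : HasLipschitzBoundary ω) {s : ℝ → ℝ} {s₀ : ℝ}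
    (hs01 : ∀ ε, 0 < ε → s ε ∈ Ioo (0 : ℝ) 1) (hs : Tendsto s (𝓝[>] (0 : ℝ)) (𝓝 s₀))
    (hs₀ : s₀ ∈ Ico (0 : ℝ) (1 / 2)) :
    IsGammaExpansion (fun ε => filmEnergy ω (s ε) ε) (fun ε => ε ^ (1 - 2 * s ε))
      (fun v => ENNReal.ofReal (constC n s₀) * verticalEnergy ω s₀ v) (fun ε => ε ^ (2 : ℕ))
      (onPlanar (planarEnergy ω s₀)) := by
  have hfin : volume ω ≠ ∞ := hbdd.measure_lt_top.ne
  have hs₁ : s₀ < 1 := hs₀.2.trans (by norm_num)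
  refine isGammaExpansion_of_vertical hn hω hne hbdd hlip hs01 hs hs₀.1 hs₁ ?_
    (rpow_isLittleO hs01) ?_ ?_ ?_ fun i w hw => planarEnergy_ne_zero_of_coord hω hne s₀ hw
  · filter_upwards [eventually_mem_nhdsWithin] with ε hε
    exact pow_pos hε 2
  · intro ε hpos hε v w u hw hu
    exact planarEnergy_le_liminf hω hfin hpos hε (hs.comp (tendsto_nhdsGT_zero hpos hε)) hs₀.1 hw hu
  · intro w ρ hρ
    obtain ⟨f, hf, hc, hfw, hE, -⟩ := exists_smooth_plane hω hbdd hlip (measurable_coe_Lp w)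
      (lintegral_sq_Lp_ne_top w) hρ
    refine ⟨f, hf, hc, hfw, fun u hu => ?_⟩
    refine (limsup_filmEnergy_le_planar hn hω hbdd hf hc hu hs01 hs hs₀.1 hs₀.2).1.trans ?_
    rw [lintegral_shiftEnergy_eq hω.measurableSet s₀ hf.continuous.measurable,
      planarEnergy_eq_lintegral_mul]
    exact hE s₀ ⟨hs₀.1, hs₁.le⟩
  · intro f hf hc u hu
    obtain ⟨h1, h2⟩ := limsup_filmEnergy_le_planar hn hω hbdd hf hc hu hs01 hs hs₀.1 hs₀.2
    exact ne_top_of_le_ne_top h2 h1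

/-- The expansion for exponents above one half. -/
theorem isGammaExpansion_supercritical (hn : 1 ≤ n) (hω : IsOpen ω) (hne : ω.Nonempty)
    (hbdd : Bornology.IsBounded ω) (hlip : HasLipschitzBoundary ω) {s : ℝ → ℝ} {s₀ : ℝ}
    (hs01 : ∀ ε, 0 < ε → s ε ∈ Ioo (0 : ℝ) 1) (hs : Tendsto s (𝓝[>] (0 : ℝ)) (𝓝 s₀))
    (hs₀ : s₀ ∈ Ioo (1 / 2 : ℝ) 1) :
    IsGammaExpansion (fun ε => filmEnergy ω (s ε) ε) (fun ε => ε ^ (1 - 2 * s ε))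
      (fun v => ENNReal.ofReal (constC n s₀) * verticalEnergy ω s₀ v)
      (fun ε => ε ^ (3 - 2 * s ε))
      (onPlanar fun w => ENNReal.ofReal (1 / (1 - s₀) * constK n s₀) * planarDirichlet ω w) := by
  have hfin : volume ω ≠ ∞ := hbdd.measure_lt_top.ne
  have h1s : 0 < 1 - s₀ := by linarith [hs₀.2]
  have hK : 0 < constK n s₀ := constK_pos hn hs₀.1 (by linarith [hs₀.2])
  -- The bounds are available at the scale ε^(3-2s)/(1-s). As s₀ < 1, the factor 1/(1-s) converges
  -- and moves into the constant.
  have hlim : Tendsto (fun ε => ENNReal.ofReal (1 / (1 - s ε))) (𝓝[>] 0)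
      (𝓝 (ENNReal.ofReal (1 / (1 - s₀)))) :=
    ENNReal.tendsto_ofReal (tendsto_const_nhds.div (tendsto_const_nhds.sub hs) h1s.ne')
  have hscale : ∀ ε, 0 < ε → ∀ u : FilmL2 ω,
      filmEnergy ω (s ε) ε u / ENNReal.ofReal (ε ^ (3 - 2 * s ε)) =
        ENNReal.ofReal (1 / (1 - s ε)) *
          (filmEnergy ω (s ε) ε u / ENNReal.ofReal (ε ^ (3 - 2 * s ε) / (1 - s ε))) := by
    intro ε hε u
    have h1 : 0 < 1 - s ε := by linarith [(hs01 ε hε).2]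
    have h2 : 0 < ε ^ (3 - 2 * s ε) := Real.rpow_pos_of_pos hε _
    rw [div_ofReal_eq_mul h2 (div_pos h2 h1), mul_comm]
    congr 2
    field_simp
  have hupper : ∀ f : Plane n → ℝ, ContDiff ℝ ((⊤ : ℕ∞) : WithTop ℕ∞) f → HasCompactSupport f →
      ∀ u : FilmL2 ω, (u =ᵐ[volume.restrict (film ω 1)] fun x => f x.1) →
        limsup (fun ε => filmEnergy ω (s ε) ε u / ENNReal.ofReal (ε ^ (3 - 2 * s ε))) (𝓝[>] 0) ≤
          ENNReal.ofReal (1 / (1 - s₀) * constK n s₀) *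
            ∫⁻ x in ω, ENNReal.ofReal (‖fderiv ℝ f x‖ ^ 2) := by
    intro f hf hc u hu
    have hcongr : ∀ᶠ ε in 𝓝[>] (0 : ℝ),
        filmEnergy ω (s ε) ε u / ENNReal.ofReal (ε ^ (3 - 2 * s ε)) =
          ENNReal.ofReal (1 / (1 - s ε)) *
            (filmEnergy ω (s ε) ε u / ENNReal.ofReal (ε ^ (3 - 2 * s ε) / (1 - s ε))) :=
      eventually_mem_nhdsWithin.mono fun ε hε => hscale ε hε u
    rw [limsup_congr hcongr, ENNReal.ofReal_mul (by positivity), mul_assoc]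
    refine (ENNReal.limsup_mul_le' (Or.inl ?_) (Or.inl ?_)).trans ?_
    · rw [hlim.limsup_eq]
      simpa using hs₀.2
    · rw [hlim.limsup_eq]
      exact ENNReal.ofReal_ne_top
    · rw [hlim.limsup_eq]
      gcongr
      exact limsup_filmEnergy_le_planarDirichlet hn hω hbdd hf hc hu hs01 hs hs₀.1 hs₀.2.le
  refine isGammaExpansion_of_vertical hn hω hne hbdd hlip hs01 hs (by linarith [hs₀.1]) hs₀.2 ?_
    (by simpa using rpow_mul_isLittleO s fun _ => 1) ?_
    (exists_smooth_planarDirichlet (F := fun ε => filmEnergy ω (s ε) ε) hω hbdd hlip hupper) ?_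
    fun i w hw => planarDirichlet_term_ne_zero hω hne hbdd (by positivity) i w hw
  · filter_upwards [eventually_mem_nhdsWithin] with ε hε
    exact Real.rpow_pos_of_pos hε _
  · intro ε hpos hε v w u hw hu
    have hεt := tendsto_nhdsGT_zero hpos hε
    simp_rw [fun k => hscale (ε k) (hpos k) (w k)]
    rw [ENNReal.ofReal_mul (by positivity), mul_assoc]
    exact mul_le_liminf_mul (hlim.comp hεt) (planarDirichlet_le_liminf hn hω hfin hpos hε
      (hs.comp hεt) (fun k => (hs01 _ (hpos k)).2) hs₀.1 hs₀.2.le hw hu)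
  · intro f hf hc u hu
    exact ne_top_of_le_ne_top
      (ENNReal.mul_ne_top ENNReal.ofReal_ne_top (lintegral_fderiv_sq_ne_top hbdd hf hc))
      (hupper f hf hc u hu)

/-- The expansion for exponents tending to one. -/
theorem isGammaExpansion_local (hn : 1 ≤ n) (hω : IsOpen ω) (hne : ω.Nonempty)
    (hbdd : Bornology.IsBounded ω) (hlip : HasLipschitzBoundary ω) {s : ℝ → ℝ}
    (hs01 : ∀ ε, 0 < ε → s ε ∈ Ioo (0 : ℝ) 1) (hs : Tendsto s (𝓝[>] (0 : ℝ)) (𝓝 1)) :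
    IsGammaExpansion (fun ε => filmEnergy ω (s ε) ε) (fun ε => ε ^ (1 - 2 * s ε) / (1 - s ε))
      (fun v => ENNReal.ofReal (constC n 1) * verticalDirichlet ω v)
      (fun ε => ε ^ (3 - 2 * s ε) / (1 - s ε))
      (onPlanar fun w => ENNReal.ofReal (constK n 1) * planarDirichlet ω w) := by
  have hfin : volume ω ≠ ∞ := hbdd.measure_lt_top.ne
  have hC : 0 < constC n 1 := constC_pos (by norm_num)
  have hpos : ∀ p : ℝ → ℝ, ∀ᶠ ε in 𝓝[>] (0 : ℝ), 0 < ε ^ p ε / (1 - s ε) := fun p => by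
    filter_upwards [eventually_mem_nhdsWithin] with ε hε
    exact div_pos (Real.rpow_pos_of_pos hε _) (by linarith [(hs01 ε hε).2])
  have hderiv : ∀ f : Plane n × ℝ → ℝ, ContDiff ℝ ((⊤ : ℕ∞) : WithTop ℕ∞) f →
      HasCompactSupport f → ∫⁻ x in film ω 1, ENNReal.ofReal (fderiv ℝ f x (0, 1) ^ 2) ≠ ∞ := by
    intro f hf hc
    have := isFiniteMeasure_restrict_film hfin
    have hcont : Continuous fun x => fderiv ℝ f x (0, 1) :=
      (hf.continuous_fderiv (by simp)).clm_apply continuous_const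
    obtain ⟨u, hu⟩ := exists_toLp_of_hasCompactSupport (μ := volume.restrict (film ω 1)) hcont
      (hc.fderiv_apply ℝ ((0 : Plane n), (1 : ℝ))) measurable_id
    rw [← lintegral_congr_ae (hu.mono fun x hx => by simp only [hx, id] :
      (fun x => ENNReal.ofReal (u x ^ 2)) =ᵐ[volume.restrict (film ω 1)] _)]
    exact lintegral_sq_Lp_ne_top u
  refine isGammaExpansion_of_bounds hn hω hne hbdd (hpos _) (hpos _)
    (rpow_mul_isLittleO s fun ε => 1 - s ε) ?_ ?_ ?_ ?_ ?_ ?_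
    (exists_smooth_planarDirichlet (F := fun ε => filmEnergy ω (s ε) ε) hω hbdd hlip
      fun f hf hc u hu => limsup_filmEnergy_le_planarDirichlet hn hω hbdd hf hc hu hs01 hs
        (by norm_num) le_rfl) ?_
    fun i w hw => planarDirichlet_term_ne_zero hω hne hbdd
      (constK_pos hn (by norm_num) (by norm_num)) i w hw
  · intro ε hpos hε v w hw
    exact verticalDirichlet_le_liminf hω hfin hpos hε (hs.comp (tendsto_nhdsGT_zero hpos hε))
      (fun k => (hs01 _ (hpos k)).2) hw
  · intro v ρ hρ
    obtain ⟨f, hf, hc, hfv, -, hg⟩ := exists_smooth_film hω hbdd hlip (measurable_coe_Lp v)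
      (lintegral_sq_Lp_ne_top v) hρ
    exact ⟨f, hf, hc, hfv, fun u hu => (limsup_filmEnergy_le_verticalDirichlet hω hfin hf hc hu
      hs01 hs (hderiv f hf hc)).trans (ofReal_mul_mul_comm (le_const_mul_verticalDirichlet
        (ofReal_one_add_ne_zero hρ) ENNReal.ofReal_ne_top hg))⟩
  · intro f hf hc u hu
    exact ne_top_of_le_ne_top (ENNReal.mul_ne_top ENNReal.ofReal_ne_top (hderiv f hf hc))
      (limsup_filmEnergy_le_verticalDirichlet hω hfin hf hc hu hs01 hs (hderiv f hf hc))
  · rw [verticalDirichlet_zero, mul_zero]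
  · intro v hv
    exact exists_planar_of_verticalDirichlet_eq_zero hω hbdd hlip
      ((mul_eq_zero.1 hv).resolve_left (by simpa using hC))
  · intro ε hpos hε v w u hw hu
    exact planarDirichlet_le_liminf hn hω hfin hpos hε (hs.comp (tendsto_nhdsGT_zero hpos hε))
      (fun k => (hs01 _ (hpos k)).2) (by norm_num) le_rfl hw hu
  · intro f hf hc u hu
    exact ne_top_of_le_ne_top
      (ENNReal.mul_ne_top ENNReal.ofReal_ne_top (lintegral_fderiv_sq_ne_top hbdd hf hc))
      (limsup_filmEnergy_le_planarDirichlet hn hω hbdd hf hc hu hs01 hs (by norm_num) le_rfl)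

/-- The expansion for the exponent one half. -/
theorem isGammaExpansion_critical (hn : 1 ≤ n) (hω : IsOpen ω) (hne : ω.Nonempty)
    (hbdd : Bornology.IsBounded ω) (hlip : HasLipschitzBoundary ω) :
    IsGammaExpansion (fun ε => filmEnergy ω (1 / 2) ε) (fun _ => 1)
      (fun v => ENNReal.ofReal (sphereArea n / (n : ℝ)) * verticalEnergy ω (1 / 2) v)
      (fun ε => ε ^ (2 : ℕ) * |Real.log ε|)
      (onPlanar fun w => ENNReal.ofReal (sphereArea n / (n : ℝ)) * planarDirichlet ω w) := by
  have hfin : volume ω ≠ ∞ := hbdd.measure_lt_top.ne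
  have hc : 0 < sphereArea n / (n : ℝ) := div_pos (sphereArea_pos n hn) (by exact_mod_cast hn)
  -- The first scale is the power with exponent 1 - 2s = 0, so this case fits the common form of the
  -- first term.
  have hone : (fun _ : ℝ => (1 : ℝ)) = fun ε : ℝ => ε ^ (1 - 2 * (1 / 2) : ℝ) := by
    funext ε
    norm_num
  rw [← constC_one_half hn] at hc ⊢
  have hab := sq_mul_log_isLittleO
  rw [hone] at hab ⊢
  refine isGammaExpansion_of_vertical (s := fun _ => 1 / 2) hn hω hne hbdd hlip
    (fun ε _ => by norm_num) tendsto_const_nhds (by norm_num) (by norm_num) ?_ hab ?_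
    (exists_smooth_planarDirichlet (F := fun ε => filmEnergy ω (1 / 2) ε) hω hbdd hlip
      fun f hf hc u hu => by
        rw [constC_one_half hn]
        exact limsup_filmEnergy_log_le hn hω hbdd hf hc hu) ?_
    fun i w hw => planarDirichlet_term_ne_zero hω hne hbdd hc i w hw
  · have h1 : ∀ᶠ ε : ℝ in 𝓝[>] 0, ε < 1 := nhdsWithin_le_nhds (Iio_mem_nhds one_pos)
    filter_upwards [eventually_mem_nhdsWithin, h1] with ε hε hε1
    exact mul_pos (pow_pos hε 2) (abs_pos.2 (Real.log_neg hε hε1).ne)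
  · intro ε hpos hε v w u hw hu
    rw [constC_one_half hn]
    exact planarDirichlet_le_liminf_log hn hω hfin hpos hε hw hu
  · intro f hf hc u hu
    exact ne_top_of_le_ne_top
      (ENNReal.mul_ne_top ENNReal.ofReal_ne_top (lintegral_fderiv_sq_ne_top hbdd hf hc))
      (limsup_filmEnergy_log_le hn hω hbdd hf hc hu)

end Cases

end ThinFilm

theorem theorem5p1 (n : ℕ) (hn : 1 ≤ n) (ω : Set (Plane n))
    (hω_open : IsOpen ω) (hω_conn : IsConnected ω) (hω_bdd : Bornology.IsBounded ω)
    (hω_lip : HasLipschitzBoundary ω) :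
    -- variable exponents, with a limit different from one half
    (∀ (s : ℝ → ℝ) (s₀ : ℝ), (∀ ε, 0 < ε → s ε ∈ Ioo (0 : ℝ) 1) →
      Tendsto s (𝓝[>] (0 : ℝ)) (𝓝 s₀) →
      (s₀ ∈ Ico (0 : ℝ) (1 / 2) →
        IsGammaExpansion (fun ε => filmEnergy ω (s ε) ε)
          (fun ε => ε ^ (1 - 2 * s ε))
          (fun v => ENNReal.ofReal (constC n s₀) * verticalEnergy ω s₀ v)
          (fun ε => ε ^ (2 : ℕ))
          (onPlanar (planarEnergy ω s₀))) ∧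
      (s₀ ∈ Ioo (1 / 2 : ℝ) 1 →
        IsGammaExpansion (fun ε => filmEnergy ω (s ε) ε)
          (fun ε => ε ^ (1 - 2 * s ε))
          (fun v => ENNReal.ofReal (constC n s₀) * verticalEnergy ω s₀ v)
          (fun ε => ε ^ (3 - 2 * s ε))
          (onPlanar fun w =>
            ENNReal.ofReal (1 / (1 - s₀) * constK n s₀) * planarDirichlet ω w)) ∧
      (s₀ = 1 →
        IsGammaExpansion (fun ε => filmEnergy ω (s ε) ε)
          (fun ε => ε ^ (1 - 2 * s ε) / (1 - s ε))
          (fun v => ENNReal.ofReal (sphereArea (n + 1) / (2 * ((n : ℝ) + 1))) *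
            verticalDirichlet ω v)
          (fun ε => ε ^ (3 - 2 * s ε) / (1 - s ε))
          (onPlanar fun w =>
            ENNReal.ofReal (sphereArea (n + 1) / (2 * ((n : ℝ) + 1))) *
              planarDirichlet ω w))) ∧
    -- the critical exponent one half
    IsGammaExpansion (fun ε => filmEnergy ω (1 / 2) ε)
      (fun _ => 1)
      (fun v => ENNReal.ofReal (sphereArea n / (n : ℝ)) * verticalEnergy ω (1 / 2) v)
      (fun ε => ε ^ (2 : ℕ) * |Real.log ε|)
      (onPlanar fun w => ENNReal.ofReal (sphereArea n / (n : ℝ)) * planarDirichlet ω w) := by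
  refine ⟨fun s s₀ hs01 hs => ⟨fun hs₀ => ?_, fun hs₀ => ?_, fun hs₀ => ?_⟩, ?_⟩
  · exact isGammaExpansion_subcritical hn hω_open hω_conn.nonempty hω_bdd hω_lip hs01 hs hs₀
  · exact isGammaExpansion_supercritical hn hω_open hω_conn.nonempty hω_bdd hω_lip hs01 hs hs₀
  · subst hs₀
    have := isGammaExpansion_local hn hω_open hω_conn.nonempty hω_bdd hω_lip hs01 hs
    -- At exponent 1 both C and K equal σ_d/(2d).
    rwa [constC_one, constK_one hn] at this
  · exact isGammaExpansion_critical hn hω_open hω_conn.nonempty hω_bdd hω_lip
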